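/- **Notation.** Let $n\ge 0$ and $I=\{\pm1,\dots,\pm n\}$, with $p(i)=0$ for $i>0$ and $p(i)=1$ for $i<0$. For a commutative ring $R$, let $M_{n|n}(R)$ be the superalgebra of matrices with rows and columns indexed by $I$, with elementary matrices $E_{ij}$ of parity $p(i)+p(j)$. Let $\iota(E_{ij})=-(-1)^{p(i)(p(j)+1)}E_{-j,-i}$ and $\mathsf E_{ij}=E_{ij}+\iota(E_{ij})$. Tensor products of superalgebras carry the product $(a\otimes b)(c\otimes d)=(-1)^{|b||c|}ac\otimes bd$, and $(a\otimes b)^\circ=(-1)^{|a||b|}b\otimes a$. **Classical side.** $\mathfrak p_n=\{X\in\mathfrak{gl}_{n|n}(\mathbb C):\iota(X)=X\}$, and the butterfly superalgebra $\mathfrak b_n$ is spanned by the $E_{ij}$ with $|i|<|j|$ and by $E_{ii}+E_{-i,-i}$, $E_{i,-i}$ for $i>0$. Let $\mathsf B(X,Y)=\mathrm{Str}(XY)$ and $\mathsf B^{\otimes2}(X_1\otimes X_2,Y_1\otimes Y_2)=(-1)^{|X_2||Y_1|}\mathsf B(X_1,Y_1)\mathsf B(X_2,Y_2)$. The enveloping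 superalgebra $U\mathfrak p_n$ is a Hopf superalgebra in which the elements of $\mathfrak p_n$ are primitive. **Quantum side.** Let $q=e^{\hbar/2}\in\mathbb C[[\hbar]]$, $K=\mathbb C((\hbar))$ and $$S=1+\sum_{i>0}\big((q-1)E_{ii}+(q^{-1}-1)E_{-i,-i}\big)\otimes(E_{ii}+E_{-i,-i})+\tfrac{q-q^{-1}}2\sum_{i<0}\mathsf E_{i,-i}\otimes E_{-i,i}+(q-q^{-1})\sum_{|j|<|i|}(-1)^{p(j)}\mathsf E_{ij}\otimes E_{ji}.$$ Let $U_K$ be the $K$-superalgebra generated by $t_{ij}$ ($i,j\in I$), of parity $p(i)+p(j)$, and $t_{ii}^{-1}$, with relations $t_{ii}t_{ii}^{-1}=t_{ii}^{-1}t_{ii}=1$, $t_{ii}=t_{-i,-i}$, $t_{-i,i}=0$ for $i>0$, $t_{ij}=0$ for $|i|>|j|$, and $T_{12}T_{13}S_{23}=S_{23}T_{13}T_{12}$ in $U_K\otimes M_{n|n}(K)^{\otimes2}$, where $T=\sum t_{ij}\otimes E_{ij}$. Put $\tau_{ij}=t_{ij}/(q-q^{-1})$ for $i\ne j$ and $\tau_{ii}=(t_{ii}-1)/(q-1)$.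 Let $U'\subset U_K$ be the $\mathbb C[[\hbar]]$-subalgebra generated by the $\tau_{ij}$ with $|i|\le|j|$, and let $U''\subset U_K$ be the one generated by these $\tau_{ij}$ and the $t_{ii}^{-1}$. **Theorem.** 1. $U_K$ is a Hopf superalgebra with $\Delta(t_{ij})=\sum_{k}(-1)^{(p(i)+p(k))(p(k)+p(j))}t_{ik}\otimes t_{kj}$. Its superbialgebra structure restricts to $U'$ and to $U''$ over $\mathbb C[[\hbar]]$, and its antipode restricts to $U''$. 2. There is a unique linear map $\delta:\mathfrak p_n\to\mathfrak p_n\otimes\mathfrak p_n$ with $\mathsf B^{\otimes2}(\delta(X),Y_1\otimes Y_2)=\mathsf B(X,[Y_1,Y_2])$ for all $X\in\mathfrak p_n$ and $Y_1,Y_2\in\mathfrak b_n$. It extends uniquely to an even linear map $\delta:U\mathfrak p_n\to U\mathfrak p_n\otimes U\mathfrak p_n$ with $\delta(ab)=\delta(a)\Delta(b)+\Delta(a)\delta(b)$. This extension is super skew-symmetric and satisfies the super co-Jacobi and the co-Leibniz identities, so that $U\mathfrak p_n$ is a co-Poisson Hopf superalgebra. 3. Let $U$ be $U'$ or $U''$.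 Then $U$ is flat over $\mathbb C[[\hbar]]$, and there is an isomorphism of superbialgebras $U\mathfrak p_n\cong U/\hbar U$ (of Hopf superalgebras if $U=U''$) under which $\mathsf E_{ji}\mapsto(-1)^{p(j)}\overline{\tau_{ij}}$ for $|i|<|j|$ and for $i=j>0$, and $\mathsf E_{-i,i}\mapsto-2\,\overline{\tau_{i,-i}}$ for $i>0$. For every $A\in U$, the element $\Delta(A)-\Delta(A)^\circ$ is divisible by $\hbar$ in $U\otimes_{\mathbb C[[\hbar]]}U$, and, under this isomorphism, $$\overline{\hbar^{-1}\big(\Delta(A)-\Delta(A)^\circ\big)}=\delta(\overline A).$$ Hence $U$ is a quantization of the co-Poisson structure on $U\mathfrak p_n$ that comes from the Manin supertriple $(\mathfrak{gl}_{n|n},\mathfrak p_n,\mathfrak b_n)$: as a superbialgebra for $U=U'$, and as a Hopf superalgebra for $U=U''$. -/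

import Mathlib

open scoped TensorProduct

noncomputable section

/-- The sign `(-1) ^ x` of a parity `x`. -/
abbrev sgn (x : ZMod 2) : ℤˣ := (-1) ^ x

/-! ### Superalgebras

A superalgebra over a commutative ring in which `2` is invertible is an algebra with an
automorphism of order two (the parity automorphism, `a ↦ (-1) ^ |a| a`); the homogeneous
components are its eigenspaces for `1` and `-1`. -/

class Superalgebra (R A : Type*) [CommRing R] [Ring A] [Algebra R A] where
  parityHom : A →ₐ[R] A
  parityHom_parityHom : ∀ a, parityHom (parityHom a) = a

namespace Superalgebra

variable (R A : Type*) [CommRing R] [Ring A] [Algebra R A] [Superalgebra R A]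

variable {A} in
/-- The parity automorphism `a ↦ (-1) ^ |a| a`. -/
abbrev parity : A →ₐ[R] A := parityHom

/-- The homogeneous elements of degree `i`. -/
def part (i : ZMod 2) : Submodule R A where
  carrier := {a | parity R a = sgn i • a}
  add_mem' {a b} ha hb := by
    simp only [Set.mem_ofPred_eq] at *
    rw [map_add, ha, hb, smul_add]
  zero_mem' := by simp
  smul_mem' r a ha := by
    simp only [Set.mem_ofPred_eq] at *
    rw [map_smul, ha, smul_comm]

variable {R A}

theorem mem_part {i : ZMod 2} {a : A} : a ∈ part R A i ↔ parity R a = sgn i • a := Iff.rfl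

instance : SetLike.GradedMonoid (part R A) where
  one_mem := by simp [mem_part]
  mul_mem i j a b ha hb := by
    rw [mem_part] at *
    rw [map_mul, ha, hb, sgn, sgn, sgn, uzpow_add, smul_mul_smul_comm]

variable [Invertible (2 : R)]

/-- The projection to the component of degree `i`. -/
def proj (i : ZMod 2) : A →ₗ[R] A :=
  (⅟2 : R) • (LinearMap.id + sgn i • (parity R : A →ₐ[R] A).toLinearMap)

theorem proj_apply (i : ZMod 2) (a : A) :
    proj (R := R) i a = (⅟2 : R) • (a + sgn i • parity R a) := rfl

theorem proj_mem (i : ZMod 2) (a : A) : proj (R := R) i a ∈ part R A i := by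
  have h : parity R (sgn i • parity R a) = sgn i • a := by
    rcases Int.units_eq_one_or (sgn i) with h | h <;> simp [h, parityHom_parityHom, Units.neg_smul]
  have h2 : sgn i • sgn i • parity R a = parity R a := by
    rw [smul_smul, Int.units_mul_self, one_smul]
  rw [mem_part, proj_apply, map_smul, map_add, h, smul_comm (sgn i) (⅟2 : R),
    smul_add (sgn i), h2, add_comm]

theorem sgn_one : sgn 1 = -1 := by decide

theorem proj_add_proj (a : A) : proj (R := R) 0 a + proj (R := R) 1 a = a := by
  rw [proj_apply, proj_apply, ← smul_add, sgn_one]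
  simp only [sgn, uzpow_zero, one_smul, Units.neg_smul]
  rw [show a + parity R a + (a + -parity R a) = (2 : R) • a by rw [two_smul]; abel,
    smul_smul, invOf_mul_self, one_smul]

theorem proj_of_mem {i : ZMod 2} {a : A} (ha : a ∈ part R A i) (j : ZMod 2) :
    proj (R := R) j a = if i = j then a else 0 := by
  rw [mem_part] at ha
  rw [proj_apply, ha, smul_smul, sgn, sgn, ← uzpow_add]
  have key : ∀ i j : ZMod 2, (-1 : ℤˣ) ^ (j + i) = if i = j then 1 else -1 := by decide
  rw [key]
  split_ifs with h
  · rw [one_smul, ← two_smul R a, smul_smul, invOf_mul_self, one_smul]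
  · simp [Units.neg_smul]

/-- The decomposition of an element into its even and its odd component. -/
def decomp : A →ₗ[R] DirectSum (ZMod 2) fun i => part R A i :=
  DirectSum.lof R (ZMod 2) (fun i => part R A i) 0 ∘ₗ (proj 0).codRestrict _ (proj_mem 0) +
    DirectSum.lof R (ZMod 2) (fun i => part R A i) 1 ∘ₗ (proj 1).codRestrict _ (proj_mem 1)

instance : DirectSum.Decomposition (part R A) :=
  DirectSum.Decomposition.ofLinearMap (part R A) decomp
    (by
      ext a
      simp [decomp, proj_add_proj])
    (by
      ext i ⟨a, ha⟩ : 2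
      have h0 : (proj (R := R) 0).codRestrict _ (proj_mem 0) a =
          if h : i = 0 then (⟨a, h ▸ ha⟩ : part R A 0) else 0 := by
        apply Subtype.ext
        rw [LinearMap.codRestrict_apply, proj_of_mem ha]
        split_ifs <;> rfl
      have h1 : (proj (R := R) 1).codRestrict _ (proj_mem 1) a =
          if h : i = 1 then (⟨a, h ▸ ha⟩ : part R A 1) else 0 := by
        apply Subtype.ext
        rw [LinearMap.codRestrict_apply, proj_of_mem ha]
        split_ifs <;> rfl
      simp only [decomp, LinearMap.comp_apply, LinearMap.add_apply, DirectSum.coeLinearMap_lof,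
        LinearMap.id_apply]
      rw [h0, h1]
      have hi : ∀ i : ZMod 2, i = 0 ∨ i = 1 := by decide
      rcases hi i with rfl | rfl <;> simp)

instance : GradedAlgebra (part R A) where

end Superalgebra

open Superalgebra

section Hopf

variable (R A : Type*) [CommRing R] [Ring A] [Algebra R A] [Superalgebra R A] [Invertible (2 : R)]

/-- `A ⊗ A` with the multiplication `(a ⊗ b) (c ⊗ d) = (-1) ^ (|b| |c|) (a c ⊗ b d)`. -/
abbrev SuperTensor : Type _ := part R A ᵍ⊗[R] part R A

/-- The map `a ⊗ b ↦ (-1) ^ (|a| |b|) (b ⊗ a)`. -/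
def superSwap : A ⊗[R] A →ₗ[R] A ⊗[R] A :=
  (GradedTensorProduct.of R (part R A) (part R A)).symm.toLinearMap ∘ₗ
    (GradedTensorProduct.comm (part R A) (part R A)).toLinearMap ∘ₗ
    (GradedTensorProduct.of R (part R A) (part R A)).toLinearMap

/-- The super swap of the first two factors. -/
def superSwap12 : (A ⊗[R] A) ⊗[R] A →ₗ[R] (A ⊗[R] A) ⊗[R] A :=
  (superSwap R A).rTensor A

/-- The super swap of the last two factors. -/
def superSwap23 : (A ⊗[R] A) ⊗[R] A →ₗ[R] (A ⊗[R] A) ⊗[R] A :=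
  (TensorProduct.assoc R A A A).symm.toLinearMap ∘ₗ (superSwap R A).lTensor A ∘ₗ
    (TensorProduct.assoc R A A A).toLinearMap

/-- The cyclic permutation `a ⊗ b ⊗ c ↦ ± b ⊗ c ⊗ a`, with the sign of the super convention. -/
def superCyc : (A ⊗[R] A) ⊗[R] A →ₗ[R] (A ⊗[R] A) ⊗[R] A :=
  superSwap23 R A ∘ₗ superSwap12 R A

variable {R A} in
/-- A linear map `A → A ⊗ A`, read off from a map into the super tensor product. -/
def underlying (f : A →ₐ[R] SuperTensor R A) : A →ₗ[R] A ⊗[R] A :=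
  (GradedTensorProduct.of R (part R A) (part R A)).symm.toLinearMap ∘ₗ f.toLinearMap

/-- A superbialgebra structure on a superalgebra `A`. -/
structure SuperBialgebra where
  comul : A →ₐ[R] SuperTensor R A
  counit : A →ₐ[R] R
  comul_parity (a : A) : underlying comul (parity R a) =
    TensorProduct.map (parity R).toLinearMap (parity R).toLinearMap (underlying comul a)
  counit_parity (a : A) : counit (parity R a) = counit a
  coassoc (a : A) :
    TensorProduct.assoc R A A A ((underlying comul).rTensor A (underlying comul a)) =
      (underlying comul).lTensor A (underlying comul a)
  counit_left (a : A) :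
    TensorProduct.lid R A (counit.toLinearMap.rTensor A (underlying comul a)) = a
  counit_right (a : A) :
    TensorProduct.rid R A (counit.toLinearMap.lTensor A (underlying comul a)) = a

/-- A Hopf superalgebra structure on a superalgebra `A`. -/
structure HopfSuperalgebra extends SuperBialgebra R A where
  antipode : A →ₗ[R] A
  antipode_parity (a : A) : antipode (parity R a) = parity R (antipode a)
  antipode_left (a : A) :
    LinearMap.mul' R A (antipode.rTensor A (underlying comul a)) = algebraMap R A (counit a)
  antipode_right (a : A) :
    LinearMap.mul' R A (antipode.lTensor A (underlying comul a)) = algebraMap R A (counit a)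

variable {R A}

/-- The comultiplication as a linear map to the tensor product. -/
abbrev SuperBialgebra.Δ (H : SuperBialgebra R A) : A →ₗ[R] A ⊗[R] A := underlying H.comul

/-- `δ` is an even map with `δ (a b) = δ a · Δ b + Δ a · δ b`, where the products are taken in the
super tensor product. -/
structure SuperBialgebra.IsCoderivation (H : SuperBialgebra R A) (δ : A →ₗ[R] A ⊗[R] A) :
    Prop where
  even (a : A) : δ (parity R a) =
    TensorProduct.map (parity R).toLinearMap (parity R).toLinearMap (δ a)
  map_mul (a b : A) : GradedTensorProduct.of R (part R A) (part R A) (δ (a * b)) =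
    GradedTensorProduct.of R (part R A) (part R A) (δ a) * H.comul b +
      H.comul a * GradedTensorProduct.of R (part R A) (part R A) (δ b)

/-- `δ` is a Poisson cobracket which makes the superbialgebra (or Hopf superalgebra) co-Poisson:
it is compatible with the product, super skew-symmetric, and satisfies the super co-Jacobi and the
co-Leibniz identity. -/
structure SuperBialgebra.IsCoPoisson (H : SuperBialgebra R A) (δ : A →ₗ[R] A ⊗[R] A) : Prop
    extends H.IsCoderivation δ where
  skew (a : A) : superSwap R A (δ a) = -δ a
  coJacobi (a : A) : δ.rTensor A (δ a) + superCyc R A (δ.rTensor A (δ a)) +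
    superCyc R A (superCyc R A (δ.rTensor A (δ a))) = 0
  coLeibniz (a : A) : H.Δ.rTensor A (δ a) =
    (TensorProduct.assoc R A A A).symm (δ.lTensor A (H.Δ a)) +
      superSwap23 R A (δ.rTensor A (H.Δ a))

end Hopf

instance : Invertible (2 : PowerSeries ℂ) where
  invOf := algebraMap ℂ _ 2⁻¹
  invOf_mul_self := by
    rw [← map_ofNat (algebraMap ℂ (PowerSeries ℂ)) 2, ← map_mul]; simp
  mul_invOf_self := by
    rw [← map_ofNat (algebraMap ℂ (PowerSeries ℂ)) 2, ← map_mul]; simp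

instance : Invertible (2 : LaurentSeries ℂ) where
  invOf := algebraMap (PowerSeries ℂ) _ (⅟2)
  invOf_mul_self := by
    rw [← map_ofNat (algebraMap (PowerSeries ℂ) (LaurentSeries ℂ)) 2, ← map_mul, invOf_mul_self,
      map_one]
  mul_invOf_self := by
    rw [← map_ofNat (algebraMap (PowerSeries ℂ) (LaurentSeries ℂ)) 2, ← map_mul, mul_invOf_self,
      map_one]

/-! ### The periplectic Lie superalgebra -/

/-- The index set `{±1, …, ±n}`: the pair `(a, p)` stands for the index of absolute value `a + 1`
(as `a` runs over `0, …, n - 1`) which is positive if `p = 0` and negative if `p = 1`. Thus `i.1`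
orders indices by absolute value and `i.2` is the parity `p(i)`. -/
abbrev Idx (n : ℕ) := Fin n × ZMod 2

/-- The index `-i`. -/
def Idx.neg {n : ℕ} (i : Idx n) : Idx n := (i.1, i.2 + 1)

theorem Idx.neg_neg {n : ℕ} (i : Idx n) : i.neg.neg = i := by
  have h : ∀ x : ZMod 2, x + 1 + 1 = x := by decide
  simp [Idx.neg, h]

section gl

variable (R : Type*) [CommRing R] (n : ℕ)

/-- `n|n` matrices. -/
abbrev Mat := Matrix (Idx n) (Idx n) R

variable {R n}

/-- The elementary matrix `E_{ij}`. -/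
def el (i j : Idx n) : Mat R n := Matrix.single i j 1

/-- The supertranspose, `E_{ij} ↦ (-1) ^ (p(i) (p(j) + 1)) E_{ji}`. -/
def supertranspose : Mat R n →ₗ[R] Mat R n where
  toFun X := Matrix.of fun j i => sgn (i.2 * (j.2 + 1)) • X i j
  map_add' X Y := by ext; simp
  map_smul' r X := by ext; simp [mul_smul_comm]

/-- The map `π`, `E_{ij} ↦ E_{-i,-j}`. -/
def matFlip : Mat R n →ₗ[R] Mat R n where
  toFun X := Matrix.of fun i j => X i.neg j.neg
  map_add' X Y := by ext; simp
  map_smul' r X := by ext; simp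

/-- The involution `ι X = - π (X ^ st)`. -/
def iota : Mat R n →ₗ[R] Mat R n := -((matFlip : Mat R n →ₗ[R] Mat R n) ∘ₗ supertranspose)

theorem iota_apply (X : Mat R n) (i j : Idx n) :
    iota X i j = -(sgn (i.2 * (j.2 + 1)) • X j.neg i.neg) := by
  have h : ∀ x y : ZMod 2, (y + 1) * (x + 1 + 1) = x * (y + 1) := by decide
  change -(sgn (j.neg.2 * (i.neg.2 + 1)) • X j.neg i.neg) = _
  simp [Idx.neg, h]

theorem iota_iota (X : Mat R n) : iota (iota X) = X := by
  ext i j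
  have h : ∀ x y : ZMod 2, sgn (x * (y + 1)) * sgn ((y + 1) * (x + 1 + 1)) = 1 := by decide
  rw [iota_apply, iota_apply, smul_neg, neg_neg, smul_smul, Idx.neg_neg, Idx.neg_neg]
  simp only [Idx.neg]
  rw [h, one_smul]

/-- `𝖤_{ij} = E_{ij} + ι E_{ij}`. -/
def sfE (i j : Idx n) : Mat R n := el i j + iota (el i j)

/-- The superbracket, `[E_{ij}, E_{kl}] =
δ_{jk} E_{il} - (-1) ^ ((p(i) + p(j)) (p(k) + p(l))) δ_{il} E_{kj}`. -/
def superBracket (X Y : Mat R n) : Mat R n := Matrix.of fun i j =>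
  ∑ k, (X i k * Y k j - sgn ((i.2 + k.2) * (k.2 + j.2)) • (Y i k * X k j))

/-- The parity operator on matrices. -/
def matParity : Mat R n →ₗ[R] Mat R n where
  toFun X := Matrix.of fun i j => sgn (i.2 + j.2) • X i j
  map_add' X Y := by ext; simp
  map_smul' r X := by ext; simp [mul_smul_comm]

/-- `X` is homogeneous of parity `a`. -/
def IsHomog (a : ZMod 2) (X : Mat R n) : Prop := ∀ i j, i.2 + j.2 ≠ a → X i j = 0

/-- The component of parity `a`. -/
def matPart (a : ZMod 2) : Mat R n →ₗ[R] Mat R n where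
  toFun X := Matrix.of fun i j => if i.2 + j.2 = a then X i j else 0
  map_add' X Y := by ext; simp only [Matrix.add_apply, Matrix.of_apply]; split_ifs <;> simp
  map_smul' r X := by ext; simp

/-- The supertrace form `B(X, Y) = Str (X Y)`. -/
def strForm : Mat R n →ₗ[R] Mat R n →ₗ[R] R :=
  LinearMap.mk₂ R (fun X Y => ∑ i : Idx n, sgn i.2 • (X * Y) i i)
    (by intros; simp [add_mul, Finset.sum_add_distrib])
    (by intros; simp [Finset.mul_sum, mul_smul_comm])
    (by intros; simp [mul_add, Finset.sum_add_distrib])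
    (by intros; simp [Finset.mul_sum, mul_smul_comm])

end gl

section periplectic

variable (n : ℕ)

/-- The Lie superalgebra `𝔭_n`, the fixed points of `ι`. -/
def periplectic : Submodule ℂ (Mat ℂ n) := LinearMap.eqLocus iota LinearMap.id

variable {n}

theorem mem_periplectic {X : Mat ℂ n} : X ∈ periplectic n ↔ iota X = X := Iff.rfl

theorem superBracket_mem {X Y : Mat ℂ n} (hX : X ∈ periplectic n) (hY : Y ∈ periplectic n) :
    superBracket X Y ∈ periplectic n := by
  rw [mem_periplectic] at *
  have e : ∀ X : Mat ℂ n, iota X = X → ∀ i j,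
      X j.neg i.neg = -(sgn (i.2 * (j.2 + 1)) • X i j) := by
    intro X hX i j
    conv_rhs => rw [← hX, iota_apply]
    rw [smul_neg, neg_neg, smul_smul, Int.units_mul_self, one_smul]
  ext i j
  rw [iota_apply]
  let f : Idx n ≃ Idx n := ⟨Idx.neg, Idx.neg, Idx.neg_neg, Idx.neg_neg⟩
  have hs : superBracket X Y j.neg i.neg = ∑ k : Idx n, (X j.neg k.neg * Y k.neg i.neg -
      sgn ((j.neg.2 + k.neg.2) * (k.neg.2 + i.neg.2)) • (Y j.neg k.neg * X k.neg i.neg)) :=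
    (Equiv.sum_comp f _).symm
  rw [hs, superBracket, Finset.smul_sum, ← Finset.sum_neg_distrib]
  refine Finset.sum_congr rfl fun k _ => ?_
  rw [e X hX, e Y hY, e Y hY, e X hX]
  simp only [Idx.neg]
  obtain ⟨i1, i2⟩ := i
  obtain ⟨j1, j2⟩ := j
  obtain ⟨k1, k2⟩ := k
  have h1 : sgn 0 = 1 := by decide
  have h2 : sgn 1 = -1 := by decide
  have hz : ∀ z : ZMod 2, z = 0 ∨ z = 1 := by decide
  have h3 : (1 + 1 : ZMod 2) = 0 := by decide
  rcases hz i2 with rfl | rfl <;> rcases hz j2 with rfl | rfl <;> rcases hz k2 with rfl | rfl <;>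
    simp [h1, h2, h3, Units.neg_smul, -uzpow_zero, -uzpow_one] <;> ring

/-- The superbracket of `𝔭_n`. -/
def pBracket (X Y : periplectic n) : periplectic n :=
  ⟨superBracket X Y, superBracket_mem X.2 Y.2⟩

theorem matParity_mem {X : Mat ℂ n} (hX : X ∈ periplectic n) : matParity X ∈ periplectic n := by
  rw [mem_periplectic] at *
  ext i j
  have h : ∀ x y : ZMod 2, (y + 1 + (x + 1)) = x + y := by decide
  conv_rhs => rw [← hX]
  change _ = sgn (i.2 + j.2) • iota X i j
  rw [iota_apply, iota_apply]
  change -(_ • sgn (j.neg.2 + i.neg.2) • X j.neg i.neg) = _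
  simp only [Idx.neg]
  rw [h, smul_comm, smul_neg]

/-- The parity operator of `𝔭_n`. -/
def pParity : periplectic n →ₗ[ℂ] periplectic n :=
  matParity.restrict fun _ hX => matParity_mem hX

/-- `𝖤_{ij}` as an element of `𝔭_n`. -/
def pE (i j : Idx n) : periplectic n :=
  ⟨sfE i j, by rw [mem_periplectic, sfE, map_add, iota_iota, add_comm]⟩

variable (n) in
/-- The butterfly Lie superalgebra `𝔟_n`. -/
def butterfly : Submodule ℂ (Mat ℂ n) :=
  Submodule.span ℂ
    ({X | ∃ i j : Idx n, i.1 < j.1 ∧ X = el i j} ∪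
      {X | ∃ i : Idx n, i.2 = 0 ∧ X = el i i + el i.neg i.neg} ∪
      {X | ∃ i : Idx n, i.2 = 0 ∧ X = el i i.neg})

/-- The functional `B^{⊗2}(·, Y₁ ⊗ Y₂)` on `𝔭_n ⊗ 𝔭_n`, where
`B^{⊗2}(X₁ ⊗ X₂, Y₁ ⊗ Y₂) = (-1) ^ (|X₂| |Y₁|) B(X₁, Y₁) B(X₂, Y₂)` for homogeneous elements. -/
def strForm2 (Y₁ Y₂ : Mat ℂ n) : periplectic n ⊗[ℂ] periplectic n →ₗ[ℂ] ℂ :=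
  ∑ a : ZMod 2, ∑ b : ZMod 2, sgn (a * b) •
    (LinearMap.mul' ℂ ℂ ∘ₗ TensorProduct.map
      (strForm.flip (matPart b Y₁) ∘ₗ (periplectic n).subtype)
      (strForm.flip Y₂ ∘ₗ matPart a ∘ₗ (periplectic n).subtype))

/-- `δ` is the supercobracket on `𝔭_n` of the Manin supertriple `(𝔤𝔩_{n|n}, 𝔭_n, 𝔟_n)`. -/
def IsManinCobracket (δ : periplectic n →ₗ[ℂ] periplectic n ⊗[ℂ] periplectic n) : Prop :=
  ∀ X : periplectic n, ∀ Y₁ ∈ butterfly n, ∀ Y₂ ∈ butterfly n,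
    strForm2 Y₁ Y₂ (δ X) = strForm (X : Mat ℂ n) (superBracket Y₁ Y₂)

/-! ### The universal enveloping superalgebra of `𝔭_n` -/

variable (n) in
/-- The relations `x y - (-1) ^ (|x| |y|) y x = [x, y]` for homogeneous `x, y`. -/
inductive URel : TensorAlgebra ℂ (periplectic n) → TensorAlgebra ℂ (periplectic n) → Prop
  | bracket (a b : ZMod 2) (x y : periplectic n) (hx : IsHomog a (x : Mat ℂ n))
      (hy : IsHomog b (y : Mat ℂ n)) :
      URel (TensorAlgebra.ι ℂ x * TensorAlgebra.ι ℂ y -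
          sgn (a * b) • (TensorAlgebra.ι ℂ y * TensorAlgebra.ι ℂ x))
        (TensorAlgebra.ι ℂ (pBracket x y))

variable (n) in
/-- The universal enveloping superalgebra `U(𝔭_n)`. -/
def Up : Type := RingQuot (URel n)

instance : Ring (Up n) := RingQuot.instRing (URel n)

instance : Algebra ℂ (Up n) := RingQuot.instAlgebra (URel n)

/-- The canonical map `𝔭_n → U(𝔭_n)`. -/
def Up.ι : periplectic n →ₗ[ℂ] Up n :=
  (RingQuot.mkAlgHom ℂ (URel n)).toLinearMap ∘ₗ TensorAlgebra.ι ℂ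

theorem Up.ι_mul (a b : ZMod 2) (x y : periplectic n) (hx : IsHomog a (x : Mat ℂ n))
    (hy : IsHomog b (y : Mat ℂ n)) :
    Up.ι x * Up.ι y - sgn (a * b) • (Up.ι y * Up.ι x) = Up.ι (pBracket x y) := by
  have := RingQuot.mkAlgHom_rel ℂ (URel.bracket a b x y hx hy)
  rw [map_sub, Units.smul_def, map_zsmul, map_mul, map_mul] at this
  exact this

theorem pParity_of_isHomog {a : ZMod 2} {x : periplectic n} (hx : IsHomog a (x : Mat ℂ n)) :
    pParity x = sgn a • x := by
  apply Subtype.ext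
  ext i j
  change sgn (i.2 + j.2) • (x : Mat ℂ n) i j = ((sgn a • x : periplectic n) : Mat ℂ n) i j
  rw [Units.smul_def (sgn a) x, Submodule.coe_smul_of_tower, Matrix.smul_apply]
  by_cases h : i.2 + j.2 = a
  · rw [h, Units.smul_def]
  · rw [hx i j h, smul_zero, smul_zero]

theorem pParity_pParity (x : periplectic n) : pParity (pParity x) = x := by
  apply Subtype.ext
  ext i j
  change sgn (i.2 + j.2) • sgn (i.2 + j.2) • (x : Mat ℂ n) i j = _
  rw [smul_smul, Int.units_mul_self, one_smul]

/-- The parity automorphism of `U(𝔭_n)`, which extends the parity operator of `𝔭_n`. -/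
def Up.parity : Up n →ₐ[ℂ] Up n :=
  RingQuot.liftAlgHom ℂ ⟨TensorAlgebra.lift ℂ (Up.ι ∘ₗ pParity), by
    rintro _ _ ⟨a, b, x, y, hx, hy⟩
    have h (c : ZMod 2) (z : periplectic n) (hz : IsHomog c (z : Mat ℂ n)) :
        Up.ι (pParity z) = sgn c • Up.ι z := by
      rw [pParity_of_isHomog hz, Units.smul_def, map_zsmul, ← Units.smul_def]
    have hxy : IsHomog (a + b) (pBracket x y : Mat ℂ n) := by
      intro i j hij
      refine Finset.sum_eq_zero fun k _ => ?_
      have key : ∀ i j k a b : ZMod 2, i + j ≠ a + b → (i + k ≠ a ∨ k + j ≠ b) ∧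
          (i + k ≠ b ∨ k + j ≠ a) := by decide
      obtain ⟨h1, h2⟩ := key _ _ k.2 _ _ hij
      rcases h1 with h1 | h1 <;> rcases h2 with h2 | h2 <;>
        simp [hx _ _, hy _ _, h1, h2]
    rw [map_sub, Units.smul_def, map_zsmul, map_mul, map_mul]
    simp only [TensorAlgebra.lift_ι_apply, LinearMap.comp_apply]
    rw [h a x hx, h b y hy, h (a + b) _ hxy, ← Up.ι_mul a b x y hx hy, ← Units.smul_def,
      smul_mul_smul_comm, smul_mul_smul_comm, smul_sub,
      show sgn (a + b) = sgn a * sgn b from uzpow_add _ _ _,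
      mul_comm (sgn b), smul_comm (sgn (a * b))]⟩

theorem Up.parity_ι (x : periplectic n) : Up.parity (Up.ι x) = Up.ι (pParity x) := by
  refine (RingQuot.liftAlgHom_mkAlgHom_apply ℂ _ _ _).trans ?_
  rw [TensorAlgebra.lift_ι_apply]
  rfl

theorem Up.algHom_ext {B : Type*} [Semiring B] [Algebra ℂ B] {f g : Up n →ₐ[ℂ] B}
    (h : ∀ x, f (Up.ι x) = g (Up.ι x)) : f = g := by
  apply RingQuot.ringQuot_ext'
  apply TensorAlgebra.hom_ext
  ext x
  exact h x

instance : Superalgebra ℂ (Up n) where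
  parityHom := Up.parity
  parityHom_parityHom a := by
    have : (Up.parity (n := n)).comp Up.parity = AlgHom.id ℂ _ :=
      Up.algHom_ext fun x => by simp [Up.parity_ι, pParity_pParity]
    exact DFunLike.congr_fun this a

end periplectic

/-! ### The quantized enveloping superalgebra of `𝔭_n` -/

section quantum

/-- The super Kronecker product: the matrix of `A ⊗ B` acting on `V ⊗ V` by
`(A ⊗ B) (v ⊗ w) = (-1) ^ (|B| |v|) (A v ⊗ B w)`. -/
def superKron {R : Type*} [CommRing R] {n : ℕ} (A B : Mat R n) :
    Matrix (Idx n × Idx n) (Idx n × Idx n) R :=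
  Matrix.of fun i j => sgn ((i.2.2 + j.2.2) * j.1.2) • (A i.1 j.1 * B i.2 j.2)

variable (K : Type*) [Field K] (q : K) (n : ℕ)

/-- The matrix `S`, an even endomorphism of `V ⊗ V` for `V = K(n|n)`. -/
def Smat : Matrix (Idx n × Idx n) (Idx n × Idx n) K :=
  1 +
  ∑ i : Idx n with i.2 = 0, superKron ((q - 1) • el i i + (q⁻¹ - 1) • el i.neg i.neg)
    (el i i + el i.neg i.neg) +
  ((q - q⁻¹) / 2) • ∑ i : Idx n with i.2 = 1, superKron (sfE i i.neg) (el i.neg i) +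
  (q - q⁻¹) • ∑ x : Idx n × Idx n with x.2.1 < x.1.1,
    sgn x.2.2 • superKron (sfE x.1 x.2) (el x.2 x.1)

/-- Names of the generators `t_{ij}` and `t_{ii}⁻¹`. -/
inductive QGen
  | t (i j : Idx n)
  | tinv (i : Idx n)

/-- The free algebra on the generators. -/
abbrev QFree := FreeAlgebra K (QGen n)

variable {n} in
/-- The generator `t_{ij}` of the free algebra. -/
def ft (i j : Idx n) : QFree K n := FreeAlgebra.ι K (QGen.t i j)

variable {n} in
/-- The generator `t_{ii}⁻¹` of the free algebra. -/
def ftinv (i : Idx n) : QFree K n := FreeAlgebra.ι K (QGen.tinv i)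

/-- Let `A` be a superalgebra. An even element `∑ X_{ab} ⊗ E_{ab}` of the superalgebra
`A ⊗ End(V ⊗ V)` is given by the matrix of its coefficients `X_{ab}`, of parity `p(a) + p(b)`. Since
`(x ⊗ E_{ac}) (y ⊗ E_{cb}) = (-1) ^ ((p(a) + p(c)) |y|) x y ⊗ E_{ab}`,
this is the product of two such elements. Here the parity of `e_{a₁} ⊗ e_{a₂}` is
`p(a₁) + p(a₂)`. -/
def superMul {n : ℕ} {A : Type*} [Ring A] (X Y : Matrix (Idx n × Idx n) (Idx n × Idx n) A) :
    Matrix (Idx n × Idx n) (Idx n × Idx n) A :=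
  Matrix.of fun a b => ∑ c, sgn ((a.1.2 + a.2.2 + (c.1.2 + c.2.2)) *
    (c.1.2 + c.2.2 + (b.1.2 + b.2.2))) • (X a c * Y c b)

/-- `T_{12} = ∑ t_{ij} ⊗ E_{ij} ⊗ 1`. -/
def T12 : Matrix (Idx n × Idx n) (Idx n × Idx n) (QFree K n) :=
  Matrix.of fun a b => if a.2 = b.2 then ft K a.1 b.1 else 0

/-- `T_{13} = ∑ t_{ij} ⊗ 1 ⊗ E_{ij}`; the sign comes from
`(1 ⊗ E_{ij}) (v ⊗ w) = (-1) ^ ((p(i) + p(j)) |v|) (v ⊗ E_{ij} w)`. -/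
def T13 : Matrix (Idx n × Idx n) (Idx n × Idx n) (QFree K n) :=
  Matrix.of fun a b => if a.1 = b.1 then sgn ((a.2.2 + b.2.2) * b.1.2) • ft K a.2 b.2 else 0

/-- `S_{23} = 1 ⊗ S`. -/
def S23 : Matrix (Idx n × Idx n) (Idx n × Idx n) (QFree K n) :=
  (Smat K q n).map (algebraMap K (QFree K n))

/-- The defining relations. The last one is `T_{12} T_{13} S_{23} = S_{23} T_{13} T_{12}`. -/
inductive QRel : QFree K n → QFree K n → Prop
  | diag (i : Idx n) : QRel (ft K i i) (ft K i.neg i.neg)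
  | anti (i : Idx n) (hi : i.2 = 0) : QRel (ft K i.neg i) 0
  | lower (i j : Idx n) (hij : j.1 < i.1) : QRel (ft K i j) 0
  | mul_inv (i : Idx n) : QRel (ft K i i * ftinv K i) 1
  | inv_mul (i : Idx n) : QRel (ftinv K i * ft K i i) 1
  | rtt (a b : Idx n × Idx n) :
      QRel (superMul (superMul (T12 K n) (T13 K n)) (S23 K q n) a b)
        (superMul (S23 K q n) (superMul (T13 K n) (T12 K n)) a b)

/-- The quantized enveloping superalgebra of `𝔭_n` over the field `K`, with parameter `q`. -/
def QEA : Type _ := RingQuot (QRel K q n)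

instance : Ring (QEA K q n) := RingQuot.instRing (QRel K q n)

instance : Algebra K (QEA K q n) := RingQuot.instAlgebra (QRel K q n)

variable {K n} in
theorem el_isHomog (i j : Idx n) : IsHomog (i.2 + j.2) (el i j : Mat K n) := by
  intro k l h
  apply Matrix.single_apply_of_ne
  rintro ⟨rfl, rfl⟩
  exact h rfl

variable {K n} in
theorem sfE_isHomog (i j : Idx n) : IsHomog (i.2 + j.2) (sfE i j : Mat K n) := by
  intro k l h
  rw [sfE, Matrix.add_apply, iota_apply, el_isHomog _ _ _ _ h, el_isHomog]
  · simp
  · have : ∀ k l : ZMod 2, l + 1 + (k + 1) = k + l := by decide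
    simp only [Idx.neg, this]
    exact h

/-- A matrix of scalars which is even as an endomorphism of `V ⊗ V`. -/
def IsEven {n : ℕ} (M : Matrix (Idx n × Idx n) (Idx n × Idx n) K) : Prop :=
  ∀ a b, a.1.2 + a.2.2 ≠ b.1.2 + b.2.2 → M a b = 0

variable {K n} in
theorem IsEven.add {M N : Matrix (Idx n × Idx n) (Idx n × Idx n) K} (hM : IsEven K M)
    (hN : IsEven K N) : IsEven K (M + N) := fun a b h => by
  rw [Matrix.add_apply, hM a b h, hN a b h, add_zero]

variable {K n} in
theorem IsEven.smul {M : Matrix (Idx n × Idx n) (Idx n × Idx n) K} (c : K) (hM : IsEven K M) :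
    IsEven K (c • M) := fun a b h => by
  rw [Matrix.smul_apply, hM a b h, smul_zero]

variable {K n} in
theorem IsEven.sum {α : Type*} (s : Finset α)
    {M : α → Matrix (Idx n × Idx n) (Idx n × Idx n) K} (hM : ∀ i ∈ s, IsEven K (M i)) :
    IsEven K (∑ i ∈ s, M i) := fun a b h => by
  rw [Matrix.sum_apply]
  exact Finset.sum_eq_zero fun i hi => hM i hi a b h

variable {K n} in
theorem isEven_superKron {p : ZMod 2} {A B : Mat K n} (hA : IsHomog p A) (hB : IsHomog p B) :
    IsEven K (superKron A B) := by
  intro a b h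
  have key : ∀ a1 a2 b1 b2 p : ZMod 2, a1 + a2 ≠ b1 + b2 → a1 + b1 ≠ p ∨ a2 + b2 ≠ p := by decide
  rw [superKron, Matrix.of_apply]
  rcases key _ _ _ _ p h with h | h
  · rw [hA _ _ h, zero_mul, smul_zero]
  · rw [hB _ _ h, mul_zero, smul_zero]

variable {K n} in
theorem IsHomog.add' {p : ZMod 2} {A B : Mat K n} (hA : IsHomog p A) (hB : IsHomog p B) :
    IsHomog p (A + B) := fun i j h => by rw [Matrix.add_apply, hA i j h, hB i j h, add_zero]

variable {K n} in
theorem IsHomog.smul' {p : ZMod 2} {A : Mat K n} (c : K) (hA : IsHomog p A) :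
    IsHomog p (c • A) := fun i j h => by rw [Matrix.smul_apply, hA i j h, smul_zero]

variable {K n} in
theorem el_diag_isHomog (i : Idx n) : IsHomog 0 (el i i : Mat K n) := by
  have h := el_isHomog (K := K) i i
  rwa [CharTwo.add_self_eq_zero] at h

theorem isEven_Smat : IsEven K (Smat K q n) := by
  refine .add (.add (.add ?_ (.sum _ fun i _ => ?_)) (.smul _ (.sum _ fun i _ => ?_)))
    (.smul _ (.sum _ fun x _ => ?_))
  · intro a b h
    refine Matrix.one_apply_ne ?_
    rintro rfl
    exact h rfl
  · exact isEven_superKron (((el_diag_isHomog i).smul' _).add' ((el_diag_isHomog i.neg).smul' _))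
      ((el_diag_isHomog i).add' (el_diag_isHomog i.neg))
  · refine isEven_superKron (sfE_isHomog _ _) ?_
    rw [add_comm]
    exact el_isHomog _ _
  · have h : IsEven K (superKron (sfE x.1 x.2) (el x.2 x.1 : Mat K n)) := by
      refine isEven_superKron (sfE_isHomog _ _) ?_
      rw [add_comm]
      exact el_isHomog _ _
    intro a b hab
    rw [Matrix.smul_apply, h a b hab, smul_zero]

/-- The parity automorphism of the free algebra; `t_{ij}` has parity `p(i) + p(j)`. -/
def fparity : QFree K n →ₐ[K] QFree K n :=
  FreeAlgebra.lift K fun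
    | QGen.t i j => sgn (i.2 + j.2) • ft K i j
    | QGen.tinv i => ftinv K i

variable {K n} in
theorem fparity_ft (i j : Idx n) : fparity K n (ft K i j) = sgn (i.2 + j.2) • ft K i j :=
  FreeAlgebra.lift_ι_apply _ _

variable {K n} in
theorem fparity_ftinv (i : Idx n) : fparity K n (ftinv K i) = ftinv K i :=
  FreeAlgebra.lift_ι_apply _ _

/-- The entries of `X` have the parities of the coefficients of an even element. -/
def IsEvenCoeff (X : Matrix (Idx n × Idx n) (Idx n × Idx n) (QFree K n)) : Prop :=
  ∀ a b, fparity K n (X a b) = sgn (a.1.2 + a.2.2 + (b.1.2 + b.2.2)) • X a b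

variable {K n} in
theorem fparity_smul (u : ℤˣ) (x : QFree K n) : fparity K n (u • x) = u • fparity K n x := by
  rw [Units.smul_def, map_zsmul, ← Units.smul_def]

variable {K n} in
theorem IsEvenCoeff.superMul {X Y : Matrix (Idx n × Idx n) (Idx n × Idx n) (QFree K n)}
    (hX : IsEvenCoeff K n X) (hY : IsEvenCoeff K n Y) : IsEvenCoeff K n (superMul X Y) := by
  intro a b
  simp only [_root_.superMul, Matrix.of_apply]
  rw [map_sum, Finset.smul_sum]
  refine Finset.sum_congr rfl fun c _ => ?_
  have key : ∀ a b c : ZMod 2, sgn (a + c) * sgn (c + b) = sgn (a + b) := by decide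
  rw [fparity_smul, map_mul, hX, hY, smul_mul_smul_comm, key, smul_comm]

theorem isEvenCoeff_T12 : IsEvenCoeff K n (T12 K n) := by
  intro a b
  rw [T12, Matrix.of_apply]
  split_ifs with h
  · have key : ∀ a b c : ZMod 2, a + c + (b + c) = a + b := by decide
    rw [fparity_ft, h, key]
  · rw [map_zero, smul_zero]

theorem isEvenCoeff_T13 : IsEvenCoeff K n (T13 K n) := by
  intro a b
  rw [T13, Matrix.of_apply]
  split_ifs with h
  · have key : ∀ a b c : ZMod 2, c + a + (c + b) = a + b := by decide
    rw [fparity_smul, fparity_ft, h, key, smul_comm]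
  · rw [map_zero, smul_zero]

theorem isEvenCoeff_S23 : IsEvenCoeff K n (S23 K q n) := by
  intro a b
  rw [S23, Matrix.map_apply, AlgHom.commutes]
  by_cases h : a.1.2 + a.2.2 = b.1.2 + b.2.2
  · rw [h, CharTwo.add_self_eq_zero, sgn, uzpow_zero, one_smul]
  · rw [isEven_Smat K q n a b h, map_zero, smul_zero]

namespace QEA

variable {K n}

/-- The projection from the free algebra. -/
def mk : QFree K n →ₐ[K] QEA K q n := RingQuot.mkAlgHom K (QRel K q n)

theorem mk_rel {x y : QFree K n} (h : QRel K q n x y) : mk q x = mk q y :=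
  RingQuot.mkAlgHom_rel K h

theorem mk_smul (u : ℤˣ) (x : QFree K n) : mk q (u • x) = u • mk q x := by
  rw [Units.smul_def, map_zsmul, ← Units.smul_def]

/-- The generator `t_{ij}`. -/
def t (i j : Idx n) : QEA K q n := mk q (ft K i j)

/-- The generator `t_{ii}⁻¹`. -/
def tinv (i : Idx n) : QEA K q n := mk q (ftinv K i)

/-- `τ_{ij} = t_{ij} / (q - q⁻¹)` for `i ≠ j` and `τ_{ii} = (t_{ii} - 1) / (q - 1)`. -/
def tau (i j : Idx n) : QEA K q n :=
  if i = j then (q - 1)⁻¹ • (t q i i - 1) else (q - q⁻¹)⁻¹ • t q i j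

/-- The parity automorphism; `t_{ij}` has parity `p(i) + p(j)`. -/
def parity : QEA K q n →ₐ[K] QEA K q n :=
  RingQuot.liftAlgHom K ⟨(mk q).comp (fparity K n), by
    have h1 : ∀ i : Idx n, sgn (i.2 + i.2) = 1 := fun i => by
      rw [CharTwo.add_self_eq_zero, sgn, uzpow_zero]
    intro x y h
    rw [AlgHom.comp_apply, AlgHom.comp_apply]
    cases h with
    | diag i => rw [fparity_ft, fparity_ft, h1, h1, one_smul, one_smul, mk_rel q (.diag i)]
    | anti i hi =>
      rw [fparity_ft, mk_smul, mk_rel q (.anti i hi), map_zero, map_zero, map_zero,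
        Units.smul_def, zsmul_zero]
    | lower i j hij =>
      rw [fparity_ft, mk_smul, mk_rel q (.lower i j hij), map_zero, map_zero, map_zero,
        Units.smul_def, zsmul_zero]
    | mul_inv i =>
      rw [map_mul, fparity_ft, fparity_ftinv, h1, one_smul, mk_rel q (.mul_inv i), map_one, map_one,
        map_one]
    | inv_mul i =>
      rw [map_mul, fparity_ft, fparity_ftinv, h1, one_smul, mk_rel q (.inv_mul i), map_one, map_one,
        map_one]
    | rtt a b =>
      have hT12 := isEvenCoeff_T12 K n
      have hT13 := isEvenCoeff_T13 K n
      have hS := isEvenCoeff_S23 K q n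
      rw [(hT12.superMul hT13).superMul hS a b, hS.superMul (hT13.superMul hT12) a b, mk_smul,
        mk_smul, mk_rel q (.rtt a b)]⟩

theorem parity_mk (x : QFree K n) : parity q (mk q x) = mk q (fparity K n x) :=
  RingQuot.liftAlgHom_mkAlgHom_apply K _ _ _

theorem parity_t (i j : Idx n) : parity q (t q i j) = sgn (i.2 + j.2) • t q i j := by
  rw [t, parity_mk, fparity_ft, mk_smul]

theorem parity_tinv (i : Idx n) : parity q (tinv q i) = tinv q i := by
  rw [tinv, parity_mk, fparity_ftinv]

theorem parity_tau (i j : Idx n) : parity q (tau q i j) = sgn (i.2 + j.2) • tau q i j := by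
  unfold tau
  split_ifs with h
  · subst h
    rw [map_smul, map_sub, map_one, parity_t, CharTwo.add_self_eq_zero, sgn, uzpow_zero, one_smul,
      one_smul]
  · rw [map_smul, parity_t, smul_comm]

instance : Superalgebra K (QEA K q n) where
  parityHom := parity q
  parityHom_parityHom a := by
    have : (parity q).comp (parity q) = AlgHom.id K (QEA K q n) := by
      apply RingQuot.ringQuot_ext'
      apply FreeAlgebra.hom_ext
      ext x
      cases x with
      | t i j =>
        change parity q (parity q (t q i j)) = t q i j
        rw [parity_t, Units.smul_def, map_zsmul, ← Units.smul_def, parity_t, smul_smul,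
          Int.units_mul_self, one_smul]
      | tinv i =>
        change parity q (parity q (tinv q i)) = tinv q i
        rw [parity_tinv, parity_tinv]
    exact DFunLike.congr_fun this a

end QEA

end quantum

/-! ### The `ħ`-adic version -/

section hadic

/-- `q = e ^ (ħ / 2)` in `ℂ((ħ))`. -/
def qh : LaurentSeries ℂ :=
  algebraMap (PowerSeries ℂ) (LaurentSeries ℂ) (PowerSeries.rescale (1 / 2) (PowerSeries.exp ℂ))

variable (n : ℕ)

/-- The quantized enveloping superalgebra over `ℂ((ħ))`, with `q = e ^ (ħ / 2)`. -/
abbrev UK : Type := QEA (LaurentSeries ℂ) qh n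

instance : Algebra (PowerSeries ℂ) (UK n) := RingQuot.instAlgebra (QRel (LaurentSeries ℂ) qh n)

instance : IsScalarTower (PowerSeries ℂ) (LaurentSeries ℂ) (UK n) :=
  inferInstanceAs (IsScalarTower (PowerSeries ℂ) (LaurentSeries ℂ)
    (RingQuot (QRel (LaurentSeries ℂ) qh n)))

/-- The generators of the `ℂ[[ħ]]`-form: all `τ_{ij}` with `|i| ≤ |j|` and, if `b = true`, all
`t_{ii}⁻¹`. -/
def hGens (b : Bool) : Set (UK n) :=
  {x | (∃ i j : Idx n, i.1 ≤ j.1 ∧ x = QEA.tau qh i j) ∨ b = true ∧ ∃ i, x = QEA.tinv qh i}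

/-- The `ℂ[[ħ]]`-subalgebra generated by `hGens`. -/
def hForm (b : Bool) : Subalgebra (PowerSeries ℂ) (UK n) :=
  Algebra.adjoin (PowerSeries ℂ) (hGens n b)

/-- The quantized enveloping superalgebra over `ℂ[[ħ]]`. -/
def Uh (b : Bool) : Type := hForm n b

instance (b : Bool) : Ring (Uh n b) := inferInstanceAs (Ring (hForm n b))

instance (b : Bool) : Algebra (PowerSeries ℂ) (Uh n b) :=
  inferInstanceAs (Algebra (PowerSeries ℂ) (hForm n b))

variable {n}

theorem parity_mem_hForm {b : Bool} {x : UK n} (hx : x ∈ hForm n b) :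
    QEA.parity qh x ∈ hForm n b := by
  let f : UK n →ₐ[PowerSeries ℂ] UK n := (QEA.parity qh).restrictScalars (PowerSeries ℂ)
  suffices h : hForm n b ≤ (hForm n b).comap f from h hx
  refine Algebra.adjoin_le ?_
  rintro _ (⟨i, j, hij, rfl⟩ | ⟨hb, i, rfl⟩)
  · have h : QEA.tau qh i j ∈ hForm n b := Algebra.subset_adjoin (Or.inl ⟨i, j, hij, rfl⟩)
    change QEA.parity qh (QEA.tau qh i j) ∈ hForm n b
    rw [QEA.parity_tau, Units.smul_def]
    exact zsmul_mem h _
  · change QEA.parity qh (QEA.tinv qh i) ∈ hForm n b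
    rw [QEA.parity_tinv]
    exact Algebra.subset_adjoin (Or.inr ⟨hb, i, rfl⟩)

/-- The inclusion of the `ℂ[[ħ]]`-form. -/
def Uh.val (b : Bool) : Uh n b →ₐ[PowerSeries ℂ] UK n := (hForm n b).val

theorem Uh.val_injective (b : Bool) : Function.Injective (Uh.val (n := n) b) :=
  Subtype.val_injective

/-- The restriction of the parity automorphism to the `ℂ[[ħ]]`-form. -/
def Uh.parity (b : Bool) : Uh n b →ₐ[PowerSeries ℂ] Uh n b :=
  (((QEA.parity qh).restrictScalars (PowerSeries ℂ)).comp (Uh.val b)).codRestrict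
    (hForm n b) fun x => parity_mem_hForm x.2

instance (b : Bool) : Superalgebra (PowerSeries ℂ) (Uh n b) where
  parityHom := Uh.parity b
  parityHom_parityHom _ :=
    Uh.val_injective b (Superalgebra.parityHom_parityHom (R := LaurentSeries ℂ) _)

/-- `τ_{ij}` as an element of the `ℂ[[ħ]]`-form. -/
def Uh.tau (b : Bool) (i j : Idx n) (h : i.1 ≤ j.1) : Uh n b :=
  ⟨QEA.tau qh i j, Algebra.subset_adjoin (Or.inl ⟨i, j, h, rfl⟩)⟩

/-- The inclusion of the `ℂ[[ħ]]`-form, as a semilinear map. -/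
def Uh.incl (b : Bool) :
    Uh n b →ₛₗ[algebraMap (PowerSeries ℂ) (LaurentSeries ℂ)] UK n where
  toFun x := Uh.val b x
  map_add' _ _ := map_add _ _ _
  map_smul' r x := by rw [map_smul, algebraMap_smul]

/-- The superbialgebra structure `H` on the `ℂ[[ħ]]`-form is the restriction of `HK`. -/
structure IsRestriction {b : Bool} (H : SuperBialgebra (PowerSeries ℂ) (Uh n b))
    (HK : SuperBialgebra (LaurentSeries ℂ) (UK n)) : Prop where
  comul (x : Uh n b) :
    TensorProduct.map (Uh.incl b) (Uh.incl b) (H.Δ x) = HK.Δ (Uh.incl b x)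
  counit (x : Uh n b) :
    algebraMap (PowerSeries ℂ) (LaurentSeries ℂ) (H.counit x) = HK.counit (Uh.incl b x)

/-- Let `A` be a superbialgebra over `ℂ[[ħ]]`, let `A₀` be a superbialgebra over `ℂ` with a Poisson
cobracket `δ`, and let `ρ : A → A₀` be a map, `ρ a` being thought of as the class of `a` modulo `ħ`.
`A` is a quantization of `A₀` by means of `ρ` if `A` is flat over `ℂ[[ħ]]`, if `ρ` induces an
isomorphism of superbialgebras `A / ħ A → A₀`, and if, for all `a`, the element
`ħ⁻¹ (Δ a - (Δ a)°)` exists in `A ⊗ A` and reduces to `δ (ρ a)` modulo `ħ`. -/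
structure IsQuantization {A A₀ : Type*} [Ring A] [Algebra (PowerSeries ℂ) A]
    [Superalgebra (PowerSeries ℂ) A] [Ring A₀] [Algebra ℂ A₀] [Superalgebra ℂ A₀]
    (H : SuperBialgebra (PowerSeries ℂ) A) (H₀ : SuperBialgebra ℂ A₀)
    (δ : A₀ →ₗ[ℂ] A₀ ⊗[ℂ] A₀)
    (ρ : A →ₛₗ[(PowerSeries.constantCoeff : PowerSeries ℂ →+* ℂ)] A₀) : Prop where
  flat : Module.Flat (PowerSeries ℂ) A
  map_one : ρ 1 = 1
  map_mul (a b : A) : ρ (a * b) = ρ a * ρ b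
  surjective : Function.Surjective ρ
  ker (a : A) : ρ a = 0 ↔ ∃ b : A, a = (PowerSeries.X : PowerSeries ℂ) • b
  map_parity (a : A) : ρ (parity (PowerSeries ℂ) a) = parity ℂ (ρ a)
  map_comul (a : A) : TensorProduct.map ρ ρ (H.Δ a) = H₀.Δ (ρ a)
  map_counit (a : A) : PowerSeries.constantCoeff (H.counit a) = H₀.counit (ρ a)
  exists_div (a : A) : ∃ D : A ⊗[PowerSeries ℂ] A,
    (PowerSeries.X : PowerSeries ℂ) • D = H.Δ a - superSwap (PowerSeries ℂ) A (H.Δ a)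
  limit (a : A) (D : A ⊗[PowerSeries ℂ] A)
    (hD : (PowerSeries.X : PowerSeries ℂ) • D = H.Δ a - superSwap (PowerSeries ℂ) A (H.Δ a)) :
    TensorProduct.map ρ ρ D = δ (ρ a)

/-- `ρ` is the reduction modulo `ħ` whose inverse is the isomorphism `U(𝔭_n) → U / ħ U` with
`𝖤_{ji} ↦ (-1) ^ p(j) τ_{ij}` for `|i| < |j|` and for `i = j > 0`, and `𝖤_{-i,i} ↦ -2 τ_{i,-i}` for
`i > 0`. -/
structure IsStandardReduction {b : Bool}
    (ρ : Uh n b →ₛₗ[(PowerSeries.constantCoeff : PowerSeries ℂ →+* ℂ)] Up n) : Prop where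
  off_diag (i j : Idx n) (h : i.1 < j.1) : Up.ι (pE j i) = sgn j.2 • ρ (Uh.tau b i j h.le)
  diag (i : Idx n) (h : i.2 = 0) : Up.ι (pE i i) = ρ (Uh.tau b i i le_rfl)
  anti_diag (i : Idx n) (h : i.2 = 0) :
    Up.ι (pE i.neg i) = -2 * ρ (Uh.tau b i i.neg le_rfl)

/-- The formula for the comultiplication on the generators `t_{ij}`. -/
def IsStandardComul (H : SuperBialgebra (LaurentSeries ℂ) (UK n)) : Prop :=
  ∀ i j : Idx n, H.comul (QEA.t qh i j) =
    ∑ k : Idx n, sgn ((i.2 + k.2) * (k.2 + j.2)) • (QEA.t qh i k ᵍ⊗ₜ[LaurentSeries ℂ] QEA.t qh k j)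

/-- The elements of `𝔭_n` are primitive. -/
def IsPrimitive (H : SuperBialgebra ℂ (Up n)) : Prop :=
  ∀ x : periplectic n, H.Δ (Up.ι x) = Up.ι x ⊗ₜ[ℂ] 1 + 1 ⊗ₜ[ℂ] Up.ι x

end hadic

end

open scoped TensorProduct

noncomputable section

open Superalgebra

set_option linter.unusedSectionVars false

/-! Hopf structure over `ℂ((ħ))`. The signs in the product of even elements of `A ⊗ End(V ⊗ V)` form
a coboundary. After rescaling entries by signs, an algebra homomorphism out of `QEA` is therefore an
upper triangular matrix `M` with invertible diagonal which satisfies the ordinary matrix identity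
`M₁ M₂ S = S M₂ M₁` (`QEA.IsQuantumMatrix`, `QEA.lift`). The product of two such matrices with
supercommuting entries is again one, which gives the comultiplication. The identity matrix gives the
counit. The inverse, read in the opposite algebra, gives the antipode; a square root of `-1`
converts super anti-homomorphisms into ordinary ones.

Forms over `ℂ[[ħ]]`. Up to units and signs the generators are `λ = (t - 1) / ħ`, for which `Δ λ = λ
⊗ 1 + 1 ⊗ λ + ħ ∑ λ ⊗ λ`. So the structure maps are integral, and the antipode is too once the
`t_{ii}⁻¹` are present. The forms embed in a vector space over `ℂ((ħ))`, hence are torsion-free,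
hence flat, so identities can be checked after extension of scalars.

Reduction modulo `ħ`. Write `S = 1 + ħ s`. The terms of order `0` and `1` of the RTT relation
cancel. The term of order `2` expresses every supercommutator of the classes of the `λ_{ij}` as a
linear combination of these classes, with coefficients that depend on `s` only. The images `L_{ij}`
of these classes in the vector representation obey the same formulas and span `𝔭_n`, and the linear
relations among the `L_{ij}` also hold among the classes. This yields a surjection from `U(𝔭_n)`
onto the reduction without any computation of structure constants
(`IsClassicalRTT.supercommutator_eq`).

The vector representation of `QEA` exists because `S` satisfies the Yang–Baxter equation, that is,
because the associated braiding satisfies the braid relation. Every absolute value has to occur an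
even number of times among the six outer indices, so at most three occur. Contributions of other
intermediate absolute values cancel in pairs `p, -p`. What remains is a finite check with six
indices (`Braid.left_eq_right`).

Injectivity of `f : U(𝔭_n) → U / ħ U` is proved without a PBW theorem. The map `f` respects
comultiplications and the vector representations. If `f u = 0`, then `(f ⊗ f) Δ u = 0`, and the
projection of the first factor to `𝔭_n` through the vector representation gives `(pr ⊗ f) Δ u = 0`.
The operator `x ⊗ y ↦ P(x) y` applied to `Δ u`, where `P` is that projection inside `U(𝔭_n)`, acts
as multiplication by `d` on the part of degree `d` modulo lower degree. Induction on the degree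
gives `u = 0` (`IsPrimitiveProjection.injective`, `Uh.ofUp_injective`).

Cobracket. The super cocommutator `Δ - Δ°` of any superbialgebra is skew and satisfies the co-Jacobi
and co-Leibniz identities exactly. Division by powers of `ħ` and reduction turn it into a co-Poisson
cobracket on `U(𝔭_n)` (`IsDeformation.isCoPoisson_cobracket`). On `L_{ij}` its value is `∑ L_{ik} ⊗
L_{kj}` minus the super swap. Since pairing with `L_{ij}` reads off, up to sign, the `(i, j)` entry
of an element of `𝔟_n`, this expression is dual to matrix multiplication, so it is the cobracket of
the Manin triple. -/

theorem sgn_zero : sgn 0 = 1 := by decide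

theorem sgn_add (x y : ZMod 2) : sgn (x + y) = sgn x * sgn y := uzpow_add _ _ _

theorem zmod_two_cases (i : ZMod 2) : i = 0 ∨ i = 1 := by
  revert i; decide

namespace Superalgebra

section

variable {R A : Type*} [CommRing R] [Ring A] [Algebra R A] [Superalgebra R A]

theorem parity_of_mem {i : ZMod 2} {a : A} (ha : a ∈ part R A i) : parity R a = sgn i • a := ha

theorem mem_part_zero {a : A} : a ∈ part R A 0 ↔ parity R a = a := by
  rw [mem_part, sgn_zero, one_smul]

theorem mem_part_one {a : A} : a ∈ part R A 1 ↔ parity R a = -a := by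
  rw [mem_part, sgn_one, Units.neg_smul, one_smul]

theorem one_mem_part : (1 : A) ∈ part R A 0 := by simp [mem_part]

theorem mul_mem_part {i j : ZMod 2} {a b : A} (ha : a ∈ part R A i) (hb : b ∈ part R A j) :
    a * b ∈ part R A (i + j) :=
  SetLike.mul_mem_graded ha hb

theorem parity_mem_part {i : ZMod 2} {a : A} (ha : a ∈ part R A i) : parity R a ∈ part R A i := by
  rw [parity_of_mem ha, Units.smul_def]
  exact zsmul_mem ha _

theorem parity_parity (a : A) : parity R (parity R a) = a := parityHom_parityHom a

variable [Invertible (2 : R)]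

variable (R) in
theorem induction_homog {P : A → Prop} (hom : ∀ i a, a ∈ part R A i → P a)
    (add : ∀ a b, P a → P b → P (a + b)) (a : A) : P a := by
  rw [← proj_add_proj (R := R) a]
  exact add _ _ (hom _ _ (proj_mem 0 a)) (hom _ _ (proj_mem 1 a))

end

/-! ### Super tensor products of superalgebras -/

section Tensor

variable {R A B C : Type*} [CommRing R] [Ring A] [Algebra R A] [Superalgebra R A]
  [Ring B] [Algebra R B] [Superalgebra R B] [Ring C] [Algebra R C] [Superalgebra R C]
  [Invertible (2 : R)]

/-- The super tensor product of two superalgebras. -/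
abbrev ST (R A B : Type*) [CommRing R] [Ring A] [Algebra R A] [Superalgebra R A]
    [Ring B] [Algebra R B] [Superalgebra R B] [Invertible (2 : R)] : Type _ :=
  part R A ᵍ⊗[R] part R B

theorem tmul_mul_tmul {j k : ZMod 2} (a : A) {b : B} (hb : b ∈ part R B j) {c : A}
    (hc : c ∈ part R A k) (d : B) :
    ((a ᵍ⊗ₜ[R] b) * (c ᵍ⊗ₜ[R] d) : ST R A B) = sgn (j * k) • ((a * c) ᵍ⊗ₜ[R] (b * d)) :=
  GradedTensorProduct.tmul_coe_mul_coe_tmul (part R A) (part R B) a ⟨b, hb⟩ ⟨c, hc⟩ d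

theorem comm_tmul {j k : ZMod 2} {a : A} (ha : a ∈ part R A j) {b : B} (hb : b ∈ part R B k) :
    GradedTensorProduct.comm (part R A) (part R B) (a ᵍ⊗ₜ[R] b) =
      sgn (j * k) • (b ᵍ⊗ₜ[R] a : ST R B A) := by
  rw [mul_comm]
  exact GradedTensorProduct.comm_coe_tmul_coe (part R A) (part R B) ⟨a, ha⟩ ⟨b, hb⟩

theorem tmul_induction_homog {P : ST R A B → Prop} (x : ST R A B)
    (hom : ∀ i j a b, a ∈ part R A i → b ∈ part R B j → P (a ᵍ⊗ₜ[R] b))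
    (add : ∀ a b, P a → P b → P (a + b)) : P x := by
  have h0 : P 0 := by
    have := hom 0 0 0 0 (zero_mem _) (zero_mem _)
    rwa [show (0 : A) ᵍ⊗ₜ[R] (0 : B) = (0 : ST R A B) by
      rw [GradedTensorProduct.tmul, TensorProduct.zero_tmul, map_zero]] at this
  refine TensorProduct.induction_on (motive := fun x => P (GradedTensorProduct.of R _ _ x))
    ((GradedTensorProduct.of R _ _).symm x) h0 (fun a b => ?_) (fun a b ha hb => add _ _ ha hb)
  refine induction_homog R
    (P := fun a => P (GradedTensorProduct.of R (part R A) (part R B) (a ⊗ₜ[R] b)))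
    (fun i a ha => ?_) (fun a a' h h' => ?_) a
  · refine induction_homog R
      (P := fun b => P (GradedTensorProduct.of R (part R A) (part R B) (a ⊗ₜ[R] b)))
      (fun j b hb => hom i j a b ha hb) (fun b b' h h' => ?_) b
    rw [TensorProduct.tmul_add]
    exact add _ _ h h'
  · rw [TensorProduct.add_tmul]
    exact add _ _ h h'

theorem units_smul_map {M N F : Type*} [AddCommGroup M] [AddCommGroup N] [FunLike F M N]
    [AddMonoidHomClass F M N] (f : F) (u : ℤˣ) (x : M) : f (u • x) = u • f x := by
  rw [Units.smul_def, map_zsmul, ← Units.smul_def]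

theorem tmul_units_smul (u : ℤˣ) (a : A) (b : B) : a ⊗ₜ[R] (u • b) = u • (a ⊗ₜ[R] b) := by
  exact units_smul_map (TensorProduct.mk R A B a) u b

theorem units_smul_tmul (u : ℤˣ) (a : A) (b : B) : (u • a) ⊗ₜ[R] b = u • (a ⊗ₜ[R] b) := by
  exact units_smul_map ((TensorProduct.mk R A B).flip b) u a

theorem lift_anticomm {D : Type*} [Ring D] [Algebra R D] {f : A →ₐ[R] D} {g : B →ₐ[R] D}
    (h : ∀ i j a b, a ∈ part R A i → b ∈ part R B j → f a * g b = sgn (i * j) • (g b * f a))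
    ⦃i j : ZMod 2⦄ (a : part R A i) (b : part R B j) :
    f a * g b = (-1 : ℤˣ) ^ (j * i) • (g b * f a) := by
  rw [mul_comm j]
  exact h i j a b a.2 b.2

/-- The tensor product of two morphisms of superalgebras. -/
def ST.map {A' B' : Type*} [Ring A'] [Algebra R A'] [Superalgebra R A'] [Ring B'] [Algebra R B']
    [Superalgebra R B'] (f : A →ₐ[R] A') (g : B →ₐ[R] B')
    (hf : ∀ a, f (parity R a) = parity R (f a)) (hg : ∀ a, g (parity R a) = parity R (g a)) :
    ST R A B →ₐ[R] ST R A' B' :=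
  GradedTensorProduct.lift (part R A) (part R B)
    ((GradedTensorProduct.includeLeft (part R A') (part R B')).comp f)
    ((GradedTensorProduct.includeRight (part R A') (part R B')).comp g) <| lift_anticomm <| by
      intro i j a b ha hb
      have ha' : f a ∈ part R A' i := by
        rw [mem_part, ← hf, parity_of_mem ha, units_smul_map]
      have hb' : g b ∈ part R B' j := by
        rw [mem_part, ← hg, parity_of_mem hb, units_smul_map]
      change (f a ᵍ⊗ₜ[R] 1) * (1 ᵍ⊗ₜ[R] g b) = sgn (i * j) • ((1 ᵍ⊗ₜ[R] g b) * (f a ᵍ⊗ₜ[R] 1))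
      rw [tmul_mul_tmul _ one_mem_part one_mem_part, tmul_mul_tmul _ hb' ha', smul_smul,
        mul_comm j i, Int.units_mul_self]
      simp

theorem ST.map_tmul {A' B' : Type*} [Ring A'] [Algebra R A'] [Superalgebra R A'] [Ring B']
    [Algebra R B'] [Superalgebra R B'] (f : A →ₐ[R] A') (g : B →ₐ[R] B') (hf hg) (a : A) (b : B) :
    ST.map (R := R) f g hf hg (a ᵍ⊗ₜ[R] b) = f a ᵍ⊗ₜ[R] g b := by
  change (f a ᵍ⊗ₜ[R] (1 : B')) * ((1 : A') ᵍ⊗ₜ[R] g b) = (_ : ST R A' B')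
  rw [tmul_mul_tmul _ one_mem_part one_mem_part]
  simp

theorem ST.map_eq {A' B' : Type*} [Ring A'] [Algebra R A'] [Superalgebra R A'] [Ring B']
    [Algebra R B'] [Superalgebra R B'] (f : A →ₐ[R] A') (g : B →ₐ[R] B') (hf hg) (x : ST R A B) :
    ST.map (R := R) f g hf hg x = GradedTensorProduct.of R _ _
      (TensorProduct.map f.toLinearMap g.toLinearMap ((GradedTensorProduct.of R _ _).symm x)) := by
  have : (ST.map (R := R) f g hf hg).toLinearMap ∘ₗ
      (GradedTensorProduct.of R (part R A) (part R B)).toLinearMap =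
      (GradedTensorProduct.of R _ _).toLinearMap ∘ₗ
        TensorProduct.map f.toLinearMap g.toLinearMap :=
    TensorProduct.ext' fun a b => ST.map_tmul f g hf hg a b
  exact LinearMap.congr_fun this ((GradedTensorProduct.of R _ _).symm x)

instance : Superalgebra R (ST R A B) where
  parityHom := ST.map (parity R) (parity R) (fun _ => rfl) (fun _ => rfl)
  parityHom_parityHom x := by
    refine tmul_induction_homog (P := fun x => ST.map _ _ _ _ (ST.map _ _ _ _ x) = x) x
      (fun i j a b _ _ => ?_) (fun x y hx hy => ?_)
    · rw [ST.map_tmul, ST.map_tmul, parity_parity, parity_parity]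
    · rw [map_add, map_add, hx, hy]

theorem ST.parity_tmul (a : A) (b : B) :
    parity R (a ᵍ⊗ₜ[R] b : ST R A B) = parity R a ᵍ⊗ₜ[R] parity R b := ST.map_tmul _ _ _ _ _ _

theorem ST.parity_eq (x : ST R A B) : parity R x = GradedTensorProduct.of R _ _
    (TensorProduct.map (parity R).toLinearMap (parity R).toLinearMap
      ((GradedTensorProduct.of R _ _).symm x)) := ST.map_eq _ _ _ _ _

theorem ST.tmul_mem {i j : ZMod 2} {a : A} {b : B} (ha : a ∈ part R A i) (hb : b ∈ part R B j) :
    (a ᵍ⊗ₜ[R] b : ST R A B) ∈ part R (ST R A B) (i + j) := by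
  rw [mem_part, ST.parity_tmul, parity_of_mem ha, parity_of_mem hb, GradedTensorProduct.tmul,
    units_smul_tmul, tmul_units_smul, units_smul_map, units_smul_map, smul_smul, sgn_add]

theorem ST.triple_induction {P : ST R (ST R A B) C → Prop} (x : ST R (ST R A B) C)
    (hom : ∀ i j k a b c, a ∈ part R A i → b ∈ part R B j → c ∈ part R C k →
      P ((a ᵍ⊗ₜ[R] b : ST R A B) ᵍ⊗ₜ[R] c))
    (add : ∀ a b, P a → P b → P (a + b)) : P x := by
  refine tmul_induction_homog x (fun _ k u c _ hc => ?_) add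
  refine tmul_induction_homog (P := fun u => P (u ᵍ⊗ₜ[R] c)) u
    (fun i j a b ha hb => hom i j k a b c ha hb hc) (fun u v hu hv => ?_)
  rw [GradedTensorProduct.tmul, TensorProduct.add_tmul]
  exact add _ _ hu hv

/-- The associativity isomorphism of super tensor products, as a linear map. -/
def ST.assocLin : ST R (ST R A B) C →ₗ[R] ST R A (ST R B C) :=
  (TensorProduct.assoc R A B C).toLinearMap

theorem ST.assocLin_tmul (a : A) (b : B) (c : C) :
    ST.assocLin ((a ᵍ⊗ₜ[R] b : ST R A B) ᵍ⊗ₜ[R] c) = a ᵍ⊗ₜ[R] (b ᵍ⊗ₜ[R] c : ST R B C) := rfl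

theorem ST.tmul_smul (u : ℤˣ) (a : A) (b : B) :
    (a ᵍ⊗ₜ[R] (u • b) : ST R A B) = u • (a ᵍ⊗ₜ[R] b) := by
  rw [GradedTensorProduct.tmul, tmul_units_smul, units_smul_map]

theorem ST.smul_tmul (u : ℤˣ) (a : A) (b : B) :
    ((u • a) ᵍ⊗ₜ[R] b : ST R A B) = u • (a ᵍ⊗ₜ[R] b) := by
  rw [GradedTensorProduct.tmul, units_smul_tmul, units_smul_map]

/-- The associativity isomorphism of super tensor products. -/
def ST.assoc : ST R (ST R A B) C →ₐ[R] ST R A (ST R B C) :=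
  AlgHom.ofLinearMap ST.assocLin rfl <| by
    intro x y
    refine ST.triple_induction (P := fun x => ST.assocLin (x * y) = ST.assocLin x * ST.assocLin y)
      x (fun i j k a b c ha hb hc => ?_) (fun x y hx hy => by rw [add_mul, map_add, hx, hy, map_add,
        add_mul])
    refine ST.triple_induction
      (P := fun y => ST.assocLin (((a ᵍ⊗ₜ[R] b : ST R A B) ᵍ⊗ₜ[R] c) * y) =
        ST.assocLin ((a ᵍ⊗ₜ[R] b : ST R A B) ᵍ⊗ₜ[R] c) * ST.assocLin y)
      y (fun i' j' k' a' b' c' ha' hb' hc' => ?_) (fun x y hx hy => by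
        rw [mul_add, map_add, hx, hy, map_add, mul_add])
    rw [tmul_mul_tmul _ hc (ST.tmul_mem ha' hb'), tmul_mul_tmul _ hb ha', ST.assocLin_tmul,
      ST.assocLin_tmul, tmul_mul_tmul _ (ST.tmul_mem hb hc) ha', tmul_mul_tmul _ hc hb',
      units_smul_map, ST.smul_tmul, units_smul_map, ST.tmul_smul, ST.assocLin_tmul, smul_smul,
      smul_smul, ← sgn_add, ← sgn_add]
    congr 2
    ring

end Tensor

end Superalgebra

/-! ### Superbialgebra axioms checked on generators -/

section Bialgebra

variable {R A : Type*} [CommRing R] [Ring A] [Algebra R A] [Superalgebra R A] [Invertible (2 : R)]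

/-- On an odd element, invariance under parity reads `ε a = -ε a`, and `2` is invertible. -/
theorem counit_eq_zero {ε : A →ₐ[R] R} (hε : ∀ a, ε (parity R a) = ε a) {a : A}
    (ha : a ∈ part R A 1) : ε a = 0 := by
  have h := hε a
  rw [mem_part_one.1 ha, map_neg] at h
  have h2 : (2 : R) * ε a = 0 := by rw [two_mul]; nth_rw 1 [← h]; ring
  calc ε a = ⅟2 * (2 * ε a) := by rw [← mul_assoc, invOf_mul_self, one_mul]
    _ = 0 := by rw [h2, mul_zero]

/-- The map `x ⊗ y ↦ ε x • y`. -/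
def counitLeft (ε : A →ₐ[R] R) (hε : ∀ a, ε (parity R a) = ε a) : ST R A A →ₐ[R] A :=
  GradedTensorProduct.lift (part R A) (part R A) ((Algebra.ofId R A).comp ε) (AlgHom.id R A) <|
    lift_anticomm <| by
      intro i j a b ha hb
      change algebraMap R A (ε a) * b = _ • (b * algebraMap R A (ε a))
      rcases zmod_two_cases i with rfl | rfl
      · rw [zero_mul, sgn_zero, one_smul, Algebra.commutes]
      · rw [counit_eq_zero hε ha]
        simp

/-- The map `x ⊗ y ↦ ε y • x`. -/
def counitRight (ε : A →ₐ[R] R) (hε : ∀ a, ε (parity R a) = ε a) : ST R A A →ₐ[R] A :=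
  GradedTensorProduct.lift (part R A) (part R A) (AlgHom.id R A) ((Algebra.ofId R A).comp ε) <|
    lift_anticomm <| by
      intro i j a b ha hb
      change a * algebraMap R A (ε b) = _ • (algebraMap R A (ε b) * a)
      rcases zmod_two_cases j with rfl | rfl
      · rw [mul_zero, sgn_zero, one_smul, Algebra.commutes]
      · rw [counit_eq_zero hε hb]
        simp

theorem counitLeft_eq (ε : A →ₐ[R] R) (hε) (x : ST R A A) : counitLeft ε hε x =
    TensorProduct.lid R A (ε.toLinearMap.rTensor A ((GradedTensorProduct.of R _ _).symm x)) := by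
  have : (counitLeft ε hε).toLinearMap ∘ₗ (GradedTensorProduct.of R _ _).toLinearMap =
      (TensorProduct.lid R A).toLinearMap ∘ₗ ε.toLinearMap.rTensor A :=
    TensorProduct.ext' fun a b => by
      change algebraMap R A (ε a) * b = ε a • b
      rw [Algebra.smul_def]
  exact LinearMap.congr_fun this ((GradedTensorProduct.of R _ _).symm x)

theorem counitRight_eq (ε : A →ₐ[R] R) (hε) (x : ST R A A) : counitRight ε hε x =
    TensorProduct.rid R A (ε.toLinearMap.lTensor A ((GradedTensorProduct.of R _ _).symm x)) := by
  have : (counitRight ε hε).toLinearMap ∘ₗ (GradedTensorProduct.of R _ _).toLinearMap =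
      (TensorProduct.rid R A).toLinearMap ∘ₗ ε.toLinearMap.lTensor A :=
    TensorProduct.ext' fun a b => by
      change a * algebraMap R A (ε b) = ε b • a
      rw [Algebra.smul_def, Algebra.commutes]
  exact LinearMap.congr_fun this ((GradedTensorProduct.of R _ _).symm x)

theorem id_parity (a : A) : AlgHom.id R A (parity R a) = parity R (AlgHom.id R A a) := rfl

/-- Both sides are algebra homomorphisms into the triple super tensor product, so they agree as soon
as they agree on generators. The algebra structure is essential here: the underlying linear maps
alone would not allow this. -/
theorem coassoc_of_adjoin {G : Set A} (hG : Algebra.adjoin R G = ⊤) (Δ : A →ₐ[R] SuperTensor R A)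
    (hΔ : ∀ a, Δ (parity R a) = parity R (Δ a))
    (hco : ∀ g ∈ G, TensorProduct.assoc R A A A ((underlying Δ).rTensor A (underlying Δ g)) =
      (underlying Δ).lTensor A (underlying Δ g)) (a : A) :
    TensorProduct.assoc R A A A ((underlying Δ).rTensor A (underlying Δ a)) =
      (underlying Δ).lTensor A (underlying Δ a) := by
  have e1 (x : SuperTensor R A) : ST.assoc (ST.map Δ (AlgHom.id R A) hΔ id_parity x) =
      TensorProduct.assoc R A A A ((underlying Δ).rTensor A
        ((GradedTensorProduct.of R _ _).symm x)) := by
    rw [ST.map_eq]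
    rfl
  have e2 (x : SuperTensor R A) : ST.map (AlgHom.id R A) Δ id_parity hΔ x =
      (underlying Δ).lTensor A ((GradedTensorProduct.of R _ _).symm x) := by
    rw [ST.map_eq]
    rfl
  have := DFunLike.congr_fun (AlgHom.ext_of_adjoin_eq_top hG
      (φ₁ := (ST.assoc.comp (ST.map Δ (AlgHom.id R A) hΔ id_parity)).comp Δ)
      (φ₂ := (ST.map (AlgHom.id R A) Δ id_parity hΔ).comp Δ) fun g hg =>
        (e1 (Δ g)).trans ((hco g hg).trans (e2 (Δ g)).symm)) a
  exact (e1 (Δ a)).symm.trans (this.trans (e2 (Δ a)))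

/-- A superbialgebra structure, given by algebra homomorphisms which satisfy the axioms on
generators. -/
def SuperBialgebra.ofGenerators {G : Set A} (hG : Algebra.adjoin R G = ⊤)
    (Δ : A →ₐ[R] SuperTensor R A) (ε : A →ₐ[R] R)
    (hΔ : ∀ g ∈ G, Δ (parity R g) = parity R (Δ g)) (hε : ∀ g ∈ G, ε (parity R g) = ε g)
    (hco : ∀ g ∈ G, TensorProduct.assoc R A A A ((underlying Δ).rTensor A (underlying Δ g)) =
      (underlying Δ).lTensor A (underlying Δ g))
    (hl : ∀ g ∈ G, TensorProduct.lid R A (ε.toLinearMap.rTensor A (underlying Δ g)) = g)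
    (hr : ∀ g ∈ G, TensorProduct.rid R A (ε.toLinearMap.lTensor A (underlying Δ g)) = g) :
    SuperBialgebra R A :=
  have hε' : ∀ a, ε (parity R a) = ε a := DFunLike.congr_fun
    (AlgHom.ext_of_adjoin_eq_top hG (φ₁ := ε.comp (parity R)) (φ₂ := ε) fun g hg => hε g hg)
  have hΔ' : ∀ a, Δ (parity R a) = parity R (Δ a) := DFunLike.congr_fun
    (AlgHom.ext_of_adjoin_eq_top hG (φ₁ := Δ.comp (parity R)) (φ₂ := (parity R).comp Δ)
      fun g hg => hΔ g hg)
  { comul := Δ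
    counit := ε
    comul_parity a := by
      have := congrArg (GradedTensorProduct.of R _ _).symm (hΔ' a)
      rw [ST.parity_eq] at this
      exact this
    counit_parity := hε'
    coassoc := coassoc_of_adjoin hG Δ hΔ' hco
    counit_left a := by
      have := DFunLike.congr_fun (AlgHom.ext_of_adjoin_eq_top hG
        (φ₁ := (counitLeft ε hε').comp Δ) (φ₂ := AlgHom.id R A) fun g hg => by
          rw [AlgHom.comp_apply, counitLeft_eq]
          exact hl g hg) a
      rw [AlgHom.comp_apply, counitLeft_eq] at this
      exact this
    counit_right a := by
      have := DFunLike.congr_fun (AlgHom.ext_of_adjoin_eq_top hG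
        (φ₁ := (counitRight ε hε').comp Δ) (φ₂ := AlgHom.id R A) fun g hg => by
          rw [AlgHom.comp_apply, counitRight_eq]
          exact hr g hg) a
      rw [AlgHom.comp_apply, counitRight_eq] at this
      exact this }

theorem SuperBialgebra.comul_parity' (H : SuperBialgebra R A) (a : A) :
    H.comul (parity R a) = parity R (H.comul a) := by
  rw [ST.parity_eq]
  exact congrArg (GradedTensorProduct.of R _ _) (H.comul_parity a)

theorem SuperBialgebra.comul_mem (H : SuperBialgebra R A) {i : ZMod 2} {a : A}
    (ha : a ∈ part R A i) : H.comul a ∈ part R (SuperTensor R A) i := by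
  rw [mem_part, ← H.comul_parity', parity_of_mem ha, units_smul_map]

/-! ### Antipodes -/

/-- The map `x ⊗ y ↦ S x * y`. -/
def convLeft (S : A →ₗ[R] A) : SuperTensor R A →ₗ[R] A :=
  LinearMap.mul' R A ∘ₗ S.rTensor A ∘ₗ (GradedTensorProduct.of R _ _).symm.toLinearMap

/-- The map `x ⊗ y ↦ x * S y`. -/
def convRight (S : A →ₗ[R] A) : SuperTensor R A →ₗ[R] A :=
  LinearMap.mul' R A ∘ₗ S.lTensor A ∘ₗ (GradedTensorProduct.of R _ _).symm.toLinearMap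

theorem convLeft_tmul (S : A →ₗ[R] A) (x y : A) : convLeft S (x ᵍ⊗ₜ[R] y) = S x * y := rfl

theorem convRight_tmul (S : A →ₗ[R] A) (x y : A) : convRight S (x ᵍ⊗ₜ[R] y) = x * S y := rfl

/-- `S` is a super anti-homomorphism. -/
structure IsSuperAnti (S : A →ₗ[R] A) : Prop where
  map_parity (a : A) : S (parity R a) = parity R (S a)
  map_one : S 1 = 1
  map_mul {i j : ZMod 2} {a b : A} (ha : a ∈ part R A i) (hb : b ∈ part R A j) :
    S (a * b) = sgn (i * j) • (S b * S a)

/-- The `k`-th power of the parity automorphism. -/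
def parityPow (k : ZMod 2) : A →ₗ[R] A :=
  if k = 0 then LinearMap.id else (parity R : A →ₐ[R] A).toLinearMap

theorem parityPow_of_mem {i k : ZMod 2} {a : A} (ha : a ∈ part R A i) :
    parityPow (R := R) k a = sgn (i * k) • a := by
  rcases zmod_two_cases k with rfl | rfl
  · rw [mul_zero, sgn_zero, one_smul]; rfl
  · rw [mul_one, ← parity_of_mem ha]; rfl

/-- For `X = a ⊗ b`, moving `z` past `b` and reversing the product `a z` contribute the signs
`|b||z|` and `|a||z|`. Together they depend on the total parity of `X` only, which is why a power of
the parity automorphism of `X` appears. -/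
theorem convLeft_mul_tmul {S : A →ₗ[R] A} (hS : IsSuperAnti S) (X : SuperTensor R A) {k : ZMod 2}
    {z : A} (hz : z ∈ part R A k) (w : A) :
    convLeft S (X * (z ᵍ⊗ₜ[R] w)) = S z * convLeft S (parityPow (R := R) k X) * w := by
  refine tmul_induction_homog (P := fun X => convLeft S (X * (z ᵍ⊗ₜ[R] w)) =
    S z * convLeft S (parityPow (R := R) k X) * w) X (fun i j a b ha hb => ?_) fun X Y hX hY => ?_
  · rw [tmul_mul_tmul _ hb hz, units_smul_map, convLeft_tmul, hS.map_mul ha hz,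
      parityPow_of_mem (ST.tmul_mem ha hb), units_smul_map, convLeft_tmul, smul_mul_assoc, smul_smul,
      mul_smul_comm, smul_mul_assoc, ← sgn_add, add_mul, add_comm]
    simp only [mul_assoc]
  · rw [add_mul, map_add, hX, hY, map_add, map_add, mul_add, add_mul]

theorem convRight_tmul_mul {S : A →ₗ[R] A} (hS : IsSuperAnti S) (Z : SuperTensor R A) {j : ZMod 2}
    (x : A) {y : A} (hy : y ∈ part R A j) :
    convRight S ((x ᵍ⊗ₜ[R] y) * Z) = x * convRight S (parityPow (R := R) j Z) * S y := by
  refine tmul_induction_homog (P := fun Z => convRight S ((x ᵍ⊗ₜ[R] y) * Z) =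
    x * convRight S (parityPow (R := R) j Z) * S y) Z (fun k l a b ha hb => ?_) fun X Y hX hY => ?_
  · rw [tmul_mul_tmul _ hy ha, units_smul_map, convRight_tmul, hS.map_mul hy hb,
      parityPow_of_mem (ST.tmul_mem ha hb), units_smul_map, convRight_tmul, mul_smul_comm, smul_smul,
      mul_smul_comm, smul_mul_assoc, ← sgn_add, add_mul, mul_comm j, mul_comm j]
    simp only [mul_assoc]
  · rw [mul_add, map_add, hX, hY, map_add, map_add, mul_add, add_mul]

/-- A scalar value of `convLeft S X` sits between `S z` and `w` and can be pulled out. The sign from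
`X` is trivial for even `X`, and for odd `X` the scalar is assumed to vanish. -/
theorem convLeft_mul {S : A →ₗ[R] A} (hS : IsSuperAnti S) {i : ZMod 2} {X : SuperTensor R A}
    (hX : X ∈ part R (SuperTensor R A) i) {c : R} (hc : convLeft S X = algebraMap R A c)
    (hi : i = 1 → c = 0) (Z : SuperTensor R A) : convLeft S (X * Z) = c • convLeft S Z := by
  refine tmul_induction_homog (P := fun Z => convLeft S (X * Z) = c • convLeft S Z) Z
    (fun k l z w hz _ => ?_) fun Y Z hY hZ => by rw [mul_add, map_add, hY, hZ, map_add, smul_add]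
  rw [convLeft_mul_tmul hS X hz, parityPow_of_mem hX, units_smul_map, hc, convLeft_tmul]
  rcases zmod_two_cases i with rfl | rfl
  · rw [zero_mul, sgn_zero, one_smul, ← Algebra.commutes, mul_assoc, Algebra.smul_def]
  · simp [hi rfl]

theorem convRight_mul {S : A →ₗ[R] A} (hS : IsSuperAnti S) {i : ZMod 2} {Z : SuperTensor R A}
    (hZ : Z ∈ part R (SuperTensor R A) i) {c : R} (hc : convRight S Z = algebraMap R A c)
    (hi : i = 1 → c = 0) (X : SuperTensor R A) : convRight S (X * Z) = c • convRight S X := by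
  refine tmul_induction_homog (P := fun X => convRight S (X * Z) = c • convRight S X) X
    (fun k l z w _ hw => ?_) fun Y Z hY hZ => by rw [add_mul, map_add, hY, hZ, map_add, smul_add]
  rw [convRight_tmul_mul hS Z z hw, parityPow_of_mem hZ, units_smul_map, hc, convRight_tmul]
  rcases zmod_two_cases i with rfl | rfl
  · rw [zero_mul, sgn_zero, one_smul, ← Algebra.commutes, mul_assoc, Algebra.smul_def]
  · simp [hi rfl]

theorem convLeft_parity {S : A →ₗ[R] A} (hS : IsSuperAnti S) (X : SuperTensor R A) :
    convLeft S (parity R X) = parity R (convLeft S X) := by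
  refine tmul_induction_homog (P := fun X => convLeft S (parity R X) = parity R (convLeft S X)) X
    (fun i j a b _ _ => ?_) fun X Y hX hY => by simp only [map_add, hX, hY]
  rw [ST.parity_tmul, convLeft_tmul, convLeft_tmul, hS.map_parity, map_mul]

theorem convRight_parity {S : A →ₗ[R] A} (hS : IsSuperAnti S) (X : SuperTensor R A) :
    convRight S (parity R X) = parity R (convRight S X) := by
  refine tmul_induction_homog (P := fun X => convRight S (parity R X) = parity R (convRight S X)) X
    (fun i j a b _ _ => ?_) fun X Y hX hY => by simp only [map_add, hX, hY]
  rw [ST.parity_tmul, convRight_tmul, convRight_tmul, hS.map_parity, map_mul]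

theorem proj_counit (H : SuperBialgebra R A) (i : ZMod 2) (a : A) (hi : i = 1) :
    H.counit (proj (R := R) i a) = 0 := by
  subst hi
  exact counit_eq_zero H.counit_parity (proj_mem 1 a)

/-- All maps in the antipode axiom commute with parity, so the axiom passes to homogeneous
components. This is needed because the product rule for `convLeft` and `convRight` requires a
homogeneous factor. -/
theorem conv_proj {H : SuperBialgebra R A} {F : SuperTensor R A →ₗ[R] A}
    (hF : ∀ X, F (parity R X) = parity R (F X)) {a : A}
    (ha : F (H.comul a) = algebraMap R A (H.counit a)) (i : ZMod 2) :
    F (H.comul (proj (R := R) i a)) = algebraMap R A (H.counit (proj (R := R) i a)) := by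
  have h : F (H.comul (parity R a)) = algebraMap R A (H.counit (parity R a)) := by
    rw [H.comul_parity', hF, ha, H.counit_parity, AlgHom.commutes]
  simp only [proj_apply, map_smul, map_add, units_smul_map, ha, h, smul_eq_mul, map_mul]
  rw [Algebra.smul_def]

/-- A super anti-homomorphism which satisfies the axioms of an antipode on generators is an
antipode. -/
def HopfSuperalgebra.ofGenerators (H : SuperBialgebra R A) {G : Set A}
    (hG : Algebra.adjoin R G = ⊤) (S : A →ₗ[R] A) (hS : IsSuperAnti S)
    (hl : ∀ g ∈ G, convLeft S (H.comul g) = algebraMap R A (H.counit g))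
    (hr : ∀ g ∈ G, convRight S (H.comul g) = algebraMap R A (H.counit g)) :
    HopfSuperalgebra R A :=
  { H with
    antipode := S
    antipode_parity := hS.map_parity
    antipode_left a := by
      change convLeft S (H.comul a) = algebraMap R A (H.counit a)
      have ha : a ∈ Algebra.adjoin R G := hG ▸ Algebra.mem_top
      induction ha using Algebra.adjoin_induction with
      | mem g hg => exact hl g hg
      | algebraMap r =>
        rw [AlgHom.commutes, AlgHom.commutes, Algebra.algebraMap_eq_smul_one, map_smul]
        change r • convLeft S ((1 : A) ᵍ⊗ₜ[R] (1 : A)) = _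
        rw [convLeft_tmul, hS.map_one, mul_one, ← Algebra.algebraMap_eq_smul_one]
        rfl
      | add x y _ _ hx hy => simp only [map_add, hx, hy]
      | mul x y _ _ hx hy =>
        -- The product rule requires a homogeneous left factor, so `x` is replaced by its two
        -- components.
        have key (i : ZMod 2) : convLeft S (H.comul (proj (R := R) i x * y)) =
            algebraMap R A (H.counit (proj (R := R) i x * y)) := by
          rw [map_mul, convLeft_mul hS (H.comul_mem (proj_mem i x))
            (conv_proj (convLeft_parity hS) hx i) (proj_counit H i x), hy, map_mul, map_mul,
            Algebra.smul_def]
        rw [← proj_add_proj (R := R) x, add_mul, map_add, map_add, key, key, map_add, map_add]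
    antipode_right a := by
      change convRight S (H.comul a) = algebraMap R A (H.counit a)
      have ha : a ∈ Algebra.adjoin R G := hG ▸ Algebra.mem_top
      induction ha using Algebra.adjoin_induction with
      | mem g hg => exact hr g hg
      | algebraMap r =>
        rw [AlgHom.commutes, AlgHom.commutes, Algebra.algebraMap_eq_smul_one, map_smul]
        change r • convRight S ((1 : A) ᵍ⊗ₜ[R] (1 : A)) = _
        rw [convRight_tmul, hS.map_one, mul_one, ← Algebra.algebraMap_eq_smul_one]
        rfl
      | add x y _ _ hx hy => simp only [map_add, hx, hy]
      | mul x y _ _ hx hy =>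
        have key (i : ZMod 2) : convRight S (H.comul (x * proj (R := R) i y)) =
            algebraMap R A (H.counit (x * proj (R := R) i y)) := by
          rw [map_mul, convRight_mul hS (H.comul_mem (proj_mem i y))
            (conv_proj (convRight_parity hS) hy i) (proj_counit H i y), hx, map_mul, mul_comm,
            map_mul, Algebra.smul_def]
        rw [← proj_add_proj (R := R) y, mul_add, map_add, map_add, key, key, map_add, map_add] }

/-- The super anti-homomorphism `a ↦ c⁻¹ ^ |a| σ a`, for an anti-homomorphism `σ` and a square root
`c` of `-1`. -/
def superAntiOf (c : R) (σ : A →ₐ[R] Aᵐᵒᵖ) : A →ₗ[R] A :=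
  (MulOpposite.opLinearEquiv R).symm.toLinearMap ∘ₗ σ.toLinearMap ∘ₗ
    (proj (R := R) 0 - c • proj (R := R) 1)

theorem superAntiOf_of_mem (c : R) (σ : A →ₐ[R] Aᵐᵒᵖ) {i : ZMod 2} {a : A} (ha : a ∈ part R A i) :
    superAntiOf c σ a = (if i = 0 then (1 : R) else -c) • (σ a).unop := by
  change (σ (proj (R := R) 0 a - c • proj (R := R) 1 a)).unop = _
  rw [proj_of_mem ha, proj_of_mem ha]
  rcases zmod_two_cases i with rfl | rfl <;> simp

/-- Only the product of two odd elements matters. It is even and gets the factor `1`, while the two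
single factors contribute `(-c)² = -1`, which is the required sign. -/
theorem isSuperAnti_superAntiOf {c : R} (hc : c * c = -1) {σ : A →ₐ[R] Aᵐᵒᵖ}
    (hσ : ∀ a, (σ (parity R a)).unop = parity R (σ a).unop) : IsSuperAnti (superAntiOf c σ) where
  map_parity a := by
    refine induction_homog R (P := fun a => superAntiOf c σ (parity R a) =
      parity R (superAntiOf c σ a)) (fun i a ha => ?_) (fun a b h1 h2 => by
        simp only [map_add, h1, h2]) a
    rw [superAntiOf_of_mem c σ ha, superAntiOf_of_mem c σ (parity_mem_part ha), hσ, map_smul]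
  map_one := by
    rw [superAntiOf_of_mem c σ one_mem_part]
    simp
  map_mul {i j a b} ha hb := by
    rw [superAntiOf_of_mem c σ ha, superAntiOf_of_mem c σ hb,
      superAntiOf_of_mem c σ (mul_mem_part ha hb), map_mul, MulOpposite.unop_mul]
    have h11 : (1 + 1 : ZMod 2) = 0 := by decide
    rcases zmod_two_cases i with rfl | rfl <;> rcases zmod_two_cases j with rfl | rfl <;>
      simp [h11, sgn_zero, -uzpow_zero, -uzpow_one, sgn_one, smul_smul, hc, Units.neg_smul]

end Bialgebra

/-! ### The super cocommutator -/

section Cocommutator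

variable {R A : Type*} [CommRing R] [Ring A] [Algebra R A] [Superalgebra R A] [Invertible (2 : R)]

theorem superSwap_tmul {i j : ZMod 2} {a b : A} (ha : a ∈ part R A i) (hb : b ∈ part R A j) :
    superSwap R A (a ⊗ₜ[R] b) = sgn (i * j) • (b ⊗ₜ[R] a) :=
  comm_tmul ha hb

theorem tensor_induction {P : A ⊗[R] A → Prop} (x : A ⊗[R] A)
    (hom : ∀ i j a b, a ∈ part R A i → b ∈ part R A j → P (a ⊗ₜ[R] b))
    (add : ∀ a b, P a → P b → P (a + b)) : P x :=
  tmul_induction_homog (P := P) x hom add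

theorem triple_induction {P : (A ⊗[R] A) ⊗[R] A → Prop} (x : (A ⊗[R] A) ⊗[R] A)
    (hom : ∀ i j k a b c, a ∈ part R A i → b ∈ part R A j → c ∈ part R A k →
      P ((a ⊗ₜ[R] b) ⊗ₜ[R] c))
    (add : ∀ a b, P a → P b → P (a + b)) : P x :=
  ST.triple_induction (P := P) x hom add

theorem superSwap_superSwap (x : A ⊗[R] A) : superSwap R A (superSwap R A x) = x := by
  refine tensor_induction (P := fun x => superSwap R A (superSwap R A x) = x) x
    (fun i j a b ha hb => ?_) fun x y hx hy => by rw [map_add, map_add, hx, hy]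
  rw [superSwap_tmul ha hb, units_smul_map, superSwap_tmul hb ha, smul_smul, mul_comm j,
    Int.units_mul_self, one_smul]

theorem units_smul_tmul' {M N : Type*} [AddCommGroup M] [Module R M] [AddCommGroup N] [Module R N]
    (u : ℤˣ) (a : M) (b : N) : (u • a) ⊗ₜ[R] b = u • (a ⊗ₜ[R] b) :=
  units_smul_map ((TensorProduct.mk R M N).flip b) u a

theorem tmul_units_smul' {M N : Type*} [AddCommGroup M] [Module R M] [AddCommGroup N] [Module R N]
    (u : ℤˣ) (a : M) (b : N) : a ⊗ₜ[R] (u • b) = u • (a ⊗ₜ[R] b) :=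
  units_smul_map (TensorProduct.mk R M N a) u b

theorem superSwap12_tmul {i j : ZMod 2} {a b : A} (ha : a ∈ part R A i) (hb : b ∈ part R A j)
    (c : A) : superSwap12 R A ((a ⊗ₜ[R] b) ⊗ₜ[R] c) = sgn (i * j) • ((b ⊗ₜ[R] a) ⊗ₜ[R] c) := by
  rw [superSwap12, LinearMap.rTensor_tmul, superSwap_tmul ha hb, units_smul_tmul']

theorem superSwap23_tmul {j k : ZMod 2} (a : A) {b c : A} (hb : b ∈ part R A j)
    (hc : c ∈ part R A k) :
    superSwap23 R A ((a ⊗ₜ[R] b) ⊗ₜ[R] c) = sgn (j * k) • ((a ⊗ₜ[R] c) ⊗ₜ[R] b) := by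
  change (TensorProduct.assoc R A A A).symm ((superSwap R A).lTensor A (a ⊗ₜ[R] (b ⊗ₜ[R] c))) = _
  rw [LinearMap.lTensor_tmul, superSwap_tmul hb hc, tmul_units_smul', units_smul_map,
    TensorProduct.assoc_symm_tmul]

theorem superCyc_tmul {i j k : ZMod 2} {a b c : A} (ha : a ∈ part R A i) (hb : b ∈ part R A j)
    (hc : c ∈ part R A k) : superCyc R A ((a ⊗ₜ[R] b) ⊗ₜ[R] c) =
      sgn (i * (j + k)) • ((b ⊗ₜ[R] c) ⊗ₜ[R] a) := by
  rw [superCyc, LinearMap.comp_apply, superSwap12_tmul ha hb, units_smul_map,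
    superSwap23_tmul b ha hc, smul_smul, ← sgn_add, mul_add]

theorem superCyc_superCyc_superCyc (x : (A ⊗[R] A) ⊗[R] A) :
    superCyc R A (superCyc R A (superCyc R A x)) = x := by
  refine triple_induction (P := fun x => superCyc R A (superCyc R A (superCyc R A x)) = x) x
    (fun i j k a b c ha hb hc => ?_) fun x y hx hy => by simp only [map_add, hx, hy]
  have key : ∀ i j k : ZMod 2,
      sgn (i * (j + k)) * (sgn (j * (k + i)) * sgn (k * (i + j))) = 1 := by decide
  rw [superCyc_tmul ha hb hc, units_smul_map, units_smul_map, superCyc_tmul hb hc ha,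
    units_smul_map, superCyc_tmul hc ha hb, smul_smul, smul_smul, mul_assoc, key,
    one_smul]

theorem superSwap12_superSwap12 (x : (A ⊗[R] A) ⊗[R] A) :
    superSwap12 R A (superSwap12 R A x) = x := by
  refine triple_induction (P := fun x => superSwap12 R A (superSwap12 R A x) = x) x
    (fun i j k a b c ha hb hc => ?_) fun x y hx hy => by simp only [map_add, hx, hy]
  rw [superSwap12_tmul ha hb, units_smul_map, superSwap12_tmul hb ha, smul_smul, mul_comm j,
    Int.units_mul_self, one_smul]

theorem superSwap23_superSwap23 (x : (A ⊗[R] A) ⊗[R] A) :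
    superSwap23 R A (superSwap23 R A x) = x := by
  refine triple_induction (P := fun x => superSwap23 R A (superSwap23 R A x) = x) x
    (fun i j k a b c ha hb hc => ?_) fun x y hx hy => by simp only [map_add, hx, hy]
  rw [superSwap23_tmul a hb hc, units_smul_map, superSwap23_tmul a hc hb, smul_smul, mul_comm k,
    Int.units_mul_self, one_smul]

namespace SuperBialgebra

variable (H : SuperBialgebra R A)

/-- The super cocommutator `Δ - Δ°`. -/
def cocomm : A →ₗ[R] A ⊗[R] A := H.Δ - superSwap R A ∘ₗ H.Δ

theorem cocomm_apply (a : A) : H.cocomm a = H.Δ a - superSwap R A (H.Δ a) := rfl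

theorem Δ_parity (a : A) : H.Δ (parity R a) =
    TensorProduct.map (parity R).toLinearMap (parity R).toLinearMap (H.Δ a) := H.comul_parity a

/-- Moving `a` past a tensor `x` costs the parity operator on `x` when `a` is odd and nothing when
`a` is even. Hence only the total parity of `x` is needed, even if `x` is not a pure tensor. -/
theorem sgn_smul_tmul_eq_superCyc {j k : ZMod 2} {a : A} (ha : a ∈ part R A j) (x : A ⊗[R] A)
    (hx : TensorProduct.map (parity R).toLinearMap (parity R).toLinearMap x = sgn k • x) :
    sgn (j * k) • (x ⊗ₜ[R] a) =
      superCyc R A ((TensorProduct.assoc R A A A).symm (a ⊗ₜ[R] x)) := by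
  have key : superCyc R A ((TensorProduct.assoc R A A A).symm (a ⊗ₜ[R] x)) =
      if j = 0 then x ⊗ₜ[R] a else
        TensorProduct.map (parity R).toLinearMap (parity R).toLinearMap x ⊗ₜ[R] a := by
    refine tensor_induction (P := fun x => superCyc R A ((TensorProduct.assoc R A A A).symm
      (a ⊗ₜ[R] x)) = if j = 0 then x ⊗ₜ[R] a else
        TensorProduct.map (parity R).toLinearMap (parity R).toLinearMap x ⊗ₜ[R] a) x
      (fun k l b c hb hc => ?_) fun x y hx hy => ?_
    · rw [TensorProduct.assoc_symm_tmul, superCyc_tmul ha hb hc, TensorProduct.map_tmul,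
        AlgHom.toLinearMap_apply, AlgHom.toLinearMap_apply, parity_of_mem hb, parity_of_mem hc,
        units_smul_tmul', tmul_units_smul', smul_smul, ← sgn_add, units_smul_tmul']
      rcases zmod_two_cases j with rfl | rfl
      · rw [zero_mul, sgn_zero, one_smul, if_pos rfl]
      · rw [one_mul, if_neg (by decide)]
    · rw [TensorProduct.tmul_add, map_add, map_add, hx, hy]
      split_ifs
      · rw [TensorProduct.add_tmul]
      · rw [map_add, TensorProduct.add_tmul]
  rw [key]
  rcases zmod_two_cases j with rfl | rfl
  · rw [zero_mul, sgn_zero, one_smul, if_pos rfl]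
  · rw [one_mul, if_neg (by decide), hx, units_smul_tmul']

/-- This is naturality of the super swap with respect to the even map `Δ`: swapping and then
splitting the new first factor is a cyclic permutation of the three factors. -/
theorem rTensor_superSwap (x : A ⊗[R] A) : H.Δ.rTensor A (superSwap R A x) =
    superCyc R A ((TensorProduct.assoc R A A A).symm (H.Δ.lTensor A x)) := by
  refine tensor_induction (P := fun x => H.Δ.rTensor A (superSwap R A x) =
    superCyc R A ((TensorProduct.assoc R A A A).symm (H.Δ.lTensor A x))) x
    (fun j k a b ha hb => ?_) fun x y hx hy => by simp only [map_add, hx, hy]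
  rw [superSwap_tmul ha hb, units_smul_map, LinearMap.rTensor_tmul, LinearMap.lTensor_tmul]
  refine sgn_smul_tmul_eq_superCyc ha _ ?_
  rw [← H.Δ_parity, parity_of_mem hb, units_smul_map]

theorem coassoc_symm (a : A) : (TensorProduct.assoc R A A A).symm (H.Δ.lTensor A (H.Δ a)) =
    H.Δ.rTensor A (H.Δ a) := by
  rw [LinearEquiv.symm_apply_eq]
  exact (H.coassoc a).symm

theorem rTensor_cocomm (x : A ⊗[R] A) : H.cocomm.rTensor A x =
    H.Δ.rTensor A x - superSwap12 R A (H.Δ.rTensor A x) := by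
  rw [cocomm, LinearMap.rTensor_sub, LinearMap.rTensor_comp]
  rfl

theorem lTensor_cocomm (x : A ⊗[R] A) :
    (TensorProduct.assoc R A A A).symm (H.cocomm.lTensor A x) =
      (TensorProduct.assoc R A A A).symm (H.Δ.lTensor A x) -
        superSwap23 R A ((TensorProduct.assoc R A A A).symm (H.Δ.lTensor A x)) := by
  rw [cocomm, LinearMap.lTensor_sub, LinearMap.lTensor_comp, LinearMap.sub_apply, map_sub]
  simp [superSwap23]

theorem rTensor_Δ_cocomm (a : A) : H.Δ.rTensor A (H.cocomm a) =
    H.Δ.rTensor A (H.Δ a) - superCyc R A (H.Δ.rTensor A (H.Δ a)) := by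
  rw [cocomm_apply, map_sub, rTensor_superSwap, coassoc_symm]

theorem cocomm_skew (a : A) : superSwap R A (H.cocomm a) = -H.cocomm a := by
  rw [cocomm_apply, map_sub, superSwap_superSwap, neg_sub]

/-- With `W = (Δ ⊗ 1) Δ a` and the transpositions `s₁₂`, `s₂₃`, the left side is `W - s₂₃ s₁₂ W` and
the right side is `(W - s₂₃ W) + s₂₃ (W - s₁₂ W)`, which telescopes. -/
theorem cocomm_coLeibniz (a : A) : H.Δ.rTensor A (H.cocomm a) =
    (TensorProduct.assoc R A A A).symm (H.cocomm.lTensor A (H.Δ a)) +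
      superSwap23 R A (H.cocomm.rTensor A (H.Δ a)) := by
  rw [rTensor_Δ_cocomm, lTensor_cocomm, coassoc_symm, rTensor_cocomm, map_sub,
    superCyc, LinearMap.comp_apply]
  abel

/-- With `W = (Δ ⊗ 1) Δ a` and the cyclic permutation `c`, the first term is `(1 - s₁₂)(1 - c) W`.
Since `s₁₂ c = c² s₁₂`, it equals `(1 - c) W - (1 - c²) s₁₂ W`, and both parts are killed by `1 + c
+ c²`. -/
theorem cocomm_coJacobi (a : A) : H.cocomm.rTensor A (H.cocomm a) +
    superCyc R A (H.cocomm.rTensor A (H.cocomm a)) +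
    superCyc R A (superCyc R A (H.cocomm.rTensor A (H.cocomm a))) = 0 := by
  rw [rTensor_cocomm, rTensor_Δ_cocomm]
  generalize H.Δ.rTensor A (H.Δ a) = W
  have h : superSwap12 R A (superCyc R A W) = superCyc R A (superCyc R A (superSwap12 R A W)) := by
    have h1 : superCyc R A (superSwap12 R A (superCyc R A W)) = superSwap12 R A W := by
      rw [superCyc, LinearMap.comp_apply, LinearMap.comp_apply, superSwap12_superSwap12,
        superSwap23_superSwap23]
    rw [← h1, superCyc_superCyc_superCyc]
  simp only [map_sub, h, superCyc_superCyc_superCyc]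
  abel

end SuperBialgebra

end Cocommutator

/-! ### Semilinear morphisms of superalgebras -/

section Semilinear

variable {R A R' A' : Type*} [CommRing R] [Ring A] [Algebra R A] [Superalgebra R A]
  [CommRing R'] [Ring A'] [Algebra R' A'] [Superalgebra R' A']
  {σ : R →+* R'}

/-- A semilinear map which is a morphism of superrings. -/
structure IsSuperHom (f : A →ₛₗ[σ] A') : Prop where
  map_one : f 1 = 1
  map_mul (a b : A) : f (a * b) = f a * f b
  map_parity (a : A) : f (parity R a) = parity R' (f a)

theorem IsSuperHom.map_mem {f : A →ₛₗ[σ] A'} (hf : IsSuperHom f) {i : ZMod 2} {a : A}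
    (ha : a ∈ part R A i) : f a ∈ part R' A' i := by
  rw [mem_part, ← hf.map_parity, parity_of_mem ha, units_smul_map]

variable [Invertible (2 : R)] [Invertible (2 : R')]

/-- The tensor square of a morphism of superrings. -/
def IsSuperHom.tensor {f : A →ₛₗ[σ] A'} (hf : IsSuperHom f) :
    SuperTensor R A →+* SuperTensor R' A' where
  toFun x := GradedTensorProduct.of R' _ _
    (TensorProduct.map f f ((GradedTensorProduct.of R _ _).symm x))
  map_zero' := map_zero (TensorProduct.map f f)
  map_add' := map_add (TensorProduct.map f f)
  map_one' := by
    change (f 1 ᵍ⊗ₜ[R'] f 1 : SuperTensor R' A') = 1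
    rw [hf.map_one]
    rfl
  map_mul' x y := by
    let g : SuperTensor R A →+ SuperTensor R' A' :=
      (TensorProduct.map f f).toAddMonoidHom
    have hg (a b : A) : g (a ᵍ⊗ₜ[R] b) = f a ᵍ⊗ₜ[R'] f b := rfl
    change g (x * y) = g x * g y
    refine tmul_induction_homog (P := fun x => g (x * y) = g x * g y) x
      (fun i j a b ha hb => ?_) fun x x' h h' => by simp only [add_mul, map_add, h, h']
    refine tmul_induction_homog (P := fun y => g ((a ᵍ⊗ₜ[R] b) * y) = g (a ᵍ⊗ₜ[R] b) * g y) y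
      (fun k l c d hc hd => ?_) fun x x' h h' => by simp only [mul_add, map_add, h, h']
    rw [tmul_mul_tmul _ hb hc, units_smul_map, hg, hg, hg,
      tmul_mul_tmul _ (hf.map_mem hb) (hf.map_mem hc), hf.map_mul, hf.map_mul]

theorem IsSuperHom.tensor_tmul {f : A →ₛₗ[σ] A'} (hf : IsSuperHom f) (a b : A) :
    hf.tensor (a ᵍ⊗ₜ[R] b) = f a ᵍ⊗ₜ[R'] f b := rfl

theorem IsSuperHom.tensor_smul {f : A →ₛₗ[σ] A'} (hf : IsSuperHom f) (r : R)
    (x : SuperTensor R A) : hf.tensor (r • x) = σ r • hf.tensor x :=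
  map_smulₛₗ (TensorProduct.map f f) r x

theorem IsSuperHom.map_superSwap {f : A →ₛₗ[σ] A'} (hf : IsSuperHom f) (x : A ⊗[R] A) :
    TensorProduct.map f f (superSwap R A x) = superSwap R' A' (TensorProduct.map f f x) := by
  refine tensor_induction (P := fun x => TensorProduct.map f f (superSwap R A x) =
    superSwap R' A' (TensorProduct.map f f x)) x
    (fun i j a b ha hb => ?_) fun x y hx hy => by simp only [map_add, hx, hy]
  rw [superSwap_tmul ha hb, units_smul_map, TensorProduct.map_tmul, TensorProduct.map_tmul,
    superSwap_tmul (hf.map_mem ha) (hf.map_mem hb)]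

end Semilinear

/-! ### Quantum matrices -/

section Legs

variable {n : ℕ} {B : Type*} [Ring B]

/-- The twist which turns `superMul` into the ordinary product of matrices. -/
def twist (X : Matrix (Idx n × Idx n) (Idx n × Idx n) B) :
    Matrix (Idx n × Idx n) (Idx n × Idx n) B :=
  Matrix.of fun a b => sgn ((a.1.2 + a.2.2 + 1) * (b.1.2 + b.2.2)) • X a b

theorem twist_apply (X : Matrix (Idx n × Idx n) (Idx n × Idx n) B) (a b) :
    twist X a b = sgn ((a.1.2 + a.2.2 + 1) * (b.1.2 + b.2.2)) • X a b := rfl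

/-- The sign `(a + c)(c + b)` in `superMul` is a coboundary: modulo `2` it equals `f(a,b) + f(a,c) +
f(c,b)` with `f(a,b) = (a + 1) b`. -/
theorem twist_superMul (X Y : Matrix (Idx n × Idx n) (Idx n × Idx n) B) :
    twist (superMul X Y) = twist X * twist Y := by
  ext a b
  rw [Matrix.mul_apply, twist_apply, superMul, Matrix.of_apply, Finset.smul_sum]
  refine Finset.sum_congr rfl fun c _ => ?_
  have key : ∀ a b c : ZMod 2, sgn ((a + 1) * b) * sgn ((a + c) * (c + b)) =
      sgn ((a + 1) * c) * sgn ((c + 1) * b) := by decide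
  rw [smul_smul, key, twist_apply, twist_apply, smul_mul_smul_comm]

theorem superMul_map {C : Type*} [Ring C] (F : B →+* C)
    (X Y : Matrix (Idx n × Idx n) (Idx n × Idx n) B) :
    (superMul X Y).map F = superMul (X.map F) (Y.map F) := by
  ext a b
  simp only [superMul, Matrix.map_apply, Matrix.of_apply, map_sum]
  refine Finset.sum_congr rfl fun c _ => ?_
  rw [units_smul_map, map_mul]

/-- The matrix `X ⊗ 1`, up to signs. -/
def leg1 (X : Matrix (Idx n) (Idx n) B) : Matrix (Idx n × Idx n) (Idx n × Idx n) B :=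
  Matrix.of fun a b => if a.2 = b.2 then sgn (a.2.2 * (a.1.2 + b.1.2)) • X a.1 b.1 else 0

/-- The matrix `1 ⊗ X`. -/
def leg2 (X : Matrix (Idx n) (Idx n) B) : Matrix (Idx n × Idx n) (Idx n × Idx n) B :=
  Matrix.of fun a b => if a.1 = b.1 then X a.2 b.2 else 0

theorem leg1_apply (X : Matrix (Idx n) (Idx n) B) (a b) : leg1 X a b =
    if a.2 = b.2 then sgn (a.2.2 * (a.1.2 + b.1.2)) • X a.1 b.1 else 0 := rfl

theorem leg2_apply (X : Matrix (Idx n) (Idx n) B) (a b) : leg2 X a b =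
    if a.1 = b.1 then X a.2 b.2 else 0 := rfl

theorem leg1_mul_apply (X : Matrix (Idx n) (Idx n) B)
    (Y : Matrix (Idx n × Idx n) (Idx n × Idx n) B) (a b) : (leg1 X * Y) a b =
      ∑ c, sgn (a.2.2 * (a.1.2 + c.2)) • (X a.1 c * Y (c, a.2) b) := by
  rw [Matrix.mul_apply, Fintype.sum_prod_type]
  refine Finset.sum_congr rfl fun c _ => ?_
  simp [leg1_apply, ite_mul, smul_mul_assoc]

theorem leg2_mul_apply (X : Matrix (Idx n) (Idx n) B)
    (Y : Matrix (Idx n × Idx n) (Idx n × Idx n) B) (a b) : (leg2 X * Y) a b =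
      ∑ c, X a.2 c * Y (a.1, c) b := by
  rw [Matrix.mul_apply, Fintype.sum_prod_type_right]
  refine Finset.sum_congr rfl fun c _ => ?_
  simp [leg2_apply, ite_mul]

theorem leg1_mul (X Y : Matrix (Idx n) (Idx n) B) : leg1 (X * Y) = leg1 X * leg1 Y := by
  ext a b
  rw [leg1_mul_apply, leg1_apply, Matrix.mul_apply]
  simp only [leg1_apply]
  split_ifs with h
  · rw [Finset.smul_sum]
    refine Finset.sum_congr rfl fun c _ => ?_
    have key : ∀ a b c d : ZMod 2, sgn (d * (a + b)) = sgn (d * (a + c)) * sgn (d * (c + b)) := by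
      decide
    rw [mul_smul_comm, smul_smul, ← key]
  · simp

theorem leg2_mul (X Y : Matrix (Idx n) (Idx n) B) : leg2 (X * Y) = leg2 X * leg2 Y := by
  ext a b
  rw [leg2_mul_apply, leg2_apply, Matrix.mul_apply]
  simp only [leg2_apply]
  split_ifs with h <;> simp

theorem leg1_one : leg1 (1 : Matrix (Idx n) (Idx n) B) = 1 := by
  ext a b
  rw [leg1_apply, Matrix.one_apply, Matrix.one_apply]
  by_cases h1 : a.1 = b.1 <;> by_cases h2 : a.2 = b.2 <;> simp [Prod.ext_iff, h1, h2]
  rw [CharTwo.add_self_eq_zero, mul_zero, sgn_zero, one_smul]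

theorem leg2_one : leg2 (1 : Matrix (Idx n) (Idx n) B) = 1 := by
  ext a b
  rw [leg2_apply, Matrix.one_apply, Matrix.one_apply]
  by_cases h1 : a.1 = b.1 <;> by_cases h2 : a.2 = b.2 <;> simp [Prod.ext_iff, h1, h2]

theorem leg1_mul_leg2_apply (X Y : Matrix (Idx n) (Idx n) B) (a b) : (leg1 X * leg2 Y) a b =
    sgn (a.2.2 * (a.1.2 + b.1.2)) • (X a.1 b.1 * Y a.2 b.2) := by
  rw [leg1_mul_apply]
  simp [leg2_apply]

theorem leg2_mul_leg1_apply (X Y : Matrix (Idx n) (Idx n) B) (a b) : (leg2 Y * leg1 X) a b =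
    sgn (b.2.2 * (a.1.2 + b.1.2)) • (Y a.2 b.2 * X a.1 b.1) := by
  rw [leg2_mul_apply]
  simp [leg1_apply, mul_smul_comm]

theorem leg1_map {C : Type*} [Ring C] (F : B →+* C) (X : Matrix (Idx n) (Idx n) B) :
    (leg1 X).map F = leg1 (X.map F) := by
  ext a b
  simp only [leg1_apply, Matrix.map_apply]
  split_ifs
  · rw [units_smul_map]
  · rw [map_zero]

theorem leg2_map {C : Type*} [Ring C] (F : B →+* C) (X : Matrix (Idx n) (Idx n) B) :
    (leg2 X).map F = leg2 (X.map F) := by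
  ext a b
  simp only [leg2_apply, Matrix.map_apply]
  split_ifs
  · rfl
  · rw [map_zero]

theorem leg1_add (X Y : Matrix (Idx n) (Idx n) B) : leg1 (X + Y) = leg1 X + leg1 Y := by
  ext a b
  simp only [leg1_apply, Matrix.add_apply]
  split_ifs
  · rw [smul_add]
  · rw [add_zero]

theorem leg2_add (X Y : Matrix (Idx n) (Idx n) B) : leg2 (X + Y) = leg2 X + leg2 Y := by
  ext a b
  simp only [leg2_apply, Matrix.add_apply]
  split_ifs
  · rfl
  · rw [add_zero]

theorem leg1_smul {R : Type*} [CommRing R] [Algebra R B] (r : R) (X : Matrix (Idx n) (Idx n) B) :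
    leg1 (r • X) = r • leg1 X := by
  ext a b
  simp only [leg1_apply, Matrix.smul_apply]
  split_ifs
  · rw [smul_comm]
  · rw [smul_zero]

theorem leg2_smul {R : Type*} [CommRing R] [Algebra R B] (r : R) (X : Matrix (Idx n) (Idx n) B) :
    leg2 (r • X) = r • leg2 X := by
  ext a b
  simp only [leg2_apply, Matrix.smul_apply]
  split_ifs
  · rfl
  · rw [smul_zero]

/-- The relation `M₁ M₂ S = S M₂ M₁`. -/
def IsRTT {K : Type*} [CommRing K] [Algebra K B] (S : Matrix (Idx n × Idx n) (Idx n × Idx n) K)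
    (M : Matrix (Idx n) (Idx n) B) : Prop :=
  leg1 M * leg2 M * S.map (algebraMap K B) = S.map (algebraMap K B) * (leg2 M * leg1 M)

theorem matrix_map_mul_comm {K : Type*} [CommRing K] [Algebra K B] {m : Type*} [Fintype m]
    (X : Matrix m m B) (c : Matrix m m K) (a b : m) :
    (X * c.map (algebraMap K B)) a b = ∑ k, c k b • X a k := by
  rw [Matrix.mul_apply]
  refine Finset.sum_congr rfl fun k _ => ?_
  rw [Matrix.map_apply, ← Algebra.commutes, Algebra.smul_def]

theorem matrix_map_mul_apply {K : Type*} [CommRing K] [Algebra K B] {m : Type*} [Fintype m]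
    (X : Matrix m m B) (c : Matrix m m K) (a b : m) :
    (c.map (algebraMap K B) * X) a b = ∑ k, c a k • X k b := by
  rw [Matrix.mul_apply]
  refine Finset.sum_congr rfl fun k _ => ?_
  rw [Matrix.map_apply, Algebra.smul_def]

end Legs

/-! ### The universal property of the quantized enveloping superalgebra -/

namespace QEA

variable {K : Type*} [Field K] (q : K) {n : ℕ}

/-- The generators `t_{ij}`, rescaled by the signs of the twist. -/
def tt : Matrix (Idx n) (Idx n) (QEA K q n) :=
  Matrix.of fun i j => sgn ((i.2 + 1) * j.2) • t q i j

theorem tt_apply (i j : Idx n) : tt q i j = sgn ((i.2 + 1) * j.2) • t q i j := rfl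

theorem add_one_mul_self (x : ZMod 2) : (x + 1) * x = 0 := by revert x; decide

theorem tt_diag (i : Idx n) : tt q i i = t q i i := by
  rw [tt_apply, add_one_mul_self, sgn_zero, one_smul]

theorem tt_diag_neg (i : Idx n) : tt q i i = tt q i.neg i.neg := by
  rw [tt_diag, tt_diag]
  exact mk_rel q (.diag i)

theorem tt_anti (i : Idx n) (hi : i.2 = 0) : tt q i.neg i = 0 := by
  have : t q i.neg i = 0 := (mk_rel q (.anti i hi)).trans (map_zero _)
  rw [tt_apply, this, smul_zero]

theorem tt_lower (i j : Idx n) (hij : j.1 < i.1) : tt q i j = 0 := by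
  have : t q i j = 0 := (mk_rel q (.lower i j hij)).trans (map_zero _)
  rw [tt_apply, this, smul_zero]

theorem tt_mul_tinv (i : Idx n) : tt q i i * tinv q i = 1 := by
  rw [tt_diag]
  exact ((map_mul _ _ _).symm.trans (mk_rel q (.mul_inv i))).trans (map_one _)

theorem tinv_mul_tt (i : Idx n) : tinv q i * tt q i i = 1 := by
  rw [tt_diag]
  exact ((map_mul _ _ _).symm.trans (mk_rel q (.inv_mul i))).trans (map_one _)

section

variable {B : Type*} [Ring B] [Algebra K B] (F : QFree K n →ₐ[K] B) (M : Matrix (Idx n) (Idx n) B)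

theorem twist_T12 (hF : ∀ i j, F (ft K i j) = sgn ((i.2 + 1) * j.2) • M i j) :
    twist ((T12 K n).map F) = leg1 M := by
  ext a b
  rw [twist_apply, leg1_apply, Matrix.map_apply, T12, Matrix.of_apply]
  split_ifs with h
  · have key : ∀ a b c : ZMod 2, sgn ((a + c + 1) * (b + c)) * sgn ((a + 1) * b) =
      sgn (c * (a + b)) := by decide
    rw [hF, smul_smul, ← h, key]
  · rw [map_zero, smul_zero]

theorem twist_T13 (hF : ∀ i j, F (ft K i j) = sgn ((i.2 + 1) * j.2) • M i j) :
    twist ((T13 K n).map F) = leg2 M := by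
  ext a b
  rw [twist_apply, leg2_apply, Matrix.map_apply, T13, Matrix.of_apply]
  split_ifs with h
  · have key : ∀ a b c : ZMod 2, sgn ((c + a + 1) * (c + b)) * (sgn ((a + b) * c) *
      sgn ((a + 1) * b)) = 1 := by decide
    rw [units_smul_map, hF, smul_smul, smul_smul, ← h, mul_assoc, key, one_smul]
  · rw [map_zero, smul_zero]

theorem twist_S23 : twist ((S23 K q n).map F) = (Smat K q n).map (algebraMap K B) := by
  ext a b
  rw [twist_apply, Matrix.map_apply, Matrix.map_apply, S23, Matrix.map_apply, AlgHom.commutes]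
  by_cases h : a.1.2 + a.2.2 = b.1.2 + b.2.2
  · rw [h, add_one_mul_self, sgn_zero, one_smul]
  · rw [isEven_Smat K q n a b h, map_zero, smul_zero]

/-- The twist carries `T₁₂` and `T₁₃` to the two legs of `M` and leaves `S` unchanged, because `S`
is even. It multiplies each entry by an invertible sign, so no information is lost. -/
theorem isRTT_iff (hF : ∀ i j, F (ft K i j) = sgn ((i.2 + 1) * j.2) • M i j) :
    IsRTT (Smat K q n) M ↔ ∀ a b,
    F (superMul (superMul (T12 K n) (T13 K n)) (S23 K q n) a b) =
      F (superMul (S23 K q n) (superMul (T13 K n) (T12 K n)) a b) := by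
  have e1 : twist ((superMul (superMul (T12 K n) (T13 K n)) (S23 K q n)).map F) =
      leg1 M * leg2 M * (Smat K q n).map (algebraMap K B) := by
    have := superMul_map (F : QFree K n →+* B) (superMul (T12 K n) (T13 K n)) (S23 K q n)
    rw [RingHom.coe_coe] at this
    rw [this, twist_superMul, twist_S23]
    have := superMul_map (F : QFree K n →+* B) (T12 K n) (T13 K n)
    rw [RingHom.coe_coe] at this
    rw [this, twist_superMul, twist_T12 F M hF, twist_T13 F M hF]
  have e2 : twist ((superMul (S23 K q n) (superMul (T13 K n) (T12 K n))).map F) =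
      (Smat K q n).map (algebraMap K B) * (leg2 M * leg1 M) := by
    have := superMul_map (F : QFree K n →+* B) (S23 K q n) (superMul (T13 K n) (T12 K n))
    rw [RingHom.coe_coe] at this
    rw [this, twist_superMul, twist_S23]
    have := superMul_map (F : QFree K n →+* B) (T13 K n) (T12 K n)
    rw [RingHom.coe_coe] at this
    rw [this, twist_superMul, twist_T12 F M hF, twist_T13 F M hF]
  rw [IsRTT, ← e1, ← e2]
  constructor
  · intro h a b
    have := congrFun (congrFun h a) b
    rw [twist_apply, twist_apply] at this
    exact smul_left_cancel _ this
  · intro h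
    ext a b
    rw [twist_apply, twist_apply, Matrix.map_apply, h, Matrix.map_apply]

end

theorem isRTT_tt : IsRTT (Smat K q n) (tt q) := by
  refine (isRTT_iff q (mk q) (tt q) fun i j => ?_).2 fun a b => mk_rel q (.rtt a b)
  rw [tt_apply, smul_smul, Int.units_mul_self, one_smul]
  rfl

/-- The data of an algebra homomorphism from `QEA`. -/
structure IsQuantumMatrix {B : Type*} [Ring B] [Algebra K B] (M : Matrix (Idx n) (Idx n) B)
    (N : Idx n → B) : Prop where
  diag (i : Idx n) : M i i = M i.neg i.neg
  anti (i : Idx n) (hi : i.2 = 0) : M i.neg i = 0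
  lower (i j : Idx n) (hij : j.1 < i.1) : M i j = 0
  mul_inv (i : Idx n) : M i i * N i = 1
  inv_mul (i : Idx n) : N i * M i i = 1
  rtt : IsRTT (Smat K q n) M

theorem isQuantumMatrix_tt : IsQuantumMatrix q (tt q : Matrix (Idx n) (Idx n) _) (tinv q) :=
  ⟨tt_diag_neg q, tt_anti q, tt_lower q, tt_mul_tinv q, tinv_mul_tt q, isRTT_tt q⟩

variable {q} in
/-- The universal property of `QEA`. -/
def lift {B : Type*} [Ring B] [Algebra K B] {M : Matrix (Idx n) (Idx n) B} {N : Idx n → B}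
    (h : IsQuantumMatrix q M N) : QEA K q n →ₐ[K] B :=
  RingQuot.liftAlgHom K ⟨FreeAlgebra.lift K fun
    | QGen.t i j => sgn ((i.2 + 1) * j.2) • M i j
    | QGen.tinv i => N i, by
    have hF (i j : Idx n) : FreeAlgebra.lift K (fun
        | QGen.t i j => sgn ((i.2 + 1) * j.2) • M i j
        | QGen.tinv i => N i : QGen n → B) (ft K i j) = sgn ((i.2 + 1) * j.2) • M i j :=
      FreeAlgebra.lift_ι_apply _ _
    have hN (i : Idx n) : FreeAlgebra.lift K (fun
        | QGen.t i j => sgn ((i.2 + 1) * j.2) • M i j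
        | QGen.tinv i => N i : QGen n → B) (ftinv K i) = N i :=
      FreeAlgebra.lift_ι_apply _ _
    generalize FreeAlgebra.lift K (fun
        | QGen.t i j => sgn ((i.2 + 1) * j.2) • M i j
        | QGen.tinv i => N i : QGen n → B) = F at hF hN
    intro x y hxy
    cases hxy with
    | diag i =>
      rw [hF, hF, add_one_mul_self, add_one_mul_self, h.diag i]
    | anti i hi => rw [hF, h.anti i hi, smul_zero, map_zero]
    | lower i j hij => rw [hF, h.lower i j hij, smul_zero, map_zero]
    | mul_inv i => rw [map_mul, hF, hN, add_one_mul_self, sgn_zero, one_smul, h.mul_inv, map_one]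
    | inv_mul i => rw [map_mul, hF, hN, add_one_mul_self, sgn_zero, one_smul, h.inv_mul, map_one]
    | rtt a b => exact (isRTT_iff q F M hF).1 h.rtt a b⟩

variable {q} in
theorem lift_tt {B : Type*} [Ring B] [Algebra K B] {M : Matrix (Idx n) (Idx n) B} {N : Idx n → B}
    (h : IsQuantumMatrix q M N) (i j : Idx n) : lift h (tt q i j) = M i j := by
  have : lift h (t q i j) = sgn ((i.2 + 1) * j.2) • M i j :=
    (RingQuot.liftAlgHom_mkAlgHom_apply K _ _ _).trans (FreeAlgebra.lift_ι_apply _ _)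
  rw [tt_apply, units_smul_map, this, smul_smul, Int.units_mul_self, one_smul]

variable {q} in
theorem lift_tinv {B : Type*} [Ring B] [Algebra K B] {M : Matrix (Idx n) (Idx n) B}
    {N : Idx n → B} (h : IsQuantumMatrix q M N) (i : Idx n) : lift h (tinv q i) = N i :=
  (RingQuot.liftAlgHom_mkAlgHom_apply K _ _ _).trans (FreeAlgebra.lift_ι_apply _ _)

/-- The rescaled generators and the inverses of the diagonal ones. -/
def gens : Set (QEA K q n) := {x | (∃ i j, x = tt q i j) ∨ ∃ i, x = tinv q i}

theorem adjoin_gens : Algebra.adjoin K (gens q : Set (QEA K q n)) = ⊤ := by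
  have hs : Function.Surjective (mk q : QFree K n →ₐ[K] QEA K q n) :=
    RingQuot.mkAlgHom_surjective K _
  rw [eq_top_iff, ← (AlgHom.range_eq_top _).2 hs, ← Algebra.map_top, ← FreeAlgebra.adjoin_range_ι,
    AlgHom.map_adjoin]
  refine Algebra.adjoin_le ?_
  rintro _ ⟨_, ⟨(⟨i, j⟩ | i), rfl⟩, rfl⟩
  · have : mk q (ft K i j) = sgn ((i.2 + 1) * j.2) • tt q i j := by
      rw [tt_apply, smul_smul, Int.units_mul_self, one_smul]
      rfl
    change mk q (ft K i j) ∈ _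
    rw [this, Units.smul_def]
    have hm : tt q i j ∈ Algebra.adjoin K (gens q : Set (QEA K q n)) :=
      Algebra.subset_adjoin (Or.inl ⟨i, j, rfl⟩)
    exact zsmul_mem hm _
  · exact Algebra.subset_adjoin (Or.inr ⟨i, rfl⟩)

theorem tt_mem (i j : Idx n) : tt q i j ∈ part K (QEA K q n) (i.2 + j.2) := by
  change parity q (sgn _ • t q i j) = _
  rw [units_smul_map, parity_t, smul_comm]
  rfl

theorem tinv_mem (i : Idx n) : tinv q i ∈ part K (QEA K q n) 0 :=
  mem_part_zero.2 (parity_tinv q i)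

end QEA

/-! ### Triangular matrices over noncommutative rings -/

section Triangular

variable {m B : Type*} [Fintype m] [DecidableEq m] [Ring B] {h : m → ℕ}

theorem pow_apply_eq_zero {X : Matrix m m B} (hX : ∀ i j, ¬ h i < h j → X i j = 0) (k : ℕ)
    (i j : m) (hij : ¬ h i + k ≤ h j) : (X ^ k) i j = 0 := by
  induction k generalizing j with
  | zero =>
    rw [pow_zero, Matrix.one_apply_ne]
    rintro rfl
    exact hij le_rfl
  | succ k ih =>
    rw [pow_succ, Matrix.mul_apply]
    refine Finset.sum_eq_zero fun l _ => ?_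
    by_cases hl : h i + k ≤ h l
    · rw [hX l j (by omega), mul_zero]
    · rw [ih l hl, zero_mul]

/-- An upper triangular matrix with invertible diagonal has an upper triangular inverse. -/
theorem exists_inverse_of_triangular {M : Matrix m m B} {N : m → B}
    (h1 : ∀ i, M i i * N i = 1) (h2 : ∀ i, N i * M i i = 1)
    (hM : ∀ i j, i ≠ j → ¬ h i < h j → M i j = 0) :
    ∃ M' : Matrix m m B, M * M' = 1 ∧ M' * M = 1 ∧ (∀ i, M' i i = N i) ∧
      ∀ i j, i ≠ j → ¬ h i < h j → M' i j = 0 := by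
  classical
  let D := Matrix.diagonal N
  let D' := Matrix.diagonal fun i => M i i
  have hDD' : D * D' = 1 := by simp [D, D', h2]
  have hD'D : D' * D = 1 := by simp [D, D', h1]
  -- `D * M` has ones on the diagonal, so `X` is strictly triangular, hence nilpotent, and the
  -- inverse of `D * M` is the finite geometric series in `X`.
  let X := 1 - D * M
  have hX : ∀ i j, ¬ h i < h j → X i j = 0 := by
    intro i j hij
    change ((1 : Matrix m m B) - D * M) i j = 0
    rw [Matrix.sub_apply, Matrix.diagonal_mul]
    by_cases e : i = j
    · subst e
      rw [Matrix.one_apply_eq, h2, sub_self]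
    · rw [Matrix.one_apply_ne e, hM i j e hij, mul_zero, sub_zero]
  obtain ⟨s, hs⟩ : ∃ s, ∀ i, h i < s :=
    ⟨Finset.univ.sup h + 1, fun i => Nat.lt_succ_of_le (Finset.le_sup (Finset.mem_univ i))⟩
  have hXs : X ^ s = 0 := by
    ext i j
    exact pow_apply_eq_zero hX s i j (by have := hs j; omega)
  have e1 : (∑ k ∈ Finset.range s, X ^ k) * (D * M) = 1 := by
    have := geom_sum_mul X s
    rw [hXs] at this
    have e : D * M = -(X - 1) := by simp [X]
    rw [e, mul_neg, this]
    simp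
  have e2 : (D * M) * (∑ k ∈ Finset.range s, X ^ k) = 1 := by
    have := mul_geom_sum X s
    rw [hXs] at this
    have e : D * M = -(X - 1) := by simp [X]
    rw [e, neg_mul, this]
    simp
  have hsum (i j : m) (hij : ¬ h i < h j) : (∑ k ∈ Finset.range s, X ^ k) i j =
      (1 : Matrix m m B) i j := by
    rw [Matrix.sum_apply]
    -- On and below the diagonal only the term `X ^ 0` contributes, so it is split off; the series
    -- is not empty because `s` exceeds every height.
    obtain ⟨r, rfl⟩ : ∃ r, s = r + 1 := ⟨s - 1, by have := hs i; omega⟩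
    rw [Finset.sum_range_succ', pow_zero, Finset.sum_eq_zero, zero_add]
    intro k _
    exact pow_apply_eq_zero hX _ i j (by omega)
  refine ⟨(∑ k ∈ Finset.range s, X ^ k) * D, ?_, by rw [mul_assoc, e1], fun i => ?_, fun i j e hij => ?_⟩
  · calc M * ((∑ k ∈ Finset.range s, X ^ k) * D)
        = D' * ((D * M) * (∑ k ∈ Finset.range s, X ^ k)) * D := by
          simp only [← mul_assoc, hD'D, one_mul]
      _ = 1 := by rw [e2, mul_one, hD'D]
  · rw [Matrix.mul_diagonal, hsum i i (lt_irrefl _), Matrix.one_apply_eq, one_mul]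
  · rw [Matrix.mul_diagonal, hsum i j hij, Matrix.one_apply_ne e, zero_mul]

end Triangular

/-! ### Products and inverses of solutions of the RTT relation -/

section Legs

variable {n : ℕ} {B : Type*} [Ring B]

theorem leg1_mul_leg2_comm {X Y : Matrix (Idx n) (Idx n) B}
    (h : ∀ i j k l, X i j * Y k l = sgn ((i.2 + j.2) * (k.2 + l.2)) • (Y k l * X i j)) :
    leg1 X * leg2 Y = leg2 Y * leg1 X := by
  ext a b
  have key : ∀ a b c d : ZMod 2, sgn (c * (a + b)) * sgn ((a + b) * (c + d)) =
    sgn (d * (a + b)) := by decide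
  rw [leg1_mul_leg2_apply, leg2_mul_leg1_apply, h, smul_smul, key]

variable {K : Type*} [CommRing K] [Algebra K B] {S : Matrix (Idx n × Idx n) (Idx n × Idx n) K}

theorem IsRTT.map {C : Type*} [Ring C] [Algebra K C] (F : B →ₐ[K] C)
    {M : Matrix (Idx n) (Idx n) B} (h : IsRTT S M) : IsRTT S (M.map F) := by
  have h := congrArg (fun X => X.map (F : B →+* C)) h
  simp only [Matrix.map_mul] at h
  rw [leg1_map, leg2_map, Matrix.map_map] at h
  have e : (F : B →+* C) ∘ (algebraMap K B) = algebraMap K C := by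
    ext x
    simp
  rw [e] at h
  exact h

/-- The legs of `X` and `Y` with different positions commute, so `(XY)₁ (XY)₂ = X₁ X₂ Y₁ Y₂`. Now
`S` is moved first through the `Y` factors and then through the `X` factors. -/
theorem IsRTT.mul {X Y : Matrix (Idx n) (Idx n) B} (hX : IsRTT S X) (hY : IsRTT S Y)
    (h : ∀ i j k l, X i j * Y k l = sgn ((i.2 + j.2) * (k.2 + l.2)) • (Y k l * X i j)) :
    IsRTT S (X * Y) := by
  have h' : ∀ i j k l, Y i j * X k l = sgn ((i.2 + j.2) * (k.2 + l.2)) • (X k l * Y i j) := by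
    intro i j k l
    rw [h, smul_smul, mul_comm (i.2 + j.2), Int.units_mul_self, one_smul]
  unfold IsRTT at *
  rw [leg1_mul, leg2_mul]
  calc leg1 X * leg1 Y * (leg2 X * leg2 Y) * S.map (algebraMap K B)
      = leg1 X * (leg1 Y * leg2 X) * (leg2 Y * S.map (algebraMap K B)) := by
        simp only [mul_assoc]
    _ = leg1 X * leg2 X * (leg1 Y * leg2 Y * S.map (algebraMap K B)) := by
        rw [leg1_mul_leg2_comm h']; simp only [mul_assoc]
    _ = leg1 X * leg2 X * S.map (algebraMap K B) * (leg2 Y * leg1 Y) := by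
        rw [hY]; simp only [mul_assoc]
    _ = S.map (algebraMap K B) * leg2 X * (leg1 X * leg2 Y) * leg1 Y := by
        rw [hX]; simp only [mul_assoc]
    _ = _ := by rw [leg1_mul_leg2_comm h]; simp only [mul_assoc]

theorem isRTT_one : IsRTT S (1 : Matrix (Idx n) (Idx n) B) := by
  simp [IsRTT, leg1_one, leg2_one]

/-- The powers of a square root of `-1`. -/
def rootPow (c : K) (x : ZMod 2) : K := if x = 0 then 1 else c

/-- The sign `(-1)^(xy)` becomes a coboundary once a square root of `-1` is available. This is what
identifies the super opposite of an algebra with its ordinary opposite. -/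
theorem rootPow_mul {c : K} (hc : c * c = -1) (x y : ZMod 2) :
    rootPow c x * rootPow c y = sgn (x * y) • rootPow c (x + y) := by
  have h11 : (1 + 1 : ZMod 2) = 0 := by decide
  rcases zmod_two_cases x with rfl | rfl <;> rcases zmod_two_cases y with rfl | rfl <;>
    simp [rootPow, h11, hc, sgn_zero, sgn_one, -uzpow_zero, -uzpow_one, Units.neg_smul]

/-- The matrix whose entries are those of `M`, in the opposite algebra, twisted by powers of a
square root of `-1`. -/
def opMatrix (c : K) (M : Matrix (Idx n) (Idx n) B) : Matrix (Idx n) (Idx n) Bᵐᵒᵖ :=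
  Matrix.of fun i j => rootPow c (i.2 + j.2) • MulOpposite.op (M i j)

theorem leg1_mul_leg2_opMatrix {c : K} (hc : c * c = -1) (M : Matrix (Idx n) (Idx n) B) (a b) :
    (leg1 (opMatrix c M) * leg2 (opMatrix c M)) a b =
      rootPow c (a.1.2 + a.2.2 + (b.1.2 + b.2.2)) • MulOpposite.op ((leg2 M * leg1 M) a b) := by
  have key : ∀ a b c d : ZMod 2, sgn (c * (a + b)) * sgn ((a + b) * (c + d)) =
    sgn (d * (a + b)) := by decide
  have key2 : ∀ a b c d : ZMod 2, a + b + (c + d) = a + c + (b + d) := by decide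
  rw [leg1_mul_leg2_apply, leg2_mul_leg1_apply, opMatrix, Matrix.of_apply, Matrix.of_apply,
    smul_mul_smul_comm, ← MulOpposite.op_mul, rootPow_mul hc, key2, smul_assoc, smul_smul, key,
    MulOpposite.op_smul, smul_comm]

theorem leg2_mul_leg1_opMatrix {c : K} (hc : c * c = -1) (M : Matrix (Idx n) (Idx n) B) (a b) :
    (leg2 (opMatrix c M) * leg1 (opMatrix c M)) a b =
      rootPow c (a.1.2 + a.2.2 + (b.1.2 + b.2.2)) • MulOpposite.op ((leg1 M * leg2 M) a b) := by
  have key : ∀ a b c d : ZMod 2, sgn (d * (a + b)) * sgn ((c + d) * (a + b)) =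
    sgn (c * (a + b)) := by decide
  have key2 : ∀ a b c d : ZMod 2, c + d + (a + b) = a + c + (b + d) := by decide
  rw [leg1_mul_leg2_apply, leg2_mul_leg1_apply, opMatrix, Matrix.of_apply, Matrix.of_apply,
    smul_mul_smul_comm, ← MulOpposite.op_mul, rootPow_mul hc, key2, smul_assoc, smul_smul, key,
    MulOpposite.op_smul, smul_comm]

/-- Passing to inverses turns `M₁ M₂ S = S M₂ M₁` into `M'₂ M'₁ S = S M'₁ M'₂`. In the opposite
algebra the two orders of the legs are interchanged, which restores the original form. The powers of
`c` come out of the sums over the middle index because `S` preserves parity. -/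
theorem IsRTT.opMatrix_inverse {c : K} (hc : c * c = -1) (hS : IsUnit S)
    (hS0 : ∀ a b, a.1.2 + a.2.2 ≠ b.1.2 + b.2.2 → S a b = 0) {M M' : Matrix (Idx n) (Idx n) B}
    (h : IsRTT S M) (h1 : M * M' = 1) (h2 : M' * M = 1) : IsRTT S (opMatrix c M') := by
  obtain ⟨u, rfl⟩ := hS
  let A : Matrix (Idx n × Idx n) (Idx n × Idx n) B := (u : Matrix _ _ K).map (algebraMap K B)
  let A' : Matrix (Idx n × Idx n) (Idx n × Idx n) B := (↑u⁻¹ : Matrix _ _ K).map (algebraMap K B)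
  have hAA' : A * A' = 1 := by
    rw [← Matrix.map_mul, Units.mul_inv, Matrix.map_one _ (map_zero _) (map_one _)]
  have hA'A : A' * A = 1 := by
    rw [← Matrix.map_mul, Units.inv_mul, Matrix.map_one _ (map_zero _) (map_one _)]
  have hl1 : leg1 M * leg1 M' = 1 := by rw [← leg1_mul, h1, leg1_one]
  have hl2 : leg2 M * leg2 M' = 1 := by rw [← leg2_mul, h1, leg2_one]
  have hl1' : leg1 M' * leg1 M = 1 := by rw [← leg1_mul, h2, leg1_one]
  have hl2' : leg2 M' * leg2 M = 1 := by rw [← leg2_mul, h2, leg2_one]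
  have h : leg1 M * leg2 M * A = A * (leg2 M * leg1 M) := h
  have key : leg2 M' * leg1 M' * A = A * (leg1 M' * leg2 M') := by
    calc leg2 M' * leg1 M' * A
        = leg2 M' * leg1 M' * (A * (leg2 M * leg1 M)) * leg1 M' * leg2 M' := by
          simp only [mul_assoc]
          rw [← mul_assoc (leg1 M), hl1, one_mul, hl2, mul_one]
      _ = A * (leg1 M' * leg2 M') := by
          rw [← h]
          simp only [← mul_assoc]
          rw [mul_assoc (leg2 M') (leg1 M'), hl1', mul_one, hl2', one_mul]
  ext a b
  rw [matrix_map_mul_comm, matrix_map_mul_apply]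
  have key' := congrArg (fun x => rootPow c (a.1.2 + a.2.2 + (b.1.2 + b.2.2)) • MulOpposite.op x)
    (congrFun (congrFun key a) b)
  beta_reduce at key'
  rw [matrix_map_mul_comm, matrix_map_mul_apply, Finset.op_sum, Finset.op_sum,
    Finset.smul_sum, Finset.smul_sum] at key'
  refine (Finset.sum_congr rfl fun k _ => ?_).trans (key'.trans (Finset.sum_congr rfl fun k _ => ?_))
  · rw [leg1_mul_leg2_opMatrix hc]
    by_cases hk : k.1.2 + k.2.2 = b.1.2 + b.2.2
    · rw [hk, MulOpposite.op_smul, smul_comm]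
    · rw [hS0 _ _ hk, zero_smul, zero_smul, MulOpposite.op_zero, smul_zero]
  · rw [leg2_mul_leg1_opMatrix hc]
    by_cases hk : a.1.2 + a.2.2 = k.1.2 + k.2.2
    · rw [hk, MulOpposite.op_smul, smul_comm]
    · rw [hS0 _ _ hk, zero_smul, zero_smul, MulOpposite.op_zero, smul_zero]

end Legs

/-- A function on indices for which quantum matrices are upper triangular. -/
def Idx.height {n : ℕ} (i : Idx n) : ℕ := 2 * i.1 + i.2.val

theorem Idx.lt_height {n : ℕ} {i j : Idx n} (h : i.1 < j.1) : i.height < j.height := by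
  have h1 : i.2.val < 2 := i.2.val_lt
  have h2 : (i.1 : ℕ) < j.1 := h
  unfold height
  omega

theorem Idx.height_lt_height_neg {n : ℕ} {i : Idx n} (h : i.2 = 0) : i.height < i.neg.height := by
  have h1 : i.neg.2.val = 1 := by simp [neg, h]; rfl
  have h2 : i.2.val = 0 := by rw [h]; rfl
  unfold height
  rw [h1, h2]
  exact Nat.lt_succ_self _

theorem Idx.eq_neg_of_fst_eq {n : ℕ} {i j : Idx n} (h : i.1 = j.1) (hij : i ≠ j) : j = i.neg := by
  have key : ∀ x y : ZMod 2, x ≠ y → y = x + 1 := by decide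
  refine Prod.ext h.symm (key _ _ fun h' => hij (Prod.ext h h'))

/-! ### The Hopf superalgebra structure over the field -/

namespace QEA

variable {K : Type*} [Field K] {q : K} {n : ℕ}

theorem IsQuantumMatrix.triangular {B : Type*} [Ring B] [Algebra K B]
    {M : Matrix (Idx n) (Idx n) B} {N : Idx n → B} (h : IsQuantumMatrix q M N) (i j : Idx n)
    (hij : i ≠ j) (hh : ¬ i.height < j.height) : M i j = 0 := by
  rcases lt_trichotomy i.1 j.1 with h1 | h1 | h1
  · exact absurd (Idx.lt_height h1) hh
  · obtain rfl := Idx.eq_neg_of_fst_eq h1 hij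
    rcases zmod_two_cases i.2 with h2 | h2
    · exact absurd (Idx.height_lt_height_neg h2) hh
    · have := h.anti i.neg (by change i.2 + 1 = 0; rw [h2]; decide)
      rwa [Idx.neg_neg] at this
  · exact h.lower i j h1

theorem IsQuantumMatrix.exists_inverse {B : Type*} [Ring B] [Algebra K B]
    {M : Matrix (Idx n) (Idx n) B} {N : Idx n → B} (h : IsQuantumMatrix q M N) :
    ∃ M' : Matrix (Idx n) (Idx n) B, M * M' = 1 ∧ M' * M = 1 ∧ (∀ i, M' i i = N i) ∧
      ∀ i j : Idx n, i ≠ j → ¬ i.height < j.height → M' i j = 0 :=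
  exists_inverse_of_triangular h.mul_inv h.inv_mul h.triangular

theorem IsQuantumMatrix.inverse_eq {B : Type*} [Ring B] [Algebra K B]
    {M : Matrix (Idx n) (Idx n) B} {N : Idx n → B} (h : IsQuantumMatrix q M N) (i : Idx n) :
    N i = N i.neg := by
  have := h.inv_mul i.neg
  rw [← h.diag] at this
  calc N i = N i.neg * M i i * N i := by rw [this, one_mul]
    _ = N i.neg := by rw [mul_assoc, h.mul_inv, mul_one]

/-- All conditions apart from the RTT relation follow from triangularity: the product is triangular,
and its diagonal is the product of the diagonals. -/
theorem IsQuantumMatrix.mul {B : Type*} [Ring B] [Algebra K B]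
    {X Y : Matrix (Idx n) (Idx n) B} {N N' : Idx n → B} (hX : IsQuantumMatrix q X N)
    (hY : IsQuantumMatrix q Y N')
    (h : ∀ i j k l, X i j * Y k l = sgn ((i.2 + j.2) * (k.2 + l.2)) • (Y k l * X i j)) :
    IsQuantumMatrix q (X * Y) fun i => N' i * N i := by
  have hd (i : Idx n) : (X * Y) i i = X i i * Y i i := by
    rw [Matrix.mul_apply, Finset.sum_eq_single_of_mem i (Finset.mem_univ i)]
    intro k _ hk
    by_cases hik : i.height < k.height
    · rw [hY.triangular k i hk (by omega), mul_zero]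
    · rw [hX.triangular i k hk.symm hik, zero_mul]
  have ht (i j : Idx n) (hij : i ≠ j) (hh : ¬ i.height < j.height) : (X * Y) i j = 0 := by
    rw [Matrix.mul_apply]
    refine Finset.sum_eq_zero fun k _ => ?_
    by_cases hik : i ≠ k ∧ ¬ i.height < k.height
    · rw [hX.triangular i k hik.1 hik.2, zero_mul]
    · rw [hY.triangular k j, mul_zero]
      · rintro rfl
        exact hik ⟨hij, hh⟩
      · intro hkj
        by_cases e : i = k
        · exact hh (e ▸ hkj)
        · exact hik ⟨e, by omega⟩
  refine ⟨fun i => ?_, fun i hi => ?_, fun i j hij => ?_, fun i => ?_, fun i => ?_,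
    hX.rtt.mul hY.rtt h⟩
  · rw [hd, hd, hX.diag, hY.diag]
  · refine ht _ _ (fun e => ?_) (by have := Idx.height_lt_height_neg hi; omega)
    have := Idx.height_lt_height_neg hi
    rw [e] at this
    omega
  · refine ht _ _ ?_ (by have := Idx.lt_height hij; omega)
    rintro rfl
    exact lt_irrefl _ hij
  · rw [hd, mul_assoc, ← mul_assoc (Y i i), hY.mul_inv, one_mul, hX.mul_inv]
  · rw [hd, mul_assoc, ← mul_assoc (N i), hX.inv_mul, one_mul, hY.inv_mul]

theorem IsQuantumMatrix.map {B C : Type*} [Ring B] [Algebra K B] [Ring C] [Algebra K C]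
    (F : B →ₐ[K] C) {M : Matrix (Idx n) (Idx n) B} {N : Idx n → B} (h : IsQuantumMatrix q M N) :
    IsQuantumMatrix q (M.map F) (fun i => F (N i)) where
  diag i := congrArg F (h.diag i)
  anti i hi := (congrArg F (h.anti i hi)).trans (map_zero F)
  lower i j hij := (congrArg F (h.lower i j hij)).trans (map_zero F)
  mul_inv i := by rw [Matrix.map_apply, ← map_mul, h.mul_inv, map_one]
  inv_mul i := by rw [Matrix.map_apply, ← map_mul, h.inv_mul, map_one]
  rtt := h.rtt.map F

theorem isQuantumMatrix_one {B : Type*} [Ring B] [Algebra K B] :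
    IsQuantumMatrix q (1 : Matrix (Idx n) (Idx n) B) fun _ => 1 where
  diag i := by rw [Matrix.one_apply_eq, Matrix.one_apply_eq]
  anti i hi := by
    refine Matrix.one_apply_ne fun e => ?_
    have := Idx.height_lt_height_neg hi
    rw [e] at this
    omega
  lower i j hij := by
    refine Matrix.one_apply_ne ?_
    rintro rfl
    exact lt_irrefl _ hij
  mul_inv i := by rw [Matrix.one_apply_eq, mul_one]
  inv_mul i := by rw [Matrix.one_apply_eq, mul_one]
  rtt := isRTT_one

theorem IsQuantumMatrix.opMatrix {c : K} (hc : c * c = -1) (hS : IsUnit (Smat K q n))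
    {B : Type*} [Ring B] [Algebra K B]
    {M M' : Matrix (Idx n) (Idx n) B} {N : Idx n → B} (h : IsQuantumMatrix q M N)
    (h1 : M * M' = 1) (h2 : M' * M = 1) (h3 : ∀ i, M' i i = N i)
    (h4 : ∀ i j : Idx n, i ≠ j → ¬ i.height < j.height → M' i j = 0) :
    IsQuantumMatrix q (_root_.opMatrix c M') fun i => MulOpposite.op (M i i) := by
  have hd (i : Idx n) : _root_.opMatrix c M' i i = MulOpposite.op (N i) := by
    rw [_root_.opMatrix, Matrix.of_apply, CharTwo.add_self_eq_zero, rootPow, if_pos rfl, one_smul,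
      h3]
  have ht (i j : Idx n) (hij : i ≠ j) (hh : ¬ i.height < j.height) :
      _root_.opMatrix c M' i j = 0 := by
    rw [_root_.opMatrix, Matrix.of_apply, h4 i j hij hh, MulOpposite.op_zero, smul_zero]
  refine ⟨fun i => ?_, fun i hi => ?_, fun i j hij => ?_, fun i => ?_, fun i => ?_,
    h.rtt.opMatrix_inverse hc hS (isEven_Smat K q n) h1 h2⟩
  · rw [hd, hd, h.inverse_eq]
  · refine ht _ _ (fun e => ?_) (by have := Idx.height_lt_height_neg hi; omega)
    have := Idx.height_lt_height_neg hi
    rw [e] at this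
    omega
  · refine ht _ _ ?_ (by have := Idx.lt_height hij; omega)
    rintro rfl
    exact lt_irrefl _ hij
  · rw [hd, ← MulOpposite.op_mul, h.mul_inv, MulOpposite.op_one]
  · rw [hd, ← MulOpposite.op_mul, h.inv_mul, MulOpposite.op_one]

variable [Invertible (2 : K)]

variable (q n) in
-- The two copies of `T` in the super tensor square supercommute with each other, so their product
-- is again a quantum matrix. The coproduct is the homomorphism it defines.
theorem isQuantumMatrix_comul : IsQuantumMatrix q
    ((tt q).map (GradedTensorProduct.includeLeft (part K (QEA K q n)) (part K (QEA K q n))) *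
      (tt q).map (GradedTensorProduct.includeRight (part K (QEA K q n)) (part K (QEA K q n))))
    fun i => (1 ᵍ⊗ₜ[K] tinv q i : SuperTensor K (QEA K q n)) * tinv q i ᵍ⊗ₜ[K] 1 := by
  refine ((isQuantumMatrix_tt q).map
    (GradedTensorProduct.includeLeft (part K (QEA K q n)) (part K (QEA K q n)))).mul
    ((isQuantumMatrix_tt q).map
      (GradedTensorProduct.includeRight (part K (QEA K q n)) (part K (QEA K q n)))) ?_
  intro i j k l
  change (tt q i j ᵍ⊗ₜ[K] 1 : SuperTensor K (QEA K q n)) * 1 ᵍ⊗ₜ[K] tt q k l =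
    _ • ((1 ᵍ⊗ₜ[K] tt q k l : SuperTensor K (QEA K q n)) * tt q i j ᵍ⊗ₜ[K] 1)
  rw [tmul_mul_tmul _ one_mem_part one_mem_part, tmul_mul_tmul _ (tt_mem q k l) (tt_mem q i j),
    smul_smul, mul_comm (k.2 + l.2), Int.units_mul_self, mul_zero, sgn_zero]
  simp

variable (q n) in
/-- The comultiplication of the quantized enveloping superalgebra. -/
def comul : QEA K q n →ₐ[K] SuperTensor K (QEA K q n) := lift (isQuantumMatrix_comul q n)

theorem comul_tt (i j : Idx n) : comul q n (tt q i j) = ∑ k, tt q i k ᵍ⊗ₜ[K] tt q k j := by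
  rw [comul, lift_tt, Matrix.mul_apply]
  refine Finset.sum_congr rfl fun k _ => ?_
  change (tt q i k ᵍ⊗ₜ[K] 1 : SuperTensor K (QEA K q n)) * 1 ᵍ⊗ₜ[K] tt q k j = _
  rw [tmul_mul_tmul _ one_mem_part one_mem_part]
  simp

theorem comul_tinv (i : Idx n) : comul q n (tinv q i) = tinv q i ᵍ⊗ₜ[K] tinv q i := by
  rw [comul, lift_tinv, tmul_mul_tmul _ (tinv_mem q i) (tinv_mem q i), mul_zero, sgn_zero, one_smul,
    one_mul, mul_one]

theorem comul_t (i j : Idx n) : comul q n (t q i j) = ∑ k : Idx n,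
    sgn ((i.2 + k.2) * (k.2 + j.2)) • (t q i k ᵍ⊗ₜ[K] t q k j) := by
  have h (i j : Idx n) : t q i j = sgn ((i.2 + 1) * j.2) • tt q i j := by
    rw [tt_apply, smul_smul, Int.units_mul_self, one_smul]
  have key : ∀ a b c : ZMod 2, sgn ((a + 1) * b) = sgn ((a + c) * (c + b)) *
      sgn ((a + 1) * c) * sgn ((c + 1) * b) := by decide
  rw [h, units_smul_map, comul_tt, Finset.smul_sum]
  refine Finset.sum_congr rfl fun k _ => ?_
  rw [h i k, h k j, ST.smul_tmul, ST.tmul_smul, smul_smul, smul_smul, ← key]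

variable (q n) in
/-- The counit of the quantized enveloping superalgebra. -/
def counit : QEA K q n →ₐ[K] K := lift isQuantumMatrix_one

theorem counit_tt (i j : Idx n) : counit q n (tt q i j) = (1 : Matrix (Idx n) (Idx n) K) i j :=
  lift_tt _ i j

theorem counit_tinv (i : Idx n) : counit q n (tinv q i) = 1 := lift_tinv _ i

theorem underlying_comul_tt (i j : Idx n) :
    underlying (comul q n) (tt q i j) = ∑ k, tt q i k ⊗ₜ[K] tt q k j := by
  change (GradedTensorProduct.of K _ _).symm (comul q n (tt q i j)) = _
  rw [comul_tt, map_sum]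
  rfl

theorem underlying_comul_tinv (i : Idx n) :
    underlying (comul q n) (tinv q i) = tinv q i ⊗ₜ[K] tinv q i := by
  change (GradedTensorProduct.of K _ _).symm (comul q n (tinv q i)) = _
  rw [comul_tinv]
  rfl

theorem parity_tt (i j : Idx n) :
    Superalgebra.parity K (tt q i j) = sgn (i.2 + j.2) • tt q i j := tt_mem q i j

variable (q n) in
/-- The superbialgebra structure on the quantized enveloping superalgebra. -/
def superBialgebra : SuperBialgebra K (QEA K q n) :=
  SuperBialgebra.ofGenerators (adjoin_gens q) (comul q n) (counit q n)
    (by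
      rintro _ (⟨i, j, rfl⟩ | ⟨i, rfl⟩)
      · rw [parity_tt, units_smul_map, comul_tt, map_sum, Finset.smul_sum]
        refine Finset.sum_congr rfl fun k _ => ?_
        have key : ∀ a b c : ZMod 2, sgn (a + b) = sgn (a + c) * sgn (c + b) := by decide
        rw [ST.parity_tmul, parity_tt, parity_tt, ST.smul_tmul, ST.tmul_smul, smul_smul, ← key]
      · rw [mem_part_zero.1 (tinv_mem q i), comul_tinv, ST.parity_tmul,
          mem_part_zero.1 (tinv_mem q i)])
    (by
      rintro _ (⟨i, j, rfl⟩ | ⟨i, rfl⟩)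
      · rw [parity_tt, units_smul_map, counit_tt]
        by_cases h : i = j
        · rw [h, CharTwo.add_self_eq_zero, sgn_zero, one_smul]
        · rw [Matrix.one_apply_ne h, smul_zero]
      · rw [mem_part_zero.1 (tinv_mem q i)])
    (by
      rintro _ (⟨i, j, rfl⟩ | ⟨i, rfl⟩)
      · rw [underlying_comul_tt, map_sum, map_sum, map_sum]
        simp only [LinearMap.rTensor_tmul, LinearMap.lTensor_tmul, underlying_comul_tt,
          TensorProduct.sum_tmul, TensorProduct.tmul_sum, map_sum, TensorProduct.assoc_tmul]
        exact Finset.sum_comm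
      · rw [underlying_comul_tinv, LinearMap.rTensor_tmul, LinearMap.lTensor_tmul,
          underlying_comul_tinv, TensorProduct.assoc_tmul])
    (by
      rintro _ (⟨i, j, rfl⟩ | ⟨i, rfl⟩)
      · rw [underlying_comul_tt, map_sum, map_sum]
        simp [counit_tt, Matrix.one_apply]
      · rw [underlying_comul_tinv, LinearMap.rTensor_tmul, TensorProduct.lid_tmul,
          AlgHom.toLinearMap_apply, counit_tinv, one_smul])
    (by
      rintro _ (⟨i, j, rfl⟩ | ⟨i, rfl⟩)
      · rw [underlying_comul_tt, map_sum, map_sum]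
        simp [counit_tt, Matrix.one_apply]
      · rw [underlying_comul_tinv, LinearMap.lTensor_tmul, TensorProduct.rid_tmul,
          AlgHom.toLinearMap_apply, counit_tinv, one_smul])

/-- Applying parity to the entries of a left inverse and correcting by the expected signs gives
another left inverse. Uniqueness of the inverse forces the two to coincide. -/
theorem inverse_tt_mem {M : Matrix (Idx n) (Idx n) (QEA K q n)} (h1 : tt q * M = 1)
    (h2 : M * tt q = 1) (i j : Idx n) : M i j ∈ part K (QEA K q n) (i.2 + j.2) := by
  let M' : Matrix (Idx n) (Idx n) (QEA K q n) :=
    Matrix.of fun i j => sgn (i.2 + j.2) • Superalgebra.parity K (M i j)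
  have h3 : M' * tt q = 1 := by
    ext i j
    have h4 := congrArg (Superalgebra.parity K) (congrFun (congrFun h2 i) j)
    rw [Matrix.mul_apply, map_sum] at h4
    calc (M' * (tt q : Matrix (Idx n) (Idx n) (QEA K q n))) i j = sgn (i.2 + j.2) •
          ∑ k, Superalgebra.parity K (M i k * tt q k j) := by
          rw [Matrix.mul_apply, Finset.smul_sum]
          refine Finset.sum_congr rfl fun k _ => ?_
          have key : ∀ a b c : ZMod 2, sgn (a + b) * sgn (c + b) = sgn (a + c) := by decide
          rw [map_mul, parity_tt, mul_smul_comm, smul_smul, key, ← smul_mul_assoc]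
          rfl
      _ = (1 : Matrix (Idx n) (Idx n) (QEA K q n)) i j := by
          rw [h4]
          by_cases h : i = j
          · rw [h, Matrix.one_apply_eq, map_one, CharTwo.add_self_eq_zero, sgn_zero, one_smul]
          · rw [Matrix.one_apply_ne h, map_zero, smul_zero]
  have h5 : M' = M := left_inv_eq_right_inv h3 h1
  have e : sgn (i.2 + j.2) • Superalgebra.parity K (M i j) = M i j := congrFun (congrFun h5 i) j
  rw [mem_part]
  nth_rw 2 [← e]
  rw [smul_smul, Int.units_mul_self, one_smul]

/-- The Hopf superalgebra structure on the quantized enveloping superalgebra. -/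
theorem exists_hopfSuperalgebra {c : K} (hc : c * c = -1) (hS : IsUnit (Smat K q n)) :
    ∃ H : HopfSuperalgebra K (QEA K q n), H.toSuperBialgebra = superBialgebra q n ∧
      IsSuperAnti H.antipode ∧ (∀ i, H.antipode (tinv q i) = tt q i i) ∧
      ∃ M : Matrix (Idx n) (Idx n) (QEA K q n), M * tt q = 1 ∧ tt q * M = 1 ∧
        ∀ i j, H.antipode (tt q i j) = M i j := by
  obtain ⟨M, h1, h2, h3, h4⟩ := (isQuantumMatrix_tt (n := n) q).exists_inverse
  -- On odd entries the twisted inverse carries a factor `c`, which is cancelled later by the factor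
  -- `-c` in `superAntiOf`. The antipode therefore sends `tt` to its plain inverse.
  let σ : QEA K q n →ₐ[K] (QEA K q n)ᵐᵒᵖ :=
    lift ((isQuantumMatrix_tt q).opMatrix hc hS h1 h2 h3 h4)
  have hσt (i j : Idx n) : (σ (tt q i j)).unop = rootPow c (i.2 + j.2) • M i j := by
    rw [lift_tt]
    rfl
  have hσi (i : Idx n) : (σ (tinv q i)).unop = tt q i i := by
    rw [lift_tinv]
    rfl
  have hσ (a) : (σ (Superalgebra.parity K a)).unop = Superalgebra.parity K (σ a).unop := by
    have := AlgHom.ext_of_adjoin_eq_top (adjoin_gens (n := n) q)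
      (φ₁ := σ.comp (Superalgebra.parity K))
      (φ₂ := (AlgHom.op (Superalgebra.parity K)).comp σ) (by
        rintro _ (⟨i, j, rfl⟩ | ⟨i, rfl⟩)
        · apply MulOpposite.unop_injective
          change (σ (Superalgebra.parity K _)).unop = Superalgebra.parity K (σ _).unop
          rw [parity_tt, units_smul_map, MulOpposite.unop_smul, hσt, map_smul,
            parity_of_mem (inverse_tt_mem h1 h2 i j), smul_comm]
        · apply MulOpposite.unop_injective
          change (σ (Superalgebra.parity K _)).unop = Superalgebra.parity K (σ _).unop
          rw [mem_part_zero.1 (tinv_mem q i), hσi, parity_tt, CharTwo.add_self_eq_zero, sgn_zero,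
            one_smul])
    exact congrArg MulOpposite.unop (DFunLike.congr_fun this a)
  have hSt (i j : Idx n) : superAntiOf c σ (tt q i j) = M i j := by
    rw [superAntiOf_of_mem c σ (tt_mem q i j), hσt, smul_smul, rootPow]
    split_ifs
    · rw [one_mul, one_smul]
    · rw [neg_mul, hc, neg_neg, one_smul]
  have hSi (i : Idx n) : superAntiOf c σ (tinv q i) = tt q i i := by
    rw [superAntiOf_of_mem c σ (tinv_mem q i), hσi, if_pos rfl, one_smul]
  refine ⟨HopfSuperalgebra.ofGenerators (superBialgebra q n) (adjoin_gens q) (superAntiOf c σ)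
    (isSuperAnti_superAntiOf hc hσ) ?_ ?_, rfl, isSuperAnti_superAntiOf hc hσ, hSi, M, h2, h1, hSt⟩
  · rintro _ (⟨i, j, rfl⟩ | ⟨i, rfl⟩)
    · change convLeft _ (comul q n _) = algebraMap K _ (counit q n _)
      rw [comul_tt, counit_tt, map_sum]
      simp only [convLeft_tmul, hSt]
      rw [← Matrix.mul_apply, h2, Matrix.one_apply, Matrix.one_apply]
      split_ifs <;> simp
    · change convLeft _ (comul q n _) = algebraMap K _ (counit q n _)
      rw [comul_tinv, counit_tinv, convLeft_tmul, hSi, tt_mul_tinv, map_one]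
  · rintro _ (⟨i, j, rfl⟩ | ⟨i, rfl⟩)
    · change convRight _ (comul q n _) = algebraMap K _ (counit q n _)
      rw [comul_tt, counit_tt, map_sum]
      simp only [convRight_tmul, hSt]
      rw [← Matrix.mul_apply, h1, Matrix.one_apply, Matrix.one_apply]
      split_ifs <;> simp
    · change convRight _ (comul q n _) = algebraMap K _ (counit q n _)
      rw [comul_tinv, counit_tinv, convRight_tmul, hSi, tinv_mul_tt, map_one]

end QEA

/-! ### The braid relation

Indices are coded by natural numbers: the index of absolute value `a + 1` and parity `p` has the code
`2 a + p`. -/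

namespace Braid

/-- The codes `a`, `b` are those of opposite indices. -/
abbrev Opp (a b : ℕ) : Prop := a / 2 = b / 2 ∧ a ≠ b

section Coeff

variable {R : Type*} [CommRing R] (q q' : R)

/-- The coefficient of the exchange term. -/
def exch (a b : ℕ) : R :=
  if a = b then (if a % 2 = 0 then q else -q')
  else if a / 2 = b / 2 then (if a % 2 = 0 then q else q')
  else if a % 2 = 1 ∧ b % 2 = 1 then -1 else 1

/-- The coefficient of the contraction term. -/
def contr (b : ℕ) : R := if b % 2 = 0 then -(q - q') else q - q'

/-- The coefficient of `e_x ⊗ e_y` in the image of `e_a ⊗ e_b` under the braiding. -/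
def coeff (a b x y : ℕ) : R :=
  (if x = b ∧ y = a then exch q q' a b else 0) +
  (if x = a ∧ y = b ∧ a < b then q - q' else 0) +
  (if Opp a b ∧ Opp x y ∧ x / 2 < b / 2 then contr q q' b else 0)

/-- The matrix entries of `B₁ B₂ B₁`. -/
def left (S : Finset ℕ) (a b c x y w : ℕ) : R :=
  ∑ p ∈ S, ∑ r ∈ S, ∑ s ∈ S, coeff q q' a b p r * coeff q q' r c s w * coeff q q' p s x y

/-- The matrix entries of `B₂ B₁ B₂`. -/
def right (S : Finset ℕ) (a b c x y w : ℕ) : R :=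
  ∑ p ∈ S, ∑ r ∈ S, ∑ s ∈ S, coeff q q' b c p r * coeff q q' a p x s * coeff q q' s r y w

end Coeff

/-! #### Polynomials with integral coefficients as lists -/

/-- Addition of polynomials. -/
def padd : List ℤ → List ℤ → List ℤ
  | [], l => l
  | a :: l, [] => a :: l
  | a :: l, b :: m => (a + b) :: padd l m

/-- Multiplication of polynomials. -/
def pmul : List ℤ → List ℤ → List ℤ
  | [], _ => []
  | a :: l, m => padd (m.map (a * ·)) (0 :: pmul l m)

section Eval

variable {R : Type*} [CommRing R] (q : R)

/-- Evaluation of polynomials. -/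
def peval : List ℤ → R
  | [] => 0
  | a :: l => a + q * peval l

theorem peval_padd (l m : List ℤ) : peval q (padd l m) = peval q l + peval q m := by
  induction l generalizing m with
  | nil => simp [padd, peval]
  | cons a l ih =>
    cases m with
    | nil => simp [padd, peval]
    | cons b m =>
      simp only [padd, peval, ih, Int.cast_add]
      ring

theorem peval_map_mul (a : ℤ) (l : List ℤ) : peval q (l.map (a * ·)) = a * peval q l := by
  induction l with
  | nil => simp [peval]
  | cons b l ih =>
    simp only [List.map_cons, peval, ih, Int.cast_mul]
    ring

theorem peval_pmul (l m : List ℤ) : peval q (pmul l m) = peval q l * peval q m := by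
  induction l with
  | nil => simp [pmul, peval]
  | cons a l ih =>
    simp only [pmul, peval, peval_padd, peval_map_mul, ih, Int.cast_zero]
    ring

theorem peval_eq_zero {l : List ℤ} (h : ∀ a ∈ l, a = 0) : peval q l = 0 := by
  induction l with
  | nil => rfl
  | cons a l ih =>
    rw [peval, h a (by simp), ih fun b hb => h b (by simp [hb])]
    simp

end Eval

/-! #### The braiding as a list of terms -/

/-- `q` times `exch`. -/
def pexch (a b : ℕ) : List ℤ :=
  if a = b then (if a % 2 = 0 then [0, 0, 1] else [-1])
  else if a / 2 = b / 2 then (if a % 2 = 0 then [0, 0, 1] else [1])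
  else if a % 2 = 1 ∧ b % 2 = 1 then [0, -1] else [0, 1]

/-- `q` times `contr`. -/
def pcontr (b : ℕ) : List ℤ := if b % 2 = 0 then [1, 0, -1] else [-1, 0, 1]

/-- The code of the opposite index. -/
def opp (a : ℕ) : ℕ := if a % 2 = 0 then a + 1 else a - 1

/-- The terms of the image of `e_a ⊗ e_b` under `q` times the braiding. -/
def step (a b : ℕ) : List (ℕ × ℕ × List ℤ) :=
  (b, a, pexch a b) :: ((if a < b then [(a, b, [-1, 0, 1])] else []) ++
    if Opp a b then (List.range (2 * (b / 2))).map fun x => (x, opp x, pcontr b) else [])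

/-- The terms of the image of `e_a ⊗ e_b ⊗ e_c` under `B₁ B₂ B₁`. -/
def leftList (a b c : ℕ) : List ((ℕ × ℕ × ℕ) × List ℤ) :=
  (step a b).flatMap fun t => (step t.2.1 c).flatMap fun u => (step t.1 u.1).map fun v =>
    ((v.1, v.2.1, u.2.1), pmul t.2.2 (pmul u.2.2 v.2.2))

/-- The terms of the image of `e_a ⊗ e_b ⊗ e_c` under `B₂ B₁ B₂`. -/
def rightList (a b c : ℕ) : List ((ℕ × ℕ × ℕ) × List ℤ) :=
  (step b c).flatMap fun t => (step a t.1).flatMap fun u => (step u.2.1 t.2.1).map fun v =>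
    ((u.1, v.1, v.2.1), pmul t.2.2 (pmul u.2.2 v.2.2))

/-- The coefficient of a basis vector in a list of terms. -/
def coeffAt (k : ℕ × ℕ × ℕ) (l : List ((ℕ × ℕ × ℕ) × List ℤ)) : List ℤ :=
  l.foldr (fun e s => if e.1 = k then padd e.2 s else s) []

/-- The braid relation for three absolute values, as a finite check. Each of the three factors is
multiplied by `q`, so that the coefficients become integral polynomials in `q`. Only basis vectors
which occur on one of the two sides have to be compared. -/
theorem coeffAt_eq : ∀ a < 6, ∀ b < 6, ∀ c < 6, ∀ e ∈ leftList a b c ++ rightList a b c,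
    ∀ z ∈ padd (coeffAt e.1 (leftList a b c)) ((coeffAt e.1 (rightList a b c)).map (-1 * ·)),
      z = 0 := by
  decide +kernel

/-! ### Soundness of the list computation -/

section Sound

variable {R : Type*} [CommRing R] {q q' : R} (hq : q * q' = 1)

theorem peval_coeffAt (k : ℕ × ℕ × ℕ) (l : List ((ℕ × ℕ × ℕ) × List ℤ)) :
    peval q (coeffAt k l) = (l.map fun e => if e.1 = k then peval q e.2 else 0).sum := by
  induction l with
  | nil => rfl
  | cons e l ih =>
    simp only [coeffAt, List.foldr_cons, List.map_cons, List.sum_cons] at ih ⊢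
    split_ifs
    · rw [peval_padd, ih]
    · rw [ih, zero_add]

theorem coeffAt_of_forall_ne (k : ℕ × ℕ × ℕ) (l : List ((ℕ × ℕ × ℕ) × List ℤ))
    (h : ∀ e ∈ l, e.1 ≠ k) : coeffAt k l = [] := by
  induction l with
  | nil => rfl
  | cons e l ih =>
    simp only [coeffAt, List.foldr_cons] at ih ⊢
    rw [if_neg (h e (by simp)), ih fun e he => h e (by simp [he])]

theorem peval_coeffAt_eq {a b c : ℕ} (ha : a < 6) (hb : b < 6) (hc : c < 6) (k : ℕ × ℕ × ℕ) :
    peval q (coeffAt k (leftList a b c)) = peval q (coeffAt k (rightList a b c)) := by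
  by_cases h : ∃ e ∈ leftList a b c ++ rightList a b c, e.1 = k
  · obtain ⟨e, he, rfl⟩ := h
    have := peval_eq_zero q (coeffAt_eq a ha b hb c hc e he)
    rw [peval_padd, peval_map_mul] at this
    push_cast at this
    linear_combination this
  · push Not at h
    rw [coeffAt_of_forall_ne _ _ fun e he => h e (List.mem_append_left _ he),
      coeffAt_of_forall_ne _ _ fun e he => h e (List.mem_append_right _ he)]

include hq in
theorem peval_pexch (a b : ℕ) : peval q (pexch a b) = q * exch q q' a b := by
  unfold pexch exch
  split_ifs <;> simp [peval, hq]

include hq in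
theorem peval_pcontr (b : ℕ) : peval q (pcontr b) = q * contr q q' b := by
  unfold pcontr contr
  split_ifs
  · simp [peval]
    linear_combination -hq
  · simp [peval]
    linear_combination hq

theorem opp_iff (x y : ℕ) : Opp x y ↔ y = opp x := by
  unfold Opp opp
  split_ifs <;> omega

include hq in
-- The list `step a b` accounts for all nonzero coefficients. The test function `G` is arbitrary so
-- that the formula can be nested: a composite of three braidings is evaluated by taking the value
-- of the next braiding as `G`.
theorem sum_coeff {M a b : ℕ} (ha : a < 2 * M) (hb : b < 2 * M) (G : ℕ → ℕ → R) :
    q * ∑ x ∈ Finset.range (2 * M), ∑ y ∈ Finset.range (2 * M), coeff q q' a b x y * G x y =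
      ((step a b).map fun t => peval q t.2.2 * G t.1 t.2.1).sum := by
  have e1 : ∑ x ∈ Finset.range (2 * M), ∑ y ∈ Finset.range (2 * M),
      (if x = b ∧ y = a then exch q q' a b else 0) * G x y = exch q q' a b * G b a := by
    rw [Finset.sum_eq_single_of_mem b (Finset.mem_range.2 hb),
      Finset.sum_eq_single_of_mem a (Finset.mem_range.2 ha)]
    · simp
    · intro y _ hy
      simp [hy]
    · intro x _ hx
      simp [hx]
  have e2 : ∑ x ∈ Finset.range (2 * M), ∑ y ∈ Finset.range (2 * M),
      (if x = a ∧ y = b ∧ a < b then q - q' else 0) * G x y =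
        if a < b then (q - q') * G a b else 0 := by
    rw [Finset.sum_eq_single_of_mem a (Finset.mem_range.2 ha),
      Finset.sum_eq_single_of_mem b (Finset.mem_range.2 hb)]
    · simp
    · intro y _ hy
      simp [hy]
    · intro x _ hx
      simp [hx]
  -- In the contraction term `y` is determined by `x`, and `x / 2 < b / 2` means `x < 2 * (b / 2)`.
  have e3 : ∑ x ∈ Finset.range (2 * M), ∑ y ∈ Finset.range (2 * M),
      (if Opp a b ∧ Opp x y ∧ x / 2 < b / 2 then contr q q' b else 0) * G x y =
        if Opp a b then ∑ x ∈ Finset.range (2 * (b / 2)), contr q q' b * G x (opp x) else 0 := by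
    by_cases hab : Opp a b
    · rw [if_pos hab]
      have hs : Finset.range (2 * (b / 2)) ⊆ Finset.range (2 * M) :=
        Finset.range_subset_range.2 (by omega)
      rw [← Finset.sum_subset hs]
      · refine Finset.sum_congr rfl fun x hx => ?_
        rw [Finset.mem_range] at hx
        have hx' : opp x < 2 * M := by unfold opp; split_ifs <;> omega
        rw [Finset.sum_eq_single_of_mem (opp x) (Finset.mem_range.2 hx')]
        · rw [if_pos ⟨hab, (opp_iff _ _).2 rfl, by omega⟩]
        · intro y _ hy
          rw [if_neg fun h => hy ((opp_iff _ _).1 h.2.1), zero_mul]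
      · intro x _ hx
        refine Finset.sum_eq_zero fun y _ => ?_
        rw [Finset.mem_range] at hx
        rw [if_neg fun h => hx (by omega), zero_mul]
    · simp [hab]
  have e : ∑ x ∈ Finset.range (2 * M), ∑ y ∈ Finset.range (2 * M), coeff q q' a b x y * G x y =
      exch q q' a b * G b a + (if a < b then (q - q') * G a b else 0) +
        if Opp a b then ∑ x ∈ Finset.range (2 * (b / 2)), contr q q' b * G x (opp x) else 0 := by
    rw [← e1, ← e2, ← e3, ← Finset.sum_add_distrib, ← Finset.sum_add_distrib]
    refine Finset.sum_congr rfl fun x _ => ?_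
    rw [← Finset.sum_add_distrib, ← Finset.sum_add_distrib]
    refine Finset.sum_congr rfl fun y _ => ?_
    rw [coeff]
    ring
  rw [e, step, List.map_cons, List.sum_cons, List.map_append, List.sum_append]
  dsimp only
  rw [peval_pexch hq, mul_add, mul_add, mul_assoc, add_assoc]
  congr 2
  · split_ifs
    · simp [peval]
      linear_combination (-G a b) * hq
    · simp
  · split_ifs
    · rw [List.map_map, Finset.mul_sum]
      change _ = ((List.range (2 * (b / 2))).map fun x =>
        peval q (pcontr b) * G x (opp x)).sum
      simp only [peval_pcontr hq, mul_assoc]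
      rfl
    · simp

theorem sum_flatMap {α β : Type*} (l : List α) (f : α → List β) (g : β → R) :
    ((l.flatMap f).map g).sum = (l.map fun a => ((f a).map g).sum).sum := by
  induction l with
  | nil => rfl
  | cons a l ih => simp [ih]

theorem step_lt {M a b : ℕ} (ha : a < 2 * M) (hb : b < 2 * M) {t : ℕ × ℕ × List ℤ}
    (ht : t ∈ step a b) : t.1 < 2 * M ∧ t.2.1 < 2 * M := by
  unfold step at ht
  rw [List.mem_cons, List.mem_append] at ht
  rcases ht with rfl | ht | ht
  · exact ⟨hb, ha⟩
  · split_ifs at ht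
    · rw [List.mem_singleton] at ht
      subst ht
      exact ⟨ha, hb⟩
    · simp at ht
  · split_ifs at ht
    · obtain ⟨x, hx, rfl⟩ := List.mem_map.1 ht
      rw [List.mem_range] at hx
      refine ⟨by dsimp only; omega, ?_⟩
      dsimp only
      unfold opp
      split_ifs <;> omega
    · simp at ht

include hq in
-- Three nested applications of `sum_coeff`, one for each factor of the composite, with the
-- indicator function of the outer indices `x, y, w` as the innermost test function.
theorem left_eq {M a b c x y w : ℕ} (ha : a < 2 * M) (hb : b < 2 * M) (hc : c < 2 * M)
    (hx : x < 2 * M) (hy : y < 2 * M) (hw : w < 2 * M) :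
    q ^ 3 * left q q' (Finset.range (2 * M)) a b c x y w =
      peval q (coeffAt (x, y, w) (leftList a b c)) := by
  rw [peval_coeffAt, leftList, sum_flatMap]
  simp only [sum_flatMap, List.map_map, Function.comp_def, peval_pmul]
  have h1 : ∀ p r : ℕ, p < 2 * M → r < 2 * M → q * (q *
      ∑ s ∈ Finset.range (2 * M), coeff q q' r c s w * coeff q q' p s x y) =
      ((step r c).map fun u => peval q u.2.2 * ((step p u.1).map fun v => peval q v.2.2 *
        if (v.1, v.2.1, u.2.1) = (x, y, w) then 1 else 0).sum).sum := by
    intro p r hp hr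
    rw [← List.map_congr_left (l := step r c) (f := fun u => peval q u.2.2 * (q *
      if u.2.1 = w then coeff q q' p u.1 x y else 0))]
    · rw [← sum_coeff hq hr hc (fun s w' => q * if w' = w then coeff q q' p s x y else 0)]
      congr 1
      rw [Finset.mul_sum]
      refine Finset.sum_congr rfl fun s _ => ?_
      rw [Finset.sum_eq_single_of_mem w (Finset.mem_range.2 hw)]
      · rw [if_pos rfl]
        ring
      · intro w' _ hw'
        rw [if_neg hw', mul_zero, mul_zero]
    · intro u hu
      congr 1
      rw [← sum_coeff hq hp (step_lt hr hc hu).1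
        (fun x' y' => if (x', y', u.2.1) = (x, y, w) then 1 else 0)]
      congr 1
      rw [Finset.sum_eq_single_of_mem x (Finset.mem_range.2 hx),
        Finset.sum_eq_single_of_mem y (Finset.mem_range.2 hy)]
      · simp
      · intro y' _ hy'
        simp [hy']
      · intro x' _ hx'
        simp [hx']
  rw [List.map_congr_left (g := fun t => peval q t.2.2 * (q * (q *
    ∑ s ∈ Finset.range (2 * M), coeff q q' t.2.1 c s w * coeff q q' t.1 s x y)))]
  · rw [← sum_coeff hq ha hb (fun p r => q * (q *
      ∑ s ∈ Finset.range (2 * M), coeff q q' r c s w * coeff q q' p s x y)), left,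
      show q ^ 3 = q * (q * q) by ring, mul_assoc, Finset.mul_sum]
    congr 1
    refine Finset.sum_congr rfl fun p _ => ?_
    rw [Finset.mul_sum]
    refine Finset.sum_congr rfl fun r _ => ?_
    rw [Finset.mul_sum, Finset.mul_sum, Finset.mul_sum, Finset.mul_sum]
    refine Finset.sum_congr rfl fun s _ => ?_
    ring
  · intro t ht
    rw [h1 t.1 t.2.1 (step_lt ha hb ht).1 (step_lt ha hb ht).2, ← List.sum_map_mul_left]
    congr 1
    refine List.map_congr_left fun u _ => ?_
    rw [← List.sum_map_mul_left, ← List.sum_map_mul_left]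
    congr 1
    refine List.map_congr_left fun v _ => ?_
    split_ifs <;> ring

include hq in
theorem right_eq {M a b c x y w : ℕ} (ha : a < 2 * M) (hb : b < 2 * M) (hc : c < 2 * M)
    (hx : x < 2 * M) (hy : y < 2 * M) (hw : w < 2 * M) :
    q ^ 3 * right q q' (Finset.range (2 * M)) a b c x y w =
      peval q (coeffAt (x, y, w) (rightList a b c)) := by
  rw [peval_coeffAt, rightList, sum_flatMap]
  simp only [sum_flatMap, List.map_map, Function.comp_def, peval_pmul]
  have h1 : ∀ p r : ℕ, p < 2 * M → r < 2 * M → q * (q *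
      ∑ s ∈ Finset.range (2 * M), coeff q q' a p x s * coeff q q' s r y w) =
      ((step a p).map fun u => peval q u.2.2 * ((step u.2.1 r).map fun v => peval q v.2.2 *
        if (u.1, v.1, v.2.1) = (x, y, w) then 1 else 0).sum).sum := by
    intro p r hp hr
    rw [← List.map_congr_left (l := step a p) (f := fun u => peval q u.2.2 * (q *
      if u.1 = x then coeff q q' u.2.1 r y w else 0))]
    · rw [← sum_coeff hq ha hp (fun x' s => q * if x' = x then coeff q q' s r y w else 0)]
      congr 1
      symm
      rw [Finset.sum_eq_single_of_mem x (Finset.mem_range.2 hx), Finset.mul_sum]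
      · refine Finset.sum_congr rfl fun s _ => ?_
        rw [if_pos rfl]
        ring
      · intro x' _ hx'
        simp [hx']
    · intro u hu
      congr 1
      rw [← sum_coeff hq (step_lt ha hp hu).2 hr
        (fun y' w' => if (u.1, y', w') = (x, y, w) then 1 else 0)]
      congr 1
      rw [Finset.sum_eq_single_of_mem y (Finset.mem_range.2 hy),
        Finset.sum_eq_single_of_mem w (Finset.mem_range.2 hw)]
      · simp
      · intro y' _ hy'
        simp [hy']
      · intro x' _ hx'
        simp [hx']
  rw [List.map_congr_left (g := fun t => peval q t.2.2 * (q * (q *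
    ∑ s ∈ Finset.range (2 * M), coeff q q' a t.1 x s * coeff q q' s t.2.1 y w)))]
  · rw [← sum_coeff hq hb hc (fun p r => q * (q *
      ∑ s ∈ Finset.range (2 * M), coeff q q' a p x s * coeff q q' s r y w)), right,
      show q ^ 3 = q * (q * q) by ring, mul_assoc, Finset.mul_sum]
    congr 1
    refine Finset.sum_congr rfl fun p _ => ?_
    rw [Finset.mul_sum]
    refine Finset.sum_congr rfl fun r _ => ?_
    rw [Finset.mul_sum, Finset.mul_sum, Finset.mul_sum, Finset.mul_sum]
    refine Finset.sum_congr rfl fun s _ => ?_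
    ring
  · intro t ht
    rw [h1 t.1 t.2.1 (step_lt hb hc ht).1 (step_lt hb hc ht).2, ← List.sum_map_mul_left]
    congr 1
    refine List.map_congr_left fun u _ => ?_
    rw [← List.sum_map_mul_left, ← List.sum_map_mul_left]
    congr 1
    refine List.map_congr_left fun v _ => ?_
    split_ifs <;> ring

include hq in
/-- The braid relation for three absolute values. -/
theorem left_eq_right_six {a b c x y w : ℕ} (ha : a < 6) (hb : b < 6) (hc : c < 6)
    (hx : x < 6) (hy : y < 6) (hw : w < 6) :
    left q q' (Finset.range 6) a b c x y w = right q q' (Finset.range 6) a b c x y w := by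
  have h := left_eq (M := 3) hq ha hb hc hx hy hw
  rw [peval_coeffAt_eq ha hb hc, ← right_eq (M := 3) hq ha hb hc hx hy hw] at h
  have h3 : q' ^ 3 * q ^ 3 = 1 := by rw [← mul_pow, mul_comm, hq, one_pow]
  have := congrArg (q' ^ 3 * ·) h
  simpa only [← mul_assoc, h3, one_mul] using this

end Sound

end Braid

/-! ### Confinement of the intermediate indices in the braid relation -/

namespace Braid

variable {R : Type*} [CommRing R] {q q' : R}

theorem opp_div (a : ℕ) : opp a / 2 = a / 2 := by
  unfold opp
  split_ifs <;> omega

theorem opp_opp (a : ℕ) : opp (opp a) = a := by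
  unfold opp
  split_ifs <;> omega

theorem opp_ne (a : ℕ) : opp a ≠ a := by
  unfold opp
  split_ifs <;> omega

/-- This change of sign makes the contributions of opposite intermediate indices cancel. -/
theorem contr_opp (a : ℕ) : contr q q' (opp a) = -contr q q' a := by
  unfold opp contr
  split_ifs <;> first | omega | simp

/-- Exchange, parallel passage and contraction each match the four absolute values in pairs, in the
three possible ways. -/
theorem coeff_eq_zero {a b x y : ℕ} (h : ¬ ((a / 2 = y / 2 ∧ b / 2 = x / 2) ∨
    (a / 2 = x / 2 ∧ b / 2 = y / 2) ∨ (a / 2 = b / 2 ∧ x / 2 = y / 2))) :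
    coeff q q' a b x y = 0 := by
  unfold coeff Opp
  rw [if_neg (by rintro ⟨rfl, rfl⟩; simp at h), if_neg (by rintro ⟨rfl, rfl, -⟩; simp at h),
    if_neg (by tauto)]
  simp

/-- An outgoing index which does not occur among the incoming ones comes from the contraction. -/
theorem coeff_of_out {a b x y : ℕ} (ha : x / 2 ≠ a / 2) (hb : x / 2 ≠ b / 2) :
    coeff q q' a b x y = if Opp a b ∧ Opp x y ∧ x / 2 < b / 2 then contr q q' b else 0 := by
  unfold coeff
  rw [if_neg (by rintro ⟨rfl, rfl⟩; simp at hb), if_neg (by rintro ⟨rfl, rfl, -⟩; simp at ha)]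
  simp

/-- An incoming index which does not occur among the outgoing ones goes into the contraction. -/
theorem coeff_of_in {a b x y : ℕ} (ha : a / 2 ≠ x / 2) (hb : a / 2 ≠ y / 2) :
    coeff q q' a b x y = if Opp a b ∧ Opp x y ∧ x / 2 < b / 2 then contr q q' b else 0 := by
  unfold coeff
  rw [if_neg (by rintro ⟨rfl, rfl⟩; simp at hb), if_neg (by rintro ⟨rfl, rfl, -⟩; simp at ha)]
  simp

theorem coeff_of_in' {a b x y : ℕ} (ha : b / 2 ≠ x / 2) (hb : b / 2 ≠ y / 2) :
    coeff q q' a b x y = if Opp a b ∧ Opp x y ∧ x / 2 < b / 2 then contr q q' b else 0 := by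
  unfold coeff
  rw [if_neg (by rintro ⟨rfl, rfl⟩; simp at ha), if_neg (by rintro ⟨rfl, rfl, -⟩; simp at hb)]
  simp

theorem coeff_parallel {a b x y : ℕ} (h : a / 2 ≠ b / 2) (hx : x / 2 ≠ b / 2) :
    coeff q q' a b x y = if x = a ∧ y = b ∧ a < b then q - q' else 0 := by
  unfold coeff
  rw [if_neg (by rintro ⟨rfl, rfl⟩; simp at hx), if_neg (c := Opp a b ∧ Opp x y ∧ x / 2 < b / 2) (fun H => h H.1.1)]
  simp

theorem coeff_parallel' {a b x y : ℕ} (h : a / 2 ≠ b / 2) (hy : y / 2 ≠ a / 2) :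
    coeff q q' a b x y = if x = a ∧ y = b ∧ a < b then q - q' else 0 := by
  unfold coeff
  rw [if_neg (by rintro ⟨rfl, rfl⟩; simp at hy), if_neg (c := Opp a b ∧ Opp x y ∧ x / 2 < b / 2) (fun H => h H.1.1)]
  simp

/-- The codes of the indices with absolute values in `A`. -/
def dbl (A : Finset ℕ) : Finset ℕ := A.biUnion fun v => {2 * v, 2 * v + 1}

theorem mem_dbl {A : Finset ℕ} {p : ℕ} : p ∈ dbl A ↔ p / 2 ∈ A := by
  simp only [dbl, Finset.mem_biUnion, Finset.mem_insert, Finset.mem_singleton]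
  constructor
  · rintro ⟨v, hv, h⟩
    rwa [show p / 2 = v by omega]
  · exact fun h => ⟨p / 2, h, by omega⟩

theorem opp_mem_dbl {A : Finset ℕ} {p : ℕ} (hp : p ∈ dbl A) : opp p ∈ dbl A := by
  rwa [mem_dbl, opp_div, ← mem_dbl]

variable {A S : Finset ℕ} {a b c x y w : ℕ}

/-- The map `p ↦ opp p` is an involution without fixed points which preserves the complement of `dbl
A`. -/
theorem sum_odd_eq_zero (hS : ∀ p ∈ S, opp p ∈ S) (g : ℕ → R)
    (hg : ∀ p ∉ dbl A, g p + g (opp p) = 0) : ∑ p ∈ S \ dbl A, g p = 0 := by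
  refine Finset.sum_involution (fun p _ => opp p) ?_ ?_ ?_ ?_
  · exact fun p hp => hg p (Finset.mem_sdiff.1 hp).2
  · exact fun p _ _ => opp_ne p
  · intro p hp
    rw [Finset.mem_sdiff] at hp ⊢
    exact ⟨hS p hp.1, fun h => hp.2 (by rw [← opp_opp p]; exact opp_mem_dbl h)⟩
  · exact fun p _ => opp_opp p

theorem ite_mul_ite_mul_ite {P Q T : Prop} [Decidable P] [Decidable Q] [Decidable T] (u v t : R) :
    (if P then u else 0) * (if Q then v else 0) * (if T then t else 0) =
      if P ∧ Q ∧ T then u * v * t else 0 := by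
  split_ifs <;> first | tauto | simp

/-- An intermediate absolute value outside `A` must be created by one contraction and destroyed by
another, and its strand passes the third index in parallel in between. The resulting product is odd
under `p ↦ opp p`, so the sum over such `p` vanishes. Once `p` is in `dbl A`, pairing of absolute
values confines `r` and `s` as well. -/
theorem left_eq_left_dbl (hS : ∀ p ∈ S, opp p ∈ S) (hA : dbl A ⊆ S) (ha : a ∈ dbl A)
    (hb : b ∈ dbl A) (hc : c ∈ dbl A) (hx : x ∈ dbl A) (hy : y ∈ dbl A) :
    left q q' S a b c x y w = left q q' (dbl A) a b c x y w := by
  have hne : ∀ {p u}, p ∉ dbl A → u ∈ dbl A → p / 2 ≠ u / 2 := by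
    intro p u hp hu h
    rw [mem_dbl] at hp hu
    exact hp (h ▸ hu)
  rw [left, left, ← Finset.sum_sdiff hA]
  have h0 : ∑ p ∈ S \ dbl A, ∑ r ∈ S, ∑ s ∈ S,
      coeff q q' a b p r * coeff q q' r c s w * coeff q q' p s x y = 0 := by
    -- The condition depends on `p` through `p / 2` only, so `g` changes sign under `opp` because of
    -- the factor `contr q q' (opp p)`.
    set g : ℕ → R := fun p => if Opp a b ∧ Opp x y ∧ p / 2 < b / 2 ∧ p / 2 < c / 2 ∧
      x / 2 < p / 2 ∧ w = c then contr q q' b * (q - q') * contr q q' (opp p) else 0 with hgdef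
    rw [← sum_odd_eq_zero (A := A) hS g]
    · refine Finset.sum_congr rfl fun p hp => ?_
      rw [Finset.mem_sdiff] at hp
      have ho := hS p hp.1
      have d := opp_div p
      rw [Finset.sum_eq_single_of_mem (opp p) ho, Finset.sum_eq_single_of_mem (opp p) ho]
      · rw [coeff_of_out (hne hp.2 ha) (hne hp.2 hb), coeff_of_in (hne hp.2 hx) (hne hp.2 hy),
          coeff_parallel (by rw [d]; exact hne hp.2 hc) (by rw [d]; exact hne hp.2 hc), hgdef]
        have h2 := hne hp.2 hc
        have h3 := opp_ne p
        rw [ite_mul_ite_mul_ite]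
        refine if_congr ?_ rfl rfl
        simp only [Opp, true_and]
        omega
      · intro s _ hs
        rw [coeff_of_in (hne hp.2 hx) (hne hp.2 hy),
          if_neg fun h => hs ((opp_iff _ _).1 h.1), mul_zero]
      · intro r _ hr
        rw [coeff_of_out (hne hp.2 ha) (hne hp.2 hb),
          if_neg fun h => hr ((opp_iff _ _).1 h.2.1)]
        simp
    · intro p _
      simp only [hgdef, opp_div, contr_opp]
      split_ifs <;> ring
  rw [h0, zero_add]
  refine Finset.sum_congr rfl fun p hp => ?_
  rw [mem_dbl] at *
  symm
  rw [← Finset.sum_subset hA]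
  · refine Finset.sum_congr rfl fun r _ => Finset.sum_subset hA fun s _ hs => ?_
    rw [coeff_eq_zero (a := p), mul_zero]
    rw [mem_dbl] at hs
    rintro (⟨-, h⟩ | ⟨-, h⟩ | ⟨h, -⟩)
    · exact hs (h ▸ hx)
    · exact hs (h ▸ hy)
    · exact hs (h ▸ hp)
  · intro r _ hr
    rw [coeff_eq_zero (a := a)]
    · simp
    rw [mem_dbl] at hr
    rintro (⟨h, -⟩ | ⟨-, h⟩ | ⟨-, h⟩)
    · exact hr (h ▸ ha)
    · exact hr (h ▸ hb)
    · exact hr (h ▸ hp)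

/-- The mirror image of the argument for `left`: a pair created by the first braiding is destroyed
by the last one, while one of its members passes the index `a` in parallel. -/
theorem right_eq_right_dbl (hS : ∀ p ∈ S, opp p ∈ S) (hA : dbl A ⊆ S) (ha : a ∈ dbl A)
    (hb : b ∈ dbl A) (hc : c ∈ dbl A) (hx : x ∈ dbl A) (hy : y ∈ dbl A) (hw : w ∈ dbl A) :
    right q q' S a b c x y w = right q q' (dbl A) a b c x y w := by
  have hne : ∀ {p u}, p ∉ dbl A → u ∈ dbl A → p / 2 ≠ u / 2 := by
    intro p u hp hu h
    rw [mem_dbl] at hp hu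
    exact hp (h ▸ hu)
  rw [right, right, ← Finset.sum_sdiff hA]
  have h0 : ∑ p ∈ S \ dbl A, ∑ r ∈ S, ∑ s ∈ S,
      coeff q q' b c p r * coeff q q' a p x s * coeff q q' s r y w = 0 := by
    set g : ℕ → R := fun p => if Opp b c ∧ Opp y w ∧ p / 2 < c / 2 ∧ a / 2 < p / 2 ∧
      y / 2 < p / 2 ∧ x = a then contr q q' c * (q - q') * contr q q' (opp p) else 0 with hgdef
    rw [← sum_odd_eq_zero (A := A) hS g]
    · refine Finset.sum_congr rfl fun p hp => ?_
      rw [Finset.mem_sdiff] at hp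
      have ho := hS p hp.1
      have d := opp_div p
      have ho' : opp p ∉ dbl A := fun h => hp.2 (by rw [← opp_opp p]; exact opp_mem_dbl h)
      rw [Finset.sum_eq_single_of_mem (opp p) ho, Finset.sum_eq_single_of_mem p hp.1]
      · rw [coeff_of_out (hne hp.2 hb) (hne hp.2 hc), coeff_of_in' (hne ho' hy) (hne ho' hw),
          coeff_parallel' (hne hp.2 ha).symm (hne hp.2 ha), hgdef]
        have h2 := hne hp.2 ha
        have h3 := opp_ne p
        rw [ite_mul_ite_mul_ite]
        refine if_congr ?_ rfl rfl
        simp only [Opp, true_and]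
        omega
      · intro s _ hs
        rw [coeff_of_in' (hne ho' hy) (hne ho' hw), if_neg, mul_zero]
        rintro ⟨h, -⟩
        have := (opp_iff _ _).1 h
        exact hs (by rw [← opp_opp s, ← this, opp_opp])
      · intro r _ hr
        rw [coeff_of_out (hne hp.2 hb) (hne hp.2 hc),
          if_neg fun h => hr ((opp_iff _ _).1 h.2.1)]
        simp
    · intro p _
      simp only [hgdef, opp_div, contr_opp]
      split_ifs <;> ring
  rw [h0, zero_add]
  refine Finset.sum_congr rfl fun p hp => ?_
  rw [mem_dbl] at *
  symm
  rw [← Finset.sum_subset hA]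
  · refine Finset.sum_congr rfl fun r _ => Finset.sum_subset hA fun s _ hs => ?_
    rw [coeff_eq_zero (a := a), mul_zero, zero_mul]
    rw [mem_dbl] at hs
    rintro (⟨h, -⟩ | ⟨-, h⟩ | ⟨-, h⟩)
    · exact hs (h ▸ ha)
    · exact hs (h ▸ hp)
    · exact hs (h ▸ hx)
  · intro r _ hr
    rw [coeff_eq_zero (a := b)]
    · simp
    rw [mem_dbl] at hr
    rintro (⟨h, -⟩ | ⟨-, h⟩ | ⟨-, h⟩)
    · exact hr (h ▸ hb)
    · exact hr (h ▸ hc)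
    · exact hr (h ▸ hp)

/-! #### Reduction to three absolute values -/

/-- Relabelling the absolute values of codes. -/
def relabel (e : ℕ → ℕ) (i : ℕ) : ℕ := 2 * e (i / 2) + i % 2

section Relabel

variable {e : ℕ → ℕ} (he : StrictMono e)

theorem relabel_div (i : ℕ) : relabel e i / 2 = e (i / 2) := by
  unfold relabel
  omega

theorem relabel_mod (i : ℕ) : relabel e i % 2 = i % 2 := by
  unfold relabel
  omega

include he in
theorem relabel_strictMono : StrictMono (relabel e) := by
  intro i j h
  unfold relabel
  rcases (show i / 2 < j / 2 ∨ i / 2 = j / 2 ∧ i % 2 < j % 2 by omega) with h' | ⟨h', h''⟩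
  · have := he h'
    omega
  · rw [h']
    omega

include he in
theorem coeff_relabel (a b x y : ℕ) :
    coeff q q' (relabel e a) (relabel e b) (relabel e x) (relabel e y) = coeff q q' a b x y := by
  have hr := relabel_strictMono he
  simp only [coeff, exch, contr, Opp, relabel_div, relabel_mod, hr.injective.eq_iff,
    he.injective.eq_iff, hr.lt_iff_lt, he.lt_iff_lt, ne_eq]

include he in
theorem left_relabel (S : Finset ℕ) (a b c x y w : ℕ) :
    left q q' (S.image (relabel e)) (relabel e a) (relabel e b) (relabel e c) (relabel e x)
      (relabel e y) (relabel e w) = left q q' S a b c x y w := by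
  have hr := (relabel_strictMono he).injective.injOn (s := S)
  simp only [left, Finset.sum_image hr, coeff_relabel he]

include he in
theorem right_relabel (S : Finset ℕ) (a b c x y w : ℕ) :
    right q q' (S.image (relabel e)) (relabel e a) (relabel e b) (relabel e c) (relabel e x)
      (relabel e y) (relabel e w) = right q q' S a b c x y w := by
  have hr := (relabel_strictMono he).injective.injOn (s := S)
  simp only [right, Finset.sum_image hr, coeff_relabel he]

end Relabel

theorem exists_relabel {A : Finset ℕ} (hA : A.card = 3) :
    ∃ e : ℕ → ℕ, StrictMono e ∧ dbl A = (Finset.range 6).image (relabel e) := by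
  obtain ⟨u, v, t, huv, hvt, rfl⟩ : ∃ u v t : ℕ, u < v ∧ v < t ∧ A = {u, v, t} := by
    let f := A.orderEmbOfFin hA
    refine ⟨f 0, f 1, f 2, f.strictMono (by decide), f.strictMono (by decide), ?_⟩
    ext i
    rw [← Finset.mem_coe, ← Finset.range_orderEmbOfFin A hA]
    simp only [Set.mem_range, Fin.exists_fin_succ, Finset.mem_insert, Finset.mem_singleton]
    simp only [eq_comm (b := i)]
    simp [f]
  -- Only the values at `0, 1, 2` matter. The tail `t + (k - 2)` takes the value `t` at `2` and
  -- makes the function strictly increasing on all natural numbers.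
  refine ⟨fun k => if k = 0 then u else if k = 1 then v else t + (k - 2), ?_, ?_⟩
  · intro i j h
    dsimp only
    split_ifs <;> omega
  · ext p
    rw [mem_dbl]
    simp only [Finset.mem_insert, Finset.mem_singleton, Finset.mem_image, Finset.mem_range,
      relabel]
    constructor
    · rintro (h | h | h)
      · exact ⟨p % 2, by omega, by rw [if_pos (by omega)]; omega⟩
      · exact ⟨2 + p % 2, by omega, by rw [if_neg (by omega), if_pos (by omega)]; omega⟩
      · exact ⟨4 + p % 2, by omega, by rw [if_neg (by omega), if_neg (by omega)]; omega⟩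
    · rintro ⟨i, hi, rfl⟩
      split_ifs <;> omega

/-- Every value that occurs among the six entries occurs an even number of times, hence at least
twice. -/
theorem card_le_three {a b c x y w : ℕ} (h : ∀ v, (if a = v then 1 else 0 : ZMod 2) +
    (if b = v then 1 else 0) + (if c = v then 1 else 0) + (if x = v then 1 else 0) +
    (if y = v then 1 else 0) + (if w = v then 1 else 0) = 0) :
    ({a, b, c, x, y, w} : Finset ℕ).card ≤ 3 := by
  let g : Fin 6 → ℕ := ![a, b, c, x, y, w]
  have := Finset.mul_card_image_le_card_of_maps_to (s := Finset.univ) (f := g)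
    (t := {a, b, c, x, y, w}) (fun i _ => by fin_cases i <;> simp [g]) 2 ?_
  · simp at this
    omega
  · intro v hv
    obtain ⟨i, hi⟩ : ∃ i, g i = v := by
      simp only [Finset.mem_insert, Finset.mem_singleton] at hv
      rcases hv with rfl | rfl | rfl | rfl | rfl | rfl
      exacts [⟨0, rfl⟩, ⟨1, rfl⟩, ⟨2, rfl⟩, ⟨3, rfl⟩, ⟨4, rfl⟩, ⟨5, rfl⟩]
    have h1 : 0 < (Finset.univ.filter fun i => g i = v).card :=
      Finset.card_pos.2 ⟨i, by simp [hi]⟩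
    have h2 : ((Finset.univ.filter fun i => g i = v).card : ZMod 2) = 0 := by
      rw [Finset.card_filter]
      push_cast
      rw [Fin.sum_univ_six]
      exact h v
    rw [ZMod.natCast_eq_zero_iff] at h2
    omega

/-- The braid relation. -/
theorem left_eq_right (hq : q * q' = 1) {M : ℕ} (ha : a < 2 * M) (hb : b < 2 * M) (hc : c < 2 * M)
    (hx : x < 2 * M) (hy : y < 2 * M) (hw : w < 2 * M) :
    left q q' (Finset.range (2 * M)) a b c x y w =
      right q q' (Finset.range (2 * M)) a b c x y w := by
  -- Counting modulo `2` how often an absolute value occurs. A nonzero coefficient has an even count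
  -- over its four indices. In a product of three coefficients each intermediate index occurs twice,
  -- so a nonzero product forces an even count over the six outer indices.
  let χ : ℕ → ℕ → ZMod 2 := fun v i => if i / 2 = v then 1 else 0
  have hχ : ∀ {a b x y : ℕ}, coeff q q' a b x y ≠ 0 → ∀ v, χ v a + χ v b + χ v x + χ v y = 0 := by
    intro a b x y h v
    have key : ∀ s t : ZMod 2, s + t + t + s = 0 ∧ s + t + s + t = 0 ∧ s + s + t + t = 0 := by
      decide
    by_contra h'
    refine h (coeff_eq_zero ?_)
    rintro (⟨h1, h2⟩ | ⟨h1, h2⟩ | ⟨h1, h2⟩) <;> refine h' ?_ <;> simp only [χ, h1, h2] <;>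
      simp only [key]
  by_cases H : ∀ v, χ v a + χ v b + χ v c + χ v x + χ v y + χ v w = 0
  · have hcard := card_le_three H
    have hm : a / 2 ∈ ({a / 2, b / 2, c / 2, x / 2, y / 2, w / 2} : Finset ℕ) ∧
        b / 2 ∈ ({a / 2, b / 2, c / 2, x / 2, y / 2, w / 2} : Finset ℕ) ∧
        c / 2 ∈ ({a / 2, b / 2, c / 2, x / 2, y / 2, w / 2} : Finset ℕ) ∧
        x / 2 ∈ ({a / 2, b / 2, c / 2, x / 2, y / 2, w / 2} : Finset ℕ) ∧
        y / 2 ∈ ({a / 2, b / 2, c / 2, x / 2, y / 2, w / 2} : Finset ℕ) ∧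
        w / 2 ∈ ({a / 2, b / 2, c / 2, x / 2, y / 2, w / 2} : Finset ℕ) := by simp
    have hAS : dbl {a / 2, b / 2, c / 2, x / 2, y / 2, w / 2} ⊆ Finset.range (2 * M) := by
      intro p
      rw [mem_dbl, Finset.mem_range]
      simp only [Finset.mem_insert, Finset.mem_singleton]
      omega
    generalize ({a / 2, b / 2, c / 2, x / 2, y / 2, w / 2} : Finset ℕ) = A at hcard hm hAS
    -- The enlarged set may contain absolute values beyond `M`. The sums are therefore first
    -- restricted to `dbl A` and then extended to `dbl A'`, both times by confinement.
    obtain ⟨A', hA', hc'⟩ := Infinite.exists_superset_card_eq A 3 hcard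
    have hAA : dbl A ⊆ dbl A' := by
      intro p
      rw [mem_dbl, mem_dbl]
      exact fun h => hA' h
    have hS : ∀ p ∈ Finset.range (2 * M), opp p ∈ Finset.range (2 * M) := by
      intro p
      rw [Finset.mem_range, Finset.mem_range]
      have := opp_div p
      omega
    simp only [← mem_dbl] at hm
    obtain ⟨ma, mb, mc, mx, my, mw⟩ := hm
    rw [left_eq_left_dbl hS hAS ma mb mc mx my, right_eq_right_dbl hS hAS ma mb mc mx my mw,
      ← left_eq_left_dbl (fun _ => opp_mem_dbl) hAA ma mb mc mx my,
      ← right_eq_right_dbl (fun _ => opp_mem_dbl) hAA ma mb mc mx my mw]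
    obtain ⟨e, he, hd⟩ := exists_relabel hc'
    rw [hd] at hAA ⊢
    have lift : ∀ {p}, p ∈ dbl A → ∃ p' < 6, relabel e p' = p := by
      intro p hp
      obtain ⟨p', h, h'⟩ := Finset.mem_image.1 (hAA hp)
      exact ⟨p', Finset.mem_range.1 h, h'⟩
    obtain ⟨a', ha', rfl⟩ := lift ma
    obtain ⟨b', hb', rfl⟩ := lift mb
    obtain ⟨c', hc', rfl⟩ := lift mc
    obtain ⟨x', hx', rfl⟩ := lift mx
    obtain ⟨y', hy', rfl⟩ := lift my
    obtain ⟨w', hw', rfl⟩ := lift mw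
    rw [left_relabel he, right_relabel he, left_eq_right_six hq ha' hb' hc' hx' hy' hw']
  · push Not at H
    obtain ⟨v, hv⟩ := H
    have h2 : (2 : ZMod 2) = 0 := by decide
    rw [left, right, Finset.sum_eq_zero, Finset.sum_eq_zero]
    · refine fun p _ => Finset.sum_eq_zero fun r _ => Finset.sum_eq_zero fun s _ => ?_
      by_contra h
      have h1 : coeff q q' b c p r ≠ 0 := fun h' => h (by rw [h']; ring)
      have h3 : coeff q q' a p x s ≠ 0 := fun h' => h (by rw [h']; ring)
      have h4 : coeff q q' s r y w ≠ 0 := fun h' => h (by rw [h']; ring)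
      refine hv ?_
      linear_combination hχ h1 v + hχ h3 v + hχ h4 v - (χ v p + χ v r + χ v s) * h2
    · refine fun p _ => Finset.sum_eq_zero fun r _ => Finset.sum_eq_zero fun s _ => ?_
      by_contra h
      have h1 : coeff q q' a b p r ≠ 0 := fun h' => h (by rw [h']; ring)
      have h3 : coeff q q' r c s w ≠ 0 := fun h' => h (by rw [h']; ring)
      have h4 : coeff q q' p s x y ≠ 0 := fun h' => h (by rw [h']; ring)
      refine hv ?_
      linear_combination hχ h1 v + hχ h3 v + hχ h4 v - (χ v p + χ v r + χ v s) * h2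

end Braid

/-! ### The vector representation -/

section Vector

variable {R : Type*} [CommRing R] {n : ℕ}

theorem Idx.height_div (i : Idx n) : i.height / 2 = i.1 := by
  have : i.2.val < 2 := i.2.val_lt
  unfold height
  omega

theorem Idx.height_mod (i : Idx n) : i.height % 2 = i.2.val := by
  have : i.2.val < 2 := i.2.val_lt
  unfold height
  omega

theorem Idx.height_injective : Function.Injective (Idx.height : Idx n → ℕ) := by
  intro i j h
  refine Prod.ext (Fin.ext ?_) (ZMod.val_injective 2 ?_)
  · rw [← height_div, ← height_div, h]
  · rw [← height_mod, ← height_mod, h]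

theorem Idx.height_neg (i : Idx n) : i.neg.height = Braid.opp i.height := by
  obtain ⟨k, p⟩ := i
  rcases zmod_two_cases p with rfl | rfl
  · have h0 : (0 : ZMod 2).val = 0 := rfl
    have h1 : (0 + 1 : ZMod 2).val = 1 := rfl
    simp only [height, neg, Braid.opp, h0, h1]
    split_ifs <;> omega
  · have h0 : (1 : ZMod 2).val = 1 := rfl
    have h1 : (1 + 1 : ZMod 2).val = 0 := rfl
    simp only [height, neg, Braid.opp, h0, h1]
    split_ifs <;> omega

theorem Idx.opp_height {i j : Idx n} : Braid.Opp i.height j.height ↔ j = i.neg := by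
  rw [Braid.opp_iff, ← height_neg, height_injective.eq_iff]

theorem Idx.height_mod_eq_zero {i : Idx n} : i.height % 2 = 0 ↔ i.2 = 0 := by
  rw [height_mod, ZMod.val_eq_zero]

theorem Idx.height_mod_eq_one {i : Idx n} : i.height % 2 = 1 ↔ i.2 = 1 := by
  have h : ∀ x : ZMod 2, x.val = 1 ↔ x = 1 := by decide
  rw [height_mod, h]

theorem Idx.height_div_eq {i j : Idx n} : i.height / 2 = j.height / 2 ↔ i.1 = j.1 := by
  rw [height_div, height_div, Fin.val_inj]

theorem Idx.height_div_lt {i j : Idx n} : i.height / 2 < j.height / 2 ↔ i.1 < j.1 := by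
  rw [height_div, height_div, Fin.val_fin_lt]

theorem Idx.height_lt_iff {i j : Idx n} :
    i.height < j.height ↔ i.1 < j.1 ∨ i.1 = j.1 ∧ i.2 = 0 ∧ j.2 = 1 := by
  have h1 := i.height_div
  have h2 := j.height_div
  have h3 := i.height_mod
  have h4 := j.height_mod
  have key : ∀ x y : ZMod 2, (x = 0 ∧ y = 1) ↔ x.val < y.val := by decide
  rw [key, Fin.lt_def, Fin.ext_iff]
  omega

theorem Idx.height_lt (i : Idx n) : i.height < 2 * n := by
  have h1 := i.height_div
  have h2 := i.1.2
  omega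

theorem Idx.sum_height {M : Type*} [AddCommMonoid M] (f : ℕ → M) :
    ∑ i : Idx n, f i.height = ∑ p ∈ Finset.range (2 * n), f p := by
  have h : Finset.range (2 * n) = Finset.univ.image (Idx.height : Idx n → ℕ) := by
    ext p
    simp only [Finset.mem_range, Finset.mem_image, Finset.mem_univ, true_and]
    constructor
    · intro hp
      refine ⟨(⟨p / 2, by omega⟩, (p : ZMod 2)), ?_⟩
      simp only [height, ZMod.val_natCast]
      omega
    · rintro ⟨i, rfl⟩
      exact i.height_lt
  rw [h, Finset.sum_image height_injective.injOn]

namespace Braid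

variable (q q' : R)

/-- The coefficients of the braiding, in terms of indices. -/
def icoeff (a b x y : Idx n) : R := coeff q q' a.height b.height x.height y.height

variable {q q'}

theorem icoeff_eq_zero {a b x y : Idx n} (h : a.2 + b.2 ≠ x.2 + y.2) :
    icoeff q q' a b x y = 0 := by
  unfold icoeff coeff
  rw [if_neg, if_neg, if_neg, add_zero, add_zero]
  · rw [Idx.opp_height, Idx.opp_height]
    rintro ⟨rfl, rfl, -⟩
    have key : ∀ a x : ZMod 2, a + (a + 1) = x + (x + 1) := by decide
    exact h (key _ _)
  · rintro ⟨h1, h2, -⟩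
    rw [Idx.height_injective h1, Idx.height_injective h2] at h
    exact h rfl
  · rintro ⟨h1, h2⟩
    rw [Idx.height_injective h1, Idx.height_injective h2, add_comm] at h
    exact h rfl

theorem icoeff_eq (a b x y : Idx n) : icoeff q q' a b x y =
    (if x = b ∧ y = a then (if a = b then (if a.2 = 0 then q else -q')
      else if a.1 = b.1 then (if a.2 = 0 then q else q')
      else if a.2 = 1 ∧ b.2 = 1 then -1 else 1) else 0) +
    (if x = a ∧ y = b ∧ (a.1 < b.1 ∨ a.1 = b.1 ∧ a.2 = 0 ∧ b.2 = 1) then q - q' else 0) +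
    (if b = a.neg ∧ y = x.neg ∧ x.1 < b.1 then (if b.2 = 0 then -(q - q') else q - q') else 0) := by
  simp only [icoeff, coeff, exch, contr, Idx.opp_height, Idx.height_div_eq, Idx.height_div_lt,
    Idx.height_injective.eq_iff, Idx.height_lt_iff, Idx.height_mod_eq_zero, Idx.height_mod_eq_one]

variable (q q')

/-- The matrix `S` with parameters `q` and `q'`. -/
def smat : Matrix (Idx n × Idx n) (Idx n × Idx n) R :=
  Matrix.of fun a b => sgn (a.1.2 * a.2.2) • icoeff q q' b.1 b.2 a.2 a.1

/-- The matrix of the generators in the vector representation. -/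
def rep : Matrix (Idx n) (Idx n) (Matrix (Idx n) (Idx n) R) :=
  Matrix.of fun i j => Matrix.of fun x y =>
    sgn ((i.2 + 1) * j.2 + (i.2 + j.2) * (y.2 + 1) + x.2 * i.2) • icoeff q q' y j i x

variable {q q'}

theorem units_smul_congr {M : Type*} [AddGroup M] [DistribMulAction ℤˣ M] {u v : ℤˣ} {x : M}
    (h : x ≠ 0 → u = v) : u • x = v • x := by
  by_cases hx : x = 0
  · rw [hx, smul_zero, smul_zero]
  · rw [h hx]

theorem sum_icoeff_left (a b c x y w : Idx n) : left q q' (Finset.range (2 * n)) a.height b.height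
    c.height x.height y.height w.height = ∑ p : Idx n, ∑ r : Idx n, ∑ s : Idx n,
      icoeff q q' a b p r * icoeff q q' r c s w * icoeff q q' p s x y := by
  simp only [left, ← Idx.sum_height]
  rfl

theorem sum_icoeff_right (a b c x y w : Idx n) : right q q' (Finset.range (2 * n)) a.height b.height
    c.height x.height y.height w.height = ∑ p : Idx n, ∑ r : Idx n, ∑ s : Idx n,
      icoeff q q' b c p r * icoeff q q' a p x s * icoeff q q' s r y w := by
  simp only [right, ← Idx.sum_height]
  rfl

/-- Both `S` and the representing matrices are the braiding up to signs, so each entry of `M₁ M₂ S =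
S M₂ M₁` is an entry of the braid relation. The work consists in matching the signs. -/
theorem isRTT_rep (hq : q * q' = 1) : IsRTT (smat q q' (n := n)) (rep q q') := by
  -- The sign exponents on the two sides. They are independent of the summation indices only after
  -- some parities have been eliminated through conservation of parity at each coefficient, as
  -- recorded in `slv`.
  have key : ∀ c1 c2 y a2 a1 : ZMod 2,
      c1 * c2 + a2 * (a1 + c1) + ((a1 + 1) * c1 + (a1 + c1) * (y + c2 + a2 + 1) +
        (y + c2 + a2 + c1 + a1) * a1) + ((a2 + 1) * c2 + (a2 + c2) * (y + 1) +
        (y + c2 + a2) * a2) = y + (y + c2 + a2 + c1 + a1) * y + a2 * y + a1 * y + a1 * a2 := by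
    decide
  have key' : ∀ y c1 w c2 x a1 : ZMod 2, a1 * (c1 + c2 + a1) + (c2 + x + w) * (c1 + (c1 + w + y)) +
      ((c2 + 1) * (c2 + x + w) + (c2 + (c2 + x + w)) * (w + 1) + x * c2) +
      ((c1 + 1) * (c1 + w + y) + (c1 + (c1 + w + y)) * (y + 1) + w * c1) =
      y + x * y + (c1 + c2 + a1) * y + a1 * y + a1 * (c1 + c2 + a1) := by
    decide
  have slv : ∀ a b c d : ZMod 2, a + b = c + d → c = a + b + d ∧ d = a + b + c ∧ b = c + d + a := by
    decide
  unfold IsRTT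
  ext a b x y
  rw [matrix_map_mul_comm, matrix_map_mul_apply, Matrix.sum_apply, Matrix.sum_apply]
  -- The common sign, which involves outer indices only, so that it can be taken out of the sums.
  set ε : ZMod 2 := y.2 + x.2 * y.2 + a.2.2 * y.2 + a.1.2 * y.2 + a.1.2 * a.2.2 with hε
  trans sgn ε • right q q' (Finset.range (2 * n)) y.height b.1.height b.2.height a.2.height
    a.1.height x.height
  · rw [sum_icoeff_right, Fintype.sum_prod_type_right, Finset.smul_sum]
    refine Finset.sum_congr rfl fun c2 _ => ?_
    rw [Finset.smul_sum]
    refine Finset.sum_congr rfl fun c1 _ => ?_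
    rw [leg1_mul_leg2_apply, Matrix.smul_apply, Matrix.smul_apply, Matrix.mul_apply,
      Finset.smul_sum, Finset.smul_sum, Finset.smul_sum]
    refine Finset.sum_congr rfl fun w _ => ?_
    simp only [smat, rep, Matrix.of_apply]
    rw [smul_mul_smul_comm, smul_smul, smul_eq_mul, smul_mul_smul_comm,
      show icoeff q q' b.1 b.2 c2 c1 * (icoeff q q' w c1 a.1 x * icoeff q q' y c2 a.2 w) =
        icoeff q q' b.1 b.2 c2 c1 * icoeff q q' y c2 a.2 w * icoeff q q' w c1 a.1 x by ring]
    refine units_smul_congr fun h => ?_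
    have h1 : y.2 + c2.2 = a.2.2 + w.2 := by
      by_contra h'
      exact h (by rw [icoeff_eq_zero h']; ring)
    have h2 : w.2 + c1.2 = a.1.2 + x.2 := by
      by_contra h'
      exact h (by rw [icoeff_eq_zero h']; ring)
    rw [← sgn_add, ← sgn_add, ← sgn_add, hε, (slv _ _ _ _ h2).2.1, (slv _ _ _ _ h1).2.1]
    congr 1
    rw [← key]
    ring
  · rw [← left_eq_right hq y.height_lt b.1.height_lt b.2.height_lt a.2.height_lt a.1.height_lt
      x.height_lt, Fintype.sum_prod_type, sum_icoeff_left, Finset.smul_sum]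
    refine Finset.sum_congr rfl fun c1 _ => ?_
    trans sgn ε • ∑ c2 : Idx n, ∑ w : Idx n, icoeff q q' y b.1 c1 w * icoeff q q' w b.2 c2 x *
      icoeff q q' c1 c2 a.2 a.1
    · exact congrArg (fun r : R => sgn ε • r) Finset.sum_comm
    rw [Finset.smul_sum]
    refine Finset.sum_congr rfl fun c2 _ => ?_
    rw [leg2_mul_leg1_apply, Matrix.smul_apply, Matrix.smul_apply, Matrix.mul_apply,
      Finset.smul_sum, Finset.smul_sum, Finset.smul_sum]
    refine Finset.sum_congr rfl fun w _ => ?_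
    simp only [smat, rep, Matrix.of_apply]
    rw [smul_mul_smul_comm, smul_smul, smul_eq_mul, smul_mul_smul_comm,
      show icoeff q q' c1 c2 a.2 a.1 * (icoeff q q' w b.2 c2 x * icoeff q q' y b.1 c1 w) =
        icoeff q q' y b.1 c1 w * icoeff q q' w b.2 c2 x * icoeff q q' c1 c2 a.2 a.1 by ring]
    symm
    refine units_smul_congr fun h => ?_
    have h1 : y.2 + b.1.2 = c1.2 + w.2 := by
      by_contra h'
      exact h (by rw [icoeff_eq_zero h']; ring)
    have h2 : w.2 + b.2.2 = c2.2 + x.2 := by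
      by_contra h'
      exact h (by rw [icoeff_eq_zero h']; ring)
    have h3 : c1.2 + c2.2 = a.2.2 + a.1.2 := by
      by_contra h'
      exact h (by rw [icoeff_eq_zero h']; ring)
    rw [← sgn_add, ← sgn_add, ← sgn_add, hε, (slv _ _ _ _ h2).2.2, (slv _ _ _ _ h1).2.2,
      (slv _ _ _ _ h3).1]
    congr 1
    rw [← key' _ _ w.2]
    ring

theorem rep_of_not_le {i j : Idx n} (h : j.1 < i.1) : rep q q' i j = 0 := by
  ext x y
  rw [rep, Matrix.of_apply, Matrix.of_apply, icoeff_eq, if_neg, if_neg, if_neg]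
  · simp
  · rintro ⟨-, -, h'⟩
    exact lt_asymm h h'
  · rintro ⟨rfl, -, h' | h'⟩
    · exact lt_asymm h h'
    · exact h.ne h'.1.symm
  · rintro ⟨rfl, -⟩
    exact lt_irrefl _ h

theorem rep_neg_self {i : Idx n} (h : i.2 = 0) : rep q q' i.neg i = 0 := by
  have key : ∀ x : ZMod 2, x + 1 ≠ x := by decide
  ext x y
  rw [rep, Matrix.of_apply, Matrix.of_apply, icoeff_eq, if_neg, if_neg, if_neg]
  · simp
  · rintro ⟨-, -, h'⟩
    exact lt_irrefl _ h'
  · rintro ⟨rfl, -, h' | h'⟩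
    · exact lt_irrefl _ h'
    · rw [h] at h'
      exact absurd h'.2.2 (by decide)
  · rintro ⟨h', -⟩
    exact key _ (congrArg Prod.snd h')

theorem rep_self (i : Idx n) : rep q q' i i = Matrix.diagonal fun x : Idx n =>
    if x.1 = i.1 then if x.2 = 0 then q else q' else 1 := by
  ext x y
  have key : ∀ x : ZMod 2, (x + 1) * x + (x + x) = 0 := by decide
  have key2 : ∀ x y z : ZMod 2, (x + 1) * x + (x + x) * (y + 1) + z = z := by decide
  rw [rep, Matrix.of_apply, Matrix.of_apply, icoeff_eq, if_neg (c := i = y ∧ _),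
    if_neg (c := i = y.neg ∧ _), Matrix.diagonal_apply, key2, add_zero, add_zero]
  · by_cases hxy : x = y
    · subst hxy
      rw [if_pos ⟨rfl, rfl⟩, if_pos rfl]
      by_cases hx : x = i
      · subst hx
        rw [if_pos rfl, if_pos rfl]
        rcases zmod_two_cases x.2 with h | h <;> simp [h, sgn_zero, sgn_one, -uzpow_zero, -uzpow_one]
      · rw [if_neg hx]
        by_cases hx1 : x.1 = i.1
        · rw [if_pos hx1, if_pos hx1, Idx.eq_neg_of_fst_eq hx1 hx]
          have key3 : ∀ x : ZMod 2, x * (x + 1) = 0 := by decide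
          rw [Idx.neg, key3, sgn_zero, one_smul]
        · rw [if_neg hx1, if_neg hx1]
          rcases zmod_two_cases x.2 with h | h <;> rcases zmod_two_cases i.2 with h' | h' <;>
            simp [h, h', sgn_zero, sgn_one, -uzpow_zero, -uzpow_one]
    · rw [if_neg hxy, if_neg (fun h => hxy h.2), smul_zero]
  · exact fun h => lt_irrefl _ h.2.2
  · rintro ⟨rfl, -, h | h⟩
    · exact lt_irrefl _ h
    · rw [h.2.1] at h
      exact absurd h.2.2 (by decide)

end Braid

/-! ### The matrix `S` as a signed braiding -/

namespace QEA

variable {K : Type*} [Field K] {q : K}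

theorem isQuantumMatrix_rep (hS : Smat K q n = Braid.smat q q⁻¹) (hq : q ≠ 0) :
    IsQuantumMatrix q (Braid.rep q q⁻¹) fun i : Idx n => Matrix.diagonal fun x : Idx n =>
      if x.1 = i.1 then if x.2 = 0 then q⁻¹ else q else 1 where
  diag i := by rw [Braid.rep_self, Braid.rep_self]; rfl
  anti i hi := Braid.rep_neg_self hi
  lower i j hij := Braid.rep_of_not_le hij
  mul_inv i := by
    rw [Braid.rep_self, Matrix.diagonal_mul_diagonal, ← Matrix.diagonal_one]
    congr 1
    ext x
    split_ifs <;> simp [hq]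
  inv_mul i := by
    rw [Braid.rep_self, Matrix.diagonal_mul_diagonal, ← Matrix.diagonal_one]
    congr 1
    ext x
    split_ifs <;> simp [hq]
  rtt := hS ▸ Braid.isRTT_rep (mul_inv_cancel₀ hq)

theorem superKron_apply {R : Type*} [CommRing R] (A B : Mat R n) (a b) :
    superKron A B a b = sgn ((a.2.2 + b.2.2) * b.1.2) • (A a.1 b.1 * B a.2 b.2) := rfl

theorem el_apply {R : Type*} [CommRing R] (i j x y : Idx n) :
    (el i j : Mat R n) x y = if i = x ∧ j = y then 1 else 0 := Matrix.single_apply ..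

theorem sfE_apply {R : Type*} [CommRing R] (i j x y : Idx n) :
    (sfE i j : Mat R n) x y = (if i = x ∧ j = y then 1 else 0) -
      sgn (x.2 * (y.2 + 1)) • (if i = y.neg ∧ j = x.neg then 1 else 0) := by
  rw [sfE, Matrix.add_apply, iota_apply, el_apply, el_apply, sub_eq_add_neg]

theorem smul_el_add_apply {R : Type*} [CommRing R] (u v : R) {i : Idx n} (hi : i.2 = 0)
    (x y : Idx n) : (u • el i i + v • el i.neg i.neg : Mat R n) x y =
      if x = y ∧ x.1 = i.1 then if x.2 = 0 then u else v else 0 := by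
  rw [Matrix.add_apply, Matrix.smul_apply, Matrix.smul_apply, el_apply, el_apply]
  by_cases hxy : x = y
  · subst hxy
    simp only [and_self, true_and, smul_eq_mul, mul_ite, mul_one, mul_zero, Prod.ext_iff, Idx.neg,
      hi, zero_add]
    have key : ∀ x : ZMod 2, (0 = x ↔ x = 0) ∧ (1 = x ↔ x ≠ 0) := by decide
    simp only [(key x.2).1, (key x.2).2, eq_comm (a := i.1)]
    by_cases h1 : x.1 = i.1 <;> by_cases h2 : x.2 = 0 <;> simp [h1, h2]
  · rw [if_neg, if_neg, if_neg fun h => hxy h.1]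
    · simp
    · exact fun h => hxy (h.1.symm.trans h.2)
    · exact fun h => hxy (h.1.symm.trans h.2)

/-- Comparison of entries. The identity and the diagonal sum give the exchange term (`p1`). The sum
over negative `i` and the `E_{ij}` half of the last sum give the parallel term (`p2`). The `ι
E_{ij}` half gives the contraction (`p3`). The factor `1/2` in `S` disappears because `𝖤_{i,-i} = 2
E_{i,-i}` for negative `i`. -/
theorem Smat_eq (h2 : (2 : K) ≠ 0) : Smat K q n = Braid.smat q q⁻¹ := by
  ext ⟨a, b⟩ ⟨c, d⟩
  have e2 : (∑ i : Idx n with i.2 = 0, superKron ((q - 1) • el i i + (q⁻¹ - 1) • el i.neg i.neg)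
      (el i i + el i.neg i.neg : Mat K n)) (a, b) (c, d) =
      if a = c ∧ b = d ∧ a.1 = b.1 then (if a.2 = 0 then q - 1 else q⁻¹ - 1) else 0 := by
    have hi (i : Idx n) (hi : i.2 = 0) : superKron ((q - 1) • el i i + (q⁻¹ - 1) • el i.neg i.neg)
        (el i i + el i.neg i.neg : Mat K n) (a, b) (c, d) =
        if (a = c ∧ b = d ∧ a.1 = b.1) ∧ i.1 = a.1 then (if a.2 = 0 then q - 1 else q⁻¹ - 1)
          else 0 := by
      have := smul_el_add_apply (1 : K) 1 hi b d
      rw [one_smul, one_smul] at this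
      rw [superKron_apply, smul_el_add_apply _ _ hi, this]
      by_cases h1 : a = c ∧ a.1 = i.1
      · by_cases h3 : b = d ∧ b.1 = i.1
        · rw [if_pos h1, if_pos h3, ite_self, mul_one, h3.1, CharTwo.add_self_eq_zero, zero_mul, sgn_zero,
            one_smul]
          exact (if_pos ⟨⟨h1.1, rfl, h1.2.trans (h3.1 ▸ h3.2).symm⟩, h1.2.symm⟩).symm
        · rw [if_neg h3, mul_zero, smul_zero, if_neg]
          exact fun h => h3 ⟨h.1.2.1, h.1.2.2.symm.trans h.2.symm⟩
      · rw [if_neg h1, zero_mul, smul_zero, if_neg]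
        exact fun h => h1 ⟨h.1.1, h.2.symm⟩
    rw [Matrix.sum_apply, Finset.sum_congr rfl fun i h => hi i (Finset.mem_filter.1 h).2,
      Finset.sum_filter, Finset.sum_eq_single_of_mem (a.1, 0) (Finset.mem_univ _)]
    · simp
    · intro i _ h
      split_ifs with h1 h3
      · exact absurd (Prod.ext h3.2 h1 : i = (a.1, 0)) h
      · exact absurd (Prod.ext h3.2 h1 : i = (a.1, 0)) h
      · rfl
      · rfl
  have e3 : (((q - q⁻¹) / 2) • ∑ i : Idx n with i.2 = 1,
      superKron (sfE i i.neg) (el i.neg i : Mat K n)) (a, b) (c, d) =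
      if d.2 = 1 ∧ b = d.neg ∧ a = d ∧ c = d.neg then q - q⁻¹ else 0 := by
    rw [Matrix.smul_apply, Matrix.sum_apply, Finset.sum_filter,
      Finset.sum_eq_single_of_mem d (Finset.mem_univ _)]
    · simp only [superKron_apply, sfE_apply, el_apply]
      by_cases h : d.2 = 1 ∧ b = d.neg ∧ a = d ∧ c = d.neg
      · obtain ⟨hd, rfl, rfl, rfl⟩ := h
        simp only [Idx.neg_neg, and_self, hd, if_true]
        simp only [Idx.neg, hd]
        have h3 : (1 + 1 : ZMod 2) = 0 := by decide
        simp [h3, sgn_one, sgn_zero, -uzpow_zero, -uzpow_one, Units.neg_smul]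
        field_simp
        norm_num
      · rw [if_neg h]
        by_cases hd : d.2 = 1
        · rw [if_pos hd]
          by_cases hb : b = d.neg
          · rw [if_neg (c := d = a ∧ d.neg = c), if_neg (c := d = c.neg ∧ d.neg = a.neg)]
            · simp
            · rintro ⟨h4, h5⟩
              refine h ⟨hd, hb, ?_, ?_⟩
              · rw [← a.neg_neg, ← h5, d.neg_neg]
              · rw [h4, c.neg_neg]
            · rintro ⟨rfl, rfl⟩
              exact h ⟨hd, hb, rfl, rfl⟩
          · simp [eq_comm (b := b), hb]
        · rw [if_neg hd, smul_zero]
    · intro i _ hi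
      simp [superKron_apply, el_apply, hi]
  have e4 : ((q - q⁻¹) • ∑ x : Idx n × Idx n with x.2.1 < x.1.1,
      sgn x.2.2 • superKron (sfE x.1 x.2) (el x.2 x.1 : Mat K n)) (a, b) (c, d) =
      if b.1 < d.1 then (q - q⁻¹) * (sgn (b.2 + (b.2 + d.2) * c.2) •
        ((if d = a ∧ b = c then 1 else 0) -
          sgn (a.2 * (c.2 + 1)) • (if d = c.neg ∧ b = a.neg then 1 else 0))) else 0 := by
    rw [Matrix.smul_apply, Matrix.sum_apply, Finset.sum_filter,
      Finset.sum_eq_single_of_mem (d, b) (Finset.mem_univ _)]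
    · dsimp only
      by_cases h : b.1 < d.1
      · have h1 : (el b d : Mat K n) b d = 1 := by simp [el_apply]
        rw [if_pos h, if_pos h, Matrix.smul_apply, superKron_apply, sfE_apply]
        dsimp only
        rw [h1, mul_one, smul_smul, ← sgn_add, smul_eq_mul]
      · rw [if_neg h, if_neg h, smul_zero]
    · rintro ⟨i, j⟩ _ hi
      rw [Ne, Prod.ext_iff, and_comm] at hi
      split_ifs
      · rw [Matrix.smul_apply, superKron_apply, el_apply, if_neg hi, mul_zero, smul_zero, smul_zero]
      · rfl
  have p1 : (if (a, b) = (c, d) then 1 else 0) +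
      (if a = c ∧ b = d ∧ a.1 = b.1 then (if a.2 = 0 then q - 1 else q⁻¹ - 1) else 0) =
      sgn (a.2 * b.2) • (if b = d ∧ a = c then (if c = d then (if c.2 = 0 then q else -q⁻¹)
        else if c.1 = d.1 then (if c.2 = 0 then q else q⁻¹)
        else if c.2 = 1 ∧ d.2 = 1 then -1 else 1) else 0) := by
    by_cases h : a = c ∧ b = d
    · obtain ⟨rfl, rfl⟩ := h
      simp only [and_self, true_and, if_true]
      by_cases h1 : a.1 = b.1
      · rw [if_pos h1]
        by_cases h3 : a = b
        · subst h3
          rw [if_pos rfl]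
          rcases zmod_two_cases a.2 with h | h <;>
            simp [h, sgn_zero, sgn_one, -uzpow_zero, -uzpow_one, Units.neg_smul]
        · rw [if_neg h3, if_pos h1, Idx.eq_neg_of_fst_eq h1 h3]
          have key3 : ∀ x : ZMod 2, x * (x + 1) = 0 := by decide
          rw [Idx.neg, key3, sgn_zero, one_smul]
          split_ifs <;> ring
      · have h3 : a ≠ b := fun h => h1 (h ▸ rfl)
        rw [if_neg h3, if_neg h1, if_neg h1]
        rcases zmod_two_cases a.2 with h | h <;> rcases zmod_two_cases b.2 with h' | h' <;>
          simp [h, h', sgn_zero, sgn_one, -uzpow_zero, -uzpow_one, Units.neg_smul]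
    · rw [if_neg, if_neg, if_neg, zero_add, smul_zero]
      · exact fun h' => h ⟨h'.2, h'.1⟩
      · exact fun h' => h ⟨h'.1, h'.2.1⟩
      · exact fun h' => h (Prod.mk.inj h')
  have p2 : (if d.2 = 1 ∧ b = d.neg ∧ a = d ∧ c = d.neg then q - q⁻¹ else 0) +
      (if b.1 < d.1 then (q - q⁻¹) * (sgn (b.2 + (b.2 + d.2) * c.2) •
        (if d = a ∧ b = c then 1 else 0)) else 0) =
      sgn (a.2 * b.2) • (if b = c ∧ a = d ∧ (c.1 < d.1 ∨ c.1 = d.1 ∧ c.2 = 0 ∧ d.2 = 1)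
        then q - q⁻¹ else 0) := by
    by_cases h : b = c ∧ a = d
    · obtain ⟨rfl, rfl⟩ := h
      by_cases h1 : b.1 < a.1
      · have key : ∀ a b : ZMod 2, b + (b + a) * b = a * b := by decide
        rw [if_pos h1, if_pos (c := a = a ∧ b = b) ⟨rfl, rfl⟩, if_pos (c := b = b ∧ _)
          ⟨rfl, rfl, Or.inl h1⟩, if_neg, zero_add, key, mul_smul_comm, mul_one]
        rintro ⟨-, h3, -⟩
        rw [h3] at h1
        exact lt_irrefl _ h1
      · rw [if_neg h1, add_zero]
        by_cases h3 : b.1 = a.1 ∧ b.2 = 0 ∧ a.2 = 1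
        · have h4 : b = a.neg := Prod.ext h3.1 (by
            change b.2 = a.2 + 1
            rw [h3.2.1, h3.2.2]
            decide)
          rw [if_pos ⟨h3.2.2, h4, rfl, h4⟩, if_pos ⟨rfl, rfl, Or.inr h3⟩, h3.2.1, mul_zero,
            sgn_zero, one_smul]
        · rw [if_neg, if_neg, smul_zero]
          · rintro ⟨-, -, h5 | h5⟩
            exacts [h1 h5, h3 h5]
          · rintro ⟨h5, h6, -⟩
            have h7 : b.2 = a.2 + 1 := congrArg Prod.snd h6
            rw [h5] at h7
            exact h3 ⟨(congrArg Prod.fst h6 : _), h7, h5⟩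
    · rw [if_neg fun h' => h ⟨h'.2.1.trans h'.2.2.2.symm, h'.2.2.1⟩,
        if_neg (c := d = a ∧ b = c) fun h' => h ⟨h'.2, h'.1.symm⟩,
        if_neg (c := b = c ∧ a = d ∧ _) fun h' => h ⟨h'.1, h'.2.1⟩]
      simp
  have p3 : (if b.1 < d.1 then (q - q⁻¹) * (sgn (b.2 + (b.2 + d.2) * c.2) •
        sgn (a.2 * (c.2 + 1)) • (if d = c.neg ∧ b = a.neg then 1 else 0)) else 0) =
      -(sgn (a.2 * b.2) • (if d = c.neg ∧ a = b.neg ∧ b.1 < d.1 then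
        if d.2 = 0 then -(q - q⁻¹) else q - q⁻¹ else 0)) := by
    by_cases h1 : b.1 < d.1
    · by_cases h : d = c.neg ∧ a = b.neg
      · rw [if_pos h1, if_pos (c := d = c.neg ∧ b = a.neg) ⟨h.1, by rw [h.2, b.neg_neg]⟩,
          if_pos (c := d = c.neg ∧ a = b.neg ∧ _) ⟨h.1, h.2, h1⟩, smul_smul,
          ← sgn_add, h.1, h.2]
        simp only [Idx.neg]
        have key : ∀ b c : ZMod 2, b + (b + (c + 1)) * c + (b + 1) * (c + 1) = c + 1 ∧
          (b + 1) * b = 0 := by decide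
        rw [(key _ _).1, (key b.2 c.2).2, sgn_zero, one_smul]
        rcases zmod_two_cases (c.2 + 1) with h | h <;>
          simp [h, sgn_zero, sgn_one, -uzpow_zero, -uzpow_one, Units.neg_smul]
      · rw [if_pos h1, if_neg, if_neg]
        · simp
        · exact fun h' => h ⟨h'.1, h'.2.1⟩
        · exact fun h' => h ⟨h'.1, by rw [h'.2, a.neg_neg]⟩
    · rw [if_neg h1, if_neg fun h => h1 h.2.2]
      simp
  have p4 : (if b.1 < d.1 then (q - q⁻¹) * (sgn (b.2 + (b.2 + d.2) * c.2) •
      ((if d = a ∧ b = c then 1 else 0) -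
        sgn (a.2 * (c.2 + 1)) • (if d = c.neg ∧ b = a.neg then 1 else 0))) else 0) =
      (if b.1 < d.1 then (q - q⁻¹) * (sgn (b.2 + (b.2 + d.2) * c.2) •
          (if d = a ∧ b = c then 1 else 0)) else 0) -
      (if b.1 < d.1 then (q - q⁻¹) * (sgn (b.2 + (b.2 + d.2) * c.2) •
          sgn (a.2 * (c.2 + 1)) • (if d = c.neg ∧ b = a.neg then 1 else 0)) else 0) := by
    by_cases h : b.1 < d.1
    · rw [if_pos h, if_pos h, if_pos h, smul_sub, mul_sub]
    · rw [if_neg h, if_neg h, if_neg h, sub_zero]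
  rw [Smat, Matrix.add_apply, Matrix.add_apply, Matrix.add_apply, e2, e3, e4, Braid.smat,
    Matrix.of_apply, Braid.icoeff_eq, Matrix.one_apply, smul_add, smul_add, p4]
  linear_combination p1 + p2 - p3

end QEA

end Vector

/-! ### The enveloping superalgebra -/

section Periplectic

variable {n : ℕ}

/-- The homogeneous components of an element of `𝔭_n`. -/
def pPart (a : ZMod 2) (x : periplectic n) : periplectic n :=
  (2⁻¹ : ℂ) • (x + sgn a • pParity x)

theorem pPart_isHomog (a : ZMod 2) (x : periplectic n) : IsHomog a (pPart a x : Mat ℂ n) := by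
  intro i j hij
  have key : ∀ a b : ZMod 2, b ≠ a → sgn a * sgn b = -1 := by decide
  change (2⁻¹ : ℂ) • ((x : Mat ℂ n) + ((sgn a • pParity x : periplectic n) : Mat ℂ n)) i j = 0
  have h : ((sgn a • pParity x : periplectic n) : Mat ℂ n) = sgn a • (pParity x : Mat ℂ n) :=
    units_smul_map (periplectic n).subtype _ _
  have h2 : (pParity x : Mat ℂ n) i j = sgn (i.2 + j.2) • (x : Mat ℂ n) i j := rfl
  rw [h, Matrix.add_apply, Matrix.smul_apply, h2, smul_smul, key _ _ hij, Units.neg_smul, one_smul,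
    add_neg_cancel, smul_zero]

theorem pPart_add (x : periplectic n) : pPart 0 x + pPart 1 x = x := by
  rw [pPart, pPart, sgn_zero, sgn_one, one_smul, Units.neg_smul, one_smul, ← smul_add,
    show x + pParity x + (x + -pParity x) = (2 : ℂ) • x by rw [two_smul]; abel, smul_smul]
  norm_num

theorem superBracket_eq {R : Type*} [CommRing R] {a b : ZMod 2} {x y : Mat R n} (hx : IsHomog a x)
    (hy : IsHomog b y) : superBracket x y = x * y - sgn (a * b) • (y * x) := by
  ext i j
  rw [superBracket, Matrix.of_apply, Matrix.sub_apply, Matrix.smul_apply, Matrix.mul_apply,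
    Matrix.mul_apply, Finset.smul_sum, ← Finset.sum_sub_distrib]
  refine Finset.sum_congr rfl fun k _ => ?_
  by_cases h1 : i.2 + k.2 = b
  · by_cases h2 : k.2 + j.2 = a
    · rw [h1, h2, mul_comm a]
    · rw [hx _ _ h2, mul_zero, smul_zero, smul_zero]
  · rw [hy _ _ h1, zero_mul, smul_zero, smul_zero]

/-! ### Hopf structure and vector representation of the enveloping superalgebra -/

namespace Up

/-- The universal property of the enveloping superalgebra. -/
def lift {B : Type*} [Ring B] [Algebra ℂ B] (f : periplectic n →ₗ[ℂ] B)
    (hf : ∀ (a b : ZMod 2) (x y : periplectic n), IsHomog a (x : Mat ℂ n) →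
      IsHomog b (y : Mat ℂ n) → f x * f y - sgn (a * b) • (f y * f x) = f (pBracket x y)) :
    Up n →ₐ[ℂ] B :=
  RingQuot.liftAlgHom ℂ ⟨TensorAlgebra.lift ℂ f, by
    rintro _ _ ⟨a, b, x, y, hx, hy⟩
    rw [map_sub, units_smul_map, map_mul, map_mul, TensorAlgebra.lift_ι_apply,
      TensorAlgebra.lift_ι_apply, TensorAlgebra.lift_ι_apply, hf a b x y hx hy]⟩

theorem lift_ι {B : Type*} [Ring B] [Algebra ℂ B] (f : periplectic n →ₗ[ℂ] B) (hf)
    (x : periplectic n) : lift f hf (ι x) = f x :=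
  (RingQuot.liftAlgHom_mkAlgHom_apply ℂ _ _ _).trans (TensorAlgebra.lift_ι_apply _ _)

theorem ι_mem {a : ZMod 2} {x : periplectic n} (hx : IsHomog a (x : Mat ℂ n)) :
    ι x ∈ part ℂ (Up n) a := by
  change Up.parity (ι x) = _
  rw [parity_ι, pParity_of_isHomog hx, units_smul_map]

theorem parity_eq (a : Up n) : Superalgebra.parity ℂ a = Up.parity a := rfl

theorem adjoin_range_ι : Algebra.adjoin ℂ (Set.range (ι : periplectic n → Up n)) = ⊤ := by
  have hs : Function.Surjective (RingQuot.mkAlgHom ℂ (URel n)) :=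
    RingQuot.mkAlgHom_surjective ℂ _
  have h : (⊤ : Subalgebra ℂ (Up n)) = (⊤ : Subalgebra ℂ (TensorAlgebra ℂ (periplectic n))).map
      (RingQuot.mkAlgHom ℂ (URel n)) := by
    rw [Algebra.map_top]
    exact ((AlgHom.range_eq_top _).2 hs).symm
  rw [h, ← TensorAlgebra.adjoin_range_ι, AlgHom.map_adjoin, ← Set.range_comp]
  rfl

/-- The homogeneous generators. -/
def gens (n : ℕ) : Set (Up n) :=
  {u | ∃ (a : ZMod 2) (x : periplectic n), IsHomog a (x : Mat ℂ n) ∧ u = ι x}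

theorem adjoin_gens : Algebra.adjoin ℂ (gens n) = ⊤ := by
  rw [eq_top_iff, ← adjoin_range_ι]
  refine Algebra.adjoin_le ?_
  rintro _ ⟨x, rfl⟩
  rw [← pPart_add x, map_add]
  exact add_mem (Algebra.subset_adjoin ⟨0, _, pPart_isHomog 0 x, rfl⟩)
    (Algebra.subset_adjoin ⟨1, _, pPart_isHomog 1 x, rfl⟩)

/-- The map `x ↦ x ⊗ 1 + 1 ⊗ x`. -/
def primitive : periplectic n →ₗ[ℂ] SuperTensor ℂ (Up n) :=
  (GradedTensorProduct.includeLeft (part ℂ (Up n)) (part ℂ (Up n))).toLinearMap ∘ₗ ι +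
    (GradedTensorProduct.includeRight (part ℂ (Up n)) (part ℂ (Up n))).toLinearMap ∘ₗ ι

theorem primitive_apply (x : periplectic n) :
    primitive x = ι x ᵍ⊗ₜ[ℂ] 1 + 1 ᵍ⊗ₜ[ℂ] ι x := rfl

theorem primitive_mul_primitive {a b : ZMod 2} {x y : periplectic n} (hx : IsHomog a (x : Mat ℂ n))
    (hy : IsHomog b (y : Mat ℂ n)) : primitive x * primitive y =
      (ι x * ι y) ᵍ⊗ₜ[ℂ] 1 + ι x ᵍ⊗ₜ[ℂ] ι y + sgn (a * b) • (ι y ᵍ⊗ₜ[ℂ] ι x) +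
        1 ᵍ⊗ₜ[ℂ] (ι x * ι y) := by
  rw [primitive_apply, primitive_apply, add_mul, mul_add, mul_add,
    tmul_mul_tmul _ one_mem_part (ι_mem hy), tmul_mul_tmul _ one_mem_part one_mem_part,
    tmul_mul_tmul _ (ι_mem hx) (ι_mem hy), tmul_mul_tmul _ (ι_mem hx) one_mem_part]
  simp only [zero_mul, mul_zero, sgn_zero, one_smul, mul_one, one_mul]
  abel

/-- The comultiplication, for which the elements of `𝔭_n` are primitive. -/
def comul : Up n →ₐ[ℂ] SuperTensor ℂ (Up n) :=
  lift primitive fun a b x y hx hy => by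
    rw [primitive_mul_primitive hx hy, primitive_mul_primitive hy hx, primitive_apply,
      ← ι_mul a b x y hx hy, smul_add, smul_add, smul_add, smul_smul, mul_comm b,
      Int.units_mul_self, one_smul]
    have hL (u : Up n) : u ᵍ⊗ₜ[ℂ] 1 =
      GradedTensorProduct.includeLeft (part ℂ (Up n)) (part ℂ (Up n)) u := rfl
    have hR (u : Up n) : 1 ᵍ⊗ₜ[ℂ] u =
      GradedTensorProduct.includeRight (part ℂ (Up n)) (part ℂ (Up n)) u := rfl
    simp only [hL, hR, map_sub, units_smul_map]
    abel

theorem comul_ι (x : periplectic n) : comul (ι x) = ι x ᵍ⊗ₜ[ℂ] 1 + 1 ᵍ⊗ₜ[ℂ] ι x :=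
  lift_ι _ _ x

theorem underlying_comul_ι (x : periplectic n) :
    underlying comul (ι x) = ι x ⊗ₜ[ℂ] 1 + 1 ⊗ₜ[ℂ] ι x := by
  change (GradedTensorProduct.of ℂ _ _).symm (comul (ι x)) = _
  rw [comul_ι]
  rfl

theorem underlying_comul_one : underlying comul (1 : Up n) = 1 ⊗ₜ[ℂ] 1 := by
  change (GradedTensorProduct.of ℂ _ _).symm (comul 1) = _
  rw [map_one]
  rfl

/-- The counit. -/
def counit : Up n →ₐ[ℂ] ℂ := lift 0 fun a b x y _ _ => by simp

theorem counit_ι (x : periplectic n) : counit (ι x) = 0 := lift_ι _ _ x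

/-- The superbialgebra structure on the enveloping superalgebra. -/
def superBialgebra (n : ℕ) : SuperBialgebra ℂ (Up n) :=
  SuperBialgebra.ofGenerators adjoin_range_ι comul counit
    (by
      rintro _ ⟨x, rfl⟩
      rw [parity_eq, parity_ι, comul_ι, comul_ι, map_add, ST.parity_tmul, ST.parity_tmul, map_one,
        parity_eq, parity_ι])
    (by
      rintro _ ⟨x, rfl⟩
      rw [parity_eq, parity_ι, counit_ι, counit_ι])
    (by
      rintro _ ⟨x, rfl⟩
      simp only [underlying_comul_ι, map_add, LinearMap.rTensor_tmul, LinearMap.lTensor_tmul,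
        underlying_comul_one, TensorProduct.add_tmul, TensorProduct.tmul_add,
        TensorProduct.assoc_tmul]
      abel)
    (by
      rintro _ ⟨x, rfl⟩
      simp [underlying_comul_ι, counit_ι])
    (by
      rintro _ ⟨x, rfl⟩
      simp [underlying_comul_ι, counit_ι])

/-- The twisted negative, which extends to the antipode. -/
def antiι (c : ℂ) : periplectic n →ₗ[ℂ] (Up n)ᵐᵒᵖ :=
  -((MulOpposite.opLinearEquiv ℂ : Up n ≃ₗ[ℂ] (Up n)ᵐᵒᵖ).toLinearMap ∘ₗ
    (proj (R := ℂ) (A := Up n) 0 + c • proj (R := ℂ) (A := Up n) 1) ∘ₗ ι)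

theorem antiι_of_isHomog (c : ℂ) {a : ZMod 2} {x : periplectic n} (hx : IsHomog a (x : Mat ℂ n)) :
    antiι c x = -(rootPow c a • MulOpposite.op (ι x)) := by
  change -MulOpposite.op (proj (R := ℂ) 0 (ι x) + c • proj (R := ℂ) 1 (ι x)) = _
  rw [proj_of_mem (ι_mem hx), proj_of_mem (ι_mem hx), rootPow]
  rcases zmod_two_cases a with rfl | rfl <;> simp

/-- The anti-homomorphism from which the antipode is obtained. -/
def anti {c : ℂ} (hc : c * c = -1) : Up n →ₐ[ℂ] (Up n)ᵐᵒᵖ :=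
  lift (antiι c) fun a b x y hx hy => by
    have hxy : IsHomog (a + b) (pBracket x y : Mat ℂ n) := by
      change IsHomog (a + b) (superBracket (x : Mat ℂ n) y)
      intro i j hij
      refine Finset.sum_eq_zero fun k _ => ?_
      have key : ∀ i j k a b : ZMod 2, i + j ≠ a + b → (i + k ≠ a ∨ k + j ≠ b) ∧
          (i + k ≠ b ∨ k + j ≠ a) := by decide
      obtain ⟨h1, h2⟩ := key _ _ k.2 _ _ hij
      rcases h1 with h1 | h1 <;> rcases h2 with h2 | h2 <;>
        simp [hx _ _, hy _ _, h1, h2]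
    rw [antiι_of_isHomog c hx, antiι_of_isHomog c hy, antiι_of_isHomog c hxy, neg_mul_neg,
      neg_mul_neg, smul_mul_smul_comm, smul_mul_smul_comm, rootPow_mul hc, rootPow_mul hc,
      ← ι_mul a b x y hx hy, MulOpposite.op_sub, MulOpposite.op_smul, ← MulOpposite.op_mul,
      ← MulOpposite.op_mul, smul_assoc, smul_assoc, smul_smul, mul_comm b, Int.units_mul_self,
      one_smul, add_comm b, smul_sub, smul_comm (sgn (a * b))]
    abel

/-- The Hopf superalgebra structure on the enveloping superalgebra. -/
theorem exists_hopfSuperalgebra (n : ℕ) : ∃ H : HopfSuperalgebra ℂ (Up n),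
    H.toSuperBialgebra = superBialgebra n ∧ IsSuperAnti H.antipode ∧
      ∀ x, H.antipode (ι x) = -ι x := by
  have hc : Complex.I * Complex.I = -1 := Complex.I_mul_I
  let σ : Up n →ₐ[ℂ] (Up n)ᵐᵒᵖ := anti hc
  have hσι {a : ZMod 2} {x : periplectic n} (hx : IsHomog a (x : Mat ℂ n)) :
      (σ (ι x)).unop = -(rootPow Complex.I a • ι x) := by
    rw [show σ (ι x) = antiι Complex.I x from lift_ι _ _ x, antiι_of_isHomog _ hx]
    rfl
  have hσ (a) : (σ (Superalgebra.parity ℂ a)).unop = Superalgebra.parity ℂ (σ a).unop := by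
    have := AlgHom.ext_of_adjoin_eq_top adjoin_gens
      (φ₁ := σ.comp (Superalgebra.parity ℂ))
      (φ₂ := (AlgHom.op (Superalgebra.parity ℂ)).comp σ) (by
        rintro _ ⟨a, x, hx, rfl⟩
        apply MulOpposite.unop_injective
        change (σ (Superalgebra.parity ℂ _)).unop = Superalgebra.parity ℂ (σ _).unop
        rw [parity_of_mem (ι_mem hx), units_smul_map, MulOpposite.unop_smul, hσι hx, map_neg,
          map_smul, parity_of_mem (ι_mem hx), smul_comm, smul_neg])
    exact congrArg MulOpposite.unop (DFunLike.congr_fun this a)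
  have hS {a : ZMod 2} {x : periplectic n} (hx : IsHomog a (x : Mat ℂ n)) :
      superAntiOf Complex.I σ (ι x) = -ι x := by
    rw [superAntiOf_of_mem Complex.I σ (ι_mem hx), hσι hx, rootPow, smul_neg, smul_smul]
    split_ifs
    · rw [one_mul, one_smul]
    · rw [neg_mul, hc, neg_neg, one_smul]
  refine ⟨HopfSuperalgebra.ofGenerators (superBialgebra n) adjoin_gens (superAntiOf Complex.I σ)
    (isSuperAnti_superAntiOf hc hσ) ?_ ?_, rfl, isSuperAnti_superAntiOf hc hσ, fun x => ?_⟩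
  · rintro _ ⟨a, x, hx, rfl⟩
    change convLeft _ (comul _) = algebraMap ℂ _ (counit _)
    rw [comul_ι, counit_ι, map_add, convLeft_tmul, convLeft_tmul, hS hx,
      (isSuperAnti_superAntiOf hc hσ).map_one, map_zero, one_mul, mul_one, neg_add_cancel]
  · rintro _ ⟨a, x, hx, rfl⟩
    change convRight _ (comul _) = algebraMap ℂ _ (counit _)
    rw [comul_ι, counit_ι, map_add, convRight_tmul, convRight_tmul, hS hx,
      (isSuperAnti_superAntiOf hc hσ).map_one, map_zero, one_mul, mul_one, add_neg_cancel]
  · change superAntiOf Complex.I σ (ι x) = -ι x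
    rw [← pPart_add x, map_add, map_add, hS (pPart_isHomog 0 x), hS (pPart_isHomog 1 x), neg_add]

/-- The vector representation of the enveloping superalgebra. -/
def rep : Up n →ₐ[ℂ] Mat ℂ n :=
  lift (periplectic n).subtype fun _ _ _ _ hx hy => (superBracket_eq hx hy).symm

theorem rep_ι (x : periplectic n) : rep (ι x) = (x : Mat ℂ n) := lift_ι _ _ x

/-- The parity automorphism of the algebra of matrices. -/
def matParityHom : Mat ℂ n →ₐ[ℂ] Mat ℂ n :=
  AlgHom.ofLinearMap matParity
    (by
      ext i j
      change sgn (i.2 + j.2) • (1 : Mat ℂ n) i j = (1 : Mat ℂ n) i j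
      by_cases h : i = j
      · rw [h, CharTwo.add_self_eq_zero, sgn_zero, one_smul]
      · rw [Matrix.one_apply_ne h, smul_zero])
    (by
      intro x y
      ext i j
      change sgn (i.2 + j.2) • (x * y) i j = (matParity x * matParity y) i j
      rw [Matrix.mul_apply, Matrix.mul_apply, Finset.smul_sum]
      refine Finset.sum_congr rfl fun k _ => ?_
      change _ = (sgn (i.2 + k.2) • x i k) * (sgn (k.2 + j.2) • y k j)
      have key : ∀ a b c : ZMod 2, sgn (a + b) = sgn (a + c) * sgn (c + b) := by decide
      rw [smul_mul_smul_comm, ← key])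

theorem rep_parity (u : Up n) : rep (Superalgebra.parity ℂ u) = matParity (rep u) := by
  have : rep.comp (Superalgebra.parity ℂ) = (matParityHom (n := n)).comp rep :=
    algHom_ext fun x => by
      change rep (Up.parity (ι x)) = matParity (rep (ι x))
      rw [parity_ι, rep_ι, rep_ι]
      rfl
  exact DFunLike.congr_fun this u

/-- The projection of matrices to `𝔭_n`. -/
def toP : Mat ℂ n →ₗ[ℂ] periplectic n :=
  LinearMap.codRestrict (periplectic n) ((2⁻¹ : ℂ) • (LinearMap.id + iota)) fun x => by
    rw [mem_periplectic]
    simp only [LinearMap.smul_apply, LinearMap.add_apply, LinearMap.id_apply, map_smul, map_add,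
      iota_iota]
    rw [add_comm]

theorem coe_toP (x : Mat ℂ n) : (toP x : Mat ℂ n) = (2⁻¹ : ℂ) • (x + iota x) := rfl

theorem toP_coe (x : periplectic n) : toP (x : Mat ℂ n) = x := by
  apply Subtype.ext
  rw [coe_toP, mem_periplectic.1 x.2, ← two_smul ℂ, smul_smul]
  norm_num

/-- The identity matrix lies in the `-1` eigenspace of `iota`. Consequently the projection to `𝔭_n`
ignores constants, which the degree argument for injectivity needs. -/
theorem toP_one : toP (1 : Mat ℂ n) = 0 := by
  apply Subtype.ext
  rw [coe_toP]
  ext i j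
  rw [Matrix.smul_apply, Matrix.add_apply, iota_apply]
  by_cases h : i = j
  · subst h
    have key : ∀ x : ZMod 2, x * (x + 1) = 0 := by decide
    simp [key, sgn_zero, -uzpow_zero]
  · have h' : j.neg ≠ i.neg := fun e => h (by rw [← i.neg_neg, ← e, j.neg_neg])
    simp [Matrix.one_apply_ne h, Matrix.one_apply_ne h']

theorem toP_matParity (x : Mat ℂ n) : toP (matParity x) = pParity (toP x) := by
  apply Subtype.ext
  ext i j
  change ((2⁻¹ : ℂ) • (matParity x + iota (matParity x))) i j =
    sgn (i.2 + j.2) • ((2⁻¹ : ℂ) • (x + iota x)) i j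
  simp only [Matrix.smul_apply, Matrix.add_apply, iota_apply]
  change (2⁻¹ : ℂ) • (sgn (i.2 + j.2) • x i j +
    -(_ • sgn (j.neg.2 + i.neg.2) • x j.neg i.neg)) = _
  have key : ∀ x y : ZMod 2, (y + 1 + (x + 1)) = x + y := by decide
  simp only [Idx.neg, key]
  rw [smul_comm (sgn (i.2 + j.2)) (2⁻¹ : ℂ), smul_add (sgn (i.2 + j.2)), smul_neg (sgn (i.2 + j.2)),
    smul_comm (sgn (i.2 + j.2)) (sgn (i.2 * (j.2 + 1)))]

/-- A left inverse of the canonical map `𝔭_n → U(𝔭_n)`. -/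
def pr : Up n →ₗ[ℂ] periplectic n := toP ∘ₗ rep.toLinearMap

theorem pr_apply (u : Up n) : pr u = toP (rep u) := rfl

theorem pr_ι (x : periplectic n) : pr (ι x) = x := by rw [pr_apply, rep_ι, toP_coe]

theorem pr_one : pr (1 : Up n) = 0 := by rw [pr_apply, map_one, toP_one]

theorem pr_isHomog {a : ZMod 2} {u : Up n} (hu : u ∈ part ℂ (Up n) a) :
    IsHomog a (pr u : Mat ℂ n) := by
  have h : pParity (pr u) = sgn a • pr u := by
    rw [pr_apply, ← toP_matParity, ← rep_parity, parity_of_mem hu, units_smul_map, units_smul_map]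
  intro i j hij
  have h1 : sgn (i.2 + j.2) • (pr u : Mat ℂ n) i j =
      ((sgn a • pr u : periplectic n) : Mat ℂ n) i j := by
    rw [← h]
    rfl
  rw [show ((sgn a • pr u : periplectic n) : Mat ℂ n) = sgn a • (pr u : Mat ℂ n) from
    units_smul_map (periplectic n).subtype _ _, Matrix.smul_apply] at h1
  have key : ∀ a b : ZMod 2, b ≠ a → sgn b = -sgn a := by decide
  rw [key _ _ hij, Units.neg_smul, neg_eq_self, smul_eq_zero_iff_eq] at h1
  exact h1

end Up

end Periplectic

/-! ### A criterion for injectivity on the enveloping superalgebra -/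

theorem tensor_eq_zero_of_forall_coord {K V W : Type*} [Field K] [AddCommGroup V] [Module K V]
    [AddCommGroup W] [Module K W] (w : V ⊗[K] W)
    (h : ∀ φ : V →ₗ[K] K, TensorProduct.lid K W (φ.rTensor W w) = 0) : w = 0 := by
  let b := Module.Free.chooseBasis K V
  apply (TensorProduct.equivFinsuppOfBasisLeft b).injective
  rw [map_zero]
  ext i
  rw [TensorProduct.equivFinsuppOfBasisLeft_apply, h]
  rfl

theorem underlying_map_one {R A : Type*} [CommRing R] [Ring A] [Algebra R A] [Superalgebra R A]
    [Invertible (2 : R)] (comul : A →ₐ[R] SuperTensor R A) :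
    underlying comul (1 : A) = 1 ⊗ₜ[R] 1 := by
  change (GradedTensorProduct.of R _ _).symm (comul 1) = _
  rw [map_one]
  rfl

section PrimitivelyGenerated

variable {K A : Type*} [Field K] [Ring A] [Algebra K A] [Superalgebra K A] [Invertible (2 : K)]

/-- `A` is generated by the space `L` of primitive elements, which is closed under the
superbracket, and `P` is an even projection to `L` with `P 1 = 0`. -/
structure IsPrimitiveProjection (comul : A →ₐ[K] SuperTensor K A) (L : Submodule K A)
    (P : A →ₗ[K] A) : Prop where
  adjoin_eq : Algebra.adjoin K (L : Set A) = ⊤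
  comul_of_mem : ∀ x ∈ L, comul x = x ᵍ⊗ₜ[K] 1 + 1 ᵍ⊗ₜ[K] x
  bracket_mem (a b : ZMod 2) (x y : A) : x ∈ L → y ∈ L → x ∈ part K A a → y ∈ part K A b →
    x * y - sgn (a * b) • (y * x) ∈ L
  map_one : P 1 = 0
  map_of_mem : ∀ x ∈ L, P x = x
  map_mem : ∀ x, P x ∈ L
  map_parity : ∀ x, P (parity K x) = parity K (P x)

namespace IsPrimitiveProjection

variable {comul : A →ₐ[K] SuperTensor K A} {L : Submodule K A} {P : A →ₗ[K] A}

theorem parity_mem (h : IsPrimitiveProjection comul L P) {x : A} (hx : x ∈ L) : parity K x ∈ L := by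
  rw [← h.map_of_mem x hx, ← h.map_parity]
  exact h.map_mem _

theorem proj_mem_of_mem (h : IsPrimitiveProjection comul L P) (i : ZMod 2) {x : A} (hx : x ∈ L) :
    proj (R := K) i x ∈ L := by
  rw [proj_apply, Units.smul_def]
  exact L.smul_mem _ (add_mem hx (zsmul_mem (h.parity_mem hx) _))

theorem map_mem_part (h : IsPrimitiveProjection comul L P) {i : ZMod 2} {x : A}
    (hx : x ∈ part K A i) : P x ∈ part K A i := by
  rw [mem_part, ← h.map_parity, parity_of_mem hx, units_smul_map]

theorem underlying_of_mem (h : IsPrimitiveProjection comul L P) {x : A} (hx : x ∈ L) :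
    underlying comul x = x ⊗ₜ[K] 1 + 1 ⊗ₜ[K] x := by
  change (GradedTensorProduct.of K _ _).symm (comul x) = _
  rw [h.comul_of_mem x hx]
  rfl

variable (L) in
/-- The elements of degree at most one. -/
def fil : Submodule K A := 1 ⊔ L

theorem one_mem_one : (1 : A) ∈ (1 : Submodule K A) := Submodule.one_le.1 le_rfl

theorem one_mem_fil : (1 : A) ∈ fil L := Submodule.mem_sup_left one_mem_one

theorem mem_fil {x : A} (hx : x ∈ L) : x ∈ fil L := Submodule.mem_sup_right hx

theorem fil_pow_le (d : ℕ) : fil L ^ d ≤ fil L ^ (d + 1) := fun u hu => by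
  rw [pow_succ', ← one_mul u]
  exact Submodule.mul_mem_mul one_mem_fil hu

/-- The step of the filtration is spanned by the previous one and by products with a homogeneous
primitive element on the left. -/
theorem fil_pow_induction (h : IsPrimitiveProjection comul L P) (d : ℕ) {Q : A → Prop}
    (le : ∀ u ∈ fil L ^ d, Q u)
    (mul : ∀ (a : ZMod 2) (x u : A), x ∈ L → x ∈ part K A a → u ∈ fil L ^ d → Q (x * u))
    (add : ∀ u v, Q u → Q v → Q (u + v)) {u : A} (hu : u ∈ fil L ^ (d + 1)) : Q u := by
  rw [pow_succ'] at hu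
  induction hu using Submodule.mul_induction_on' with
  | add u _ v _ hu hv => exact add u v hu hv
  | mem_mul_mem m hm u hu =>
    obtain ⟨y, hy, x, hx, rfl⟩ := Submodule.mem_sup.1 hm
    obtain ⟨c, rfl⟩ := Submodule.mem_one.1 hy
    rw [add_mul, ← Algebra.smul_def, ← proj_add_proj (R := K) x, add_mul]
    exact add _ _ (le _ (Submodule.smul_mem _ c hu))
      (add _ _ (mul 0 _ u (h.proj_mem_of_mem 0 hx) (proj_mem 0 x) hu)
        (mul 1 _ u (h.proj_mem_of_mem 1 hx) (proj_mem 1 x) hu))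

theorem exists_mem_fil_pow (h : IsPrimitiveProjection comul L P) (u : A) :
    ∃ d, u ∈ fil L ^ d := by
  have hu : u ∈ Algebra.adjoin K (L : Set A) := by
    rw [h.adjoin_eq]
    exact Algebra.mem_top
  have mono {d e : ℕ} (h : d ≤ e) : fil L ^ d ≤ fil L ^ e :=
    monotone_nat_of_le_succ fil_pow_le h
  induction hu using Algebra.adjoin_induction with
  | mem u hu => exact ⟨1, by rw [pow_one]; exact mem_fil hu⟩
  | algebraMap r => exact ⟨0, by rw [pow_zero]; exact Submodule.algebraMap_mem r⟩
  | add u v _ _ hu hv =>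
    obtain ⟨d, hd⟩ := hu
    obtain ⟨e, he⟩ := hv
    exact ⟨max d e, add_mem (mono (le_max_left _ _) hd) (mono (le_max_right _ _) he)⟩
  | mul u v _ _ hu hv =>
    obtain ⟨d, hd⟩ := hu
    obtain ⟨e, he⟩ := hv
    exact ⟨d + e, by rw [pow_add]; exact Submodule.mul_mem_mul hd he⟩

/-- Multiplication by `x ⊗ 1 + 1 ⊗ x`, written as a linear operator on the tensor square. In the
second summand `x` moves past the first factor, which produces the parity operator for odd `x`. -/
theorem underlying_mul (h : IsPrimitiveProjection comul L P) {a : ZMod 2} {x : A} (hx : x ∈ L)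
    (hxa : x ∈ part K A a) (u : A) :
    underlying comul (x * u) = (LinearMap.mulLeft K x).rTensor A (underlying comul u) +
      TensorProduct.map (parityPow (R := K) a) (LinearMap.mulLeft K x) (underlying comul u) := by
  change (GradedTensorProduct.of K _ _).symm (comul (x * u)) = _
  rw [map_mul, h.comul_of_mem x hx, add_mul, map_add]
  congr 1
  · refine tmul_induction_homog (P := fun X => (GradedTensorProduct.of K _ _).symm
      ((x ᵍ⊗ₜ[K] 1 : SuperTensor K A) * X) = (LinearMap.mulLeft K x).rTensor A
        ((GradedTensorProduct.of K _ _).symm X)) (comul u) (fun i j b c hb hc => ?_)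
      fun X Y hX hY => by rw [mul_add, map_add, hX, hY, map_add, map_add]
    rw [tmul_mul_tmul _ one_mem_part hb, zero_mul, sgn_zero, one_smul, one_mul]
    rfl
  · refine tmul_induction_homog (P := fun X => (GradedTensorProduct.of K _ _).symm
      ((1 ᵍ⊗ₜ[K] x : SuperTensor K A) * X) =
        TensorProduct.map (parityPow (R := K) a) (LinearMap.mulLeft K x)
        ((GradedTensorProduct.of K _ _).symm X)) (comul u) (fun i j b c hb hc => ?_)
      fun X Y hX hY => by rw [mul_add, map_add, hX, hY, map_add, map_add]
    rw [tmul_mul_tmul _ hxa hb, one_mul, ← ST.smul_tmul]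
    change (sgn (a * i) • b) ⊗ₜ[K] (x * c) = parityPow (R := K) a b ⊗ₜ[K] (x * c)
    rw [parityPow_of_mem hb]
    congr 3
    first | rfl | rw [mul_comm]

theorem parityPow_one (a : ZMod 2) : parityPow (R := K) a (1 : A) = 1 := by
  rw [parityPow_of_mem one_mem_part]
  simp

/-- Exchanging `x` with the primitive element `P b` costs a superbracket. It lies in `L`, so it has
degree one instead of two and can be neglected at leading order. -/
theorem map_mul_sub_mem (h : IsPrimitiveProjection comul L P) {a : ZMod 2} {x : A} (hx : x ∈ L)
    (hxa : x ∈ part K A a) (b : A) : P (parityPow (R := K) a b) * x - x * P b ∈ L := by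
  refine induction_homog K (P := fun b => P (parityPow (R := K) a b) * x - x * P b ∈ L)
    (fun i b hb => ?_) (fun b c hb hc => ?_) b
  · rw [parityPow_of_mem hb, units_smul_map]
    have h := h.bracket_mem a i x (P b) hx (h.map_mem b) hxa (h.map_mem_part hb)
    rw [smul_mul_assoc, ← neg_sub]
    refine neg_mem ?_
    convert h using 4
    first | rfl | rw [mul_comm]
  · simp only [map_add, add_mul, mul_add]
    rw [add_sub_add_comm]
    exact add_mem hb hc

variable (L) in
/-- The image of `A ⊗ F^d`. -/
def tfil (d : ℕ) : Submodule K (A ⊗[K] A) :=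
  Submodule.span K {w | ∃ a b, b ∈ fil L ^ d ∧ w = a ⊗ₜ[K] b}

theorem tmul_mem_tfil {d : ℕ} (a : A) {b : A} (hb : b ∈ fil L ^ d) :
    a ⊗ₜ[K] b ∈ tfil L d := Submodule.subset_span ⟨a, b, hb, rfl⟩

theorem mem_of_mem_tfil {V : Type*} [AddCommGroup V] [Module K V]
    (f : A ⊗[K] A →ₗ[K] V) {d : ℕ} {N : Submodule K V}
    (hf : ∀ a, ∀ b ∈ fil L ^ d, f (a ⊗ₜ[K] b) ∈ N) {w : A ⊗[K] A} (hw : w ∈ tfil L d) :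
    f w ∈ N := by
  have : tfil L d ≤ N.comap f := Submodule.span_le.2 (by rintro _ ⟨a, b, hb, rfl⟩; exact hf a b hb)
  exact this hw

theorem tfil_le (d : ℕ) : tfil L d ≤ tfil L (d + 1) := fun _ hw =>
  mem_of_mem_tfil LinearMap.id (fun a _ hb => tmul_mem_tfil a (fil_pow_le d hb)) hw

theorem mul_mem_fil_pow {x : A} (hx : x ∈ L) {d : ℕ} {u : A} (hu : u ∈ fil L ^ d) :
    x * u ∈ fil L ^ (d + 1) := by
  rw [pow_succ']
  exact Submodule.mul_mem_mul (mem_fil hx) hu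

/-- Among the terms of `Δ` of a product of primitive elements, `1 ⊗ u` is the only one whose second
factor has full degree. -/
theorem underlying_sub_mem (h : IsPrimitiveProjection comul L P) (d : ℕ) {u : A}
    (hu : u ∈ fil L ^ (d + 1)) : underlying comul u - 1 ⊗ₜ[K] u ∈ tfil L d := by
  induction d generalizing u with
  | zero =>
    refine h.fil_pow_induction 0 (Q := fun u => underlying comul u - 1 ⊗ₜ[K] u ∈ tfil L 0)
      (fun u hu => ?_) (fun a x u hx hxa hu => ?_) (fun u v hu hv => ?_) hu
    · rw [pow_zero] at hu
      obtain ⟨c, rfl⟩ := Submodule.mem_one.1 hu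
      rw [Algebra.algebraMap_eq_smul_one, map_smul, underlying_map_one, TensorProduct.tmul_smul,
        sub_self]
      exact zero_mem _
    · rw [pow_zero] at hu
      obtain ⟨c, rfl⟩ := Submodule.mem_one.1 hu
      rw [Algebra.algebraMap_eq_smul_one, mul_smul_comm, mul_one, map_smul, h.underlying_of_mem hx,
        TensorProduct.tmul_smul, ← smul_sub, add_sub_cancel_right]
      exact Submodule.smul_mem _ _ (tmul_mem_tfil _ (by rw [pow_zero]; exact one_mem_one))
    · rw [map_add, TensorProduct.tmul_add, add_sub_add_comm]
      exact add_mem hu hv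
  | succ d ih =>
    refine h.fil_pow_induction (d + 1)
      (Q := fun u => underlying comul u - 1 ⊗ₜ[K] u ∈ tfil L (d + 1))
      (fun u hu => tfil_le d (ih hu)) (fun a x u hx hxa hu => ?_) (fun u v hu hv => ?_) hu
    · obtain ⟨p, hp, e⟩ : ∃ p ∈ tfil L d, underlying comul u = p + 1 ⊗ₜ[K] u := ⟨_, ih hu, by abel⟩
      rw [h.underlying_mul hx hxa, e, map_add, map_add, LinearMap.rTensor_tmul,
        TensorProduct.map_tmul, parityPow_one, LinearMap.mulLeft_apply, LinearMap.mulLeft_apply,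
        mul_one, ← add_assoc, add_sub_cancel_right]
      refine add_mem (add_mem (tfil_le d ?_) (tmul_mem_tfil _ hu)) ?_
      · refine mem_of_mem_tfil _ (fun a b hb => ?_) hp
        rw [LinearMap.rTensor_tmul]
        exact tmul_mem_tfil _ hb
      · refine mem_of_mem_tfil _ (fun a b hb => ?_) hp
        rw [TensorProduct.map_tmul]
        exact tmul_mem_tfil _ (mul_mem_fil_pow hx hb)
    · rw [map_add, TensorProduct.tmul_add, add_sub_add_comm]
      exact add_mem hu hv

variable (P) in
/-- The map `a ⊗ b ↦ P(a) b`. -/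
def mulLeftMap : A ⊗[K] A →ₗ[K] A := LinearMap.mul' K A ∘ₗ P.rTensor A

theorem mulLeftMap_tmul (a b : A) : mulLeftMap P (a ⊗ₜ[K] b) = P a * b := rfl

/-- Applied to `Δ` of a product of `d + 1` primitive elements, `P` selects at leading order one
factor at a time and moves it to the front. Up to lower degree each of the `d + 1` choices gives
back the product, so the operator acts as the scalar `d + 1` on the graded piece. -/
theorem mulLeftMap_sub_mem (h : IsPrimitiveProjection comul L P) (d : ℕ) {u : A}
    (hu : u ∈ fil L ^ (d + 1)) :
    mulLeftMap P (underlying comul u) - ((d + 1 : ℕ) : K) • u ∈ fil L ^ d := by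
  induction d generalizing u with
  | zero =>
    refine h.fil_pow_induction 0
      (Q := fun u => mulLeftMap P (underlying comul u) - ((0 + 1 : ℕ) : K) • u ∈ fil L ^ 0)
      (fun u hu => ?_) (fun a x u hx hxa hu => ?_) (fun u v hu hv => ?_) hu
    · refine sub_mem ?_ (Submodule.smul_mem _ _ hu)
      rw [pow_zero] at hu
      obtain ⟨c, rfl⟩ := Submodule.mem_one.1 hu
      rw [Algebra.algebraMap_eq_smul_one, map_smul, underlying_map_one, map_smul, mulLeftMap_tmul,
        h.map_one, zero_mul, smul_zero]
      exact zero_mem _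
    · rw [pow_zero] at hu
      obtain ⟨c, rfl⟩ := Submodule.mem_one.1 hu
      rw [Algebra.algebraMap_eq_smul_one, mul_smul_comm, mul_one, map_smul, h.underlying_of_mem hx,
        map_smul, map_add, mulLeftMap_tmul, mulLeftMap_tmul, h.map_of_mem x hx, h.map_one,
        zero_mul, add_zero, mul_one, zero_add, Nat.cast_one, one_smul, sub_self]
      exact zero_mem _
    · rw [map_add, map_add, smul_add, add_sub_add_comm]
      exact add_mem hu hv
  | succ d ih =>
    refine h.fil_pow_induction (d + 1)
      (Q := fun u => mulLeftMap P (underlying comul u) - ((d + 1 + 1 : ℕ) : K) • u ∈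
        fil L ^ (d + 1))
      (fun u hu => ?_) (fun a x u hx hxa hu => ?_) (fun u v hu hv => ?_) hu
    · rw [Nat.cast_add, add_smul, ← sub_sub]
      exact sub_mem (fil_pow_le d (ih hu)) (Submodule.smul_mem _ _ hu)
    · obtain ⟨p, hp, e⟩ : ∃ p ∈ tfil L d, underlying comul u = p + 1 ⊗ₜ[K] u :=
        ⟨_, h.underlying_sub_mem d hu, by abel⟩
      have h1 : mulLeftMap P ((LinearMap.mulLeft K x).rTensor A p) ∈ fil L ^ (d + 1) := by
        refine mem_of_mem_tfil (mulLeftMap P ∘ₗ (LinearMap.mulLeft K x).rTensor A)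
          (fun a b hb => ?_) hp
        exact mul_mem_fil_pow (h.map_mem _) hb
      have h2 : mulLeftMap P (TensorProduct.map (parityPow (R := K) a) (LinearMap.mulLeft K x) p) -
          x * mulLeftMap P p ∈ fil L ^ (d + 1) := by
        refine mem_of_mem_tfil (mulLeftMap P ∘ₗ TensorProduct.map (parityPow (R := K) a)
          (LinearMap.mulLeft K x) - LinearMap.mulLeft K x ∘ₗ mulLeftMap P) (fun b c hc => ?_) hp
        change P (parityPow (R := K) a b) * (x * c) - x * (P b * c) ∈ _
        rw [← mul_assoc, ← mul_assoc, ← sub_mul]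
        exact mul_mem_fil_pow (h.map_mul_sub_mem hx hxa b) hc
      have h3 : mulLeftMap P (underlying comul u) = mulLeftMap P p := by
        rw [e, map_add, mulLeftMap_tmul, h.map_one, zero_mul, add_zero]
      have h4 := mul_mem_fil_pow hx (ih hu)
      rw [h3, mul_sub, mul_smul_comm] at h4
      rw [h.underlying_mul hx hxa, e, map_add (LinearMap.rTensor _ _),
        map_add (TensorProduct.map _ _), LinearMap.rTensor_tmul, TensorProduct.map_tmul,
        parityPow_one, map_add, map_add, map_add, mulLeftMap_tmul, mulLeftMap_tmul,
        LinearMap.mulLeft_apply, LinearMap.mulLeft_apply, mul_one, h.map_of_mem x hx, h.map_one,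
        zero_mul, add_zero, Nat.cast_add, add_smul, Nat.cast_one, one_smul]
      have := add_mem (add_mem h1 h2) h4
      convert this using 1
      abel
    · rw [map_add, map_add, smul_add, add_sub_add_comm]
      exact add_mem hu hv

/-- An algebra homomorphism `f` is injective if its kernel is contained in that of
`(P ⊗ f) Δ`. -/
theorem injective [CharZero K] (h : IsPrimitiveProjection comul L P) {B : Type*} [Ring B]
    [Algebra K B] [Nontrivial B] (f : A →ₐ[K] B)
    (hf : ∀ u, f u = 0 → TensorProduct.map P f.toLinearMap (underlying comul u) = 0) :
    Function.Injective f := by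
  rw [injective_iff_map_eq_zero]
  suffices h : ∀ d, ∀ u ∈ fil L ^ d, f u = 0 → u = 0 by
    intro u hu
    obtain ⟨d, hd⟩ := IsPrimitiveProjection.exists_mem_fil_pow ‹_› u
    exact h d u hd hu
  intro d
  induction d with
  | zero =>
    intro u hu h
    rw [pow_zero] at hu
    obtain ⟨c, rfl⟩ := Submodule.mem_one.1 hu
    rw [AlgHom.commutes] at h
    rw [(map_eq_zero_iff _ (algebraMap K B).injective).1 h, map_zero]
  | succ d ih =>
    intro u hu h0
    -- Contracting the first factor with a functional `φ` leaves an element of degree at most `d`,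
    -- since `P` kills the term `1 ⊗ u`. It lies in the kernel of `f` by hypothesis, so the
    -- induction hypothesis applies to it.
    have hpr : P.rTensor A (underlying comul u) = 0 := by
      refine tensor_eq_zero_of_forall_coord _ fun φ => ih _ ?_ ?_
      · obtain ⟨p, hp, e⟩ : ∃ p ∈ tfil L d, underlying comul u = p + 1 ⊗ₜ[K] u :=
          ⟨_, h.underlying_sub_mem d hu, by abel⟩
        rw [e, map_add, LinearMap.rTensor_tmul, h.map_one, TensorProduct.zero_tmul, add_zero]
        refine mem_of_mem_tfil ((TensorProduct.lid K A).toLinearMap ∘ₗ φ.rTensor A ∘ₗ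
          P.rTensor A) (fun a b hb => ?_) hp
        exact Submodule.smul_mem _ _ hb
      · have key : ∀ w : A ⊗[K] A,
            f (TensorProduct.lid K A (φ.rTensor A (P.rTensor A w))) =
            TensorProduct.lid K B (φ.rTensor B (TensorProduct.map P f.toLinearMap w)) := by
          intro w
          induction w with
          | zero => simp
          | tmul a b => simp
          | add a b ha hb => simp only [map_add, ha, hb]
        rw [key, hf u h0, map_zero, map_zero]
    have h1 : mulLeftMap P (underlying comul u) = 0 := by
      rw [mulLeftMap, LinearMap.comp_apply, hpr, map_zero]
    have h2 := h.mulLeftMap_sub_mem d hu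
    rw [h1, zero_sub, neg_mem_iff] at h2
    -- Now `(d + 1) u` has degree at most `d`, and in characteristic zero so does `u`.
    have hd : ((d + 1 : ℕ) : K) ≠ 0 := Nat.cast_ne_zero.2 d.succ_ne_zero
    refine ih u ?_ h0
    rw [← inv_smul_smul₀ hd u]
    exact Submodule.smul_mem _ _ h2

end IsPrimitiveProjection

end PrimitivelyGenerated

namespace Up

variable {n : ℕ}

theorem isPrimitiveProjection :
    IsPrimitiveProjection (comul (n := n)) (LinearMap.range ι) (ι ∘ₗ pr) where
  adjoin_eq := adjoin_range_ι
  comul_of_mem := by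
    rintro _ ⟨x, rfl⟩
    exact comul_ι x
  bracket_mem := by
    have hpr : ∀ (a : ZMod 2) (x : periplectic n), ι x ∈ part ℂ (Up n) a →
        IsHomog a (x : Mat ℂ n) := fun a x hx => by
      rw [← pr_ι x]
      exact pr_isHomog hx
    rintro a b _ _ ⟨x, rfl⟩ ⟨y, rfl⟩ hx hy
    exact ⟨pBracket x y, (ι_mul a b x y (hpr a x hx) (hpr b y hy)).symm⟩
  map_one := by rw [LinearMap.comp_apply, pr_one, map_zero]
  map_of_mem := by
    rintro _ ⟨x, rfl⟩
    rw [LinearMap.comp_apply, pr_ι]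
  map_mem x := ⟨_, rfl⟩
  map_parity x := by
    rw [LinearMap.comp_apply, pr_apply, rep_parity, toP_matParity]
    exact (parity_ι _).symm

/-- An algebra homomorphism from the enveloping superalgebra is injective if its kernel is
contained in that of `(pr ⊗ f) Δ`. -/
theorem injective_of_comul {B : Type*} [Ring B] [Algebra ℂ B] [Nontrivial B] (f : Up n →ₐ[ℂ] B)
    (hf : ∀ u, f u = 0 → TensorProduct.map pr f.toLinearMap (underlying comul u) = 0) :
    Function.Injective f := by
  refine isPrimitiveProjection.injective f fun u hu => ?_
  have h := congrArg ((ι : periplectic n →ₗ[ℂ] Up n).rTensor B) (hf u hu)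
  rw [map_zero] at h
  rw [← h]
  generalize underlying comul u = w
  induction w with
  | zero => simp
  | tmul a b => rfl
  | add a b ha hb => simp only [map_add, ha, hb]

end Up

/-! ### Modules and algebras over `ℂ[[ħ]]` -/

open PowerSeries in
theorem PowerSeries.exists_eq_C_add_X_mul {R : Type*} [CommRing R] (f : PowerSeries R) :
    ∃ g, f = C (constantCoeff f) + X * g :=
  ⟨_, by rw [add_comm]; exact eq_X_mul_shift_add_const f⟩

/-- Descent to integral forms: if `F` maps generators and scalars into the subring `B`, it maps all
of `A` there, and injectivity of `J` makes the lift a homomorphism. It yields the coproduct, the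
counit and the vector representation of the forms. -/
theorem exists_algHom_lift {O A B C : Type*} [CommRing O] [Ring A] [Algebra O A] [Ring B]
    [Algebra O B] [Ring C] (F : A →+* C) {J : B →+* C} (hJ : Function.Injective J) {G : Set A}
    (hG : Algebra.adjoin O G = ⊤) (hF : ∀ g ∈ G, ∃ b, J b = F g)
    (hr : ∀ r : O, J (algebraMap O B r) = F (algebraMap O A r)) :
    ∃ f : A →ₐ[O] B, ∀ a, J (f a) = F a := by
  have h (a : A) : ∃ b, J b = F a := by
    have ha : a ∈ Algebra.adjoin O G := hG ▸ Algebra.mem_top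
    induction ha using Algebra.adjoin_induction with
    | mem g hg => exact hF g hg
    | algebraMap r => exact ⟨_, hr r⟩
    | add x y _ _ hx hy =>
      obtain ⟨b, hb⟩ := hx
      obtain ⟨c, hc⟩ := hy
      exact ⟨b + c, by rw [map_add, hb, hc, map_add]⟩
    | mul x y _ _ hx hy =>
      obtain ⟨b, hb⟩ := hx
      obtain ⟨c, hc⟩ := hy
      exact ⟨b * c, by rw [map_mul, hb, hc, map_mul]⟩
  choose f hf using h
  exact ⟨{ toFun := f
           map_one' := hJ (by rw [hf, map_one, map_one])
           map_mul' := fun a b => hJ (by rw [hf, map_mul, map_mul, hf, hf])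
           map_zero' := hJ (by rw [hf, map_zero, map_zero])
           map_add' := fun a b => hJ (by rw [hf, map_add, map_add, hf, hf])
           commutes' := fun r => hJ (by rw [hf, hr]) }, hf⟩

/-- A module inside a vector space over a field extension of `O` is torsion-free, and torsion-free
modules over a Dedekind domain are flat. -/
theorem flat_of_injective {O K M V : Type*} [CommRing O] [IsDedekindDomain O] [Field K] [Algebra O K]
    [FaithfulSMul O K] [Ring M] [Algebra O M] [Ring V] [Algebra K V] (f : M →ₛₗ[algebraMap O K] V)
    (hf : Function.Injective f) : Module.Flat O M := by
  have : Module.IsTorsionFree O M :=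
    ⟨fun r hr x y h => hf (smul_right_injective V ((map_ne_zero_iff _
      (FaithfulSMul.algebraMap_injective O K)).2 hr.ne_zero) (by
        change algebraMap O K r • f x = algebraMap O K r • f y
        rw [← map_smulₛₗ, ← map_smulₛₗ]
        exact congrArg f h))⟩
  infer_instance

/-- Flatness gives injectivity of `M ⊗ M → M ⊗ V → V ⊗ V` over `O`. Over a localization, tensor
products of vector spaces agree with those over `O`. -/
theorem tensor_map_injective {O K M V : Type*} [CommRing O] [Field K] [Algebra O K] (S : Submonoid O)
    [IsLocalization S K] [Ring M] [Algebra O M] [Ring V] [Algebra O V] [Algebra K V]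
    [IsScalarTower O K V] [Module.Flat O M] [Module.Flat O V] (f : M →ₛₗ[algebraMap O K] V)
    (hf : Function.Injective f) : Function.Injective (TensorProduct.map f f) := by
  let g : M →ₗ[O] V :=
    { toFun := f
      map_add' := map_add f
      map_smul' := fun r x => by rw [map_smulₛₗ, algebraMap_smul]; rfl }
  let e := IsLocalization.moduleTensorEquiv S K V V
  have h1 : Function.Injective (g.lTensor M) := Module.Flat.lTensor_preserves_injective_linearMap g hf
  have h2 : Function.Injective (g.rTensor V) := Module.Flat.rTensor_preserves_injective_linearMap g hf
  have h3 (w : M ⊗[O] M) : e (TensorProduct.map f f w) = g.rTensor V (g.lTensor M w) := by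
    induction w with
    | zero => simp only [map_zero]
    | tmul a b => rfl
    | add a b ha hb => simp only [map_add, ha, hb]
  intro a b h
  have h' := congrArg e h
  rw [h3, h3] at h'
  exact h1 (h2 h')

/-! ### Reduction modulo `ħ` -/

section Reduction

variable (A : Type*) [Ring A] [Algebra (PowerSeries ℂ) A]

/-- Congruence modulo `ħ`. -/
def redCon : RingCon A where
  r a b := ∃ d, a = b + (PowerSeries.X : PowerSeries ℂ) • d
  iseqv :=
    { refl := fun a => ⟨0, by rw [smul_zero, add_zero]⟩
      symm := by
        rintro a b ⟨d, rfl⟩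
        exact ⟨-d, by rw [smul_neg, add_neg_cancel_right]⟩
      trans := by
        rintro a b c ⟨d, rfl⟩ ⟨e, rfl⟩
        exact ⟨e + d, by rw [smul_add, add_assoc]⟩ }
  add' := by
    rintro _ b _ c ⟨d, rfl⟩ ⟨e, rfl⟩
    exact ⟨d + e, by rw [smul_add]; abel⟩
  mul' := by
    rintro _ b _ c ⟨d, rfl⟩ ⟨e, rfl⟩
    refine ⟨d * c + b * e + (PowerSeries.X : PowerSeries ℂ) • (d * e), ?_⟩
    rw [add_mul, mul_add, mul_add, smul_mul_assoc, smul_mul_assoc, mul_smul_comm, mul_smul_comm,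
      smul_add, smul_add]
    abel

/-- The reduction `A / ħ A`. -/
def Red : Type _ := (redCon A).Quotient

instance : Ring (Red A) := inferInstanceAs (Ring (redCon A).Quotient)

namespace Red

variable {A}

/-- The reduction as a ring homomorphism. -/
def mkHom : A →+* Red A := (redCon A).mk'

theorem mkHom_surjective : Function.Surjective (mkHom : A →+* Red A) := (redCon A).mk'_surjective

theorem mkHom_eq_zero {a : A} : mkHom a = 0 ↔ ∃ d, a = (PowerSeries.X : PowerSeries ℂ) • d := by
  rw [← map_zero mkHom]
  change ((a : (redCon A).Quotient) = ((0 : A) : (redCon A).Quotient)) ↔ _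
  rw [RingCon.eq]
  change (∃ d, a = 0 + (PowerSeries.X : PowerSeries ℂ) • d) ↔ _
  simp only [zero_add]

instance : Algebra ℂ (Red A) :=
  RingHom.toAlgebra' (mkHom.comp ((algebraMap (PowerSeries ℂ) A).comp PowerSeries.C))
    fun c x => by
      obtain ⟨a, rfl⟩ := mkHom_surjective x
      rw [RingHom.comp_apply, RingHom.comp_apply, ← map_mul, ← map_mul, Algebra.commutes]

theorem smul_mkHom (c : ℂ) (a : A) : c • mkHom a = mkHom (PowerSeries.C c • a) := by
  rw [Algebra.smul_def, Algebra.smul_def, map_mul]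
  rfl

theorem mkHom_smul (r : PowerSeries ℂ) (a : A) :
    mkHom (r • a) = PowerSeries.constantCoeff r • mkHom a := by
  obtain ⟨g, hg⟩ := PowerSeries.exists_eq_C_add_X_mul r
  rw [smul_mkHom, ← sub_eq_zero, ← map_sub, mkHom_eq_zero]
  refine ⟨g • a, ?_⟩
  nth_rw 1 [hg]
  rw [add_smul, mul_smul, add_sub_cancel_left]

variable (A) in
/-- The reduction modulo `ħ`. -/
def mk : A →ₛₗ[(PowerSeries.constantCoeff : PowerSeries ℂ →+* ℂ)] Red A where
  toFun := mkHom
  map_add' := map_add mkHom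
  map_smul' := mkHom_smul

theorem mk_surjective : Function.Surjective (mk A) := mkHom_surjective

theorem mk_eq_zero {a : A} : mk A a = 0 ↔ ∃ d, a = (PowerSeries.X : PowerSeries ℂ) • d :=
  mkHom_eq_zero

theorem mk_one : mk A 1 = 1 := map_one mkHom

theorem mk_mul (a b : A) : mk A (a * b) = mk A a * mk A b := map_mul mkHom a b

/-- The universal property of the reduction. -/
def lift {B : Type*} [Ring B] [Algebra ℂ B] (F : A →+* B) (hF : ∀ (r : PowerSeries ℂ),
    F (algebraMap _ _ r) = algebraMap ℂ B (PowerSeries.constantCoeff r)) : Red A →ₐ[ℂ] B where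
  toRingHom := (redCon A).lift F (by
    rintro _ b ⟨d, rfl⟩
    change F (b + (PowerSeries.X : PowerSeries ℂ) • d) = F b
    rw [map_add, Algebra.smul_def, map_mul, hF, PowerSeries.constantCoeff_X, map_zero, zero_mul,
      add_zero])
  commutes' c := by
    change F (algebraMap (PowerSeries ℂ) A (PowerSeries.C c)) = _
    rw [hF, PowerSeries.constantCoeff_C]

theorem lift_mk {B : Type*} [Ring B] [Algebra ℂ B] (F : A →+* B) (hF) (a : A) :
    lift F hF (mk A a) = F a := rfl

variable [Superalgebra (PowerSeries ℂ) A]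

instance : Superalgebra ℂ (Red A) where
  parityHom := lift (mkHom.comp (Superalgebra.parity (PowerSeries ℂ) : A →ₐ[_] A).toRingHom)
    fun r => by
      change mkHom (Superalgebra.parity (PowerSeries ℂ) (algebraMap _ A r)) = _
      rw [AlgHom.commutes, Algebra.algebraMap_eq_smul_one, mkHom_smul, map_one,
        Algebra.algebraMap_eq_smul_one]
  parityHom_parityHom x := by
    obtain ⟨a, rfl⟩ := mkHom_surjective x
    change mkHom (Superalgebra.parity (PowerSeries ℂ) (Superalgebra.parity (PowerSeries ℂ) a)) = _
    rw [parity_parity]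

theorem isSuperHom_mk : IsSuperHom (mk A) := ⟨mk_one, mk_mul, fun _ => rfl⟩

/-- The comultiplication of the reduction. -/
def comul (H : SuperBialgebra (PowerSeries ℂ) A) : Red A →ₐ[ℂ] SuperTensor ℂ (Red A) :=
  lift ((isSuperHom_mk (A := A)).tensor.comp H.comul.toRingHom) fun r => by
    change isSuperHom_mk.tensor (H.comul (algebraMap _ A r)) = _
    rw [AlgHom.commutes, Algebra.algebraMap_eq_smul_one, IsSuperHom.tensor_smul, map_one,
      Algebra.algebraMap_eq_smul_one]

end Red

end Reduction

/-! ### The parameter `q` -/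

namespace HAdic

open PowerSeries

/-- `q = e ^ (ħ / 2)`. -/
def qO : PowerSeries ℂ := rescale (1 / 2) (exp ℂ)

/-- `q⁻¹ = e ^ (-ħ / 2)`. -/
def qO' : PowerSeries ℂ := rescale (1 / 2) (evalNegHom (exp ℂ))

theorem qO_mul : qO * qO' = 1 := by
  rw [qO, qO', ← map_mul, exp_mul_exp_neg_eq_one, map_one]

theorem constantCoeff_qO : constantCoeff qO = 1 := by
  rw [qO, ← coeff_zero_eq_constantCoeff_apply, coeff_rescale, coeff_exp]
  simp

theorem coeff_one_qO : coeff 1 qO = 1 / 2 := by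
  rw [qO, coeff_rescale, coeff_exp]
  simp

theorem constantCoeff_qO' : constantCoeff qO' = 1 := by
  rw [qO', ← coeff_zero_eq_constantCoeff_apply, coeff_rescale, evalNegHom, coeff_rescale,
    coeff_exp]
  simp

theorem coeff_one_qO' : coeff 1 qO' = -1 / 2 := by
  rw [qO', coeff_rescale, evalNegHom, coeff_rescale, coeff_exp]
  simp
  norm_num

/-- `(q - 1) / ħ`. -/
def g : PowerSeries ℂ := PowerSeries.mk fun p => coeff (p + 1) qO

/-- `(q⁻¹ - 1) / ħ`. -/
def g' : PowerSeries ℂ := PowerSeries.mk fun p => coeff (p + 1) qO'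

theorem qO_eq : qO = 1 + X * g := by
  rw [eq_X_mul_shift_add_const qO, constantCoeff_qO, map_one, add_comm]
  rfl

theorem qO'_eq : qO' = 1 + X * g' := by
  rw [eq_X_mul_shift_add_const qO', constantCoeff_qO', map_one, add_comm]
  rfl

theorem constantCoeff_g : constantCoeff g = 1 / 2 := by
  rw [g, ← coeff_zero_eq_constantCoeff_apply, coeff_mk, coeff_one_qO]

theorem constantCoeff_g' : constantCoeff g' = -1 / 2 := by
  rw [g', ← coeff_zero_eq_constantCoeff_apply, coeff_mk, coeff_one_qO']

theorem qO_sub : qO - qO' = X * (g - g') := by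
  rw [qO_eq, qO'_eq]
  ring

theorem constantCoeff_g_sub : constantCoeff (g - g') = 1 := by
  rw [map_sub, constantCoeff_g, constantCoeff_g']
  norm_num

theorem isUnit_g : IsUnit g := by
  rw [isUnit_iff_constantCoeff, constantCoeff_g]
  norm_num

theorem isUnit_g_sub : IsUnit (g - g') := by
  rw [isUnit_iff_constantCoeff, constantCoeff_g_sub]
  exact isUnit_one

/-- The embedding of `ℂ[[ħ]]` in `ℂ((ħ))`. -/
abbrev toK : PowerSeries ℂ →+* LaurentSeries ℂ := algebraMap (PowerSeries ℂ) (LaurentSeries ℂ)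

theorem toK_injective : Function.Injective toK := IsFractionRing.injective _ _

theorem qh_eq : qh = toK qO := rfl

theorem qh_mul : qh * toK qO' = 1 := by rw [qh_eq, ← map_mul, qO_mul, map_one]

theorem qh_ne_zero : qh ≠ 0 := left_ne_zero_of_mul_eq_one qh_mul

theorem qh_inv : qh⁻¹ = toK qO' := inv_eq_of_mul_eq_one_right qh_mul

theorem toK_X_ne_zero : toK X ≠ 0 := by
  rw [map_ne_zero_iff _ toK_injective]
  exact X_ne_zero

theorem qh_sub_one : qh - 1 = toK X * toK g := by
  rw [qh_eq, qO_eq, map_add, map_one, map_mul]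
  ring

theorem qh_sub_inv : qh - qh⁻¹ = toK X * toK (g - g') := by
  rw [qh_inv, qh_eq, ← map_sub, qO_sub, map_mul]

variable {n : ℕ}

theorem Braid_smat_map {R S : Type*} [CommRing R] [CommRing S] (f : R →+* S) (q q' : R) :
    (Braid.smat q q' (n := n)).map f = Braid.smat (f q) (f q') := by
  ext a b
  rw [Matrix.map_apply, Braid.smat, Braid.smat, Matrix.of_apply, Matrix.of_apply, units_smul_map,
    Braid.icoeff_eq, Braid.icoeff_eq]
  simp only [map_add, apply_ite f, map_sub, map_neg, map_zero, map_one]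

theorem Braid_rep_map {R S : Type*} [CommRing R] [CommRing S] (f : R →+* S) (q q' : R) (i j : Idx n) :
    (Braid.rep q q' i j).map f = Braid.rep (f q) (f q') i j := by
  ext a b
  rw [Matrix.map_apply, Braid.rep, Braid.rep, Matrix.of_apply, Matrix.of_apply, Matrix.of_apply,
    Matrix.of_apply, units_smul_map, Braid.icoeff_eq, Braid.icoeff_eq]
  simp only [map_add, apply_ite f, map_sub, map_neg, map_zero, map_one]

theorem Smat_qh : Smat (LaurentSeries ℂ) qh n = (Braid.smat qO qO').map toK := by
  rw [QEA.Smat_eq two_ne_zero, Braid_smat_map, qh_inv]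
  rfl

/-- At `q = 1` the parallel and contraction terms vanish and the braiding is the graded flip, whose
sign is cancelled by the one in `smat`. -/
theorem smat_one_one {R : Type*} [CommRing R] : Braid.smat (1 : R) 1 = (1 : Matrix (Idx n × Idx n) _ R) := by
  ext a b
  rw [Braid.smat, Matrix.of_apply, Braid.icoeff_eq, Matrix.one_apply]
  simp only [sub_self, neg_zero, ite_self, add_zero]
  by_cases h : a = b
  · subst h
    rw [if_pos ⟨rfl, rfl⟩, if_pos rfl]
    by_cases h1 : a.1 = a.2
    · rw [if_pos h1, h1]
      rcases zmod_two_cases a.2.2 with h | h <;> simp [h, sgn_zero, sgn_one, -uzpow_zero, -uzpow_one]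
    · rw [if_neg h1]
      by_cases h2 : a.1.1 = a.2.1
      · rw [if_pos h2, Idx.eq_neg_of_fst_eq h2 h1]
        have key : ∀ x : ZMod 2, x * (x + 1) = 0 := by decide
        simp [Idx.neg, key, sgn_zero, -uzpow_zero]
      · rw [if_neg h2]
        rcases zmod_two_cases a.1.2 with h | h <;> rcases zmod_two_cases a.2.2 with h' | h' <;>
          simp [h, h', sgn_zero, sgn_one, -uzpow_zero, -uzpow_one]
  · rw [if_neg h, if_neg, smul_zero]
    exact fun h' => h (Prod.ext h'.2 h'.1)

/-- `S` becomes the identity at `ħ = 0`, so its determinant over the power series has constant term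
`1`. -/
theorem isUnit_Smat_qh : IsUnit (Smat (LaurentSeries ℂ) qh n) := by
  have h : IsUnit (Braid.smat qO qO' (n := n)) := by
    rw [Matrix.isUnit_iff_isUnit_det, isUnit_iff_constantCoeff, RingHom.map_det]
    change IsUnit (Matrix.det ((Braid.smat qO qO').map _))
    rw [Braid_smat_map, constantCoeff_qO, constantCoeff_qO', smat_one_one, Matrix.det_one]
    exact isUnit_one
  rw [Smat_qh]
  exact h.map (RingHom.mapMatrix toK)

end HAdic

/-! ### The forms over `ℂ[[ħ]]` -/

namespace Uh

open HAdic

variable {n : ℕ} {b : Bool}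

theorem incl_injective (b : Bool) : Function.Injective (incl (n := n) b) := val_injective b

theorem isSuperHom_incl (b : Bool) : IsSuperHom (incl (n := n) b) := ⟨rfl, fun _ _ => rfl, fun _ => rfl⟩

instance : Module.Flat (PowerSeries ℂ) (UK n) :=
  flat_of_injective (K := LaurentSeries ℂ)
    { toFun := fun x : UK n => x
      map_add' := fun _ _ => rfl
      map_smul' := fun r x => (algebraMap_smul (LaurentSeries ℂ) r x).symm } fun _ _ h => h

instance (b : Bool) : Module.Flat (PowerSeries ℂ) (Uh n b) :=
  flat_of_injective (incl b) (incl_injective b)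

theorem X_smul_injective (b : Bool) :
    Function.Injective fun x : Uh n b => (PowerSeries.X : PowerSeries ℂ) • x :=
  smul_right_injective _ PowerSeries.X_ne_zero

/-- The inclusion as a ring homomorphism. -/
def valHom (b : Bool) : Uh n b →+* UK n := (val b).toRingHom

theorem incl_smul (r : PowerSeries ℂ) (x : Uh n b) : incl b (r • x) = toK r • incl b x :=
  map_smulₛₗ (incl b) r x

/-- The inclusion of the tensor square. -/
def inclTensor (b : Bool) : SuperTensor (PowerSeries ℂ) (Uh n b) →+*
    SuperTensor (LaurentSeries ℂ) (UK n) := (isSuperHom_incl b).tensor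

theorem inclTensor_injective (b : Bool) : Function.Injective (inclTensor (n := n) b) :=
  tensor_map_injective (Submonoid.powers (PowerSeries.X : PowerSeries ℂ)) (incl b)
    (incl_injective b)

variable (b) in
/-- The elements `(t_{ij} - δ_{ij}) / ħ`, up to signs. -/
def lam : Matrix (Idx n) (Idx n) (Uh n b) := Matrix.of fun i j =>
  if h : i.1 ≤ j.1 then
    if i = j then g • tau b i j h else sgn ((i.2 + 1) * j.2) • (g - g') • tau b i j h
  else 0

theorem lam_self (i : Idx n) : lam b i i = g • tau b i i le_rfl := by
  rw [lam, Matrix.of_apply, dif_pos le_rfl, if_pos rfl]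

theorem lam_of_ne {i j : Idx n} (h : i ≠ j) (hij : i.1 ≤ j.1) :
    lam b i j = sgn ((i.2 + 1) * j.2) • (g - g') • tau b i j hij := by
  rw [lam, Matrix.of_apply, dif_pos hij, if_neg h]

theorem lam_of_lt {i j : Idx n} (h : j.1 < i.1) : lam b i j = 0 := by
  rw [lam, Matrix.of_apply, dif_neg (not_le.2 h)]

theorem incl_lam (i j : Idx n) : toK PowerSeries.X • incl b (lam b i j) =
    QEA.tt qh i j - (1 : Matrix (Idx n) (Idx n) (UK n)) i j := by
  by_cases h : i = j
  · subst h
    have h1 : qh - 1 ≠ 0 := by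
      rw [qh_sub_one]
      exact mul_ne_zero toK_X_ne_zero ((map_ne_zero_iff _ toK_injective).2 isUnit_g.ne_zero)
    rw [lam_self, incl_smul, Matrix.one_apply_eq, QEA.tt_diag]
    refine (mul_smul (toK PowerSeries.X) (toK g) (QEA.tau qh i i)).symm.trans ?_
    rw [← qh_sub_one]
    rw [QEA.tau, if_pos rfl, smul_inv_smul₀ h1]
  · rw [Matrix.one_apply_ne h, sub_zero]
    by_cases hij : i.1 ≤ j.1
    · have h1 : qh - qh⁻¹ ≠ 0 := by
        rw [qh_sub_inv]
        exact mul_ne_zero toK_X_ne_zero ((map_ne_zero_iff _ toK_injective).2 isUnit_g_sub.ne_zero)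
      rw [lam_of_ne h hij, units_smul_map, incl_smul, smul_comm (toK _), QEA.tt_apply]
      refine congrArg _ ((mul_smul (toK PowerSeries.X) (toK (g - g'))
        (QEA.tau qh i j)).symm.trans ?_)
      rw [← qh_sub_inv, QEA.tau, if_neg h, smul_inv_smul₀ h1]
    · rw [lam_of_lt (not_le.1 hij), map_zero, smul_zero, QEA.tt_lower qh i j (not_le.1 hij)]

variable (b) in
/-- The matrix of the `t_{ij}`, up to signs. -/
def tt : Matrix (Idx n) (Idx n) (Uh n b) := 1 + (PowerSeries.X : PowerSeries ℂ) • lam b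

theorem tt_apply (i j : Idx n) : tt b i j = (1 : Matrix (Idx n) (Idx n) (Uh n b)) i j +
    (PowerSeries.X : PowerSeries ℂ) • lam b i j := rfl

theorem incl_one_apply (i j : Idx n) : incl b ((1 : Matrix (Idx n) (Idx n) (Uh n b)) i j) =
    (1 : Matrix (Idx n) (Idx n) (UK n)) i j := by
  rw [Matrix.one_apply, Matrix.one_apply, apply_ite (incl b), map_zero, (isSuperHom_incl b).map_one]

theorem incl_tt (i j : Idx n) : incl b (tt b i j) = QEA.tt qh i j := by
  rw [tt_apply, map_add, incl_smul, incl_lam, incl_one_apply, add_sub_cancel]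

theorem tt_map : (tt b).map (valHom b) = (QEA.tt qh : Matrix (Idx n) (Idx n) (UK n)) := by
  ext i j
  exact incl_tt i j

theorem isRTT_tt : IsRTT (Braid.smat qO qO' (n := n)) (tt b) := by
  have hS : ((Braid.smat qO qO' (n := n)).map (algebraMap _ (Uh n b))).map (valHom b) =
      (Smat (LaurentSeries ℂ) qh n).map (algebraMap _ (UK n)) := by
    rw [Smat_qh]
    ext x y
    change val b (algebraMap (PowerSeries ℂ) (Uh n b) _) =
      algebraMap (LaurentSeries ℂ) (UK n) (algebraMap (PowerSeries ℂ) (LaurentSeries ℂ) _)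
    rw [AlgHom.commutes, ← IsScalarTower.algebraMap_apply]
  have hmul (X Y : Matrix (Idx n × Idx n) (Idx n × Idx n) (Uh n b)) :
      (X * Y).map (valHom b) = X.map (valHom b) * Y.map (valHom b) :=
    map_mul (valHom b).mapMatrix X Y
  have h := QEA.isRTT_tt (n := n) qh
  rw [IsRTT, ← hS, ← tt_map (b := b), ← leg1_map, ← leg2_map, ← hmul, ← hmul, ← hmul, ← hmul] at h
  exact Matrix.map_injective (val_injective b) h

theorem lam_mem (i j : Idx n) : lam b i j ∈ part (PowerSeries ℂ) (Uh n b) (i.2 + j.2) := by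
  have h : ∀ hij, tau b i j hij ∈ part (PowerSeries ℂ) (Uh n b) (i.2 + j.2) := fun hij => by
    rw [mem_part]
    apply val_injective b
    rw [units_smul_map]
    exact QEA.parity_tau qh i j
  rw [lam, Matrix.of_apply]
  split_ifs with h1 h2
  · exact Submodule.smul_mem _ _ (h _)
  · rw [Units.smul_def]
    exact zsmul_mem (Submodule.smul_mem _ _ (h _)) _
  · exact zero_mem _

/-- The generator `t_{ii}⁻¹`. -/
def tinv (i : Idx n) : Uh n true := ⟨QEA.tinv qh i, Algebra.subset_adjoin (Or.inr ⟨rfl, i, rfl⟩)⟩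

theorem incl_tinv (i : Idx n) : incl true (tinv i) = QEA.tinv qh i := rfl

variable (n b) in
/-- Generators of the form. -/
def gens : Set (Uh n b) := {x | (∃ i j, x = lam b i j) ∨ b = true ∧ ∃ i, incl b x = QEA.tinv qh i}

variable (n b) in
theorem adjoin_gens : Algebra.adjoin (PowerSeries ℂ) (gens n b) = ⊤ := by
  rw [eq_top_iff]
  rintro ⟨x, hx⟩ -
  refine Algebra.adjoin_induction (p := fun x hx =>
    (⟨x, hx⟩ : Uh n b) ∈ Algebra.adjoin (PowerSeries ℂ) (gens n b)) ?_ ?_ ?_ ?_ hx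
  · rintro x (⟨i, j, hij, rfl⟩ | ⟨hb, i, rfl⟩)
    · change tau b i j hij ∈ Algebra.adjoin (PowerSeries ℂ) (gens n b)
      have hl : lam b i j ∈ Algebra.adjoin (PowerSeries ℂ) (gens n b) :=
        Algebra.subset_adjoin (Or.inl ⟨i, j, rfl⟩)
      by_cases e : i = j
      · subst e
        obtain ⟨v, hv⟩ := isUnit_g.exists_left_inv
        rw [lam_self] at hl
        have := Subalgebra.smul_mem _ hl v
        rwa [smul_smul, hv, one_smul] at this
      · obtain ⟨v, hv⟩ := isUnit_g_sub.exists_left_inv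
        rw [lam_of_ne e hij, Units.smul_def] at hl
        have := Subalgebra.smul_mem _ (zsmul_mem hl (sgn ((i.2 + 1) * j.2) : ℤˣ)) v
        rwa [← Units.smul_def, ← Units.smul_def, smul_smul, Int.units_mul_self, one_smul, smul_smul,
          hv, one_smul] at this
    · exact Algebra.subset_adjoin (Or.inr ⟨hb, i, rfl⟩)
  · exact fun r => (Algebra.adjoin (PowerSeries ℂ) (gens n b)).algebraMap_mem r
  · exact fun x y _ _ hx hy => (Algebra.adjoin (PowerSeries ℂ) (gens n b)).add_mem hx hy
  · exact fun x y _ _ hx hy => (Algebra.adjoin (PowerSeries ℂ) (gens n b)).mul_mem hx hy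

/-- The expansion of `∑ t ⊗ t` for `t = 1 + x M`. Everything beyond the constant term is a multiple
of `x`, which is why the coproduct of `(t - 1) / ħ` is integral. -/
theorem sum_one_add_tmul {R A : Type*} [CommRing R] [Ring A] [Algebra R A] (x : R)
    (M : Matrix (Idx n) (Idx n) A) (i j : Idx n) :
    ∑ k, ((1 : Matrix (Idx n) (Idx n) A) i k + x • M i k) ⊗ₜ[R]
      ((1 : Matrix (Idx n) (Idx n) A) k j + x • M k j) =
    (1 : Matrix (Idx n) (Idx n) A) i j ⊗ₜ[R] 1 +
      x • (M i j ⊗ₜ[R] 1 + 1 ⊗ₜ[R] M i j + x • ∑ k, M i k ⊗ₜ[R] M k j) := by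
  simp only [TensorProduct.add_tmul, TensorProduct.tmul_add, Finset.sum_add_distrib,
    Matrix.one_apply, TensorProduct.ite_tmul, TensorProduct.tmul_ite, Finset.sum_ite_eq,
    Finset.sum_ite_eq', Finset.mem_univ, if_true, TensorProduct.tmul_smul,
    ← TensorProduct.smul_tmul', smul_add, ← Finset.smul_sum]
  abel

variable (b) in
/-- The coproduct of `lam`. -/
def comulLam (i j : Idx n) : Uh n b ⊗[PowerSeries ℂ] Uh n b :=
  lam b i j ⊗ₜ 1 + 1 ⊗ₜ lam b i j +
    (PowerSeries.X : PowerSeries ℂ) • ∑ k, lam b i k ⊗ₜ lam b k j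

/-- After multiplication by `ħ`, which is injective over the field, the formula becomes the
coproduct of the matrix `tt`. -/
theorem map_incl_comulLam (i j : Idx n) : TensorProduct.map (incl b) (incl b) (comulLam b i j) =
    (QEA.superBialgebra qh n).Δ (incl b (lam b i j)) := by
  have hx := toK_X_ne_zero
  apply smul_right_injective _ hx
  change toK PowerSeries.X • _ = toK PowerSeries.X • _
  rw [← map_smul (QEA.superBialgebra qh n).Δ, incl_lam, map_sub]
  change _ = underlying (QEA.comul qh n) (QEA.tt qh i j) - underlying (QEA.comul qh n) _
  have h1 : underlying (QEA.comul qh n) ((1 : Matrix (Idx n) (Idx n) (UK n)) i j) =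
      (1 : Matrix (Idx n) (Idx n) (UK n)) i j ⊗ₜ[LaurentSeries ℂ] 1 := by
    rw [Matrix.one_apply, apply_ite (underlying (QEA.comul qh n)), map_zero,
      underlying_map_one, TensorProduct.ite_tmul]
  have h2 (i j : Idx n) : QEA.tt qh i j = (1 : Matrix (Idx n) (Idx n) (UK n)) i j +
      toK PowerSeries.X • incl b (lam b i j) := by
    rw [incl_lam, add_sub_cancel]
  rw [h1, QEA.underlying_comul_tt, Finset.sum_congr rfl fun k _ => by rw [h2 i k, h2 k j]]
  have h3 := sum_one_add_tmul (R := LaurentSeries ℂ) (toK PowerSeries.X)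
    (Matrix.of fun i j => incl b (lam b i j)) i j
  simp only [Matrix.of_apply] at h3
  rw [h3, add_sub_cancel_left, comulLam, map_add, map_add, map_smulₛₗ, map_sum]
  simp only [TensorProduct.map_tmul, (isSuperHom_incl b).map_one]

theorem counit_incl_lam (i j : Idx n) :
    (QEA.superBialgebra qh n).counit (incl b (lam b i j)) = 0 := by
  apply smul_right_injective _ toK_X_ne_zero
  change toK PowerSeries.X • _ = toK PowerSeries.X • _
  rw [← map_smul (QEA.superBialgebra qh n).counit, incl_lam, smul_zero, map_sub]
  change QEA.counit qh n _ - QEA.counit qh n _ = 0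
  rw [QEA.counit_tt, sub_eq_zero, Matrix.one_apply, Matrix.one_apply]
  split_ifs
  · rw [map_one]
  · rw [map_zero]

variable (n b) in
/-- The superbialgebra structure of `QEA` restricts to the form. -/
theorem exists_superBialgebra : ∃ H : SuperBialgebra (PowerSeries ℂ) (Uh n b),
    IsRestriction H (QEA.superBialgebra qh n) := by
  -- The structure maps descend from the field because their values on generators are integral. The
  -- relation to the field version is used to evaluate them on generators, where the axioms are then
  -- verified.
  obtain ⟨Δ, hΔ⟩ := exists_algHom_lift (O := PowerSeries ℂ)
    ((QEA.comul qh n).toRingHom.comp (valHom b)) (inclTensor_injective b) (adjoin_gens n b)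
    (by
      rintro x (⟨i, j, rfl⟩ | ⟨hb, i, hi⟩)
      · exact ⟨_, map_incl_comulLam i j⟩
      · refine ⟨x ᵍ⊗ₜ x, ?_⟩
        change incl b x ᵍ⊗ₜ[LaurentSeries ℂ] incl b x = QEA.comul qh n (incl b x)
        rw [hi, QEA.comul_tinv])
    (fun r => by
      change inclTensor b (algebraMap _ _ r) = QEA.comul qh n (val b (algebraMap _ _ r))
      rw [AlgHom.commutes, IsScalarTower.algebraMap_apply (PowerSeries ℂ) (LaurentSeries ℂ) (UK n),
        AlgHom.commutes, Algebra.algebraMap_eq_smul_one, Algebra.algebraMap_eq_smul_one]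
      exact ((isSuperHom_incl b).tensor_smul r 1).trans (by rw [map_one]))
  obtain ⟨ε, hε⟩ := exists_algHom_lift (O := PowerSeries ℂ) (B := PowerSeries ℂ)
    ((QEA.counit qh n).toRingHom.comp (valHom b)) toK_injective (adjoin_gens n b)
    (by
      rintro x (⟨i, j, rfl⟩ | ⟨hb, i, hi⟩)
      · exact ⟨0, (map_zero _).trans (counit_incl_lam i j).symm⟩
      · refine ⟨1, ?_⟩
        change _ = QEA.counit qh n (incl b x)
        rw [hi, QEA.counit_tinv, map_one])
    (fun r => by
      change _ = QEA.counit qh n (val b (algebraMap _ _ r))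
      rw [AlgHom.commutes, IsScalarTower.algebraMap_apply (PowerSeries ℂ) (LaurentSeries ℂ) (UK n),
        AlgHom.commutes]
      rfl)
  have hΔ1 (x : Uh n b) : TensorProduct.map (incl b) (incl b) (underlying Δ x) =
      (QEA.superBialgebra qh n).Δ (incl b x) := hΔ x
  have hε1 (x : Uh n b) : toK (ε x) = (QEA.superBialgebra qh n).counit (incl b x) := hε x
  have hinj : Function.Injective (TensorProduct.map (incl (n := n) b) (incl b)) :=
    inclTensor_injective b
  have hΔl (i j : Idx n) : underlying Δ (lam b i j) = comulLam b i j :=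
    hinj ((hΔ1 _).trans (map_incl_comulLam i j).symm)
  have hΔi (x : Uh n b) (i : Idx n) (hx : incl b x = QEA.tinv qh i) : underlying Δ x = x ⊗ₜ x := by
    apply hinj
    rw [hΔ1, TensorProduct.map_tmul, hx]
    exact QEA.underlying_comul_tinv i
  have hεl (i j : Idx n) : ε (lam b i j) = 0 := by
    apply toK_injective
    rw [hε1, counit_incl_lam, map_zero]
  have hεi (x : Uh n b) (i : Idx n) (hx : incl b x = QEA.tinv qh i) : ε x = 1 := by
    apply toK_injective
    rw [hε1, hx, map_one]
    exact QEA.counit_tinv i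
  have hone : underlying Δ (1 : Uh n b) = 1 ⊗ₜ 1 := underlying_map_one Δ
  refine ⟨SuperBialgebra.ofGenerators (adjoin_gens n b) Δ ε ?_ ?_ ?_ ?_ ?_, hΔ1, hε1⟩
  · intro x _
    rw [ST.parity_eq]
    apply inclTensor_injective b
    change TensorProduct.map (incl b) (incl b) (underlying Δ (Superalgebra.parity (PowerSeries ℂ) x)) =
      TensorProduct.map (incl b) (incl b) (TensorProduct.map _ _ (underlying Δ x))
    rw [hΔ1, (isSuperHom_incl b).map_parity, SuperBialgebra.Δ_parity, ← hΔ1]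
    generalize underlying Δ x = w
    induction w with
    | zero => simp only [map_zero]
    | tmul c d => rfl
    | add c d hc hd => simp only [map_add, hc, hd]
  · intro x _
    apply toK_injective
    rw [hε1, hε1, (isSuperHom_incl b).map_parity, SuperBialgebra.counit_parity]
  · rintro x (⟨i, j, rfl⟩ | ⟨hb, i, hi⟩)
    · rw [hΔl, comulLam]
      simp only [map_add, map_smul, map_sum, LinearMap.rTensor_tmul, LinearMap.lTensor_tmul, hΔl,
        hone, comulLam, TensorProduct.add_tmul, TensorProduct.tmul_add, TensorProduct.sum_tmul,
        TensorProduct.tmul_sum, TensorProduct.assoc_tmul, Finset.sum_add_distrib, smul_add,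
        ← TensorProduct.smul_tmul', TensorProduct.tmul_smul, ← Finset.smul_sum]
      rw [Finset.sum_comm]
      abel
    · rw [hΔi x i hi, LinearMap.rTensor_tmul, LinearMap.lTensor_tmul, hΔi x i hi,
        TensorProduct.assoc_tmul]
  · rintro x (⟨i, j, rfl⟩ | ⟨hb, i, hi⟩)
    · rw [hΔl, comulLam]
      simp [hεl]
    · rw [hΔi x i hi, LinearMap.rTensor_tmul, AlgHom.toLinearMap_apply, hεi x i hi,
        TensorProduct.lid_tmul, one_smul]
  · rintro x (⟨i, j, rfl⟩ | ⟨hb, i, hi⟩)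
    · rw [hΔl, comulLam]
      simp [hεl]
    · rw [hΔi x i hi, LinearMap.lTensor_tmul, AlgHom.toLinearMap_apply, hεi x i hi,
        TensorProduct.rid_tmul, one_smul]

end Uh

/-! ### Restriction of the antipode to the form with inverses -/

section

variable {R A R' A' : Type*} [CommRing R] [Ring A] [Algebra R A] [Superalgebra R A]
  [CommRing R'] [Ring A'] [Algebra R' A'] [Superalgebra R' A'] {σ : R →+* R'}
  [Invertible (2 : R)] [Invertible (2 : R')]

theorem IsSuperHom.map_proj {f : A →ₛₗ[σ] A'} (hf : IsSuperHom f) (i : ZMod 2) (a : A) :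
    f (proj (R := R) i a) = proj (R := R') i (f a) := by
  nth_rw 2 [← proj_add_proj (R := R) a]
  rw [map_add, map_add, proj_of_mem (hf.map_mem (proj_mem 0 a)),
    proj_of_mem (hf.map_mem (proj_mem 1 a))]
  rcases zmod_two_cases i with rfl | rfl <;> simp

theorem IsSuperAnti.map_proj {S : A →ₗ[R] A} (hS : IsSuperAnti S) (i : ZMod 2) (a : A) :
    S (proj (R := R) i a) = proj (R := R) i (S a) := by
  rw [proj_apply, proj_apply, map_smul, map_add, units_smul_map, hS.map_parity]

/-- The sign rule for arbitrary elements, by splitting `b` into components: an odd component of `b`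
contributes the parity operator on `S a`. This form suits inductions in which the factors are not
homogeneous. -/
theorem IsSuperAnti.map_mul_eq {S : A →ₗ[R] A} (hS : IsSuperAnti S) (a b : A) :
    S (a * b) = proj (R := R) 0 (S b) * S a + proj (R := R) 1 (S b) * parity R (S a) := by
  have h (i : ZMod 2) : S (a * proj (R := R) i b) = if i = 0 then S (proj (R := R) i b) * S a else
      S (proj (R := R) i b) * S (parity R a) := by
    refine induction_homog R (P := fun a => S (a * proj (R := R) i b) =
      if i = 0 then S (proj (R := R) i b) * S a else S (proj (R := R) i b) * S (parity R a))
      (fun j a ha => ?_) (fun x y hx hy => ?_) a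
    · rw [hS.map_mul ha (proj_mem i b), parity_of_mem ha, units_smul_map, mul_smul_comm]
      rcases zmod_two_cases i with rfl | rfl <;> simp
    · rw [add_mul, map_add, hx, hy]
      split_ifs
      · rw [map_add, mul_add]
      · rw [map_add, map_add, mul_add]
  nth_rw 1 [← proj_add_proj (R := R) b]
  rw [mul_add, map_add, h, h, if_pos rfl, if_neg one_ne_zero, hS.map_proj, hS.map_proj,
    hS.map_parity]

theorem IsSuperHom.map_mul'_rTensor {f : A →ₛₗ[σ] A'} (hf : IsSuperHom f) {S : A →ₗ[R] A}
    {S' : A' →ₗ[R'] A'} (hS : ∀ a, f (S a) = S' (f a)) (w : A ⊗[R] A) :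
    f (LinearMap.mul' R A (S.rTensor A w)) =
      LinearMap.mul' R' A' (S'.rTensor A' (TensorProduct.map f f w)) := by
  induction w with
  | zero => simp only [map_zero]
  | tmul c d =>
    rw [LinearMap.rTensor_tmul, TensorProduct.map_tmul, LinearMap.rTensor_tmul,
      LinearMap.mul'_apply, LinearMap.mul'_apply, hf.map_mul, hS]
  | add c d hc hd => simp only [map_add, hc, hd]

theorem IsSuperHom.map_mul'_lTensor {f : A →ₛₗ[σ] A'} (hf : IsSuperHom f) {S : A →ₗ[R] A}
    {S' : A' →ₗ[R'] A'} (hS : ∀ a, f (S a) = S' (f a)) (w : A ⊗[R] A) :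
    f (LinearMap.mul' R A (S.lTensor A w)) =
      LinearMap.mul' R' A' (S'.lTensor A' (TensorProduct.map f f w)) := by
  induction w with
  | zero => simp only [map_zero]
  | tmul c d =>
    rw [LinearMap.lTensor_tmul, TensorProduct.map_tmul, LinearMap.lTensor_tmul,
      LinearMap.mul'_apply, LinearMap.mul'_apply, hf.map_mul, hS]
  | add c d hc hd => simp only [map_add, hc, hd]

end

namespace Uh

open HAdic

variable {n : ℕ} {b : Bool}

theorem Δ_lam {H : SuperBialgebra (PowerSeries ℂ) (Uh n b)}
    (hH : IsRestriction H (QEA.superBialgebra qh n)) (i j : Idx n) : H.Δ (lam b i j) = comulLam b i j :=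
  inclTensor_injective b ((hH.comul _).trans (map_incl_comulLam i j).symm)

theorem Δ_of_incl_eq {H : SuperBialgebra (PowerSeries ℂ) (Uh n b)}
    (hH : IsRestriction H (QEA.superBialgebra qh n)) {x : Uh n b} {i : Idx n} (hx : incl b x = QEA.tinv qh i) :
    H.Δ x = x ⊗ₜ x := by
  apply inclTensor_injective b
  refine (hH.comul _).trans ?_
  change _ = TensorProduct.map (incl b) (incl b) (x ⊗ₜ x)
  rw [TensorProduct.map_tmul, hx]
  exact QEA.underlying_comul_tinv i

theorem counit_lam {H : SuperBialgebra (PowerSeries ℂ) (Uh n b)}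
    (hH : IsRestriction H (QEA.superBialgebra qh n)) (i j : Idx n) : H.counit (lam b i j) = 0 := by
  apply toK_injective
  rw [hH.counit, counit_incl_lam, map_zero]

theorem counit_of_incl_eq {H : SuperBialgebra (PowerSeries ℂ) (Uh n b)}
    (hH : IsRestriction H (QEA.superBialgebra qh n)) {x : Uh n b} {i : Idx n} (hx : incl b x = QEA.tinv qh i) :
    H.counit x = 1 := by
  apply toK_injective
  rw [hH.counit, hx, map_one]
  exact QEA.counit_tinv i

theorem tt_mul_tinv (i : Idx n) : tt true i i * tinv i = 1 := by
  apply incl_injective true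
  rw [(isSuperHom_incl true).map_mul, incl_tt, incl_tinv, (isSuperHom_incl true).map_one,
    QEA.tt_mul_tinv]

theorem tinv_mul_tt (i : Idx n) : tinv i * tt true i i = 1 := by
  apply incl_injective true
  rw [(isSuperHom_incl true).map_mul, incl_tt, incl_tinv, (isSuperHom_incl true).map_one,
    QEA.tinv_mul_tt]

theorem tt_triangular (i j : Idx n) (hij : i ≠ j) (hh : ¬ i.height < j.height) : tt b i j = 0 := by
  apply incl_injective b
  rw [incl_tt, map_zero, (QEA.isQuantumMatrix_tt qh).triangular i j hij hh]

/-- From `M (1 + ħ λ) = 1` one gets `M - 1 = -ħ M λ`. Thus the antipode of `λ = (t - 1) / ħ` is `-M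
λ`, which lies in the form. -/
theorem exists_mul_lam : ∃ M : Matrix (Idx n) (Idx n) (Uh n true), M * tt true = 1 ∧
    tt true * M = 1 ∧ ∀ i j, M i j = (1 : Matrix (Idx n) (Idx n) (Uh n true)) i j -
      (PowerSeries.X : PowerSeries ℂ) • (M * lam true : Matrix (Idx n) (Idx n) (Uh n true)) i j := by
  obtain ⟨M, h1, h2, -, -⟩ := exists_inverse_of_triangular tt_mul_tinv tinv_mul_tt
    (tt_triangular (n := n))
  refine ⟨M, h2, h1, fun i j => ?_⟩
  rw [← h2, tt, mul_add, mul_one, Matrix.mul_smul, Matrix.add_apply, Matrix.smul_apply,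
    add_sub_cancel_right]

/-- The antipode of `QEA` restricts to the form which contains the inverses. -/
theorem exists_hopfSuperalgebra (HK : HopfSuperalgebra (LaurentSeries ℂ) (UK n))
    (h1 : HK.toSuperBialgebra = QEA.superBialgebra qh n) (h2 : IsSuperAnti HK.antipode)
    (h3 : ∀ i, HK.antipode (QEA.tinv qh i) = QEA.tt qh i i)
    (h4 : ∃ M : Matrix (Idx n) (Idx n) (UK n), M * QEA.tt qh = 1 ∧ QEA.tt qh * M = 1 ∧
        ∀ i j, HK.antipode (QEA.tt qh i j) = M i j) :
    ∃ H : HopfSuperalgebra (PowerSeries ℂ) (Uh n true),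
      IsRestriction H.toSuperBialgebra (QEA.superBialgebra qh n) ∧
      (∀ x, incl true (H.antipode x) = HK.antipode (incl true x)) ∧ IsSuperAnti H.antipode := by
  obtain ⟨H, hH⟩ := exists_superBialgebra n true
  obtain ⟨M, hM1, hM2, hM⟩ := h4
  obtain ⟨M', hM1', hM2', hM'⟩ := exists_mul_lam (n := n)
  have hMM (i j : Idx n) : incl true (M' i j) = M i j := by
    have e : M'.map (valHom true) * (QEA.tt qh : Matrix (Idx n) (Idx n) (UK n)) = 1 := by
      rw [← tt_map (b := true)]
      refine (map_mul (valHom true).mapMatrix M' (tt true)).symm.trans ?_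
      rw [hM1', map_one]
    have := left_inv_eq_right_inv e hM2
    exact congrFun (congrFun this i) j
  have hex (x : Uh n true) : ∃ y, incl true y = HK.antipode (incl true x) := by
    have hx : x ∈ Algebra.adjoin (PowerSeries ℂ) (gens n true) := by
      rw [adjoin_gens]
      exact Algebra.mem_top
    induction hx using Algebra.adjoin_induction with
    | mem x hx =>
      obtain ⟨i, j, rfl⟩ | ⟨-, i, hi⟩ := hx
      · refine ⟨-(M' * lam true : Matrix (Idx n) (Idx n) (Uh n true)) i j, ?_⟩
        apply smul_right_injective _ toK_X_ne_zero
        change toK PowerSeries.X • _ = toK PowerSeries.X • _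
        rw [← incl_smul, ← map_smul HK.antipode, incl_lam, map_sub, hM, smul_neg, ← hMM,
          ← incl_one_apply (b := true), show HK.antipode (incl true
            ((1 : Matrix (Idx n) (Idx n) (Uh n true)) i j)) =
            incl true ((1 : Matrix (Idx n) (Idx n) (Uh n true)) i j) by
              rw [incl_one_apply, Matrix.one_apply]
              split_ifs
              · exact h2.map_one
              · exact map_zero _, ← map_sub, hM' i j, sub_sub_cancel_left]
      · exact ⟨tt true i i, by rw [hi, h3, incl_tt]⟩
    | algebraMap r =>
      refine ⟨algebraMap _ _ r, ?_⟩
      rw [Algebra.algebraMap_eq_smul_one, incl_smul, (isSuperHom_incl true).map_one, map_smul,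
        h2.map_one]
    | add x y _ _ hx hy =>
      obtain ⟨x', hx⟩ := hx
      obtain ⟨y', hy⟩ := hy
      exact ⟨x' + y', by rw [map_add, hx, hy, map_add, map_add]⟩
    | mul x y _ _ hx hy =>
      obtain ⟨x', hx⟩ := hx
      obtain ⟨y', hy⟩ := hy
      refine ⟨proj (R := PowerSeries ℂ) 0 y' * x' + proj (R := PowerSeries ℂ) 1 y' *
        Superalgebra.parity (PowerSeries ℂ) x', ?_⟩
      rw [(isSuperHom_incl true).map_mul, h2.map_mul_eq, ← hx, ← hy, map_add,
        (isSuperHom_incl true).map_mul, (isSuperHom_incl true).map_mul,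
        (isSuperHom_incl true).map_proj, (isSuperHom_incl true).map_proj,
        (isSuperHom_incl true).map_parity]
  choose S hS using hex
  let S' : Uh n true →ₗ[PowerSeries ℂ] Uh n true :=
    { toFun := S
      map_add' := fun x y => incl_injective true (by
        rw [hS, map_add, map_add, map_add, hS, hS])
      map_smul' := fun r x => incl_injective true (by
        rw [hS, incl_smul, map_smul, RingHom.id_apply, incl_smul, hS]) }
  -- The antipode axioms for `S'` follow from those over the field, because the inclusion is
  -- injective and respects products and coproducts.
  have hS' (x) : incl true (S' x) = HK.antipode (incl true x) := hS x
  have key3 (r : PowerSeries ℂ) : incl true (algebraMap (PowerSeries ℂ) (Uh n true) r) =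
      algebraMap (LaurentSeries ℂ) (UK n) (toK r) := by
    rw [Algebra.algebraMap_eq_smul_one (A := Uh n true), incl_smul,
      (isSuperHom_incl true).map_one]
    exact (Algebra.algebraMap_eq_smul_one (A := UK n) _).symm
  refine ⟨{ H with
    antipode := S'
    antipode_parity := fun x => incl_injective true (by
      rw [hS', (isSuperHom_incl true).map_parity, (isSuperHom_incl true).map_parity,
        HK.antipode_parity, hS'])
    antipode_left := fun x => incl_injective true (by
      have := HK.antipode_left (incl true x)
      rw [h1] at this
      rw [(isSuperHom_incl true).map_mul'_rTensor hS', key3, hH.counit, ← this]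
      exact congrArg _ (congrArg _ (hH.comul x)))
    antipode_right := fun x => incl_injective true (by
      have := HK.antipode_right (incl true x)
      rw [h1] at this
      rw [(isSuperHom_incl true).map_mul'_lTensor hS', key3, hH.counit, ← this]
      exact congrArg _ (congrArg _ (hH.comul x))) }, hH, hS', ?_⟩
  refine ⟨fun x => incl_injective true ?_, incl_injective true ?_, fun hx hy =>
    incl_injective true ?_⟩
  · rw [hS', (isSuperHom_incl true).map_parity, (isSuperHom_incl true).map_parity,
      HK.antipode_parity, hS']
  · rw [hS', (isSuperHom_incl true).map_one, h2.map_one]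
  · rw [hS', (isSuperHom_incl true).map_mul, h2.map_mul ((isSuperHom_incl true).map_mem hx)
      ((isSuperHom_incl true).map_mem hy), units_smul_map, (isSuperHom_incl true).map_mul, hS', hS']

end Uh

/-! ### The vector representation modulo `ħ` -/

namespace Braid

variable {R : Type*} [CommRing R] {n : ℕ}

/-- The off-diagonal entries of the vector representation, divided by `q - q⁻¹`. -/
def nrep (i j : Idx n) : Mat R n :=
  if i.1 < j.1 then sgn (i.2 * j.2) • sfE j i else
    if i.1 = j.1 ∧ i.2 = 0 ∧ j.2 = 1 then el j i else 0

theorem rep_of_ne (q q' : R) {i j : Idx n} (h : i ≠ j) : rep q q' i j = (q - q') • nrep i j := by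
  ext x y
  rw [rep, Matrix.of_apply, Matrix.of_apply, icoeff_eq, if_neg (c := i = j ∧ _) fun h' => h h'.1,
    zero_add, Matrix.smul_apply, smul_eq_mul, nrep]
  by_cases h1 : i.1 < j.1
  · rw [if_pos h1, Matrix.smul_apply, QEA.sfE_apply, smul_sub, mul_sub, smul_add,
      sub_eq_add_neg (_ * _) (_ * _)]
    refine congrArg₂ (fun s t : R => s + t) ?_ ?_
    · by_cases h2 : i = y ∧ x = j
      · obtain ⟨rfl, rfl⟩ := h2
        have key : ∀ i j : ZMod 2, (i + 1) * j + (i + j) * (i + 1) + j * i = i * j := by decide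
        rw [if_pos ⟨rfl, rfl, Or.inl h1⟩, key]
        simp
      · rw [if_neg fun h' => h2 ⟨h'.1, h'.2.1⟩]
        have : ¬ (j = x ∧ i = y) := fun h' => h2 ⟨h'.2, h'.1.symm⟩
        rw [if_neg this, smul_zero, smul_zero, mul_zero]
    · by_cases h2 : j = y.neg ∧ x = i.neg
      · have hy : y = j.neg := by rw [h2.1, y.neg_neg]
        obtain ⟨-, rfl⟩ := h2
        subst hy
        rw [if_pos ⟨j.neg_neg.symm, rfl, h1⟩]
        have key : ∀ i j : ZMod 2, (i + 1) * j + (i + j) * (j + 1 + 1) + (i + 1) * i = 0 := by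
          decide
        have key2 : ∀ i j : ZMod 2, sgn (i * j) * sgn ((i + 1) * (j + 1 + 1)) = sgn j := by decide
        simp only [Idx.neg_neg, and_self, if_true]
        simp only [Idx.neg]
        rw [key, sgn_zero, one_smul, smul_smul, key2, mul_smul_comm, mul_one]
        rcases zmod_two_cases j.2 with h | h <;> simp [h, sgn_zero, sgn_one, -uzpow_zero, -uzpow_one,
          Units.neg_smul]
      · rw [if_neg fun h' => h2 ⟨h'.1, h'.2.1⟩, if_neg]
        · simp
        · rintro ⟨h3, h4⟩
          refine h2 ⟨?_, ?_⟩
          all_goals first | exact h3 | exact h4 | (rw [h3, Idx.neg_neg]) | (rw [h4, Idx.neg_neg])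
  · rw [if_neg h1, if_neg (c := _ ∧ _ ∧ i.1 < j.1) fun h' => h1 h'.2.2, add_zero]
    by_cases h2 : i.1 = j.1 ∧ i.2 = 0 ∧ j.2 = 1
    · rw [if_pos h2, QEA.el_apply]
      by_cases h3 : i = y ∧ x = j
      · obtain ⟨rfl, rfl⟩ := h3
        rw [if_pos ⟨rfl, rfl, Or.inr h2⟩, if_pos (by simp), h2.2.1, h2.2.2]
        have key : sgn ((0 + 1) * 1 + (0 + 1) * (0 + 1) + 1 * 0) = 1 := by decide
        rw [key, one_smul, mul_one]
      · rw [if_neg fun h' => h3 ⟨h'.1, h'.2.1⟩, if_neg, smul_zero, mul_zero]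
        first
          | exact fun h' => h3 ⟨h'.2.symm, h'.1⟩
          | exact fun h' => h3 ⟨h'.2, h'.1.symm⟩
    · rw [if_neg h2, if_neg, smul_zero, Matrix.zero_apply, mul_zero]
      rintro ⟨rfl, -, h' | h'⟩
      · exact h1 h'
      · exact h2 h'

/-- The derivative at `q = 1` of the vector representation. -/
def lrep (c c' : R) (i j : Idx n) : Mat R n :=
  if i = j then Matrix.diagonal fun x : Idx n => if x.1 = i.1 then if x.2 = 0 then c else c' else 0
  else (c - c') • nrep i j

/-- The entries of the vector representation are affine linear in `q` and `q⁻¹`. With `q = 1 + ħ g`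
and `q⁻¹ = 1 + ħ g'` they differ from those of the identity by exact multiples of `ħ`. -/
theorem rep_eq_one_add (x c c' : R) (i j : Idx n) : rep (1 + x * c) (1 + x * c') i j =
    (1 : Matrix (Idx n) (Idx n) (Mat R n)) i j + x • lrep c c' i j := by
  by_cases h : i = j
  · subst h
    rw [rep_self, Matrix.one_apply_eq, lrep, if_pos rfl, ← Matrix.diagonal_one,
      ← Matrix.diagonal_smul, Matrix.diagonal_add]
    congr 1
    ext y
    simp only [Pi.smul_apply, smul_eq_mul]
    split_ifs <;> simp
  · rw [rep_of_ne _ _ h, Matrix.one_apply_ne h, zero_add, lrep, if_neg h, smul_smul]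
    congr 1
    ring

theorem nrep_map {S : Type*} [CommRing S] (f : R →+* S) (i j : Idx n) :
    (nrep i j : Mat R n).map f = nrep i j := by
  ext x y
  rw [Matrix.map_apply, nrep, nrep]
  split_ifs
  · rw [Matrix.smul_apply, Matrix.smul_apply, units_smul_map, QEA.sfE_apply, QEA.sfE_apply, map_sub,
      units_smul_map, apply_ite f, apply_ite f, map_one, map_zero]
  · rw [QEA.el_apply, QEA.el_apply, apply_ite f, map_one, map_zero]
  · exact map_zero f

theorem lrep_map {S : Type*} [CommRing S] (f : R →+* S) (c c' : R) (i j : Idx n) :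
    (lrep c c' i j).map f = lrep (f c) (f c') i j := by
  rw [lrep, lrep]
  split_ifs
  · ext x y
    simp only [Matrix.map_apply, Matrix.diagonal_apply, apply_ite f, map_zero]
  · rw [← nrep_map f i j, ← map_sub]
    ext x y
    simp

end Braid

/-- The matrices `L_{ij}`, which are the images in the vector representation of the classes of
the generators `lam`. -/
def Lmat {n : ℕ} (i j : Idx n) : Mat ℂ n :=
  (if i.1 < j.1 then (1 : ℂ) else if i.1 = j.1 then 2⁻¹ else 0) • sgn (i.2 * j.2) • sfE j i

theorem Idx.neg_ne {n : ℕ} (i : Idx n) : i ≠ i.neg := fun h => by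
  have key : ∀ x : ZMod 2, x ≠ x + 1 := by decide
  exact key _ (congrArg Prod.snd h)

theorem Idx.eq_neg_iff {n : ℕ} {i j : Idx n} : i = j.neg ↔ j = i.neg :=
  ⟨fun h => by rw [h, j.neg_neg], fun h => by rw [h, i.neg_neg]⟩

/-- `ι` fixes `E_{-i,i}` for positive `i` and negates it for negative `i`. This accounts for the
factor `1/2` in `Lmat` at opposite indices. -/
theorem sfE_neg_self {n : ℕ} (i : Idx n) :
    (sfE i.neg i : Mat ℂ n) = if i.2 = 0 then (2 : ℂ) • el i.neg i else 0 := by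
  ext x y
  rw [QEA.sfE_apply]
  by_cases h : i.neg = x ∧ i = y
  · obtain ⟨rfl, rfl⟩ := h
    rw [if_pos ⟨rfl, rfl⟩, if_pos ⟨rfl, i.neg_neg.symm⟩]
    have key : ∀ a : ZMod 2, (a + 1) * (a + 1) = a + 1 := by decide
    change 1 - sgn ((i.2 + 1) * (i.2 + 1)) • (1 : ℂ) = _
    rw [key]
    rcases zmod_two_cases i.2 with h | h
    · rw [h, if_pos rfl, Matrix.smul_apply, QEA.el_apply, if_pos ⟨rfl, rfl⟩]
      simp only [zero_add, sgn_one, Units.neg_smul, one_smul]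
      norm_num
    · have h2 : (1 + 1 : ZMod 2) = 0 := by decide
      rw [h, if_neg (by decide), h2, sgn_zero, one_smul, sub_self]
      rfl
  · rw [if_neg h, if_neg, smul_zero, sub_zero]
    · split_ifs
      · rw [Matrix.smul_apply, QEA.el_apply, if_neg h, smul_zero]
      · rfl
    · rintro ⟨h1, h2⟩
      refine h ⟨(Idx.eq_neg_iff.1 h2).symm, ?_⟩
      rw [← i.neg_neg, h1, y.neg_neg]

theorem lrep_half {n : ℕ} (i j : Idx n) : Braid.lrep (1 / 2 : ℂ) (-1 / 2) i j = Lmat i j := by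
  rw [Braid.lrep, Lmat]
  by_cases h : i = j
  · subst h
    rw [if_pos rfl, if_neg (lt_irrefl _), if_pos rfl]
    ext x y
    rw [Matrix.diagonal_apply, Matrix.smul_apply, Matrix.smul_apply, QEA.sfE_apply]
    have key : ∀ a : ZMod 2, a * a = a ∧ (a + 1) * (a + 1 + 1) = 0 := by decide
    by_cases hxy : x = y
    · subst hxy
      rw [if_pos rfl]
      by_cases hx : i = x
      · subst hx
        rw [if_pos (c := i.1 = i.1) rfl, if_pos (c := i = i ∧ i = i) ⟨rfl, rfl⟩,
          if_neg (c := i = i.neg ∧ i = i.neg) fun h => i.neg_ne h.1, (key i.2).1]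
        rcases zmod_two_cases i.2 with h | h <;> simp [h, sgn_zero, sgn_one, -uzpow_zero,
          -uzpow_one, Units.neg_smul, neg_div]
      · rw [if_neg (c := i = x ∧ _) fun h => hx h.1]
        by_cases hx2 : x.1 = i.1
        · obtain rfl := Idx.eq_neg_of_fst_eq hx2.symm hx
          rw [if_pos hx2, if_pos (c := i = i.neg.neg ∧ i = i.neg.neg) ⟨i.neg_neg.symm, i.neg_neg.symm⟩,
            (key i.2).1]
          change _ = (2⁻¹ : ℂ) • sgn i.2 • (0 - sgn ((i.2 + 1) * (i.2 + 1 + 1)) • (1 : ℂ))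
          rw [(key i.2).2]
          have h2 : (1 + 1 : ZMod 2) = 0 := by decide
          rcases zmod_two_cases i.2 with h | h <;> simp [h, h2, Idx.neg, sgn_zero, sgn_one,
            -uzpow_zero, -uzpow_one, Units.neg_smul] <;> norm_num
        · rw [if_neg hx2, if_neg]
          · simp
          · rintro ⟨h', -⟩
            exact hx2 (congrArg Prod.fst h').symm
    · rw [if_neg hxy, if_neg, if_neg]
      · simp
      · rintro ⟨h1, h2⟩
        exact hxy (by rw [← x.neg_neg, ← h2, h1, y.neg_neg])
      · rintro ⟨h1, h2⟩
        exact hxy (h1.symm.trans h2)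
  · rw [if_neg h, show (1 / 2 - -1 / 2 : ℂ) = 1 by norm_num, one_smul, Braid.nrep]
    by_cases h1 : i.1 < j.1
    · rw [if_pos h1, if_pos h1, one_smul]
    · rw [if_neg h1, if_neg h1]
      by_cases h2 : i.1 = j.1
      · obtain rfl := Idx.eq_neg_of_fst_eq h2 h
        rw [if_pos h2, sfE_neg_self]
        have key : ∀ a : ZMod 2, a * (a + 1) = 0 := by decide
        change _ = (2⁻¹ : ℂ) • sgn (i.2 * (i.2 + 1)) • _
        rw [key, sgn_zero, one_smul]
        rcases zmod_two_cases i.2 with h | h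
        · rw [if_pos ⟨rfl, h, by change i.2 + 1 = 1; rw [h]; decide⟩, if_pos h, smul_smul,
            inv_mul_cancel₀ two_ne_zero, one_smul]
        · rw [if_neg (c := _ ∧ _), if_neg, smul_zero]
          · rw [h]
            decide
          · rw [h]
            exact fun h' => absurd h'.2.1 (by decide)
      · rw [if_neg fun h' => h2 h'.1, if_neg h2, zero_smul]

theorem Lmat_mem {n : ℕ} (i j : Idx n) : (Lmat i j : Mat ℂ n) ∈ periplectic n := by
  rw [Lmat, Units.smul_def]
  exact Submodule.smul_mem _ _ (zsmul_mem (pE j i).2 _)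

/-- `L_{ij}` as an element of `𝔭_n`. -/
def pL {n : ℕ} (i j : Idx n) : periplectic n := ⟨Lmat i j, Lmat_mem i j⟩

namespace Uh

open HAdic

variable {n : ℕ} {b : Bool}

variable (n b) in
/-- The vector representation of the form modulo `ħ`. -/
theorem exists_rep : ∃ F : Red (Uh n b) →ₐ[ℂ] Mat ℂ n,
    ∀ i j, F (Red.mk _ (lam b i j)) = Lmat i j := by
  let G : UK n →ₐ[LaurentSeries ℂ] Mat (LaurentSeries ℂ) n :=
    QEA.lift (QEA.isQuantumMatrix_rep (QEA.Smat_eq two_ne_zero) qh_ne_zero)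
  have hrep (i j : Idx n) : (Braid.rep qh qh⁻¹ i j : Mat (LaurentSeries ℂ) n) =
      ((1 : Matrix (Idx n) (Idx n) (Mat (PowerSeries ℂ) n)) i j +
        (PowerSeries.X : PowerSeries ℂ) • Braid.lrep g g' i j).map toK := by
    rw [qh_inv, qh_eq, ← Braid_rep_map, qO_eq, qO'_eq, Braid.rep_eq_one_add]
  have hG (i j : Idx n) : G (incl b (lam b i j)) = (Braid.lrep g g' i j).map toK := by
    apply smul_right_injective _ toK_X_ne_zero
    change toK PowerSeries.X • _ = toK PowerSeries.X • _
    rw [← map_smul G, incl_lam, map_sub, QEA.lift_tt, hrep]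
    ext x y
    rw [Matrix.sub_apply, Matrix.map_apply, Matrix.add_apply, map_add, Matrix.smul_apply,
      Matrix.smul_apply, smul_eq_mul, map_mul, Matrix.map_apply, smul_eq_mul]
    by_cases h : i = j
    · subst h
      rw [Matrix.one_apply_eq, Matrix.one_apply_eq, map_one]
      by_cases hxy : x = y <;> simp [Matrix.one_apply, hxy]
    · rw [Matrix.one_apply_ne h, Matrix.one_apply_ne h, map_zero, Matrix.zero_apply,
        Matrix.zero_apply, map_zero, sub_zero, zero_add]
  have hJ : Function.Injective (toK.mapMatrix : Mat (PowerSeries ℂ) n →+* _) :=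
    Matrix.map_injective toK_injective
  obtain ⟨f, hf⟩ := exists_algHom_lift (O := PowerSeries ℂ) (G.toRingHom.comp (valHom b)) hJ
    (adjoin_gens n b)
    (by
      rintro x (⟨i, j, rfl⟩ | ⟨hb, i, hi⟩)
      · exact ⟨_, (hG i j).symm⟩
      · refine ⟨Matrix.diagonal fun x : Idx n => if x.1 = i.1 then if x.2 = 0 then qO' else qO
          else 1, ?_⟩
        change _ = G (incl b x)
        rw [hi, QEA.lift_tinv, qh_inv, qh_eq]
        ext x y
        simp only [RingHom.mapMatrix_apply, Matrix.map_apply, Matrix.diagonal_apply,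
          apply_ite toK, map_one, map_zero])
    (fun r => by
      change _ = G (val b (algebraMap _ _ r))
      rw [AlgHom.commutes, IsScalarTower.algebraMap_apply (PowerSeries ℂ) (LaurentSeries ℂ) (UK n),
        AlgHom.commutes]
      ext x y
      simp only [RingHom.mapMatrix_apply, Matrix.map_apply, Matrix.algebraMap_matrix_apply,
        apply_ite toK, map_zero]
      rfl)
  have hfl (i j : Idx n) : f (lam b i j) = Braid.lrep g g' i j :=
    hJ ((hf _).trans (hG i j))
  refine ⟨Red.lift ((PowerSeries.constantCoeff (R := ℂ)).mapMatrix.comp f.toRingHom) fun r => ?_,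
    fun i j => ?_⟩
  · change (PowerSeries.constantCoeff (R := ℂ)).mapMatrix (f (algebraMap _ _ r)) = _
    rw [AlgHom.commutes]
    ext x y
    simp only [RingHom.mapMatrix_apply, Matrix.map_apply, Matrix.algebraMap_matrix_apply,
      apply_ite (PowerSeries.constantCoeff (R := ℂ)), map_zero]
    rfl
  · rw [Red.lift_mk]
    change (f (lam b i j)).map (PowerSeries.constantCoeff (R := ℂ)) = Lmat i j
    rw [hfl, Braid.lrep_map, constantCoeff_g, constantCoeff_g', lrep_half]

end Uh

/-! ### The classical limit of the RTT relation -/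

section ClassicalRTT

variable {n : ℕ} {B : Type*} [Ring B]

/-- The linearization of the relation `M₁ M₂ S = S M₂ M₁`. -/
def IsClassicalRTT {K : Type*} [CommRing K] [Algebra K B]
    (s : Matrix (Idx n × Idx n) (Idx n × Idx n) K) (L : Matrix (Idx n) (Idx n) B) : Prop :=
  leg1 L * leg2 L - leg2 L * leg1 L =
    s.map (algebraMap K B) * (leg1 L + leg2 L) - (leg1 L + leg2 L) * s.map (algebraMap K B)

/-- The terms of order `0` and `1` in `x` cancel. The coefficient of `x²` is the linearized
relation, up to a further multiple of `x`. -/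
theorem one_add_smul_mul_sub {R M : Type*} [CommRing R] [Ring M] [Algebra R M] (x : R)
    (a b c : M) : (1 + x • a) * (1 + x • b) * (1 + x • c) - (1 + x • c) * ((1 + x • b) * (1 + x • a)) =
      x • x • (a * b - b * a - (c * (a + b) - (a + b) * c) + x • (a * b * c - c * (b * a))) := by
  simp only [mul_add, add_mul, smul_mul_assoc, mul_smul_comm, smul_add, smul_sub, one_mul, mul_one,
    mul_assoc]
  abel

/-- Division by `ħ²` must take place in `B`, where multiplication by `ħ` is injective; only
afterwards can one pass to the reduction. -/
theorem IsRTT.exists_eq_smul [Algebra (PowerSeries ℂ) B]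
    (hB : Function.Injective fun b : B => (PowerSeries.X : PowerSeries ℂ) • b)
    {S s : Matrix (Idx n × Idx n) (Idx n × Idx n) (PowerSeries ℂ)}
    (hS : S = 1 + (PowerSeries.X : PowerSeries ℂ) • s) {M L : Matrix (Idx n) (Idx n) B}
    (hM : M = 1 + (PowerSeries.X : PowerSeries ℂ) • L) (h : IsRTT S M) :
    ∃ D, leg1 L * leg2 L - leg2 L * leg1 L - (s.map (algebraMap (PowerSeries ℂ) B) *
      (leg1 L + leg2 L) - (leg1 L + leg2 L) * s.map (algebraMap (PowerSeries ℂ) B)) =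
        (PowerSeries.X : PowerSeries ℂ) • D := by
  have hS' : S.map (algebraMap (PowerSeries ℂ) B) =
      1 + (PowerSeries.X : PowerSeries ℂ) • s.map (algebraMap (PowerSeries ℂ) B) := by
    ext a b
    rw [hS, Matrix.map_apply, Matrix.add_apply, Matrix.add_apply, map_add, Matrix.smul_apply,
      Matrix.smul_apply, Matrix.map_apply, smul_eq_mul, map_mul, Algebra.smul_def, Matrix.one_apply,
      Matrix.one_apply, apply_ite (algebraMap (PowerSeries ℂ) B), map_one, map_zero]
  have hinj : Function.Injective fun b : Matrix (Idx n × Idx n) (Idx n × Idx n) B =>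
      (PowerSeries.X : PowerSeries ℂ) • b := fun x y hxy => by
    ext i j
    exact hB (congrFun (congrFun hxy i) j)
  rw [IsRTT, hS', hM, leg1_add, leg2_add, leg1_smul, leg2_smul, leg1_one, leg2_one, ← sub_eq_zero,
    one_add_smul_mul_sub] at h
  have h2 : leg1 L * leg2 L - leg2 L * leg1 L - (s.map (algebraMap (PowerSeries ℂ) B) *
      (leg1 L + leg2 L) - (leg1 L + leg2 L) * s.map (algebraMap (PowerSeries ℂ) B)) +
      (PowerSeries.X : PowerSeries ℂ) • (leg1 L * leg2 L * s.map (algebraMap (PowerSeries ℂ) B) -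
        s.map (algebraMap (PowerSeries ℂ) B) * (leg2 L * leg1 L)) = 0 := by
    apply hinj
    apply hinj
    simp only [smul_zero]
    exact h
  refine ⟨-(leg1 L * leg2 L * s.map (algebraMap (PowerSeries ℂ) B) -
        s.map (algebraMap (PowerSeries ℂ) B) * (leg2 L * leg1 L)), ?_⟩
  rw [smul_neg, ← add_eq_zero_iff_eq_neg]
  exact h2

theorem IsRTT.isClassicalRTT [Algebra (PowerSeries ℂ) B]
    (hB : Function.Injective fun b : B => (PowerSeries.X : PowerSeries ℂ) • b)
    {S s : Matrix (Idx n × Idx n) (Idx n × Idx n) (PowerSeries ℂ)}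
    (hS : S = 1 + (PowerSeries.X : PowerSeries ℂ) • s) {M L : Matrix (Idx n) (Idx n) B}
    (hM : M = 1 + (PowerSeries.X : PowerSeries ℂ) • L) (h : IsRTT S M) :
    IsClassicalRTT (s.map (PowerSeries.constantCoeff (R := ℂ)))
      (L.map (Red.mkHom : B →+* Red B)) := by
  obtain ⟨D, hD⟩ := h.exists_eq_smul hB hS hM
  have hs : (s.map (PowerSeries.constantCoeff (R := ℂ))).map (algebraMap ℂ (Red B)) =
      (Red.mkHom : B →+* Red B).mapMatrix (s.map (algebraMap (PowerSeries ℂ) B)) := by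
    ext a b
    simp only [Matrix.map_apply, RingHom.mapMatrix_apply]
    rw [Algebra.algebraMap_eq_smul_one (R := PowerSeries ℂ), Red.mkHom_smul, map_one,
      Algebra.algebraMap_eq_smul_one (R := ℂ)]
  have hD2 : (Red.mkHom : B →+* Red B).mapMatrix ((PowerSeries.X : PowerSeries ℂ) • D) = 0 := by
    ext a b
    exact Red.mkHom_eq_zero.2 ⟨_, rfl⟩
  rw [IsClassicalRTT, hs, ← leg1_map, ← leg2_map, ← sub_eq_zero]
  rw [← hD] at hD2
  simp only [map_sub, map_mul, map_add] at hD2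
  exact hD2

theorem IsClassicalRTT.map {C : Type*} [Ring C] [Algebra ℂ B] [Algebra ℂ C] (F : B →ₐ[ℂ] C)
    {s : Matrix (Idx n × Idx n) (Idx n × Idx n) ℂ} {L : Matrix (Idx n) (Idx n) B}
    (h : IsClassicalRTT s L) : IsClassicalRTT s (L.map F) := by
  have hs : s.map (algebraMap ℂ C) = (F : B →+* C).mapMatrix (s.map (algebraMap ℂ B)) := by
    ext a b
    simp
  have h1 : leg1 (L.map F) = (F : B →+* C).mapMatrix (leg1 L) := (leg1_map (F : B →+* C) L).symm
  have h2 : leg2 (L.map F) = (F : B →+* C).mapMatrix (leg2 L) := (leg2_map (F : B →+* C) L).symm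
  have := congrArg (F : B →+* C).mapMatrix h
  rw [IsClassicalRTT, hs, h1, h2]
  simpa only [map_sub, map_mul, map_add] using this

/-- The classical relation expresses supercommutators of entries as linear combinations of entries,
with coefficients that depend on `s` only. A linear map which matches the entries therefore matches
their supercommutators, and no structure constants have to be computed. -/
theorem IsClassicalRTT.supercommutator_eq {C : Type*} [Ring C] [Algebra ℂ B] [Algebra ℂ C]
    {s : Matrix (Idx n × Idx n) (Idx n × Idx n) ℂ} {L : Matrix (Idx n) (Idx n) B}
    {M : Matrix (Idx n) (Idx n) C} (hL : IsClassicalRTT s L) (hM : IsClassicalRTT s M)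
    (f : B →ₗ[ℂ] C) (hf : ∀ i j, f (L i j) = M i j) (i j k l : Idx n) :
    M i j * M k l - sgn ((i.2 + j.2) * (k.2 + l.2)) • (M k l * M i j) =
      f (L i j * L k l - sgn ((i.2 + j.2) * (k.2 + l.2)) • (L k l * L i j)) := by
  have key : ∀ i j k l : ZMod 2, sgn (l * (i + j)) = sgn (k * (i + j)) * sgn ((i + j) * (k + l)) := by
    decide
  have hleg1 (a b) : leg1 M a b = f (leg1 L a b) := by
    simp only [leg1_apply]
    split_ifs
    · rw [units_smul_map, hf]
    · rw [map_zero]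
  have hleg2 (a b) : leg2 M a b = f (leg2 L a b) := by
    simp only [leg2_apply]
    split_ifs
    · rw [hf]
    · rw [map_zero]
  have hl := congrFun (congrFun hL (i, k)) (j, l)
  have hm := congrFun (congrFun hM (i, k)) (j, l)
  rw [Matrix.sub_apply, leg1_mul_leg2_apply, leg2_mul_leg1_apply, key i.2 j.2 k.2 l.2, mul_smul,
    ← smul_sub, Matrix.sub_apply, matrix_map_mul_comm, matrix_map_mul_apply] at hl hm
  simp only [Matrix.add_apply] at hl hm
  apply smul_left_cancel (sgn (k.2 * (i.2 + j.2)))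
  refine hm.trans ?_
  rw [← units_smul_map, hl, map_sub, map_sum, map_sum]
  simp only [map_smul, map_add, hleg1, hleg2]

end ClassicalRTT

/-! ### Coordinates on `𝔭_n` -/

section Coordinates

variable {n : ℕ}

theorem Lmat_apply (i j x y : Idx n) : Lmat i j x y =
    (if i.1 < j.1 then (1 : ℂ) else if i.1 = j.1 then 2⁻¹ else 0) * sgn (i.2 * j.2) •
      ((if j = x ∧ i = y then (1 : ℂ) else 0) -
        sgn (x.2 * (y.2 + 1)) • (if j = y.neg ∧ i = x.neg then (1 : ℂ) else 0)) := by
  rw [Lmat, Matrix.smul_apply, Matrix.smul_apply, QEA.sfE_apply, smul_eq_mul]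

/-- The coordinate of `x` at `L_{ij}`. -/
def pCoord (p : Idx n × Idx n) : periplectic n →ₗ[ℂ] ℂ where
  toFun x := sgn (p.1.2 * p.2.2) • (x : Mat ℂ n) p.2 p.1
  map_add' _ _ := smul_add _ _ _
  map_smul' r x := smul_comm (sgn (p.1.2 * p.2.2)) r ((x : Mat ℂ n) p.2 p.1)

theorem pCoord_apply (p : Idx n × Idx n) (x : periplectic n) :
    pCoord p x = sgn (p.1.2 * p.2.2) • (x : Mat ℂ n) p.2 p.1 := rfl

theorem pCoord_eq_zero {a : ZMod 2} {x : periplectic n} (hx : IsHomog a (x : Mat ℂ n))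
    {p : Idx n × Idx n} (hp : p.1.2 + p.2.2 ≠ a) : pCoord p x = 0 := by
  rw [pCoord_apply, hx _ _ (by rwa [add_comm]), smul_zero]

theorem periplectic_neg (x : periplectic n) (i j : Idx n) :
    (x : Mat ℂ n) j.neg i.neg = -(sgn (i.2 * (j.2 + 1)) • (x : Mat ℂ n) i j) := by
  conv_rhs => rw [← mem_periplectic.1 x.2, iota_apply]
  rw [smul_neg, neg_neg, smul_smul, Int.units_mul_self, one_smul]

/-- The `L_{ij}` span `𝔭_n` but are not independent as a family. The entry at `(u, v)` receives
contributions from the pairs `(v, u)` and `(-u, -v)`, whose weights `1, 1/2, 0` add up to `1`. -/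
theorem sum_pCoord_smul (x : periplectic n) : ∑ p, pCoord p x • pL p.1 p.2 = x := by
  apply Subtype.ext
  rw [AddSubmonoidClass.coe_finsetSum]
  ext u v
  rw [Matrix.sum_apply]
  have h (p : Idx n × Idx n) : ((pCoord p x • pL p.1 p.2 : periplectic n) : Mat ℂ n) u v =
      (if (v, u) = p then (if v.1 < u.1 then (1 : ℂ) else if v.1 = u.1 then 2⁻¹ else 0) *
        (x : Mat ℂ n) u v else 0) +
      (if (u.neg, v.neg) = p then (if u.1 < v.1 then (1 : ℂ) else if u.1 = v.1 then 2⁻¹ else 0) *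
        (x : Mat ℂ n) u v else 0) := by
    change pCoord p x * Lmat p.1 p.2 u v = _
    rw [Lmat_apply, pCoord_apply]
    obtain ⟨k, l⟩ := p
    rw [smul_sub, mul_sub, mul_sub, sub_eq_add_neg]
    refine congrArg₂ (fun s t : ℂ => s + t) ?_ ?_
    · by_cases h1 : l = u ∧ k = v
      · obtain ⟨rfl, rfl⟩ := h1
        rw [if_pos (c := l = l ∧ k = k) ⟨rfl, rfl⟩, if_pos rfl, mul_smul_comm, mul_smul_comm, smul_mul_assoc,
          smul_smul, Int.units_mul_self, one_smul, mul_one, mul_comm]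
      · rw [if_neg h1, if_neg (c := (_, _) = (_, _)) fun h => h1 ⟨(Prod.ext_iff.1 h).2.symm,
            (Prod.ext_iff.1 h).1.symm⟩,
          smul_zero, mul_zero, mul_zero]
    · by_cases h1 : l = v.neg ∧ k = u.neg
      · obtain ⟨rfl, rfl⟩ := h1
        have e : u.neg.1 = u.1 ∧ v.neg.1 = v.1 := ⟨rfl, rfl⟩
        rw [if_pos (c := _ ∧ _) ⟨rfl, rfl⟩, if_pos (c := (u.neg, v.neg) = _) rfl, e.1, e.2,
          periplectic_neg, mul_smul_comm, mul_smul_comm, smul_mul_assoc, smul_smul,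
          Int.units_mul_self, one_smul, mul_smul_comm, neg_mul, neg_neg,
          mul_smul_comm, smul_mul_assoc, smul_smul, Int.units_mul_self, one_smul, mul_one, mul_comm]
      · rw [if_neg h1, if_neg (c := (u.neg, v.neg) = _) fun h => h1 ⟨(Prod.ext_iff.1 h).2.symm,
            (Prod.ext_iff.1 h).1.symm⟩,
          smul_zero, smul_zero, mul_zero, mul_zero, neg_zero]
  simp only [h, Finset.sum_add_distrib, Finset.sum_ite_eq, Finset.mem_univ, if_true]
  rcases lt_trichotomy u.1 v.1 with h | h | h
  · rw [if_neg h.not_gt, if_neg h.ne', if_pos h]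
    ring
  · rw [h]
    simp
    ring
  · rw [if_pos h, if_neg h.not_gt, if_neg h.ne']
    ring

variable {B : Type*} [Ring B] [Algebra ℂ B]

/-- A matrix which satisfies the relations of the matrix `L`. -/
structure IsClassicalMatrix (s : Matrix (Idx n × Idx n) (Idx n × Idx n) ℂ)
    (M : Matrix (Idx n) (Idx n) B) : Prop where
  diag (i : Idx n) : M i i = M i.neg i.neg
  anti (i : Idx n) (hi : i.2 = 0) : M i.neg i = 0
  lower (i j : Idx n) (hij : j.1 < i.1) : M i j = 0
  rtt : IsClassicalRTT s M

/-- The linear map `𝔭_n → B` with `L_{ij} ↦ M_{ij}`. -/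
def ofMatrix (M : Matrix (Idx n) (Idx n) B) : periplectic n →ₗ[ℂ] B :=
  ∑ p : Idx n × Idx n, (pCoord p).smulRight (M p.1 p.2)

theorem ofMatrix_apply (M : Matrix (Idx n) (Idx n) B) (x : periplectic n) :
    ofMatrix M x = ∑ p : Idx n × Idx n, pCoord p x • M p.1 p.2 := by
  rw [ofMatrix, LinearMap.sum_apply]
  rfl

/-- The point is that the redundancy among the `L_{ij}` is respected. The coordinates of `L_{kl}`
are concentrated at `(k, l)` and `(-l, -k)`, and the relations of a classical matrix make the two
contributions combine to `M_{kl}`. -/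
theorem IsClassicalMatrix.ofMatrix_pL {s : Matrix (Idx n × Idx n) (Idx n × Idx n) ℂ}
    {M : Matrix (Idx n) (Idx n) B} (hM : IsClassicalMatrix s M) (k l : Idx n) :
    ofMatrix M (pL k l) = M k l := by
  rw [ofMatrix_apply]
  have h (p : Idx n × Idx n) : pCoord p (pL k l) • M p.1 p.2 =
      (if (k, l) = p then (if k.1 < l.1 then (1 : ℂ) else if k.1 = l.1 then 2⁻¹ else 0) •
        M k l else 0) -
      (if (l.neg, k.neg) = p then (if k.1 < l.1 then (1 : ℂ) else if k.1 = l.1 then 2⁻¹ else 0) •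
        sgn (k.2 * l.2 + k.2 + 1) • M l.neg k.neg else 0) := by
    obtain ⟨i, j⟩ := p
    rw [pCoord_apply]
    change (sgn (i.2 * j.2) • Lmat k l j i) • M i j = _
    rw [Lmat_apply, smul_sub, mul_sub, smul_sub, sub_smul]
    refine congrArg₂ (fun s t : B => s - t) ?_ ?_
    · by_cases h1 : l = j ∧ k = i
      · obtain ⟨rfl, rfl⟩ := h1
        rw [if_pos (c := l = l ∧ k = k) ⟨rfl, rfl⟩, if_pos (c := (k, l) = (k, l)) rfl, mul_smul_comm, smul_smul,
          Int.units_mul_self, one_smul, mul_one]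
      · rw [if_neg h1, if_neg (c := (_, _) = (_, _)) fun h => h1 ⟨(Prod.ext_iff.1 h).2,
            (Prod.ext_iff.1 h).1⟩,
          smul_zero, mul_zero, smul_zero, zero_smul]
    · by_cases h1 : l = i.neg ∧ k = j.neg
      · obtain ⟨rfl, rfl⟩ := h1
        have key : ∀ i j : ZMod 2, sgn (i * j) * sgn ((j + 1) * (i + 1)) * sgn (j * (i + 1)) =
          sgn ((j + 1) * (i + 1) + (j + 1) + 1) := by decide
        rw [if_pos (c := _ ∧ _) ⟨rfl, rfl⟩, i.neg_neg, j.neg_neg, if_pos (c := (i, j) = _) rfl,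
          mul_smul_comm, mul_smul_comm, smul_smul, smul_smul]
        change ((sgn (i.2 * j.2) * sgn ((j.2 + 1) * (i.2 + 1)) * sgn (j.2 * (i.2 + 1))) • _) • _ =
          _ • sgn ((j.2 + 1) * (i.2 + 1) + (j.2 + 1) + 1) • _
        rw [key, mul_one, smul_comm, smul_assoc]
      · rw [if_neg h1, if_neg (c := (_, _) = (_, _)), smul_zero, smul_zero, mul_zero, smul_zero,
          zero_smul]
        intro h
        rw [Prod.mk.injEq] at h
        exact h1 ⟨by rw [← h.1, l.neg_neg], by rw [← h.2, k.neg_neg]⟩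
  simp only [h, Finset.sum_sub_distrib, Finset.sum_ite_eq, Finset.mem_univ, if_true]
  by_cases h1 : k.1 < l.1
  · rw [if_pos h1, hM.lower l.neg k.neg h1]
    simp
  · rw [if_neg h1]
    by_cases h2 : k.1 = l.1
    · rw [if_pos h2]
      by_cases h3 : k = l
      · subst h3
        have key : ∀ k : ZMod 2, k * k + k + 1 = 1 := by decide
        rw [key, sgn_one, ← hM.diag, Units.neg_smul, one_smul, smul_neg, sub_neg_eq_add, ← add_smul,
          show (2⁻¹ + 2⁻¹ : ℂ) = 1 by norm_num, one_smul]
      · obtain rfl := Idx.eq_neg_of_fst_eq h2 h3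
        rw [k.neg_neg]
        have key : ∀ k : ZMod 2, k * (k + 1) + k + 1 = k + 1 := by decide
        change _ - (2⁻¹ : ℂ) • sgn (k.2 * (k.2 + 1) + k.2 + 1) • _ = _
        rw [key]
        rcases zmod_two_cases k.2 with h | h
        · rw [h, zero_add, sgn_one, Units.neg_smul, one_smul, smul_neg, sub_neg_eq_add, ← add_smul,
            show (2⁻¹ + 2⁻¹ : ℂ) = 1 by norm_num, one_smul]
        · have h4 : k.neg.2 = 0 := by
            change k.2 + 1 = 0
            rw [h]
            decide
          have h5 := hM.anti k.neg h4
          rw [k.neg_neg] at h5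
          rw [h5]
          simp
    · rw [if_neg h2, hM.lower k l (lt_of_le_of_ne (not_lt.1 h1) (Ne.symm h2))]
      simp

theorem sum_smul_supercommutator {C ι : Type*} [Ring C] [Algebra ℂ C] [Fintype ι] (u v : ι → ℂ)
    (X : ι → C) (ε : ℤˣ) : (∑ p, u p • X p) * (∑ p, v p • X p) -
      ε • ((∑ p, v p • X p) * (∑ p, u p • X p)) =
      ∑ p, ∑ r, (u p * v r) • (X p * X r - ε • (X r * X p)) := by
  rw [Finset.sum_mul_sum, Finset.sum_mul_sum, Finset.sum_comm (s := Finset.univ) (t := Finset.univ)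
    (f := fun i j => v i • X i * u j • X j), Finset.smul_sum, ← Finset.sum_sub_distrib]
  refine Finset.sum_congr rfl fun p _ => ?_
  rw [Finset.smul_sum, ← Finset.sum_sub_distrib]
  refine Finset.sum_congr rfl fun r _ => ?_
  rw [smul_mul_smul_comm, smul_mul_smul_comm, smul_sub, mul_comm (v r), smul_comm ε]

/-- The composite `f` of the projection to `𝔭_n` with `ofMatrix M` sends `L_{ij}` to `M_{ij}`, so
supercommutators of generators correspond. The general case follows by bilinearity, since only
coordinates of the right parity are nonzero for homogeneous elements. -/
theorem IsClassicalMatrix.ofMatrix_supercommutator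
    {s : Matrix (Idx n × Idx n) (Idx n × Idx n) ℂ} {M : Matrix (Idx n) (Idx n) B}
    (hL : IsClassicalRTT s (Matrix.of Lmat : Matrix (Idx n) (Idx n) (Mat ℂ n)))
    (hM : IsClassicalMatrix s M) (a b : ZMod 2) (x y : periplectic n)
    (hx : IsHomog a (x : Mat ℂ n)) (hy : IsHomog b (y : Mat ℂ n)) :
    ofMatrix M x * ofMatrix M y - sgn (a * b) • (ofMatrix M y * ofMatrix M x) =
      ofMatrix M (pBracket x y) := by
  let f : Mat ℂ n →ₗ[ℂ] B := ofMatrix M ∘ₗ Up.toP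
  have hf (i j : Idx n) : f (Lmat i j) = M i j := by
    change ofMatrix M (Up.toP ((pL i j : periplectic n) : Mat ℂ n)) = _
    rw [Up.toP_coe, hM.ofMatrix_pL]
  have hsum (x : periplectic n) : (x : Mat ℂ n) =
      ∑ p : Idx n × Idx n, pCoord p x • (Lmat p.1 p.2 : Mat ℂ n) := by
    conv_lhs => rw [← sum_pCoord_smul x, AddSubmonoidClass.coe_finsetSum]
    rfl
  have hb : ofMatrix M (pBracket x y) =
      f ((x : Mat ℂ n) * y - sgn (a * b) • ((y : Mat ℂ n) * x)) := by
    change _ = ofMatrix M (Up.toP _)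
    rw [← superBracket_eq hx hy]
    exact congrArg _ (Up.toP_coe (pBracket x y)).symm
  rw [hb, ofMatrix_apply, ofMatrix_apply, hsum x, hsum y, sum_smul_supercommutator,
    sum_smul_supercommutator, map_sum]
  refine Finset.sum_congr rfl fun p _ => ?_
  rw [map_sum]
  refine Finset.sum_congr rfl fun r _ => ?_
  by_cases hp : p.1.2 + p.2.2 = a
  · by_cases hr : r.1.2 + r.2.2 = b
    · rw [map_smul, ← hp, ← hr, hL.supercommutator_eq hM.rtt f hf]
      rfl
    · rw [pCoord_eq_zero hy hr, mul_zero, zero_smul, zero_smul, map_zero]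
  · rw [pCoord_eq_zero hx hp, zero_mul, zero_smul, zero_smul, map_zero]

end Coordinates

theorem periplectic_linearMap_ext {n : ℕ} {M : Type*} [AddCommMonoid M] [Module ℂ M]
    {f g : periplectic n →ₗ[ℂ] M} (h : ∀ i j, f (pL i j) = g (pL i j)) : f = g := by
  ext x
  rw [← sum_pCoord_smul x, map_sum, map_sum]
  exact Finset.sum_congr rfl fun p _ => by rw [map_smul, map_smul, h]

theorem pL_eq {n : ℕ} (i j : Idx n) : pL i j =
    (if i.1 < j.1 then (1 : ℂ) else if i.1 = j.1 then 2⁻¹ else 0) • sgn (i.2 * j.2) • pE j i := by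
  apply Subtype.ext
  refine Eq.trans ?_ (map_smul (periplectic n).subtype _ _).symm
  rw [units_smul_map]
  rfl

theorem pCoord_pParity {n : ℕ} (p : Idx n × Idx n) (x : periplectic n) :
    pCoord p (pParity x) = sgn (p.1.2 + p.2.2) • pCoord p x := by
  rw [pCoord_apply, pCoord_apply, smul_comm, add_comm]
  rfl

/-! ### The isomorphism of the enveloping superalgebra with the reduction of the form -/

namespace Uh

open HAdic

variable {n : ℕ} {b : Bool}

theorem lam_diag_neg (i : Idx n) : lam b i i = lam b i.neg i.neg := by
  apply incl_injective b
  apply smul_right_injective _ toK_X_ne_zero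
  change toK PowerSeries.X • _ = toK PowerSeries.X • _
  rw [incl_lam, incl_lam, QEA.tt_diag_neg, Matrix.one_apply_eq, Matrix.one_apply_eq]

theorem lam_anti (i : Idx n) (hi : i.2 = 0) : lam b i.neg i = 0 := by
  apply incl_injective b
  apply smul_right_injective _ toK_X_ne_zero
  change toK PowerSeries.X • _ = toK PowerSeries.X • _
  rw [incl_lam, QEA.tt_anti qh i hi, Matrix.one_apply_ne i.neg_ne.symm, map_zero, smul_zero, sub_zero]

variable (n) in
theorem exists_smat_eq : ∃ s : Matrix (Idx n × Idx n) (Idx n × Idx n) (PowerSeries ℂ),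
    Braid.smat qO qO' = 1 + (PowerSeries.X : PowerSeries ℂ) • s := by
  have h (a b : Idx n × Idx n) : ∃ r : PowerSeries ℂ, Braid.smat qO qO' a b -
      (1 : Matrix (Idx n × Idx n) (Idx n × Idx n) (PowerSeries ℂ)) a b = PowerSeries.X * r := by
    have h1 : (Braid.smat qO qO' (n := n)).map (PowerSeries.constantCoeff (R := ℂ)) = 1 := by
      rw [Braid_smat_map, constantCoeff_qO, constantCoeff_qO', smat_one_one]
    have h2 := congrFun (congrFun h1 a) b
    rw [Matrix.map_apply] at h2
    rw [← dvd_iff_exists_eq_mul_right, PowerSeries.X_dvd_iff, map_sub, h2, Matrix.one_apply,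
      Matrix.one_apply, apply_ite (PowerSeries.constantCoeff (R := ℂ)), map_one, map_zero, sub_self]
  choose s hs using h
  refine ⟨Matrix.of s, ?_⟩
  ext1 a b
  rw [Matrix.add_apply, Matrix.smul_apply, Matrix.of_apply, smul_eq_mul, ← hs, add_sub_cancel]

variable (n) in
/-- The derivative at `ħ = 0` of the matrix `S`. -/
def sbar : Matrix (Idx n × Idx n) (Idx n × Idx n) ℂ :=
  (exists_smat_eq n).choose.map (PowerSeries.constantCoeff (R := ℂ))

variable (b) in
/-- The classes of the generators `lam` modulo `ħ`. -/
def lamBar : Matrix (Idx n) (Idx n) (Red (Uh n b)) := (lam b).map (Red.mk (Uh n b))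

theorem isClassicalMatrix_lamBar : IsClassicalMatrix (sbar n) (lamBar (n := n) b) where
  diag i := congrArg _ (lam_diag_neg i)
  anti i hi := (congrArg (Red.mk _) (lam_anti i hi)).trans (map_zero _)
  lower _ _ hij := (congrArg (Red.mk _) (lam_of_lt hij)).trans (map_zero _)
  rtt := isRTT_tt.isClassicalRTT (X_smul_injective b) (exists_smat_eq n).choose_spec rfl

variable (n b) in
/-- The vector representation of the form modulo `ħ`. -/
def rep : Red (Uh n b) →ₐ[ℂ] Mat ℂ n := (exists_rep n b).choose

theorem rep_lamBar (i j : Idx n) : rep n b (lamBar b i j) = Lmat i j :=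
  (exists_rep n b).choose_spec i j

/-- The relation for the matrices `L_{ij}` is inherited from the classes of the `λ_{ij}` through the
vector representation; either of the two forms serves for this. -/
theorem isClassicalRTT_Lmat :
    IsClassicalRTT (sbar n) (Matrix.of Lmat : Matrix (Idx n) (Idx n) (Mat ℂ n)) := by
  have h := (isClassicalMatrix_lamBar (n := n) (b := false)).rtt.map (rep n false)
  rwa [show (lamBar false).map (rep n false) = Matrix.of Lmat from by ext1 i j; exact rep_lamBar i j]
    at h

variable (n b) in
/-- The homomorphism from the enveloping superalgebra to the form modulo `ħ`. -/
def ofUp : Up n →ₐ[ℂ] Red (Uh n b) :=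
  Up.lift (ofMatrix (lamBar b))
    (isClassicalMatrix_lamBar.ofMatrix_supercommutator isClassicalRTT_Lmat)

theorem ofUp_ι (x : periplectic n) : ofUp n b (Up.ι x) = ofMatrix (lamBar b) x := Up.lift_ι _ _ x

theorem ofUp_pL (i j : Idx n) : ofUp n b (Up.ι (pL i j)) = lamBar b i j := by
  rw [ofUp_ι, isClassicalMatrix_lamBar.ofMatrix_pL]

theorem lamBar_mem (i j : Idx n) : lamBar b i j ∈ part ℂ (Red (Uh n b)) (i.2 + j.2) :=
  Red.isSuperHom_mk.map_mem (lam_mem i j)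

theorem isSuperHom_ofUp : IsSuperHom (ofUp n b).toLinearMap where
  map_one := map_one (ofUp n b)
  map_mul := map_mul (ofUp n b)
  map_parity u := by
    have : (ofUp n b).comp (Superalgebra.parity ℂ) = (Superalgebra.parity ℂ).comp (ofUp n b) :=
      Up.algHom_ext fun x => by
        change ofUp n b (Up.parity (Up.ι x)) = Superalgebra.parity ℂ (ofUp n b (Up.ι x))
        rw [Up.parity_ι, ofUp_ι, ofUp_ι, ofMatrix_apply, ofMatrix_apply, map_sum]
        refine Finset.sum_congr rfl fun p _ => ?_
        rw [pCoord_pParity, map_smul, parity_of_mem (lamBar_mem p.1 p.2), smul_assoc, smul_comm]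
    exact DFunLike.congr_fun this u

/-- `t_{ii} = 1 + ħ λ_{ii}` reduces to `1`, hence so does its inverse. This is why both forms have
the same reduction. -/
theorem eq_one_of_incl_eq {B : Type*} [Ring B] [Algebra ℂ B]
    {ρ : Uh n b →ₛₗ[(PowerSeries.constantCoeff : PowerSeries ℂ →+* ℂ)] B} (h1 : ρ 1 = 1)
    (hmul : ∀ x y, ρ (x * y) = ρ x * ρ y) {x : Uh n b} {i : Idx n}
    (hx : incl b x = QEA.tinv qh i) : ρ x = 1 := by
  have h : x * tt b i i = 1 := by
    apply incl_injective b
    rw [(isSuperHom_incl b).map_mul, incl_tt, hx, (isSuperHom_incl b).map_one, QEA.tinv_mul_tt]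
  have h2 : ρ (tt b i i) = 1 := by
    rw [tt_apply, Matrix.one_apply_eq, map_add, map_smulₛₗ, PowerSeries.constantCoeff_X, zero_smul,
      add_zero, h1]
  rw [← mul_one (ρ x), ← h2, ← hmul, h, h1, h2]

theorem ofUp_surjective : Function.Surjective (ofUp n b) := by
  intro y
  obtain ⟨a, rfl⟩ := Red.mk_surjective y
  change _ ∈ (ofUp n b).range
  have ha : a ∈ Algebra.adjoin (PowerSeries ℂ) (gens n b) := by
    rw [adjoin_gens]
    trivial
  induction ha using Algebra.adjoin_induction with
  | mem x hx =>
    obtain ⟨i, j, rfl⟩ | ⟨-, i, hi⟩ := hx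
    · exact ⟨Up.ι (pL i j), ofUp_pL i j⟩
    · rw [eq_one_of_incl_eq Red.mk_one Red.mk_mul hi]
      exact one_mem _
  | algebraMap r =>
    rw [Algebra.algebraMap_eq_smul_one, map_smulₛₗ, Red.mk_one]
    exact Subalgebra.smul_mem _ (one_mem _) _
  | add x y _ _ hx hy =>
    rw [map_add]
    exact add_mem hx hy
  | mul x y _ _ hx hy =>
    rw [Red.mk_mul]
    exact mul_mem hx hy

instance : Nontrivial (Red (Uh n b)) := by
  obtain ⟨H, -⟩ := exists_superBialgebra n b
  exact (Red.lift ((PowerSeries.constantCoeff (R := ℂ)).comp H.counit.toRingHom) fun r => by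
    change PowerSeries.constantCoeff (H.counit (algebraMap _ _ r)) = _
    rw [AlgHom.commutes]
    rfl : Red (Uh n b) →ₐ[ℂ] ℂ).toRingHom.domain_nontrivial

/-- The classes of the `λ_{ij}` are primitive, because the remaining term of their coproduct is a
multiple of `ħ`. Two algebra homomorphisms which agree on `𝔭_n` are equal. -/
theorem comul_ofUp {H : SuperBialgebra (PowerSeries ℂ) (Uh n b)}
    (hH : IsRestriction H (QEA.superBialgebra qh n)) (u : Up n) :
    Red.comul H (ofUp n b u) = isSuperHom_ofUp.tensor (Up.comul u) := by
  let T : SuperTensor ℂ (Up n) →ₐ[ℂ] SuperTensor ℂ (Red (Uh n b)) :=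
    { isSuperHom_ofUp.tensor with
      commutes' := fun r => by
        rw [Algebra.algebraMap_eq_smul_one, Algebra.algebraMap_eq_smul_one]
        exact (isSuperHom_ofUp.tensor_smul r 1).trans (by rw [map_one]; rfl) }
  have : (Red.comul H).comp (ofUp n b) = T.comp Up.comul := by
    refine Up.algHom_ext fun x => ?_
    have hlin : ((Red.comul H).comp (ofUp n b)).toLinearMap ∘ₗ Up.ι =
        (T.comp Up.comul).toLinearMap ∘ₗ Up.ι := by
      refine periplectic_linearMap_ext fun i j => ?_
      change Red.comul H (ofUp n b (Up.ι (pL i j))) = isSuperHom_ofUp.tensor (Up.comul (Up.ι (pL i j)))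
      rw [Up.comul_ι, map_add, IsSuperHom.tensor_tmul, IsSuperHom.tensor_tmul, isSuperHom_ofUp.map_one]
      change _ = ofUp n b (Up.ι (pL i j)) ᵍ⊗ₜ[ℂ] 1 + 1 ᵍ⊗ₜ[ℂ] ofUp n b (Up.ι (pL i j))
      rw [ofUp_pL]
      change GradedTensorProduct.of ℂ _ _
        (TensorProduct.map (Red.mk _) (Red.mk _) (H.Δ (lam b i j))) = _
      rw [Δ_lam hH, comulLam, map_add (TensorProduct.map _ _), map_add (TensorProduct.map _ _),
        map_smulₛₗ, PowerSeries.constantCoeff_X, zero_smul, add_zero, TensorProduct.map_tmul,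
        TensorProduct.map_tmul, Red.mk_one]
      rfl
    exact DFunLike.congr_fun hlin x
  exact DFunLike.congr_fun this u

theorem rep_ofUp (u : Up n) : rep n b (ofUp n b u) = Up.rep u := by
  have : (rep n b).comp (ofUp n b) = Up.rep := by
    refine Up.algHom_ext fun x => ?_
    have hlin : ((rep n b).comp (ofUp n b)).toLinearMap ∘ₗ Up.ι = Up.rep.toLinearMap ∘ₗ Up.ι := by
      refine periplectic_linearMap_ext fun i j => ?_
      change rep n b (ofUp n b (Up.ι (pL i j))) = Up.rep (Up.ι (pL i j))
      rw [ofUp_pL, rep_lamBar, Up.rep_ι]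
      rfl
    exact DFunLike.congr_fun hlin x
  exact DFunLike.congr_fun this u

/-- This replaces a PBW theorem. From `f u = 0` one gets `(f ⊗ f) Δ u = 0`. The vector
representation factors through `f`, so projecting the first factor to `𝔭_n` gives `(pr ⊗ f) Δ u =
0`, which is the hypothesis of the injectivity criterion. -/
theorem ofUp_injective : Function.Injective (ofUp n b) := by
  obtain ⟨H, hH⟩ := exists_superBialgebra n b
  refine Up.injective_of_comul (ofUp n b) fun u hu => ?_
  have h : TensorProduct.map (ofUp n b).toLinearMap (ofUp n b).toLinearMap
      (underlying Up.comul u) = 0 := by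
    have := comul_ofUp hH u
    rw [hu, map_zero] at this
    exact this.symm
  have h2 := congrArg ((Up.toP ∘ₗ (rep n b).toLinearMap).rTensor (Red (Uh n b))) h
  rw [map_zero] at h2
  rw [← h2]
  generalize underlying Up.comul u = w
  induction w with
  | zero => simp only [map_zero]
  | tmul c d =>
    rw [TensorProduct.map_tmul, TensorProduct.map_tmul, LinearMap.rTensor_tmul, Up.pr_apply,
      ← rep_ofUp (b := b)]
    rfl
  | add c d hc hd => simp only [map_add, hc, hd]

variable (n b) in
/-- The form modulo `ħ` is the enveloping superalgebra. -/
def redEquiv : Up n ≃ₐ[ℂ] Red (Uh n b) :=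
  AlgEquiv.ofBijective (ofUp n b) ⟨ofUp_injective, ofUp_surjective⟩

variable (n b) in
/-- The reduction modulo `ħ`. -/
def red : Uh n b →ₛₗ[(PowerSeries.constantCoeff : PowerSeries ℂ →+* ℂ)] Up n :=
  (redEquiv n b).symm.toLinearMap ∘ₛₗ Red.mk (Uh n b)

theorem ofUp_red (a : Uh n b) : ofUp n b (red n b a) = Red.mk _ a :=
  (redEquiv n b).apply_symm_apply _

theorem isSuperHom_red : IsSuperHom (red n b) where
  map_one := by
    apply ofUp_injective (b := b)
    rw [ofUp_red, Red.mk_one, map_one]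
  map_mul x y := by
    apply ofUp_injective (b := b)
    rw [ofUp_red, Red.mk_mul, map_mul, ofUp_red, ofUp_red]
  map_parity x := by
    apply ofUp_injective (b := b)
    refine Eq.trans ?_ (isSuperHom_ofUp.map_parity _).symm
    rw [ofUp_red, Red.isSuperHom_mk.map_parity]
    exact congrArg _ (ofUp_red x).symm

theorem red_surjective : Function.Surjective (red n b) := fun u => by
  obtain ⟨a, ha⟩ := Red.mk_surjective (ofUp n b u)
  exact ⟨a, ofUp_injective ((ofUp_red a).trans ha)⟩

theorem red_eq_zero {a : Uh n b} :
    red n b a = 0 ↔ ∃ d, a = (PowerSeries.X : PowerSeries ℂ) • d := by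
  rw [← Red.mk_eq_zero, ← ofUp_red, map_eq_zero_iff _ ofUp_injective]

theorem red_lam (i j : Idx n) : red n b (lam b i j) = Up.ι (pL i j) := by
  apply ofUp_injective (b := b)
  rw [ofUp_red, ofUp_pL]
  rfl

theorem red_of_incl_eq {x : Uh n b} {i : Idx n} (hx : incl b x = QEA.tinv qh i) :
    red n b x = 1 :=
  eq_one_of_incl_eq isSuperHom_red.map_one isSuperHom_red.map_mul hx

theorem isStandardReduction_red : IsStandardReduction (red n b) where
  off_diag i j h := by
    have h1 : i ≠ j := fun e => h.ne (congrArg Prod.fst e)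
    have h2 := red_lam (b := b) i j
    rw [lam_of_ne h1 h.le, units_smul_map, map_smulₛₗ, constantCoeff_g_sub, one_smul, pL_eq,
      if_pos h, one_smul, units_smul_map] at h2
    have key : ∀ i j : ZMod 2, sgn (i * j) * sgn ((i + 1) * j) = sgn j := by decide
    rw [← key i.2 j.2, mul_smul, h2, smul_smul, Int.units_mul_self, one_smul]
  diag i h := by
    have h2 := red_lam (b := b) i i
    rw [lam_self, map_smulₛₗ, constantCoeff_g, pL_eq, if_neg (lt_irrefl _), if_pos rfl, h, mul_zero,
      sgn_zero, one_smul, map_smul, one_div] at h2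
    exact (smul_right_injective _ (inv_ne_zero (two_ne_zero (α := ℂ))) h2).symm
  anti_diag i h := by
    have h2 := red_lam (b := b) i i.neg
    have h3 : i.neg.2 = 1 := by
      change i.2 + 1 = 1
      rw [h]
      decide
    rw [lam_of_ne i.neg_ne le_rfl, units_smul_map, map_smulₛₗ, constantCoeff_g_sub, one_smul, pL_eq,
      if_neg (c := i.1 < i.neg.1) (lt_irrefl i.1), if_pos (c := i.1 = i.neg.1) rfl, h, h3, zero_mul,
      sgn_zero, one_smul, map_smul, zero_add, one_mul, sgn_one, Units.neg_smul, one_smul] at h2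
    rw [neg_mul, ← mul_neg, h2, ← map_ofNat (algebraMap ℂ (Up n)) 2, ← Algebra.smul_def, smul_smul,
      mul_inv_cancel₀ two_ne_zero, one_smul]

theorem ringHom_ext {C : Type*} [Ring C] {F G : Uh n b →+* C}
    (h : ∀ x ∈ gens n b, F x = G x) (hr : ∀ r, F (algebraMap (PowerSeries ℂ) _ r) = G (algebraMap (PowerSeries ℂ) _ r)) :
    F = G := by
  ext a
  have ha : a ∈ Algebra.adjoin (PowerSeries ℂ) (gens n b) := by
    rw [adjoin_gens]
    trivial
  induction ha using Algebra.adjoin_induction with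
  | mem x hx => exact h x hx
  | algebraMap r => exact hr r
  | add x y _ _ hx hy => rw [map_add, map_add, hx, hy]
  | mul x y _ _ hx hy => rw [map_mul, map_mul, hx, hy]

theorem red_comul {H : SuperBialgebra (PowerSeries ℂ) (Uh n b)}
    (hH : IsRestriction H (QEA.superBialgebra qh n)) (a : Uh n b) :
    TensorProduct.map (red n b) (red n b) (H.Δ a) = (Up.superBialgebra n).Δ (red n b a) := by
  let R : Uh n b →+* Up n :=
    { toFun := red n b
      map_one' := isSuperHom_red.map_one
      map_mul' := isSuperHom_red.map_mul
      map_zero' := map_zero _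
      map_add' := map_add _ }
  have : isSuperHom_red.tensor.comp H.comul.toRingHom = Up.comul.toRingHom.comp R := by
    refine ringHom_ext ?_ fun r => ?_
    · rintro x (⟨i, j, rfl⟩ | ⟨-, i, hi⟩)
      · change TensorProduct.map (red n b) (red n b) (H.Δ (lam b i j)) = underlying Up.comul (red n b (lam b i j))
        rw [Δ_lam hH, comulLam, map_add, map_add, map_smulₛₗ, PowerSeries.constantCoeff_X, zero_smul,
          add_zero, TensorProduct.map_tmul, TensorProduct.map_tmul, isSuperHom_red.map_one, red_lam,
          Up.underlying_comul_ι]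
      · change TensorProduct.map (red n b) (red n b) (H.Δ x) = underlying Up.comul (red n b x)
        rw [Δ_of_incl_eq hH hi, red_of_incl_eq hi, TensorProduct.map_tmul, red_of_incl_eq hi,
          Up.underlying_comul_one]
    · change isSuperHom_red.tensor (H.comul (algebraMap _ _ r)) = Up.comul (red n b (algebraMap _ _ r))
      rw [AlgHom.commutes, Algebra.algebraMap_eq_smul_one, Algebra.algebraMap_eq_smul_one,
        IsSuperHom.tensor_smul, map_smulₛₗ, isSuperHom_red.map_one, map_one, map_smul, map_one]
  exact DFunLike.congr_fun this a

theorem red_counit {H : SuperBialgebra (PowerSeries ℂ) (Uh n b)}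
    (hH : IsRestriction H (QEA.superBialgebra qh n)) (a : Uh n b) :
    PowerSeries.constantCoeff (H.counit a) = (Up.superBialgebra n).counit (red n b a) := by
  let R : Uh n b →+* Up n :=
    { toFun := red n b
      map_one' := isSuperHom_red.map_one
      map_mul' := isSuperHom_red.map_mul
      map_zero' := map_zero _
      map_add' := map_add _ }
  have : (PowerSeries.constantCoeff (R := ℂ)).comp H.counit.toRingHom =
      Up.counit.toRingHom.comp R := by
    refine ringHom_ext ?_ fun r => ?_
    · rintro x (⟨i, j, rfl⟩ | ⟨-, i, hi⟩)
      · change PowerSeries.constantCoeff (H.counit (lam b i j)) = Up.counit (red n b (lam b i j))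
        rw [counit_lam hH, red_lam, Up.counit_ι, map_zero]
      · change PowerSeries.constantCoeff (H.counit x) = Up.counit (red n b x)
        rw [counit_of_incl_eq hH hi, red_of_incl_eq hi, map_one, map_one]
    · change PowerSeries.constantCoeff (H.counit (algebraMap _ _ r)) = Up.counit (red n b (algebraMap _ _ r))
      rw [AlgHom.commutes, Algebra.algebraMap_eq_smul_one (A := Uh n b), map_smulₛₗ,
        isSuperHom_red.map_one, map_smul, map_one, smul_eq_mul, mul_one]
      rfl
  exact DFunLike.congr_fun this a

end Uh

/-! ### The classical limit of the super cocommutator -/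

section SuperTriple

variable {R A R' A' : Type*} [CommRing R] [Ring A] [Algebra R A] [Superalgebra R A]
  [CommRing R'] [Ring A'] [Algebra R' A'] [Superalgebra R' A']
  {σ : R →+* R'} [Invertible (2 : R)] [Invertible (2 : R')]

/-- The third tensor power of a semilinear map. -/
def tripleMap (f : A →ₛₗ[σ] A') : (A ⊗[R] A) ⊗[R] A →ₛₗ[σ] (A' ⊗[R'] A') ⊗[R'] A' :=
  TensorProduct.map (TensorProduct.map f f) f

theorem tripleMap_rTensor (f : A →ₛₗ[σ] A') {φ : A →ₗ[R] A ⊗[R] A} {ψ : A' →ₗ[R'] A' ⊗[R'] A'}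
    (h : ∀ a, TensorProduct.map f f (φ a) = ψ (f a)) (w : A ⊗[R] A) :
    tripleMap f (φ.rTensor A w) = ψ.rTensor A' (TensorProduct.map f f w) := by
  induction w with
  | zero => simp only [map_zero]
  | tmul a b =>
    rw [LinearMap.rTensor_tmul, TensorProduct.map_tmul, LinearMap.rTensor_tmul, ← h]
    rfl
  | add a b ha hb => simp only [map_add, ha, hb]

theorem tripleMap_assoc_symm (f : A →ₛₗ[σ] A') (w : A ⊗[R] (A ⊗[R] A)) :
    tripleMap f ((TensorProduct.assoc R A A A).symm w) =
      (TensorProduct.assoc R' A' A' A').symm (TensorProduct.map f (TensorProduct.map f f) w) := by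
  induction w with
  | zero => simp only [map_zero]
  | tmul a w =>
    induction w with
    | zero => simp only [TensorProduct.tmul_zero, map_zero]
    | tmul b c => rfl
    | add x y hx hy => simp only [TensorProduct.tmul_add, map_add, hx, hy]
  | add x y hx hy => simp only [map_add, hx, hy]

theorem tripleMap_lTensor (f : A →ₛₗ[σ] A') {φ : A →ₗ[R] A ⊗[R] A} {ψ : A' →ₗ[R'] A' ⊗[R'] A'}
    (h : ∀ a, TensorProduct.map f f (φ a) = ψ (f a)) (w : A ⊗[R] A) :
    tripleMap f ((TensorProduct.assoc R A A A).symm (φ.lTensor A w)) =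
      (TensorProduct.assoc R' A' A' A').symm (ψ.lTensor A' (TensorProduct.map f f w)) := by
  rw [tripleMap_assoc_symm]
  congr 1
  induction w with
  | zero => simp only [map_zero]
  | tmul a b =>
    rw [LinearMap.lTensor_tmul, TensorProduct.map_tmul, TensorProduct.map_tmul,
      LinearMap.lTensor_tmul, ← h]
  | add a b ha hb => simp only [map_add, ha, hb]

theorem IsSuperHom.tripleMap_superSwap12 {f : A →ₛₗ[σ] A'} (hf : IsSuperHom f)
    (w : (A ⊗[R] A) ⊗[R] A) :
    tripleMap f (superSwap12 R A w) = superSwap12 R' A' (tripleMap f w) := by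
  induction w with
  | zero => simp only [map_zero]
  | tmul x a =>
    change TensorProduct.map f f (superSwap R A x) ⊗ₜ[R'] f a =
      superSwap R' A' (TensorProduct.map f f x) ⊗ₜ[R'] f a
    rw [hf.map_superSwap]
  | add a b ha hb => simp only [map_add, ha, hb]

theorem IsSuperHom.tripleMap_superSwap23 {f : A →ₛₗ[σ] A'} (hf : IsSuperHom f)
    (w : (A ⊗[R] A) ⊗[R] A) :
    tripleMap f (superSwap23 R A w) = superSwap23 R' A' (tripleMap f w) := by
  obtain ⟨w, rfl⟩ := (TensorProduct.assoc R A A A).symm.surjective w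
  rw [tripleMap_assoc_symm, superSwap23, superSwap23]
  simp only [LinearMap.comp_apply, LinearEquiv.coe_coe, LinearEquiv.apply_symm_apply]
  rw [tripleMap_assoc_symm]
  congr 1
  induction w with
  | zero => simp only [map_zero]
  | tmul a x =>
    rw [LinearMap.lTensor_tmul, TensorProduct.map_tmul, TensorProduct.map_tmul,
      LinearMap.lTensor_tmul, hf.map_superSwap]
  | add a b ha hb => simp only [map_add, ha, hb]

theorem IsSuperHom.tripleMap_superCyc {f : A →ₛₗ[σ] A'} (hf : IsSuperHom f)
    (w : (A ⊗[R] A) ⊗[R] A) :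
    tripleMap f (superCyc R A w) = superCyc R' A' (tripleMap f w) := by
  rw [superCyc, LinearMap.comp_apply, hf.tripleMap_superSwap23, hf.tripleMap_superSwap12]
  rfl

end SuperTriple

namespace SuperBialgebra

variable {R A : Type*} [CommRing R] [Ring A] [Algebra R A] [Superalgebra R A] [Invertible (2 : R)]
  (H : SuperBialgebra R A)

theorem isSuperHom_parity : IsSuperHom (parity R : A →ₐ[R] A).toLinearMap :=
  ⟨map_one (parity R), map_mul (parity R), fun _ => rfl⟩

theorem cocomm_parity (a : A) : H.cocomm (parity R a) =
    TensorProduct.map (parity R).toLinearMap (parity R).toLinearMap (H.cocomm a) := by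
  rw [cocomm_apply, cocomm_apply, Δ_parity, map_sub, isSuperHom_parity.map_superSwap]

/-- Both `Δ` and `Δ°` are multiplicative, and `Δ a - cocomm a` is `Δ° a`. In the classical limit
`Δ°` and `Δ` agree, and the rule becomes the coderivation property. -/
theorem cocomm_mul (a b : A) : GradedTensorProduct.of R (part R A) (part R A) (H.cocomm (a * b)) =
    GradedTensorProduct.of R (part R A) (part R A) (H.cocomm a) * H.comul b +
      (H.comul a - GradedTensorProduct.of R (part R A) (part R A) (H.cocomm a)) *
        GradedTensorProduct.of R (part R A) (part R A) (H.cocomm b) := by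
  have h (x : A) : GradedTensorProduct.of R (part R A) (part R A) (H.cocomm x) =
      H.comul x - GradedTensorProduct.comm (part R A) (part R A) (H.comul x) := rfl
  rw [h, h, h, map_mul, map_mul]
  noncomm_ring

end SuperBialgebra

section Limit

variable {A A₀ : Type*} [Ring A] [Algebra (PowerSeries ℂ) A] [Superalgebra (PowerSeries ℂ) A]
  [Ring A₀] [Algebra ℂ A₀] [Superalgebra ℂ A₀]

/-- `A` is a deformation, by means of the reduction `ρ`, and it is cocommutative modulo `ħ`. -/
structure IsDeformation (H : SuperBialgebra (PowerSeries ℂ) A) (H₀ : SuperBialgebra ℂ A₀)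
    (ρ : A →ₛₗ[(PowerSeries.constantCoeff : PowerSeries ℂ →+* ℂ)] A₀) : Prop where
  isSuperHom : IsSuperHom ρ
  surjective : Function.Surjective ρ
  ker (a : A) : ρ a = 0 ↔ ∃ b : A, a = (PowerSeries.X : PowerSeries ℂ) • b
  map_comul (a : A) : TensorProduct.map ρ ρ (H.Δ a) = H₀.Δ (ρ a)
  map_counit (a : A) : PowerSeries.constantCoeff (H.counit a) = H₀.counit (ρ a)
  exists_div (a : A) : ∃ D : A ⊗[PowerSeries ℂ] A, (PowerSeries.X : PowerSeries ℂ) • D = H.cocomm a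

namespace IsDeformation

variable [Module.Flat (PowerSeries ℂ) A] {H : SuperBialgebra (PowerSeries ℂ) A}
  {H₀ : SuperBialgebra ℂ A₀} {ρ : A →ₛₗ[(PowerSeries.constantCoeff : PowerSeries ℂ →+* ℂ)] A₀}

theorem X_smul_injective₂ : Function.Injective fun x : A ⊗[PowerSeries ℂ] A =>
    (PowerSeries.X : PowerSeries ℂ) • x :=
  smul_right_injective _ PowerSeries.X_ne_zero

theorem X_smul_injective₃ :
    Function.Injective fun x : (A ⊗[PowerSeries ℂ] A) ⊗[PowerSeries ℂ] A =>
      (PowerSeries.X : PowerSeries ℂ) • x :=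
  smul_right_injective _ PowerSeries.X_ne_zero

/-- The map `ħ⁻¹ (Δ - Δ°)`. -/
def div (h : IsDeformation H H₀ ρ) : A →ₗ[PowerSeries ℂ] A ⊗[PowerSeries ℂ] A where
  toFun a := (h.exists_div a).choose
  map_add' a b := X_smul_injective₂ <| by
    change (PowerSeries.X : PowerSeries ℂ) • (h.exists_div (a + b)).choose = (PowerSeries.X : PowerSeries ℂ) •
      ((h.exists_div a).choose + (h.exists_div b).choose)
    rw [smul_add, (h.exists_div (a + b)).choose_spec, (h.exists_div a).choose_spec,
      (h.exists_div b).choose_spec, map_add]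
  map_smul' r a := X_smul_injective₂ <| by
    change (PowerSeries.X : PowerSeries ℂ) • (h.exists_div (r • a)).choose = (PowerSeries.X : PowerSeries ℂ) •
      (r • (h.exists_div a).choose)
    rw [smul_comm, (h.exists_div (r • a)).choose_spec, (h.exists_div a).choose_spec, map_smul]

theorem X_smul_div (h : IsDeformation H H₀ ρ) (a : A) :
    (PowerSeries.X : PowerSeries ℂ) • h.div a = H.cocomm a := (h.exists_div a).choose_spec

theorem eq_div (h : IsDeformation H H₀ ρ) {a : A} {D : A ⊗[PowerSeries ℂ] A}
    (hD : (PowerSeries.X : PowerSeries ℂ) • D = H.cocomm a) : D = h.div a :=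
  X_smul_injective₂ (hD.trans (h.X_smul_div a).symm)

/-- If `a - b` is a multiple of `ħ`, then so is the difference of the images under the linear map
`div`. Hence the cobracket on the reduction is well defined. -/
theorem map_div_congr (h : IsDeformation H H₀ ρ) {a b : A} (hab : ρ a = ρ b) :
    TensorProduct.map ρ ρ (h.div a) = TensorProduct.map ρ ρ (h.div b) := by
  rw [← sub_eq_zero, ← map_sub, h.ker] at hab
  obtain ⟨c, hc⟩ := hab
  rw [← sub_eq_zero, ← map_sub, ← map_sub, hc, map_smul, map_smulₛₗ, PowerSeries.constantCoeff_X,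
    zero_smul]

/-- The reduction of `ħ⁻¹ (Δ - Δ°)`. -/
def cobracket (h : IsDeformation H H₀ ρ) : A₀ →ₗ[ℂ] A₀ ⊗[ℂ] A₀ where
  toFun u := TensorProduct.map ρ ρ (h.div (Function.surjInv h.surjective u))
  map_add' u v := by
    rw [← map_add, ← map_add]
    apply h.map_div_congr
    rw [map_add]
    simp only [Function.surjInv_eq h.surjective]
  map_smul' c u := by
    have : TensorProduct.map ρ ρ (h.div (PowerSeries.C c • Function.surjInv h.surjective u)) =
        c • TensorProduct.map ρ ρ (h.div (Function.surjInv h.surjective u)) := by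
      rw [map_smul, map_smulₛₗ, PowerSeries.constantCoeff_C]
    rw [RingHom.id_apply, ← this]
    apply h.map_div_congr
    rw [map_smulₛₗ, PowerSeries.constantCoeff_C]
    simp only [Function.surjInv_eq h.surjective]

theorem cobracket_apply (h : IsDeformation H H₀ ρ) (a : A) :
    h.cobracket (ρ a) = TensorProduct.map ρ ρ (h.div a) :=
  h.map_div_congr (Function.surjInv_eq h.surjective _)

theorem X_smul_div_rTensor (h : IsDeformation H H₀ ρ) (w : A ⊗[PowerSeries ℂ] A) :
    (PowerSeries.X : PowerSeries ℂ) • h.div.rTensor A w = H.cocomm.rTensor A w := by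
  have : H.cocomm = (PowerSeries.X : PowerSeries ℂ) • h.div := LinearMap.ext fun a =>
    (h.X_smul_div a).symm
  rw [this, LinearMap.rTensor_smul]
  rfl

theorem X_smul_div_lTensor (h : IsDeformation H H₀ ρ) (w : A ⊗[PowerSeries ℂ] A) :
    (PowerSeries.X : PowerSeries ℂ) • h.div.lTensor A w = H.cocomm.lTensor A w := by
  have : H.cocomm = (PowerSeries.X : PowerSeries ℂ) • h.div := LinearMap.ext fun a =>
    (h.X_smul_div a).symm
  rw [this, LinearMap.lTensor_smul]
  rfl

theorem div_mul (h : IsDeformation H H₀ ρ) (a b : A) :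
    GradedTensorProduct.of (PowerSeries ℂ) (part _ A) (part _ A) (h.div (a * b)) =
    GradedTensorProduct.of (PowerSeries ℂ) (part _ A) (part _ A) (h.div a) * H.comul b +
      (H.comul a - (PowerSeries.X : PowerSeries ℂ) •
        GradedTensorProduct.of (PowerSeries ℂ) (part _ A) (part _ A) (h.div a)) *
        GradedTensorProduct.of (PowerSeries ℂ) (part _ A) (part _ A) (h.div b) := by
  have hinj : Function.Injective fun x : SuperTensor (PowerSeries ℂ) A =>
    (PowerSeries.X : PowerSeries ℂ) • x := X_smul_injective₂
  apply hinj
  change (PowerSeries.X : PowerSeries ℂ) • _ = (PowerSeries.X : PowerSeries ℂ) • _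
  have hs (x : A) : (PowerSeries.X : PowerSeries ℂ) •
      GradedTensorProduct.of (PowerSeries ℂ) (part _ A) (part _ A) (h.div x) =
        GradedTensorProduct.of (PowerSeries ℂ) (part _ A) (part _ A) (H.cocomm x) := by
    rw [← map_smul (GradedTensorProduct.of (PowerSeries ℂ) (part _ A) (part _ A)), h.X_smul_div]
  rw [smul_add, ← smul_mul_assoc, ← mul_smul_comm, hs, hs, hs, H.cocomm_mul]

/-- Each identity holds exactly for `Δ - Δ°`. Multiplication by `ħ` is injective on the tensor
powers by flatness, so the identities can be divided by powers of `ħ` and then reduced. -/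
theorem isCoPoisson_cobracket (h : IsDeformation H H₀ ρ) : H₀.IsCoPoisson h.cobracket where
  even u := by
    obtain ⟨a, rfl⟩ := h.surjective u
    have h1 : h.div (parity (PowerSeries ℂ) a) =
        TensorProduct.map (parity _).toLinearMap (parity _).toLinearMap (h.div a) := by
      apply X_smul_injective₂
      change (PowerSeries.X : PowerSeries ℂ) • _ = (PowerSeries.X : PowerSeries ℂ) • _
      rw [← map_smul (TensorProduct.map (parity (PowerSeries ℂ) : A →ₐ[PowerSeries ℂ] A).toLinearMap
        (parity (PowerSeries ℂ) : A →ₐ[PowerSeries ℂ] A).toLinearMap), h.X_smul_div, h.X_smul_div,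
        H.cocomm_parity]
    rw [← h.isSuperHom.map_parity, h.cobracket_apply, h.cobracket_apply, h1]
    generalize h.div a = w
    induction w with
    | zero => simp only [map_zero]
    | tmul a b =>
      simp only [TensorProduct.map_tmul, AlgHom.toLinearMap_apply, h.isSuperHom.map_parity]
    | add a b ha hb => simp only [map_add, ha, hb]
  map_mul u v := by
    obtain ⟨a, rfl⟩ := h.surjective u
    obtain ⟨b, rfl⟩ := h.surjective v
    have e (x : A) : GradedTensorProduct.of ℂ (part ℂ A₀) (part ℂ A₀) (h.cobracket (ρ x)) =
        h.isSuperHom.tensor (GradedTensorProduct.of _ (part _ A) (part _ A) (h.div x)) := by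
      rw [h.cobracket_apply]
      rfl
    have e2 (x : A) : H₀.comul (ρ x) = h.isSuperHom.tensor (H.comul x) := (h.map_comul x).symm
    rw [← h.isSuperHom.map_mul, e, e, e, e2, e2, h.div_mul, map_add, map_mul, map_mul, map_sub,
      IsSuperHom.tensor_smul, PowerSeries.constantCoeff_X, zero_smul, sub_zero]
  skew u := by
    obtain ⟨a, rfl⟩ := h.surjective u
    have h1 : superSwap _ A (h.div a) = -h.div a := by
      apply X_smul_injective₂
      change (PowerSeries.X : PowerSeries ℂ) • _ = (PowerSeries.X : PowerSeries ℂ) • _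
      rw [← map_smul, smul_neg, h.X_smul_div, H.cocomm_skew]
    rw [h.cobracket_apply, ← h.isSuperHom.map_superSwap, h1, map_neg]
  coJacobi u := by
    obtain ⟨a, rfl⟩ := h.surjective u
    have h1 : h.div.rTensor A (h.div a) + superCyc _ A (h.div.rTensor A (h.div a)) +
        superCyc _ A (superCyc _ A (h.div.rTensor A (h.div a))) = 0 := by
      -- The co-Jacobi identity is quadratic in the cobracket, so one factor `ħ` is removed for each
      -- of its two occurrences.
      apply X_smul_injective₃
      apply X_smul_injective₃
      simp only [smul_add, ← map_smul, h.X_smul_div, smul_zero, h.X_smul_div_rTensor]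
      simpa only [← map_smul, h.X_smul_div, h.X_smul_div_rTensor] using H.cocomm_coJacobi a
    have h2 := congrArg (tripleMap ρ) h1
    have e := tripleMap_rTensor ρ fun a => (h.cobracket_apply a).symm
    rw [map_add, map_add, h.isSuperHom.tripleMap_superCyc, h.isSuperHom.tripleMap_superCyc,
      h.isSuperHom.tripleMap_superCyc, e, ← h.cobracket_apply, map_zero] at h2
    exact h2
  coLeibniz u := by
    obtain ⟨a, rfl⟩ := h.surjective u
    have h1 : H.Δ.rTensor A (h.div a) =
        (TensorProduct.assoc _ A A A).symm (h.div.lTensor A (H.Δ a)) +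
          superSwap23 _ A (h.div.rTensor A (H.Δ a)) := by
      apply X_smul_injective₃
      change (PowerSeries.X : PowerSeries ℂ) • _ = (PowerSeries.X : PowerSeries ℂ) • _
      rw [smul_add, ← map_smul, ← map_smul (superSwap23 _ A), ← map_smul (TensorProduct.assoc _ A A A).symm,
        h.X_smul_div, h.X_smul_div_rTensor, h.X_smul_div_lTensor, H.cocomm_coLeibniz]
    have h2 := congrArg (tripleMap ρ) h1
    rw [map_add, tripleMap_rTensor ρ h.map_comul, h.isSuperHom.tripleMap_superSwap23,
      tripleMap_rTensor ρ fun a => (h.cobracket_apply a).symm,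
      tripleMap_lTensor ρ fun a => (h.cobracket_apply a).symm, h.map_comul, ← h.cobracket_apply] at h2
    exact h2

theorem isQuantization (h : IsDeformation H H₀ ρ) : IsQuantization H H₀ h.cobracket ρ where
  flat := inferInstance
  map_one := h.isSuperHom.map_one
  map_mul := h.isSuperHom.map_mul
  surjective := h.surjective
  ker := h.ker
  map_parity := h.isSuperHom.map_parity
  map_comul := h.map_comul
  map_counit := h.map_counit
  exists_div := h.exists_div
  limit a D hD := by rw [h.cobracket_apply, h.eq_div hD]

end IsDeformation

end Limit

/-! ### The cobracket obtained from the forms -/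

namespace Uh

open HAdic

variable {n : ℕ} {b : Bool}

variable (b) in
/-- The element `ħ⁻¹ (Δ - Δ°)` at `lam`. -/
def divLam (i j : Idx n) : Uh n b ⊗[PowerSeries ℂ] Uh n b :=
  ∑ k, (lam b i k ⊗ₜ lam b k j - sgn ((i.2 + k.2) * (k.2 + j.2)) • (lam b k j ⊗ₜ lam b i k))

/-- The primitive part `λ ⊗ 1 + 1 ⊗ λ` is invariant under the super swap, so only the terms with the
factor `ħ` contribute. -/
theorem X_smul_divLam {H : SuperBialgebra (PowerSeries ℂ) (Uh n b)}
    (hH : IsRestriction H (QEA.superBialgebra qh n)) (i j : Idx n) :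
    (PowerSeries.X : PowerSeries ℂ) • divLam b i j = H.cocomm (lam b i j) := by
  have h1 (x : Uh n b) : superSwap (PowerSeries ℂ) (Uh n b) (x ⊗ₜ 1) = 1 ⊗ₜ x ∧
      superSwap (PowerSeries ℂ) (Uh n b) (1 ⊗ₜ x) = x ⊗ₜ 1 := by
    refine induction_homog (PowerSeries ℂ) (P := fun x : Uh n b =>
      superSwap (PowerSeries ℂ) (Uh n b) (x ⊗ₜ 1) = 1 ⊗ₜ x ∧
      superSwap (PowerSeries ℂ) (Uh n b) (1 ⊗ₜ x) = x ⊗ₜ 1) (fun i a ha => ?_)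
      (fun a c ha hc => ?_) x
    · rw [superSwap_tmul ha one_mem_part, superSwap_tmul one_mem_part ha, mul_zero, zero_mul,
        sgn_zero, one_smul, one_smul]
      exact ⟨rfl, rfl⟩
    · rw [TensorProduct.add_tmul, TensorProduct.tmul_add, map_add, map_add, ha.1, ha.2, hc.1, hc.2]
      exact ⟨rfl, rfl⟩
  rw [H.cocomm_apply, Δ_lam hH, comulLam, map_add, map_add, (h1 _).1, (h1 _).2, map_smul, map_sum,
    divLam, Finset.sum_sub_distrib, smul_sub]
  simp only [superSwap_tmul (lam_mem _ _) (lam_mem _ _)]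
  abel

variable (n b) in
theorem isDeformation {H : SuperBialgebra (PowerSeries ℂ) (Uh n b)}
    (hH : IsRestriction H (QEA.superBialgebra qh n)) :
    IsDeformation H (Up.superBialgebra n) (red n b) where
  isSuperHom := isSuperHom_red
  surjective := red_surjective
  ker _ := red_eq_zero
  map_comul := red_comul hH
  map_counit := red_counit hH
  exists_div a := by
    have ha : a ∈ Algebra.adjoin (PowerSeries ℂ) (gens n b) := by
      rw [adjoin_gens]
      trivial
    induction ha using Algebra.adjoin_induction with
    | mem x hx =>
      obtain ⟨i, j, rfl⟩ | ⟨-, i, hi⟩ := hx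
      · exact ⟨_, X_smul_divLam hH i j⟩
      -- The inverses `t_{ii}⁻¹` are even and group-like, so their cocommutator vanishes.
      · have hx0 : x ∈ part (PowerSeries ℂ) (Uh n b) 0 := by
          rw [mem_part_zero]
          apply incl_injective b
          rw [(isSuperHom_incl b).map_parity, hi]
          exact QEA.parity_tinv qh i
        refine ⟨0, ?_⟩
        rw [H.cocomm_apply, Δ_of_incl_eq hH hi, superSwap_tmul hx0 hx0, mul_zero, sgn_zero, one_smul,
          sub_self, smul_zero]
    | algebraMap r =>
      refine ⟨0, ?_⟩
      have h1 : superSwap (PowerSeries ℂ) (Uh n b) (1 ⊗ₜ 1) = 1 ⊗ₜ 1 := by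
        rw [superSwap_tmul one_mem_part one_mem_part, mul_zero, sgn_zero, one_smul]
      rw [Algebra.algebraMap_eq_smul_one, map_smul, H.cocomm_apply, underlying_map_one, h1,
        sub_self, smul_zero, smul_zero]
    | add x y _ _ hx hy =>
      obtain ⟨D, hD⟩ := hx
      obtain ⟨E, hE⟩ := hy
      exact ⟨D + E, by rw [smul_add, map_add, hD, hE]⟩
    | mul x y _ _ hx hy =>
      obtain ⟨D, hD⟩ := hx
      obtain ⟨E, hE⟩ := hy
      let e := GradedTensorProduct.of (PowerSeries ℂ) (part (PowerSeries ℂ) (Uh n b))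
        (part (PowerSeries ℂ) (Uh n b))
      -- The quotient by `ħ` of the product rule `cocomm_mul`: in each summand the cocommutator
      -- factor is divided.
      refine ⟨e.symm (e D * H.comul y + (H.comul x - e (H.cocomm x)) * e E), ?_⟩
      apply e.injective
      rw [H.cocomm_mul, ← hD, ← hE, map_smul, map_smul, map_smul, LinearEquiv.apply_symm_apply,
        smul_add, smul_mul_assoc, mul_smul_comm]

theorem cobracket_pL {H : SuperBialgebra (PowerSeries ℂ) (Uh n b)}
    (hH : IsRestriction H (QEA.superBialgebra qh n)) (i j : Idx n) :
    (isDeformation n b hH).cobracket (Up.ι (pL i j)) =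
      ∑ k, (Up.ι (pL i k) ⊗ₜ Up.ι (pL k j) -
        sgn ((i.2 + k.2) * (k.2 + j.2)) • (Up.ι (pL k j) ⊗ₜ Up.ι (pL i k))) := by
  rw [← red_lam (b := b), IsDeformation.cobracket_apply,
    ← (isDeformation n b hH).eq_div (X_smul_divLam hH i j), divLam, map_sum]
  refine Finset.sum_congr rfl fun k _ => ?_
  rw [map_sub, units_smul_map, TensorProduct.map_tmul, TensorProduct.map_tmul, red_lam, red_lam]

end Uh

/-! ### The Manin triple -/

theorem units_smul_tmul_units_smul {R M N : Type*} [CommRing R] [AddCommGroup M] [Module R M]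
    [AddCommGroup N] [Module R N] (u v : ℤˣ) (x : M) (y : N) :
    (u • x) ⊗ₜ[R] (v • y) = u • v • (x ⊗ₜ[R] y) :=
  (units_smul_map ((TensorProduct.mk R M N).flip _) u x).trans
    (congrArg _ (units_smul_map (TensorProduct.mk R M N x) v y))

theorem units_smul_smul_smul {R M : Type*} [CommRing R] [AddCommGroup M] [Module R M]
    (u v w : ℤˣ) (r : R) (x : M) : (u * v * w) • (w • r) • x = u • v • r • x := by
  rw [smul_assoc, smul_smul, mul_assoc, Int.units_mul_self, mul_one, mul_smul]

section Manin

variable {n : ℕ}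

/-- The linear equations of the butterfly superalgebra. -/
structure IsButterfly (Y : Mat ℂ n) : Prop where
  diag (i : Idx n) : Y i i = Y i.neg i.neg
  anti (i : Idx n) (hi : i.2 = 0) : Y i.neg i = 0
  lower (i j : Idx n) (hij : j.1 < i.1) : Y i j = 0

theorem Idx.neg_injective : Function.Injective (Idx.neg : Idx n → Idx n) := fun i j h => by
  rw [← i.neg_neg, h, j.neg_neg]

theorem isButterfly_of_mem {Y : Mat ℂ n} (hY : Y ∈ butterfly n) : IsButterfly Y := by
  induction hY using Submodule.span_induction with
  | mem Y hY =>
    obtain (⟨i, j, hij, rfl⟩ | ⟨i, hi, rfl⟩) | ⟨i, hi, rfl⟩ := hY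
    · have h (k l : Idx n) (hkl : ¬ k.1 < l.1) : (el i j : Mat ℂ n) k l = 0 := by
        rw [QEA.el_apply, if_neg]
        rintro ⟨rfl, rfl⟩
        exact hkl hij
      exact ⟨fun k => by rw [h _ _ (lt_irrefl _), h _ _ (lt_irrefl _)],
        fun k _ => h _ _ (lt_irrefl k.1), fun k l hkl => h _ _ hkl.not_gt⟩
    · refine ⟨fun k => ?_, fun k _ => ?_, fun k l hkl => ?_⟩ <;>
        simp only [Matrix.add_apply, QEA.el_apply]
      · rw [add_comm]
        simp only [Idx.neg_injective.eq_iff, Idx.eq_neg_iff (i := i), @eq_comm _ k i.neg, and_self]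
      · rw [if_neg, if_neg, add_zero]
        · rintro ⟨h1, h2⟩
          exact k.neg_ne (h2.symm.trans h1)
        · rintro ⟨h1, h2⟩
          exact k.neg_ne (h2.symm.trans h1)
      · rw [if_neg, if_neg, add_zero]
        · rintro ⟨rfl, rfl⟩
          exact hkl.ne rfl
        · rintro ⟨rfl, rfl⟩
          exact hkl.ne rfl
    · refine ⟨fun k => ?_, fun k hk => ?_, fun k l hkl => ?_⟩ <;> simp only [QEA.el_apply]
      · rw [if_neg, if_neg]
        · rintro ⟨h1, h2⟩
          exact i.neg_ne (h1.trans h2.symm)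
        · rintro ⟨h1, h2⟩
          exact i.neg_ne (h1.trans h2.symm)
      · rw [if_neg]
        rintro ⟨rfl, -⟩
        change k.2 + 1 = 0 at hi
        rw [hk] at hi
        exact absurd hi (by decide)
      · rw [if_neg]
        rintro ⟨rfl, rfl⟩
        exact hkl.ne rfl
  | zero => exact ⟨fun _ => rfl, fun _ _ => rfl, fun _ _ _ => rfl⟩
  | add X Y _ _ hX hY =>
    refine ⟨fun i => ?_, fun i hi => ?_, fun i j hij => ?_⟩ <;> simp only [Matrix.add_apply]
    · rw [hX.diag, hY.diag]
    · rw [hX.anti i hi, hY.anti i hi, add_zero]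
    · rw [hX.lower i j hij, hY.lower i j hij, add_zero]
  | smul c X _ hX =>
    refine ⟨fun i => ?_, fun i hi => ?_, fun i j hij => ?_⟩ <;> simp only [Matrix.smul_apply]
    · rw [hX.diag]
    · rw [hX.anti i hi, smul_zero]
    · rw [hX.lower i j hij, smul_zero]

theorem matPart_apply (a : ZMod 2) (Y : Mat ℂ n) (i j : Idx n) :
    matPart a Y i j = if i.2 + j.2 = a then Y i j else 0 := rfl

theorem IsButterfly.matPart {Y : Mat ℂ n} (hY : IsButterfly Y) (a : ZMod 2) :
    IsButterfly (matPart a Y) := by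
  refine ⟨fun i => ?_, fun i hi => ?_, fun i j hij => ?_⟩ <;> simp only [matPart_apply]
  · rw [hY.diag, CharTwo.add_self_eq_zero, CharTwo.add_self_eq_zero]
  · rw [hY.anti i hi, ite_self]
  · rw [hY.lower i j hij, ite_self]

theorem IsButterfly.superBracket {X Y : Mat ℂ n} (hX : IsButterfly X) (hY : IsButterfly Y) :
    IsButterfly (superBracket X Y) := by
  have hlow (X Y : Mat ℂ n) (hX : IsButterfly X) (hY : IsButterfly Y) (i j k : Idx n)
      (hij : j.1 < i.1) : X i k * Y k j = 0 := by
    by_cases h1 : k.1 < i.1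
    · rw [hX.lower i k h1, zero_mul]
    · rw [hY.lower k j (hij.trans_le (not_lt.1 h1)), mul_zero]
  have hanti (X Y : Mat ℂ n) (hX : IsButterfly X) (hY : IsButterfly Y) (i k : Idx n)
      (hi : i.2 = 0) : X i.neg k * Y k i = 0 := by
    rcases lt_trichotomy k.1 i.1 with h | h | h
    · rw [hX.lower i.neg k h, zero_mul]
    · by_cases h1 : k = i
      · rw [h1, hX.anti i hi, zero_mul]
      · have h2 := Idx.eq_neg_of_fst_eq h.symm (Ne.symm h1)
        rw [h2, hY.anti i hi, mul_zero]
    · rw [hY.lower k i h, mul_zero]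
  have hdiag (i : Idx n) : _root_.superBracket X Y i i = 0 := by
    have key : ∀ i k : ZMod 2, (i + k) * (k + i) = i + k := by decide
    have hz (X Y : Mat ℂ n) (hX : IsButterfly X) (hY : IsButterfly Y) (k : Idx n) (hk : k ≠ i) :
        X i k * Y k i = 0 := by
      rcases lt_trichotomy k.1 i.1 with h | h | h
      · rw [hX.lower i k h, zero_mul]
      · rw [Idx.eq_neg_of_fst_eq h.symm (Ne.symm hk)]
        rcases zmod_two_cases i.2 with hi | hi
        · rw [hY.anti i hi, mul_zero]
        · have h2 := hX.anti i.neg (by change i.2 + 1 = 0; rw [hi]; decide)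
          rw [i.neg_neg] at h2
          rw [h2, zero_mul]
      · rw [hY.lower k i h, mul_zero]
    refine Finset.sum_eq_zero fun k _ => ?_
    by_cases hk : k = i
    · rw [hk, key, CharTwo.add_self_eq_zero, sgn_zero, one_smul, mul_comm, sub_self]
    · rw [hz X Y hX hY k hk, hz Y X hY hX k hk, smul_zero, sub_zero]
  refine ⟨fun i => by rw [hdiag, hdiag], fun i hi => ?_, fun i j hij => ?_⟩
  · refine Finset.sum_eq_zero fun k _ => ?_
    rw [hanti X Y hX hY i k hi, hanti Y X hY hX i k hi, smul_zero, sub_zero]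
  · refine Finset.sum_eq_zero fun k _ => ?_
    rw [hlow X Y hX hY i j k hij, hlow Y X hY hX i j k hij, smul_zero, sub_zero]

theorem strForm_apply (X Y : Mat ℂ n) :
    strForm X Y = ∑ i : Idx n, sgn i.2 • (X * Y) i i := rfl

theorem strForm_el (i j : Idx n) (Y : Mat ℂ n) : strForm (el i j) Y = sgn i.2 • Y j i := by
  rw [strForm_apply]
  simp only [Matrix.mul_apply, QEA.el_apply, ite_and, ite_mul, one_mul, zero_mul,
    Finset.sum_ite_irrel, Finset.sum_ite_eq, Finset.mem_univ, if_true, Finset.sum_const_zero,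
    smul_ite, smul_zero]

theorem strForm_comm_el (X : Mat ℂ n) (i j : Idx n) : strForm X (el i j) = sgn j.2 • X j i := by
  rw [strForm_apply, Finset.sum_eq_single j]
  · simp only [Matrix.mul_apply, QEA.el_apply, and_true, mul_ite, mul_one, mul_zero,
      Finset.sum_ite_eq, Finset.mem_univ, if_true]
  · intro k _ hk
    simp only [Matrix.mul_apply, QEA.el_apply, Ne.symm hk, and_false, if_false, mul_zero,
      Finset.sum_const_zero, smul_zero]
  · exact fun h => absurd (Finset.mem_univ j) h

theorem iota_el (i j : Idx n) :
    iota (el i j : Mat ℂ n) = -(sgn (i.2 * (j.2 + 1)) • el j.neg i.neg) := by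
  ext x y
  rw [iota_apply, Matrix.neg_apply, Matrix.smul_apply, QEA.el_apply, QEA.el_apply]
  by_cases h : j.neg = x ∧ i.neg = y
  · obtain ⟨rfl, rfl⟩ := h
    have key : ∀ i j : ZMod 2, (j + 1) * (i + 1 + 1) = i * (j + 1) := by decide
    rw [if_pos (c := i = _ ∧ j = _) ⟨i.neg_neg.symm, j.neg_neg.symm⟩, if_pos ⟨rfl, rfl⟩]
    change -(sgn ((j.2 + 1) * (i.2 + 1 + 1)) • (1 : ℂ)) = _
    rw [key]
  · rw [if_neg h, if_neg, smul_zero, smul_zero]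
    rintro ⟨h1, h2⟩
    exact h ⟨(Idx.eq_neg_iff.1 h2).symm, (Idx.eq_neg_iff.1 h1).symm⟩

/-- The family `L_{ij}` is dual to the entries of elements of `𝔟_n`. Both parts of `𝖤_{ji}`
contribute, at `(i, j)` and at `(-j, -i)`. On `𝔟_n` the second contribution vanishes for `|i| <
|j|`, and for `|i| = |j|` it combines with the first, which explains the weights `1` and `1/2` in
`Lmat`. -/
theorem strForm_Lmat {Y : Mat ℂ n} (hY : IsButterfly Y) (i j : Idx n) :
    strForm (Lmat i j) Y = sgn ((i.2 + 1) * j.2) • Y i j := by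
  have h : strForm (sfE j i) Y =
      sgn j.2 • Y i j - sgn ((j.2 + 1) * (i.2 + 1)) • Y j.neg i.neg := by
    have key : ∀ i j : ZMod 2, sgn (j * (i + 1)) * sgn (i + 1) = sgn ((j + 1) * (i + 1)) := by
      decide
    rw [sfE, iota_el, map_add, map_neg, units_smul_map, LinearMap.add_apply, LinearMap.neg_apply,
      LinearMap.smul_apply, strForm_el, strForm_el, ← sub_eq_add_neg, smul_smul]
    change _ - (sgn (j.2 * (i.2 + 1)) * sgn (i.2 + 1)) • _ = _
    rw [key]
  rw [Lmat, map_smul, units_smul_map, LinearMap.smul_apply, LinearMap.smul_apply, h]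
  by_cases h1 : i.1 < j.1
  · have key : ∀ i j : ZMod 2, sgn (i * j) * sgn j = sgn ((i + 1) * j) := by decide
    rw [if_pos h1, one_smul, hY.lower j.neg i.neg h1, smul_zero, sub_zero, smul_smul, key]
  · rw [if_neg h1]
    by_cases h2 : i.1 = j.1
    · rw [if_pos h2]
      by_cases h3 : i = j
      · subst h3
        have key : ∀ i : ZMod 2, i * i = i ∧ (i + 1) * (i + 1) = i + 1 ∧ (i + 1) * i = 0 ∧
          sgn (i + 1) = -sgn i := by decide
        rw [(key i.2).1, (key i.2).2.1, (key i.2).2.2.1, (key i.2).2.2.2, ← hY.diag, Units.neg_smul,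
          sub_neg_eq_add, smul_add, smul_smul, Int.units_mul_self, sgn_zero, one_smul, smul_eq_mul]
        ring
      · obtain rfl := Idx.eq_neg_of_fst_eq h2 h3
        rw [i.neg_neg]
        change (2⁻¹ : ℂ) • sgn (i.2 * (i.2 + 1)) • (sgn (i.2 + 1) • Y i i.neg -
          sgn ((i.2 + 1 + 1) * (i.2 + 1)) • Y i i.neg) = sgn ((i.2 + 1) * (i.2 + 1)) • Y i i.neg
        rcases zmod_two_cases i.2 with hi | hi
        · have e : sgn ((0 + 1) * (0 + 1)) = -1 ∧ sgn (0 + 1) = -1 ∧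
            sgn (0 * (0 + 1)) = 1 ∧ sgn ((0 + 1 + 1) * (0 + 1)) = 1 := by decide
          rw [hi, e.1, e.2.1, e.2.2.1, e.2.2.2, Units.neg_smul, one_smul, one_smul, smul_eq_mul]
          ring
        · have h4 := hY.anti i.neg (by change i.2 + 1 = 0; rw [hi]; decide)
          rw [i.neg_neg] at h4
          rw [h4]
          simp
    · rw [if_neg h2, zero_smul, hY.lower i j (lt_of_le_of_ne (not_lt.1 h1) (Ne.symm h2)), smul_zero]

theorem strForm_matPart (a : ZMod 2) (X Y : Mat ℂ n) :
    strForm (matPart a X) Y = strForm X (matPart a Y) := by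
  rw [strForm_apply, strForm_apply]
  simp only [Matrix.mul_apply, matPart_apply]
  refine Finset.sum_congr rfl fun i _ => congrArg _ (Finset.sum_congr rfl fun j _ => ?_)
  rw [add_comm j.2, ite_mul, mul_ite, zero_mul, mul_zero]

/-- The parity assumptions concern only the pairings, not `x` and `y`. The formula can then be
applied to arbitrary tensors against homogeneous elements of `𝔟_n`. -/
theorem strForm2_tmul (Y₁ Y₂ : Mat ℂ n) (x y : periplectic n) {α β : ZMod 2} {u v : ℂ}
    (hu : ∀ b, strForm (x : Mat ℂ n) (matPart b Y₁) = if β = b then u else 0)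
    (hv : ∀ a, strForm (y : Mat ℂ n) (matPart a Y₂) = if α = a then v else 0) :
    strForm2 Y₁ Y₂ (x ⊗ₜ y) = sgn (α * β) • (u * v) := by
  have h : strForm2 Y₁ Y₂ (x ⊗ₜ y) = ∑ a : ZMod 2, ∑ b : ZMod 2, sgn (a * b) •
      (strForm (x : Mat ℂ n) (matPart b Y₁) * strForm (matPart a (y : Mat ℂ n)) Y₂) := by
    simp only [strForm2, LinearMap.sum_apply]
    rfl
  rw [h]
  simp only [strForm_matPart, hu, hv]
  rw [Finset.sum_eq_single α, Finset.sum_eq_single β, if_pos rfl, if_pos rfl]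
  · intro b _ hb
    rw [if_neg (Ne.symm hb), zero_mul, smul_zero]
  · exact fun h => absurd (Finset.mem_univ _) h
  · intro a _ ha
    refine Finset.sum_eq_zero fun b _ => ?_
    rw [if_neg (c := α = a) (Ne.symm ha), mul_zero, smul_zero]
  · exact fun h => absurd (Finset.mem_univ _) h

theorem strForm2_pL {Y₁ Y₂ : Mat ℂ n} (h₁ : IsButterfly Y₁) (h₂ : IsButterfly Y₂)
    (i j k l : Idx n) : strForm2 Y₁ Y₂ (pL i j ⊗ₜ pL k l) =
      sgn ((k.2 + l.2) * (i.2 + j.2)) •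
        (sgn ((i.2 + 1) * j.2) • Y₁ i j * sgn ((k.2 + 1) * l.2) • Y₂ k l) := by
  refine strForm2_tmul Y₁ Y₂ _ _ (fun b => ?_) fun a => ?_
  · refine (strForm_Lmat (h₁.matPart b) i j).trans ?_
    rw [matPart_apply, smul_ite, smul_zero]
  · refine (strForm_Lmat (h₂.matPart a) k l).trans ?_
    rw [matPart_apply, smul_ite, smul_zero]

/-- The cobracket at `L_{ij}`. -/
def cobracketL (i j : Idx n) : periplectic n ⊗[ℂ] periplectic n :=
  ∑ k, (pL i k ⊗ₜ pL k j - sgn ((i.2 + k.2) * (k.2 + j.2)) • (pL k j ⊗ₜ pL i k))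

/-- Since pairing with `L_{ij}` reads off an entry, the sum of the terms `L_{ik} ⊗ L_{kj}` is paired
to the entry of `Y₁ Y₂`, and the swapped terms give the signed entry of `Y₂ Y₁`. Up to sign the
result is an entry of the superbracket, which lies again in the span cut out by `IsButterfly`. -/
theorem strForm2_cobracketL {Y₁ Y₂ : Mat ℂ n} (h₁ : IsButterfly Y₁) (h₂ : IsButterfly Y₂)
    (i j : Idx n) :
    strForm2 Y₁ Y₂ (cobracketL i j) = strForm (Lmat i j) (superBracket Y₁ Y₂) := by
  have key1 : ∀ i j k : ZMod 2, sgn ((k + j) * (i + k)) * (sgn ((i + 1) * k) * sgn ((k + 1) * j)) =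
    sgn ((i + 1) * j) := by decide
  have key2 : ∀ i j k : ZMod 2, sgn ((i + k) * (k + j)) * sgn ((i + k) * (k + j)) *
    (sgn ((k + 1) * j) * sgn ((i + 1) * k)) = sgn ((i + 1) * j) * sgn ((i + k) * (k + j)) := by
    decide
  rw [strForm_Lmat (h₁.superBracket h₂), cobracketL, map_sum, superBracket, Matrix.of_apply,
    Finset.smul_sum]
  refine Finset.sum_congr rfl fun k _ => ?_
  rw [map_sub, units_smul_map, strForm2_pL h₁ h₂, strForm2_pL h₁ h₂, smul_mul_smul_comm,
    smul_mul_smul_comm, smul_smul, smul_smul, smul_smul, key1, key2, smul_sub, smul_smul,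
    mul_comm (Y₁ k j)]

variable (n) in
/-- The cobracket of the Manin triple. -/
def maninCobracket : periplectic n →ₗ[ℂ] periplectic n ⊗[ℂ] periplectic n :=
  ∑ p : Idx n × Idx n, (pCoord p).smulRight (cobracketL p.1 p.2)

theorem maninCobracket_apply (x : periplectic n) :
    maninCobracket n x = ∑ p : Idx n × Idx n, pCoord p x • cobracketL p.1 p.2 := by
  rw [maninCobracket, LinearMap.sum_apply]
  rfl

theorem isManinCobracket_maninCobracket : IsManinCobracket (maninCobracket n) := by
  intro X Y₁ hY₁ Y₂ hY₂
  have h (x : periplectic n) : (x : Mat ℂ n) =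
      ∑ p : Idx n × Idx n, pCoord p x • (Lmat p.1 p.2 : Mat ℂ n) := by
    conv_lhs => rw [← sum_pCoord_smul x, AddSubmonoidClass.coe_finsetSum]
    rfl
  rw [maninCobracket_apply, h X, map_sum, map_sum, LinearMap.sum_apply]
  refine Finset.sum_congr rfl fun p _ => ?_
  rw [map_smul, map_smul, LinearMap.smul_apply,
    strForm2_cobracketL (isButterfly_of_mem hY₁) (isButterfly_of_mem hY₂)]

/-- The elements of `𝔟_n` which are dual to the `L_{ij}`. -/
def butterflyDual (p : Idx n × Idx n) : Mat ℂ n :=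
  if p.1.1 < p.2.1 then el p.1 p.2 else
    if p.1 = p.2 then (2⁻¹ : ℂ) • (el p.1 p.1 + el p.1.neg p.1.neg) else
      if p.1.2 = 0 ∧ p.2 = p.1.neg then el p.1 p.1.neg else 0

theorem butterflyDual_mem (p : Idx n × Idx n) : butterflyDual p ∈ butterfly n := by
  rw [butterflyDual]
  split_ifs with h1 h2 h3
  · exact Submodule.subset_span (Or.inl (Or.inl ⟨_, _, h1, rfl⟩))
  · refine Submodule.smul_mem _ _ (Submodule.subset_span (Or.inl (Or.inr ?_)))
    rcases zmod_two_cases p.1.2 with h | h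
    · exact ⟨_, h, rfl⟩
    · exact ⟨p.1.neg, by change p.1.2 + 1 = 0; rw [h]; decide, by rw [Idx.neg_neg, add_comm]⟩
  · exact Submodule.subset_span (Or.inr ⟨_, h3.1, rfl⟩)
  · exact zero_mem _

theorem matPart_el (b : ZMod 2) (i j : Idx n) :
    matPart b (el i j : Mat ℂ n) = if i.2 + j.2 = b then el i j else 0 := by
  ext x y
  rw [matPart_apply, apply_ite (fun M : Mat ℂ n => M x y), QEA.el_apply]
  by_cases h : i = x ∧ j = y
  · obtain ⟨rfl, rfl⟩ := h
    rfl
  · rw [if_neg h, ite_self, Matrix.zero_apply, ite_self]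

theorem matPart_butterflyDual (b : ZMod 2) (p : Idx n × Idx n) :
    matPart b (butterflyDual p) = if p.1.2 + p.2.2 = b then butterflyDual p else 0 := by
  rw [butterflyDual]
  split_ifs with h1 h2 h3 h4 h5 h6 h7
  · rw [matPart_el, if_pos h2]
  · rw [matPart_el, if_neg h2]
  · rw [← h3, CharTwo.add_self_eq_zero] at h4
    rw [map_smul, map_add, matPart_el, matPart_el, CharTwo.add_self_eq_zero,
      CharTwo.add_self_eq_zero, if_pos h4, if_pos h4]
  · rw [← h3, CharTwo.add_self_eq_zero] at h4
    rw [map_smul, map_add, matPart_el, matPart_el, CharTwo.add_self_eq_zero,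
      CharTwo.add_self_eq_zero, if_neg h4, if_neg h4, add_zero, smul_zero]
  · rw [matPart_el, ← h5.2, if_pos h6]
  · rw [matPart_el, ← h5.2, if_neg h6]
  · rw [map_zero]
  · rw [map_zero]

/-- The coordinate is the pairing with the dual element, up to sign. The statement is multiplied by
`L_{ij}` because for `|i| > |j|` the coordinate need not vanish, while `L_{ij}` and the dual element
do. -/
theorem pCoord_smul_pL (x : periplectic n) (p : Idx n × Idx n) : pCoord p x • pL p.1 p.2 =
    sgn ((p.1.2 + 1) * p.2.2) • strForm (x : Mat ℂ n) (butterflyDual p) • pL p.1 p.2 := by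
  obtain ⟨i, j⟩ := p
  have key : ∀ i j : ZMod 2, sgn ((i + 1) * j) * sgn j = sgn (i * j) := by decide
  change pCoord (i, j) x • pL i j = sgn ((i.2 + 1) * j.2) • strForm (x : Mat ℂ n) (butterflyDual (i, j)) • pL i j
  have hp : pCoord (i, j) x = sgn (i.2 * j.2) • (x : Mat ℂ n) j i := rfl
  rw [hp, butterflyDual, ← smul_assoc]
  by_cases h1 : i.1 < j.1
  · rw [if_pos (c := (i, j).1.1 < (i, j).2.1) h1, strForm_comm_el, smul_smul, key]
  · rw [if_neg (c := (i, j).1.1 < (i, j).2.1) h1]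
    by_cases h2 : i = j
    · subst h2
      have h3 := periplectic_neg x i i
      have key2 : ∀ i : ZMod 2, sgn (i * (i + 1)) = 1 ∧ sgn (i + 1) = -sgn i := by decide
      rw [(key2 _).1, one_smul] at h3
      rw [if_pos (c := (i, i).1 = (i, i).2) rfl, map_smul, map_add, strForm_comm_el, strForm_comm_el, h3]
      change _ = (_ • (2⁻¹ : ℂ) • (sgn i.2 • (x : Mat ℂ n) i i + sgn (i.2 + 1) • _)) • _
      rw [(key2 _).2, Units.neg_smul, smul_neg, neg_neg, ← two_smul ℂ, smul_smul,
        inv_mul_cancel₀ two_ne_zero, one_smul, smul_smul, key]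
    · rw [if_neg (c := (i, j).1 = (i, j).2) h2]
      by_cases h3 : i.2 = 0 ∧ j = i.neg
      · rw [if_pos (c := (i, j).1.2 = 0 ∧ (i, j).2 = (i, j).1.neg) h3]
        obtain ⟨h3, rfl⟩ := h3
        rw [strForm_comm_el, smul_smul, key]
      · rw [if_neg (c := (i, j).1.2 = 0 ∧ (i, j).2 = (i, j).1.neg) h3, map_zero, smul_zero, zero_smul]
        by_cases h4 : i.1 = j.1
        · obtain rfl := Idx.eq_neg_of_fst_eq h4 h2
          have hi : i.neg.2 = 0 := by
            rcases zmod_two_cases i.2 with h | h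
            · exact absurd ⟨h, rfl⟩ h3
            · change i.2 + 1 = 0
              rw [h]
              decide
          have h5 := periplectic_neg x i.neg i
          rw [i.neg_neg, hi, zero_mul, sgn_zero, one_smul] at h5
          have h6 : (x : Mat ℂ n) i.neg i = 0 := by
            linear_combination (1 / 2 : ℂ) * h5
          rw [h6, smul_zero, zero_smul]
        · rw [pL_eq, if_neg h1, if_neg h4, zero_smul, smul_zero]

/-- A tensor can be reconstructed from its pairings with elements of `𝔟_n`. This nondegeneracy gives
the uniqueness of the Manin cobracket. -/
theorem sum_strForm2_smul (w : periplectic n ⊗[ℂ] periplectic n) :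
    ∑ p : Idx n × Idx n, ∑ r : Idx n × Idx n,
      sgn ((p.1.2 + 1) * p.2.2 + (r.1.2 + 1) * r.2.2 + (r.1.2 + r.2.2) * (p.1.2 + p.2.2)) •
        strForm2 (butterflyDual p) (butterflyDual r) w • (pL p.1 p.2 ⊗ₜ[ℂ] pL r.1 r.2) = w := by
  induction w with
  | zero => simp
  | tmul x y =>
    conv_rhs => rw [← sum_pCoord_smul x, ← sum_pCoord_smul y, TensorProduct.sum_tmul]
    refine Finset.sum_congr rfl fun p _ => ?_
    rw [TensorProduct.tmul_sum]
    refine Finset.sum_congr rfl fun r _ => ?_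
    rw [pCoord_smul_pL, pCoord_smul_pL, strForm2_tmul _ _ x y (α := r.1.2 + r.2.2)
      (β := p.1.2 + p.2.2) (u := strForm (x : Mat ℂ n) (butterflyDual p))
      (v := strForm (y : Mat ℂ n) (butterflyDual r))
      (fun b => by rw [matPart_butterflyDual, apply_ite (strForm (x : Mat ℂ n)), map_zero])
      (fun a => by rw [matPart_butterflyDual, apply_ite (strForm (y : Mat ℂ n)), map_zero])]
    have h1 : (sgn ((p.1.2 + 1) * p.2.2) • strForm (x : Mat ℂ n) (butterflyDual p) • pL p.1 p.2) ⊗ₜ[ℂ]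
        (sgn ((r.1.2 + 1) * r.2.2) • strForm (y : Mat ℂ n) (butterflyDual r) • pL r.1 r.2) =
        sgn ((p.1.2 + 1) * p.2.2) • sgn ((r.1.2 + 1) * r.2.2) •
        (strForm (x : Mat ℂ n) (butterflyDual p) * strForm (y : Mat ℂ n) (butterflyDual r)) •
          (pL p.1 p.2 ⊗ₜ[ℂ] pL r.1 r.2) := by
      rw [← TensorProduct.smul_tmul_smul, units_smul_tmul_units_smul]
    rw [h1, sgn_add, sgn_add]
    exact units_smul_smul_smul (R := ℂ) (M := periplectic n ⊗[ℂ] periplectic n) _ _ _ _ _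
  | add v w hv hw =>
    conv_rhs => rw [← hv, ← hw, ← Finset.sum_add_distrib]
    refine Finset.sum_congr rfl fun p _ => ?_
    rw [← Finset.sum_add_distrib]
    exact Finset.sum_congr rfl fun r _ => by rw [map_add, add_smul, smul_add]

theorem IsManinCobracket.eq {δ₁ δ₂ : periplectic n →ₗ[ℂ] periplectic n ⊗[ℂ] periplectic n}
    (h₁ : IsManinCobracket δ₁) (h₂ : IsManinCobracket δ₂) : δ₁ = δ₂ := by
  ext1 x
  rw [← sum_strForm2_smul (δ₁ x), ← sum_strForm2_smul (δ₂ x)]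
  refine Finset.sum_congr rfl fun p _ => Finset.sum_congr rfl fun r _ => ?_
  rw [h₁ x _ (butterflyDual_mem p) _ (butterflyDual_mem r),
    h₂ x _ (butterflyDual_mem p) _ (butterflyDual_mem r)]

end Manin

/-! ### The quantization theorem -/

section AntipodeAux

variable {R A : Type*} [CommRing R] [Ring A] [Algebra R A] [Superalgebra R A] [Invertible (2 : R)]

theorem HopfSuperalgebra.antipode_mul_of_groupLike (H : HopfSuperalgebra R A) {x : A}
    (hx : H.Δ x = x ⊗ₜ x) (hε : H.counit x = 1) : H.antipode x * x = 1 := by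
  have h := H.antipode_left x
  have hx' : underlying H.comul x = x ⊗ₜ x := hx
  rwa [hx', LinearMap.rTensor_tmul, LinearMap.mul'_apply, hε, map_one] at h

/-- The antipode axiom for an element which is primitive up to a multiple of `r` reads `S x + x + r
(…) = 0`. -/
theorem HopfSuperalgebra.exists_antipode_eq (H : HopfSuperalgebra R A)
    (h1 : H.antipode 1 = 1) {x : A} {r : R} {w : A ⊗[R] A}
    (hx : H.Δ x = x ⊗ₜ 1 + 1 ⊗ₜ x + r • w) (hε : H.counit x = 0) :
    ∃ d, H.antipode x = -x + r • d := by
  have h := H.antipode_left x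
  have hx' : underlying H.comul x = x ⊗ₜ 1 + 1 ⊗ₜ x + r • w := hx
  rw [hx', map_add, map_add, map_add, map_add, map_smul, map_smul, LinearMap.rTensor_tmul,
    LinearMap.rTensor_tmul, LinearMap.mul'_apply, LinearMap.mul'_apply, h1, hε, map_zero, one_mul,
    mul_one] at h
  refine ⟨-LinearMap.mul' R A (H.antipode.rTensor A w), ?_⟩
  rw [smul_neg, ← sub_eq_zero, ← h]
  abel

end AntipodeAux

namespace Up

variable {n : ℕ}

/-- A coderivation kills `1`, since `δ 1 = δ 1 + δ 1`. By the product rule it is then determined by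
its values on generators. -/
theorem coderivation_ext {H : SuperBialgebra ℂ (Up n)} {δ₁ δ₂ : Up n →ₗ[ℂ] Up n ⊗[ℂ] Up n}
    (h₁ : H.IsCoderivation δ₁) (h₂ : H.IsCoderivation δ₂) (h : ∀ x, δ₁ (ι x) = δ₂ (ι x)) :
    δ₁ = δ₂ := by
  have hone {δ : Up n →ₗ[ℂ] Up n ⊗[ℂ] Up n} (hδ : H.IsCoderivation δ) : δ 1 = 0 := by
    have := hδ.map_mul 1 1
    rw [map_one H.comul, mul_one, mul_one, one_mul] at this
    exact (GradedTensorProduct.of ℂ _ _).injective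
      ((left_eq_add.1 this).trans (map_zero _).symm)
  ext1 u
  have hu : u ∈ Algebra.adjoin ℂ (Set.range (ι : periplectic n → Up n)) := by
    rw [adjoin_range_ι]
    trivial
  induction hu using Algebra.adjoin_induction with
  | mem u hu =>
    obtain ⟨x, rfl⟩ := hu
    exact h x
  | algebraMap r => rw [Algebra.algebraMap_eq_smul_one, map_smul, map_smul, hone h₁, hone h₂]
  | add u v _ _ hu hv => rw [map_add, map_add, hu, hv]
  | mul u v _ _ hu hv =>
    apply (GradedTensorProduct.of ℂ (part ℂ (Up n)) (part ℂ (Up n))).injective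
    rw [h₁.map_mul, h₂.map_mul, hu, hv]

end Up

namespace Uh

open HAdic

variable {n : ℕ} {b : Bool}

theorem cobracket_ι {H : SuperBialgebra (PowerSeries ℂ) (Uh n b)}
    (hH : IsRestriction H (QEA.superBialgebra qh n)) (x : periplectic n) :
    (isDeformation n b hH).cobracket (Up.ι x) =
      TensorProduct.map Up.ι Up.ι (maninCobracket n x) := by
  conv_lhs => rw [← sum_pCoord_smul x]
  rw [map_sum, map_sum, maninCobracket_apply, map_sum]
  refine Finset.sum_congr rfl fun p _ => ?_
  rw [map_smul, map_smul, map_smul, cobracket_pL hH, cobracketL, map_sum]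
  refine congrArg _ (Finset.sum_congr rfl fun k _ => ?_)
  rw [map_sub, units_smul_map, TensorProduct.map_tmul, TensorProduct.map_tmul]

/-- On generators: modulo `ħ` the `λ_{ij}` are primitive, so the antipode negates them, and the
`t_{ii}⁻¹` reduce to `1`. Products are handled by the sign rule for super anti-homomorphisms, which
both antipodes satisfy. -/
theorem red_antipode {H : HopfSuperalgebra (PowerSeries ℂ) (Uh n b)}
    (hH : IsRestriction H.toSuperBialgebra (QEA.superBialgebra qh n)) (hS : IsSuperAnti H.antipode)
    {H₀ : HopfSuperalgebra ℂ (Up n)} (hS₀ : IsSuperAnti H₀.antipode)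
    (hι : ∀ x, H₀.antipode (Up.ι x) = -Up.ι x) (a : Uh n b) :
    red n b (H.antipode a) = H₀.antipode (red n b a) := by
  have ha : a ∈ Algebra.adjoin (PowerSeries ℂ) (gens n b) := by
    rw [adjoin_gens]
    trivial
  induction ha using Algebra.adjoin_induction with
  | mem x hx =>
    obtain ⟨i, j, rfl⟩ | ⟨-, i, hi⟩ := hx
    · obtain ⟨d, hd⟩ := H.exists_antipode_eq hS.map_one (Δ_lam hH i j) (counit_lam hH i j)
      rw [hd, map_add, map_neg, map_smulₛₗ, PowerSeries.constantCoeff_X, zero_smul, add_zero,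
        red_lam, hι]
    · have h := congrArg (red n b) (H.antipode_mul_of_groupLike (Δ_of_incl_eq hH hi)
        (counit_of_incl_eq hH hi))
      rw [isSuperHom_red.map_mul, red_of_incl_eq hi, mul_one, isSuperHom_red.map_one] at h
      rw [h, red_of_incl_eq hi, hS₀.map_one]
  | algebraMap r =>
    rw [Algebra.algebraMap_eq_smul_one, map_smul, map_smulₛₗ, map_smulₛₗ, map_smul, hS.map_one,
      isSuperHom_red.map_one, hS₀.map_one]
  | add x y _ _ hx hy => rw [map_add, map_add, map_add, map_add, hx, hy]
  | mul x y _ _ hx hy =>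
    rw [hS.map_mul_eq, isSuperHom_red.map_mul, hS₀.map_mul_eq, map_add, isSuperHom_red.map_mul,
      isSuperHom_red.map_mul, isSuperHom_red.map_proj, isSuperHom_red.map_proj,
      isSuperHom_red.map_parity, hx, hy]

end Uh

theorem theorem4p3 (n : ℕ) :
    -- the Hopf superalgebra over `ℂ((ħ))`
    ∃ HK : HopfSuperalgebra (LaurentSeries ℂ) (UK n), IsStandardComul HK.toSuperBialgebra ∧
    -- the standard Hopf superalgebra structure on the enveloping superalgebra
    ∃ H₀ : HopfSuperalgebra ℂ (Up n), IsPrimitive H₀.toSuperBialgebra ∧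
    -- the cobracket of the Manin triple and its unique extension to a co-Poisson structure
    ∃ δ₀ : periplectic n →ₗ[ℂ] periplectic n ⊗[ℂ] periplectic n,
      IsManinCobracket δ₀ ∧ (∀ δ₁, IsManinCobracket δ₁ → δ₁ = δ₀) ∧
    ∃ δ : Up n →ₗ[ℂ] Up n ⊗[ℂ] Up n,
      H₀.IsCoPoisson δ ∧
      (∀ x, δ (Up.ι x) = TensorProduct.map Up.ι Up.ι (δ₀ x)) ∧
      (∀ δ₁ : Up n →ₗ[ℂ] Up n ⊗[ℂ] Up n, H₀.IsCoderivation δ₁ →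
        (∀ x, δ₁ (Up.ι x) = TensorProduct.map Up.ι Up.ι (δ₀ x)) → δ₁ = δ) ∧
    -- the subalgebra generated by the `τ_{ij}` is a quantization, as a superbialgebra
    (∃ H : SuperBialgebra (PowerSeries ℂ) (Uh n false), IsRestriction H HK.toSuperBialgebra ∧
      ∃ ρ, IsStandardReduction ρ ∧ IsQuantization H H₀.toSuperBialgebra δ ρ) ∧
    -- the subalgebra generated by the `τ_{ij}` and the `t_{ii}⁻¹` is one, as a Hopf superalgebra
    (∃ H : HopfSuperalgebra (PowerSeries ℂ) (Uh n true),
      IsRestriction H.toSuperBialgebra HK.toSuperBialgebra ∧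
      (∀ x, Uh.incl true (H.antipode x) = HK.antipode (Uh.incl true x)) ∧
      ∃ ρ, IsStandardReduction ρ ∧ IsQuantization H.toSuperBialgebra H₀.toSuperBialgebra δ ρ ∧
        ∀ x, ρ (H.antipode x) = H₀.antipode (ρ x)) := by
  -- The square root of `-1` from which the antipode over the field is built.
  have hc : algebraMap ℂ (LaurentSeries ℂ) Complex.I * algebraMap ℂ (LaurentSeries ℂ) Complex.I =
      -1 := by
    rw [← map_mul, Complex.I_mul_I, map_neg, map_one]
  obtain ⟨HK, e, hS, hSinv, hSt⟩ := QEA.exists_hopfSuperalgebra (q := qh) (n := n) hc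
    HAdic.isUnit_Smat_qh
  obtain ⟨H₀, e₀, hS₀, hι⟩ := Up.exists_hopfSuperalgebra n
  obtain ⟨Hf, hf⟩ := Uh.exists_superBialgebra n false
  obtain ⟨Ht, ht, hincl, hSt'⟩ := Uh.exists_hopfSuperalgebra HK e hS hSinv hSt
  have hcop := (Uh.isDeformation n false hf).isCoPoisson_cobracket
  have hcop' := (Uh.isDeformation n true ht).isCoPoisson_cobracket
  have hquant := (Uh.isDeformation n true ht).isQuantization
  -- The two forms give cobrackets which agree on `𝔭_n`, where both are the Manin cobracket. They
  -- are therefore equal, and a single `δ` serves both quantizations.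
  rw [Up.coderivation_ext hcop'.toIsCoderivation hcop.toIsCoderivation fun x => by
    rw [Uh.cobracket_ι ht, Uh.cobracket_ι hf]] at hquant
  refine ⟨HK, ?_, H₀, ?_, maninCobracket n, isManinCobracket_maninCobracket,
    fun δ₁ h => h.eq isManinCobracket_maninCobracket, (Uh.isDeformation n false hf).cobracket, ?_,
    Uh.cobracket_ι hf, fun δ₁ h hx => ?_, ⟨Hf, ?_, Uh.red n false, Uh.isStandardReduction_red, ?_⟩,
    ⟨Ht, ?_, hincl, Uh.red n true, Uh.isStandardReduction_red, ?_,
      Uh.red_antipode ht hSt' hS₀ hι⟩⟩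
  · rw [e]
    exact QEA.comul_t
  · rw [e₀]
    exact Up.underlying_comul_ι
  · rw [e₀]
    exact hcop
  · rw [e₀] at h
    exact Up.coderivation_ext h hcop.toIsCoderivation fun x => by rw [hx, Uh.cobracket_ι hf]
  · rw [e]
    exact hf
  · rw [e₀]
    exact (Uh.isDeformation n false hf).isQuantization
  · rw [e]
    exact ht
  · rw [e₀]
    exact hquant
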